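/- **Setting.** Let $e_1,\dots,e_7$ be the canonical basis of $\mathbb R^7\subset\mathbb C^7$ with the standard bilinear dot product, and $\mathfrak H=\{u\in\mathbb C^7: u_5+u_6+u_7=0\}$. Let $P^L$ (resp. $P^R$) be the set of vectors $\frac12(\pm e_1\pm e_2\pm e_3\pm e_4)$ with an even (resp. odd) number of minus signs, $P^V=\{\pm e_j:1\le j\le4\}$, $R(so(8))=\{\pm e_j\pm e_k: 1\le j\neq k\le 4\}$, and $$R=R(so(8))\cup\{\alpha^L_{w,\pm}\}_{w\in P^L}\cup\{\alpha^R_{w,\pm}\}_{w\in P^R}\cup\{\alpha^V_{w,\pm}\}_{w\in P^V},$$ where $\alpha^L_{w,\pm}=w\pm\frac{1}{\sqrt2}(e_5-e_7)$, $\alpha^R_{w,\pm}=w\pm\frac1{\sqrt2}(e_5-e_6)$, $\alpha^V_{w,\pm}=w\pm\frac1{\sqrt2}(e_6-e_7)$. This is the root system of $e_6$ (72 roots), with simple roots $\alpha_1=\frac12(e_4-e_3-e_2-e_1)+\frac1{\sqrt2}(e_5-e_6)$, $\alpha_2=e_3-e_4$, $\alpha_3=e_2-e_3$, $\alpha_4=e_1-e_2$,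 $\alpha_5=-e_1+\frac1{\sqrt2}(e_6-e_7)$, $\alpha_6=e_3+e_4$, minimal root $\alpha_0=-\frac12(e_1+e_2+e_3+e_4)-\frac1{\sqrt2}(e_5-e_7)=-(\alpha_1+2\alpha_2+3\alpha_3+2\alpha_4+\alpha_5+2\alpha_6)$ and fundamental weight $\varpi_1=\frac{\sqrt2}3(2e_5-e_6-e_7)$. Let $C=\{u\in\mathfrak H\cap\mathbb R^7: \alpha_i\cdot u>0\ (1\le i\le 6),\ -\alpha_0\cdot u<1\}$ be the fundamental alcove, $W$ the Weyl group generated by the reflections in $R$, $\omega=e^{2\pi i/3}$, and $(x,y)=\frac1{24}\operatorname{tr}(\operatorname{ad}x\operatorname{ad}y)$ the normalized Killing form. **(1)** There is exactly one $w\in W$ with $w(C-\varpi_1)=C$. It is the map $\lambda_1$ of order 3 with $e_1\mapsto\frac12(e_1+e_2+e_3-e_4)$, $e_2\mapsto\frac12(e_1+e_2-e_3+e_4)$, $e_3\mapsto\frac12(e_1-e_2+e_3+e_4)$, $e_4\mapsto\frac12(e_1-e_2-e_3-e_4)$, $e_5\mapsto e_7\mapsto e_6\mapsto e_5$. It acts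 by $\alpha_1\to\alpha_0\to\alpha_5\to\alpha_1$, $\alpha_2\to\alpha_6\to\alpha_4\to\alpha_2$, $\alpha_3\to\alpha_3$. The roots fixed by it are exactly $\pm(e_2-e_3),\pm(e_1+e_3),\pm(e_1+e_2)$. Further $e_1-e_2\to e_3-e_4\to e_3+e_4$, $e_1-e_3\to e_2-e_4\to e_2+e_4$, $e_1-e_4\to e_2+e_3\to e_1+e_4$, and $\alpha^L_{w,\pm}\to\alpha^V_{\lambda_1w,\mp}\to\alpha^R_{\lambda_1^2w,\mp}$ for $w\in P^L$. **(2)** Let $\mathfrak g$ be a finite-dimensional complex simple Lie algebra of type $E_6$. Then $\mathfrak g$ has a Cartan subalgebra identified with $\mathfrak H$, a Chevalley basis $E_\alpha$ ($\alpha\in R$) — that is, $[u,E_\alpha]=(\alpha\cdot u)E_\alpha$, $[E_\alpha,E_{-\alpha}]=\alpha$, $[E_\alpha,E_\beta]=\pm E_{\alpha+\beta}$ if $\alpha+\beta\in R$, and $[E_\alpha,E_\beta]=0$ if $0\ne\alpha+\beta\notin R$ — and an automorphism of order 3, again denoted $\lambda_1$, extending $\lambda_1$ on $\mathfrak H$ with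 $\lambda_1(E_\alpha)=E_{\lambda_1\alpha}$, such that the following hold. The form satisfies $(u,v)=u\cdot v$ on $\mathfrak H$, $(E_\alpha,E_{\beta})=\delta_{\beta,-\alpha}$, $(u,E_\alpha)=0$. (a) With $\mathfrak g_k=\{x:\lambda_1x=\omega^kx\}$, one has $\mathfrak g=\mathfrak g_0\oplus\mathfrak g_1\oplus\mathfrak g_2$, a $\mathbb Z/3$-grading, of dimensions $78=30+24+24$. (b) The root vectors of $R(so(8))$ generate a $\lambda_1$-stable subalgebra isomorphic to $so(8)$, and $so(8)=\mathbf g_2\oplus\underline7\oplus\underline7'$ is its decomposition into the eigenspaces of $\lambda_1$ for $1,\omega,\omega^2$. Here $\mathbf g_2$ is a simple Lie algebra of type $G_2$ and $\underline7,\underline7'$ are both its 7-dimensional fundamental representation. (c) $\mathfrak g_0=\mathbf g_2\oplus V$, where $V$ is the span of the vectors $\mathfrak t^0_{w,\pm}$ below, $\dim V=16$, and $\mathfrak g_0\cong so(8)\oplus 2\cdot\underline1$ as a Lie algebra. Moreover $\mathfrak g_0$ is isomorphic to the subalgebra of $\mathfrak g$ generated by $\mathfrak H$ and $E_{\pm\alpha_i}$,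 $i=2,3,4,6$ (drop $\alpha_0,\alpha_1,\alpha_5$ from the extended Dynkin diagram). (d) (Generalized sine bases.) Put $E^0_\alpha=E_\alpha+E_{\lambda_1\alpha}+E_{\lambda_1^2\alpha}$, $\mathfrak t^k_\alpha=\frac1{\sqrt3}(E_\alpha+\omega^{-k}E_{\lambda_1\alpha}+\omega^{-2k}E_{\lambda_1^2\alpha})$, $\mathfrak t^k_{w,\pm}=\mathfrak t^k_{\alpha^L_{w,\pm}}$ for $w\in P^L$, $\mathfrak h^k_{\alpha_2}=\frac1{\sqrt3}(\alpha_2+\omega^k\alpha_4+\omega^{2k}\alpha_6)$, $\mathfrak h^k_5=\frac1{\sqrt3}(e_5+\omega^ke_6+\omega^{2k}e_7)$, and $O=\{\pm(e_1-e_m):m=2,3,4\}$. - The Cartan part of $\mathbf g_2$ is $\mathfrak H\cap\mathbf g_2=\{u_1e_1+u_2e_2+u_3e_3:u_1=u_2+u_3\}$. A basis of $\mathbf g_2$ is: $3\alpha_3$, $\alpha_2+\alpha_4+\alpha_6$, $E^0_\alpha$ ($\alpha\in O$), and $E_\alpha$ for the six fixed roots $\alpha$. - For $k=1,2$, a basis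 of $\underline7$ (resp. $\underline7'$) is $\mathfrak h^k_{\alpha_2}$, $\mathfrak t^k_\alpha$ ($\alpha\in O$). - The 16 vectors $\mathfrak t^0_{w,\pm}$ are a basis of $V$. - For $k=1,2$, a basis of $\mathfrak g_k$ is $\mathfrak t^k_{w,\pm}$ ($w\in P^L$), $\mathfrak h^k_5$, $\mathfrak h^k_{\alpha_2}$, $\mathfrak t^k_\alpha$ ($\alpha\in O$). (e) (Killing form.) On $\mathbf g_2$: $(E^0_\alpha,E^0_\beta)=3\delta_{\beta,-\alpha}$ for $\alpha,\beta\in O$, $(E_\alpha,E_\beta)=\delta_{\beta,-\alpha}$ for fixed roots $\alpha,\beta$, and $(E^0_\alpha,E_\beta)=0$ for $\alpha\in O$, $\beta$ fixed. Further $(\mathfrak g_k,\mathfrak g_l)=0$ unless $k+l\equiv0\pmod 3$. If $k+l\equiv0$ and $k\not\equiv 0$, then $(\mathfrak h^k_{\alpha_2},\mathfrak h^l_{\alpha_2})=2$, $(\mathfrak h^k_5,\mathfrak h^l_5)=1$, $(\mathfrak h^k_{\alpha_2},\mathfrak h^l_5)=0$. If $k+l\equiv0$, then $(\mathfrak t^k_\alpha,\mathfrak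 t^l_\beta)=\delta_{\beta,-\alpha}$ for $\alpha,\beta\in O$, $(\mathfrak t^k_{w,s},\mathfrak t^l_{v,r})=\delta_{v,-w}\delta_{r,-s}$ for $w,v\in P^L$ and signs $s,r$, and $(\mathfrak t^k_\alpha,\mathfrak t^l_{w,s})=0$ for $\alpha\in O$. Finally $(u,\mathfrak t^k_\alpha)=0$ for all $u\in\mathfrak H$, $\alpha\in R$. -/

import Mathlib

open scoped Matrix

noncomputable section

namespace E6GS

/-! ### Canonical coordinates, roots and weights

Vectors of `ℝ⁷` are written in the canonical basis `e 1, …, e 7`; the Cartan subalgebra of `e₆` is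
the hyperplane `u₅ + u₆ + u₇ = 0`, with the standard dot product, by means of which the roots are
vectors of the same hyperplane. -/

/-- The canonical basis vector `e_j` of `ℝ⁷`, `j = 1, …, 7`. -/
def e (j : ℕ) : Fin 7 → ℝ := fun i => if (i : ℕ) + 1 = j then 1 else 0

/-- The hyperplane `u₅ + u₆ + u₇ = 0` of `K⁷`. -/
def cartan (K : Type*) [Field K] : Submodule K (Fin 7 → K) where
  carrier := {u | u 4 + u 5 + u 6 = 0}
  zero_mem' := by simp
  add_mem' := by
    intro a b ha hb
    simp only [Set.mem_ofPred_eq, Pi.add_apply] at *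
    linear_combination ha + hb
  smul_mem' := by
    intro c a ha
    simp only [Set.mem_ofPred_eq, Pi.smul_apply, smul_eq_mul] at *
    linear_combination c * ha

/-- Complexification of a real vector. -/
def cx (v : Fin 7 → ℝ) : Fin 7 → ℂ := fun i => (v i : ℂ)

/-- The real number `±1` attached to a sign. -/
def sg (s : ℤˣ) : ℝ := ((s : ℤ) : ℝ)

/-- The roots `± e_j ± e_k`, `1 ≤ j ≠ k ≤ 4`, of `so(8)`. -/
def rootsSO8 : Set (Fin 7 → ℝ) :=
  {v | ∃ (j k : Fin 4) (s t : ℤˣ), j ≠ k ∧ v = sg s • e (j + 1) + sg t • e (k + 1)}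

/-- The weights `(± e₁ ± e₂ ± e₃ ± e₄) / 2` with an even number of minus signs. -/
def weightsL : Set (Fin 7 → ℝ) :=
  {v | ∃ s : Fin 4 → ℤˣ, ∏ j, s j = 1 ∧ v = (1 / 2 : ℝ) • ∑ j : Fin 4, sg (s j) • e (j + 1)}

/-- The weights `(± e₁ ± e₂ ± e₃ ± e₄) / 2` with an odd number of minus signs. -/
def weightsR : Set (Fin 7 → ℝ) :=
  {v | ∃ s : Fin 4 → ℤˣ, ∏ j, s j = -1 ∧ v = (1 / 2 : ℝ) • ∑ j : Fin 4, sg (s j) • e (j + 1)}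

/-- The weights `± e_j`, `1 ≤ j ≤ 4`. -/
def weightsV : Set (Fin 7 → ℝ) :=
  {v | ∃ (j : Fin 4) (s : ℤˣ), v = sg s • e (j + 1)}

/-- `w ± (e₅ - e₇) / √2`. -/
def aL (w : Fin 7 → ℝ) (s : ℤˣ) : Fin 7 → ℝ := w + (sg s / √2) • (e 5 - e 7)

/-- `w ± (e₅ - e₆) / √2`. -/
def aR (w : Fin 7 → ℝ) (s : ℤˣ) : Fin 7 → ℝ := w + (sg s / √2) • (e 5 - e 6)

/-- `w ± (e₆ - e₇) / √2`. -/
def aV (w : Fin 7 → ℝ) (s : ℤˣ) : Fin 7 → ℝ := w + (sg s / √2) • (e 6 - e 7)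

/-- The 72 roots of `e₆`. -/
def roots : Set (Fin 7 → ℝ) :=
  rootsSO8 ∪ {v | ∃ w ∈ weightsL, ∃ s, v = aL w s} ∪ {v | ∃ w ∈ weightsR, ∃ s, v = aR w s} ∪
    {v | ∃ w ∈ weightsV, ∃ s, v = aV w s}

/-- The simple roots `α₁, …, α₆` and, at `0`, the minimal root `α₀`. -/
def α : Fin 7 → (Fin 7 → ℝ) :=
  ![-(1 / 2 : ℝ) • (e 4 + e 3 + e 2 + e 1) - (1 / √2) • (e 5 - e 7),
    (1 / 2 : ℝ) • (e 4 - e 3 - e 2 - e 1) + (1 / √2) • (e 5 - e 6),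
    e 3 - e 4,
    e 2 - e 3,
    e 1 - e 2,
    -e 1 + (1 / √2) • (e 6 - e 7),
    e 4 + e 3]

/-- The fundamental weight `ϖ₁`. -/
def ϖ₁ : Fin 7 → ℝ := (√2 / 3) • ((2 : ℝ) • e 5 - e 6 - e 7)

/-- The orthogonal reflection in a vector `a` with `a ⬝ a = 2`. -/
def reflection (a : Fin 7 → ℝ) : Module.End ℝ (Fin 7 → ℝ) where
  toFun v := v - (v ⬝ᵥ a) • a
  map_add' v w := by rw [add_dotProduct, add_smul]; abel
  map_smul' c v := by rw [smul_dotProduct, smul_sub, smul_assoc, RingHom.id_apply]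

/-- The Weyl group of `e₆`, acting on `ℝ⁷`. As reflections are involutions, the monoid that they
generate is a group. -/
def weylGroup : Submonoid (Module.End ℝ (Fin 7 → ℝ)) :=
  Submonoid.closure (reflection '' roots)

/-- The fundamental alcove. -/
def alcove : Set (Fin 7 → ℝ) :=
  {u | u ∈ cartan ℝ ∧ (∀ i : Fin 7, i ≠ 0 → 0 < α i ⬝ᵥ u) ∧ -(α 0 ⬝ᵥ u) < 1}

/-- The linear map `λ₁`, given by
`e₁ ↦ (e₁ + e₂ + e₃ - e₄) / 2`, `e₂ ↦ (e₁ + e₂ - e₃ + e₄) / 2`, `e₃ ↦ (e₁ - e₂ + e₃ + e₄) / 2`,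
`e₄ ↦ (e₁ - e₂ - e₃ - e₄) / 2`, `e₅ ↦ e₇`, `e₆ ↦ e₅`, `e₇ ↦ e₆`. -/
def lam (K : Type*) [Field K] : Module.End K (Fin 7 → K) :=
  Matrix.mulVecLin
    !![1 / 2,  1 / 2,  1 / 2,  1 / 2, 0, 0, 0;
       1 / 2,  1 / 2, -1 / 2, -1 / 2, 0, 0, 0;
       1 / 2, -1 / 2,  1 / 2, -1 / 2, 0, 0, 0;
      -1 / 2,  1 / 2,  1 / 2, -1 / 2, 0, 0, 0;
       0, 0, 0, 0, 0, 1, 0;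
       0, 0, 0, 0, 0, 0, 1;
       0, 0, 0, 0, 1, 0, 0]

/-! ### Lie algebras -/

/-- A finite-dimensional simple complex Lie algebra with Cartan matrix `A`. -/
def IsOfType {ι : Type*} [Finite ι] (A : Matrix ι ι ℤ)
    (L : Type*) [LieRing L] [LieAlgebra ℂ L] : Prop :=
  FiniteDimensional ℂ L ∧ LieAlgebra.IsSimple ℂ L ∧
    ∃ (H : LieSubalgebra ℂ L) (b : LieAlgebra.Basis ι H), b.A = A

/-- `M` is the fundamental representation attached to the `i`-th vertex: it is irreducible and has
a highest weight vector on which `h_i` acts by `1` and `h_j`, `j ≠ i`, by `0`. -/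
def IsFundamental {ι : Type*} [Finite ι] [DecidableEq ι] {L : Type*} [LieRing L] [LieAlgebra ℂ L]
    {H : LieSubalgebra ℂ L} (b : LieAlgebra.Basis ι H) (i : ι)
    (M : Type*) [AddCommGroup M] [Module ℂ M] [LieRingModule L M] : Prop :=
  LieModule.IsIrreducible ℂ L M ∧
    ∃ v : M, v ≠ 0 ∧ (∀ j, ⁅b.e j, v⁆ = 0) ∧ ∀ j, ⁅b.h j, v⁆ = if j = i then v else 0

/-- The abelian Lie algebra `ℂ²` (two copies of the trivial one-dimensional one). -/
def TwoTrivial : Type := Fin 2 → ℂ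

instance : AddCommGroup TwoTrivial := inferInstanceAs (AddCommGroup (Fin 2 → ℂ))

instance : Module ℂ TwoTrivial := inferInstanceAs (Module ℂ (Fin 2 → ℂ))

instance : LieRing TwoTrivial where
  bracket _ _ := 0
  add_lie _ _ _ := (add_zero 0).symm
  lie_add _ _ _ := (add_zero 0).symm
  lie_self _ := rfl
  leibniz_lie _ _ _ := (add_zero 0).symm

instance : LieAlgebra ℂ TwoTrivial where
  lie_smul c _ _ := (smul_zero c).symm

variable {g : Type*} [LieRing g] [LieAlgebra ℂ g]

/-- The Killing form of `e₆`, normalized so that roots have squared length `2`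
(the dual Coxeter number is `12`). -/
def form (x y : g) : ℂ := (1 / 24 : ℂ) * killingForm ℂ g x y

/-- A Chevalley basis of `g` with root system `roots`. The map `h` identifies the hyperplane
`cartan ℂ` with a Cartan subalgebra; it is extended to `ℂ⁷` by zero on `e₅ + e₆ + e₇`, on which
all roots vanish. `E a` is the root vector of the root `a`, and `E a = 0` if `a` is not a root. -/
structure IsChevalleyBasis (h : (Fin 7 → ℂ) →ₗ[ℂ] g) (E : (Fin 7 → ℝ) → g) : Prop where
  h_injective : ∀ u ∈ cartan ℂ, h u = 0 → u = 0
  h_degenerate : h (cx (e 5 + e 6 + e 7)) = 0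
  isCartan : ∃ H : LieSubalgebra ℂ g, H.IsCartanSubalgebra ∧ H.toSubmodule = LinearMap.range h
  E_of_not_root : ∀ a ∉ roots, E a = 0
  linearIndependent : LinearIndependent ℂ (fun a : roots => E a)
  isCompl : IsCompl (LinearMap.range h) (Submodule.span ℂ (E '' roots))
  lie_h_h : ∀ u v, ⁅h u, h v⁆ = 0
  lie_h_E : ∀ u, ∀ a ∈ roots, ⁅h u, E a⁆ = (cx a ⬝ᵥ u) • E a
  lie_E_neg : ∀ a ∈ roots, ⁅E a, E (-a)⁆ = h (cx a)
  lie_E_E : ∀ a ∈ roots, ∀ b ∈ roots, a + b ∈ roots →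
    ⁅E a, E b⁆ = E (a + b) ∨ ⁅E a, E b⁆ = -E (a + b)
  lie_E_E_zero : ∀ a ∈ roots, ∀ b ∈ roots, a + b ≠ 0 → a + b ∉ roots → ⁅E a, E b⁆ = 0

/-- `ω = exp (2πi/3)`. -/
def ω : ℂ := Complex.exp (2 * Real.pi * Complex.I / 3)

/-- The `ω^k`-eigenspace of an automorphism. -/
def grade (Λ : g ≃ₗ⁅ℂ⁆ g) (k : ZMod 3) : Submodule ℂ g where
  carrier := {x | Λ x = ω ^ k.val • x}
  zero_mem' := by simp
  add_mem' := by
    intro x y hx hy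
    simp only [Set.mem_ofPred_eq] at *
    rw [map_add, hx, hy, smul_add]
  smul_mem' := by
    intro c x hx
    simp only [Set.mem_ofPred_eq] at *
    rw [map_smul, hx, smul_comm]

/-- The subalgebra of fixed points of an automorphism. -/
def fixedSubalgebra (Λ : g ≃ₗ⁅ℂ⁆ g) : LieSubalgebra ℂ g where
  carrier := {x | Λ x = x}
  zero_mem' := by simp
  add_mem' := by
    intro x y hx hy
    simp only [Set.mem_ofPred_eq] at *
    rw [map_add, hx, hy]
  smul_mem' := by
    intro c x hx
    simp only [Set.mem_ofPred_eq] at *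
    rw [map_smul, hx]
  lie_mem' := by
    intro x y hx hy
    have hx2 : Λ x = x := hx
    have hy2 : Λ y = y := hy
    change Λ ⁅x, y⁆ = ⁅x, y⁆
    rw [LieEquiv.map_lie, hx2, hy2]

/-- The subalgebra `so(8)` of `e₆`, generated by the root vectors of `± e_j ± e_k`. -/
def so8 (E : (Fin 7 → ℝ) → g) : LieSubalgebra ℂ g := LieSubalgebra.lieSpan ℂ g (E '' rootsSO8)

/-- The `λ₁`-invariant part of `so(8)`. -/
def so8Fixed (E : (Fin 7 → ℝ) → g) (Λ : g ≃ₗ⁅ℂ⁆ g) : LieSubalgebra ℂ g :=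
  so8 E ⊓ fixedSubalgebra Λ

/-- The `ω^k`-eigenspace in `so(8)`, as a module over the invariant part of `so(8)`. -/
def so8Grade (E : (Fin 7 → ℝ) → g) (Λ : g ≃ₗ⁅ℂ⁆ g) (k : ZMod 3) :
    LieSubmodule ℂ (so8Fixed E Λ) g where
  toSubmodule := (so8 E).toSubmodule ⊓ grade Λ k
  lie_mem := by
    rintro ⟨x, hx⟩ y hy
    have hx2 : Λ x = x := hx.2
    have hy2 : Λ y = ω ^ k.val • y := hy.2
    refine ⟨(so8 E).lie_mem hx.1 hy.1, ?_⟩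
    change Λ ⁅x, y⁆ = ω ^ k.val • ⁅x, y⁆
    rw [LieEquiv.map_lie, hx2, hy2, lie_smul]

/-- The subalgebra of `e₆` obtained from the extended Dynkin diagram by dropping the vertices
`α₀, α₁, α₅`: it is generated by the Cartan subalgebra and the root vectors of `± α₂, ± α₃, ± α₄,
± α₆`. -/
def droppedSubalgebra (h : (Fin 7 → ℂ) →ₗ[ℂ] g) (E : (Fin 7 → ℝ) → g) : LieSubalgebra ℂ g :=
  LieSubalgebra.lieSpan ℂ g (Set.range h ∪
    {x | ∃ i : Fin 7, i ≠ 0 ∧ i ≠ 1 ∧ i ≠ 5 ∧ (x = E (α i) ∨ x = E (-α i))})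

/-! ### Generalized sine bases -/

/-- Representatives `±(e₁ - e_m)`, `m = 2, 3, 4`, of the `λ₁`-orbits of length three in the roots
of `so(8)`. -/
def orbitReps : Set (Fin 7 → ℝ) :=
  {e 1 - e 2, e 1 - e 3, e 1 - e 4, e 2 - e 1, e 3 - e 1, e 4 - e 1}

/-- The roots `±(e₂ - e₃)`, `±(e₁ + e₃)`, `±(e₁ + e₂)`. -/
def fixedRoots : Set (Fin 7 → ℝ) :=
  {e 2 - e 3, e 1 + e 3, e 1 + e 2, e 3 - e 2, -(e 1 + e 3), -(e 1 + e 2)}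

/-- The generator `E⁰_a = E_a + E_{λ₁ a} + E_{λ₁² a}`. -/
def E0 (E : (Fin 7 → ℝ) → g) (a : Fin 7 → ℝ) : g :=
  E a + E (lam ℝ a) + E (lam ℝ (lam ℝ a))

/-- The generator `𝔱^k_a = (E_a + ω^{-k} E_{λ₁ a} + ω^{-2k} E_{λ₁² a}) / √3`. -/
def t (E : (Fin 7 → ℝ) → g) (k : ZMod 3) (a : Fin 7 → ℝ) : g :=
  (1 / (√3 : ℂ)) • (E a + (ω ^ k.val)⁻¹ • E (lam ℝ a) + (ω ^ (2 * k.val))⁻¹ • E (lam ℝ (lam ℝ a)))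

/-- The generator `𝔥^k_{α₂} = (α₂ + ω^k α₄ + ω^{2k} α₆) / √3`. -/
def hα₂ (h : (Fin 7 → ℂ) →ₗ[ℂ] g) (k : ZMod 3) : g :=
  h ((1 / (√3 : ℂ)) • (cx (α 2) + ω ^ k.val • cx (α 4) + ω ^ (2 * k.val) • cx (α 6)))

/-- The generator `𝔥^k_5 = (e₅ + ω^k e₆ + ω^{2k} e₇) / √3`. -/
def h₅ (h : (Fin 7 → ℂ) →ₗ[ℂ] g) (k : ZMod 3) : g :=
  h ((1 / (√3 : ℂ)) • (cx (e 5) + ω ^ k.val • cx (e 6) + ω ^ (2 * k.val) • cx (e 7)))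

/-- The basis of `g₂`: the coroots `3 α₃`, `α₂ + α₄ + α₆`, the `E⁰_a` for the orbits of length
three, and the `E_a` for the invariant roots. -/
def basisG2 (h : (Fin 7 → ℂ) →ₗ[ℂ] g) (E : (Fin 7 → ℝ) → g) :
    Fin 2 ⊕ orbitReps ⊕ fixedRoots → g :=
  Sum.elim ![h (cx ((3 : ℝ) • α 3)), h (cx (α 2 + α 4 + α 6))]
    (Sum.elim (fun a => E0 E a) (fun a => E a))

/-- The basis of the summands `7` (`k = 1`) and `7'` (`k = 2`) of `so(8)`. -/
def basis7 (h : (Fin 7 → ℂ) →ₗ[ℂ] g) (E : (Fin 7 → ℝ) → g) (k : ZMod 3) :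
    Unit ⊕ orbitReps → g :=
  Sum.elim (fun _ => hα₂ h k) (fun a => t E k a)

/-- The vectors `𝔱^k_{w,±}`, where `w` runs over the weights of the left spinor representation. -/
def basisJ (E : (Fin 7 → ℝ) → g) (k : ZMod 3) : weightsL × ℤˣ → g :=
  fun p => t E k (aL p.1 p.2)

/-- The generalized sine basis of `g_k`, `k = 1, 2`. -/
def basisGrade (h : (Fin 7 → ℂ) →ₗ[ℂ] g) (E : (Fin 7 → ℝ) → g) (k : ZMod 3) :
    (weightsL × ℤˣ) ⊕ Unit ⊕ (Unit ⊕ orbitReps) → g :=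
  Sum.elim (basisJ E k) (Sum.elim (fun _ => h₅ h k) (basis7 h E k))

/-- A family is a basis of a subspace: it is linearly independent and spans the subspace. -/
def IsBasisOf {ι : Type*} (v : ι → g) (S : Submodule ℂ g) : Prop :=
  LinearIndependent ℂ v ∧ Submodule.span ℂ (Set.range v) = S

end E6GS

end

open scoped Matrix

set_option linter.unusedSimpArgs false

namespace E6GS

/-! ### The root lattice in coordinates with respect to the simple roots -/

/-! The root lattice is `Q` = ℤ⁶ with λ₁ acting by the integral map `lamQ`, and `rv` embeds it in
ℝ⁷, so that assertions about the 72 roots become finite checks. The rest follows from a Chevalley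
basis that λ₁ permutes without signs.

Weyl group. λ₁ permutes α₀, …, α₆ and ϖ₁ pairs to 1, -1, 0 with α₁, α₀ and the other αᵢ; hence u ↦
λ₁(u - ϖ₁) permutes the seven inequalities of the alcove (`lam_sub_mem_alcove`). For a second such
w, the product w λ₁⁻¹ maps the alcove to itself, so it permutes the simple roots. Weyl group
elements move ϖ₁ by root lattice vectors only, whereas the nontrivial diagram automorphism exchanges
the two nonzero classes of weights modulo roots; hence w λ₁⁻¹ = 1 (`eq_one_of_image_alcove`).

Chevalley basis. The usual signs are (-1)^c(a,b) with c bilinear and c(a,a) ≡ (a,a)/2 modulo 2. Here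
c is chosen λ₁-invariant modulo 2. The remaining sign in [E_a, E_{-a}] is removed by an odd
λ₁-invariant sign function, which exists because no λ₁-orbit contains opposite roots. The structure
constants are then λ₁-invariant (`strC_lamQ`). The Jacobi identity need not be checked: the root
vectors are realized by matrices on the minuscule representation of dimension 27, and the Lie
algebra that they generate is mapped to the given simple one by a Goursat argument (`exists_lieHom`,
`exists_chev`). As the constants are invariant, permuting the root vectors is an automorphism
(`Chev.autLin_lie`).

Killing form and bases. On the Cartan subalgebra the form is the sum of (a·u)(a·v) over the roots;
invariance gives all other values. The eigenvectors formed from λ₁-orbits have dual families under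
the form, hence are independent, and 14 + 7 + 7 = 28 and 30 + 24 + 24 = 78 show that they span
(`span_eq_of_card_le`).

Isomorphism types. Lie algebras are recognized by Chevalley generators, a dimension bound and the
fact that nonzero ideals meet the Cartan subalgebra (`nonempty_lieEquiv`, `exists_mem_ideal`). The
relations are identities between formal combinations over ℤ[τ], τ a root of unity, and are decided
by computation (`lie_lval_eq`). The invariants of so(8) are simple because an ideal that meets the
Cartan subalgebra contains all generators (`ideal_eq_top`); the 7-dimensional modules are
irreducible because seven vectors of distinct weights are joined by raising and lowering operators.
In g₀ the short simple root of g₂ has a three-dimensional weight space, whose Fourier basis supplies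
the three outer simple root vectors of D₄. -/

/-- The root lattice of `E₆`, in coordinates with respect to the simple roots in Bourbaki's
numbering. -/
abbrev Q : Type := ℤ × ℤ × ℤ × ℤ × ℤ × ℤ

/-- The coordinates of a lattice vector. -/
def Q.coord (a : Q) : Fin 6 → ℤ := ![a.1, a.2.1, a.2.2.1, a.2.2.2.1, a.2.2.2.2.1, a.2.2.2.2.2]

/-- The simple roots. -/
def sQ (i : Fin 6) : Q :=
  (if i = 0 then 1 else 0, if i = 1 then 1 else 0, if i = 2 then 1 else 0,
    if i = 3 then 1 else 0, if i = 4 then 1 else 0, if i = 5 then 1 else 0)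

/-- The scalar product of the root lattice. -/
def pr : Q → Q → ℤ
  | (a0, a1, a2, a3, a4, a5), (b0, b1, b2, b3, b4, b5) =>
    2 * (a0 * b0 + a1 * b1 + a2 * b2 + a3 * b3 + a4 * b4 + a5 * b5) - (a0 * b2 + a2 * b0)
      - (a1 * b3 + a3 * b1) - (a2 * b3 + a3 * b2) - (a3 * b4 + a4 * b3) - (a4 * b5 + a5 * b4)

/-- The action of `λ₁` on the root lattice. -/
def lamQ : Q → Q
  | (c0, c1, c2, c3, c4, c5) =>
    (c5 - c0, c2 - 2 * c0, c4 - 2 * c0, c3 - 3 * c0, c1 - 2 * c0, -c0)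

/-- A `λ₁`-invariant bilinear form, whose reduction modulo `2` polarizes the norm form. -/
def cocycle : Q → Q → ℤ
  | (a0, a1, a2, a3, a4, a5), (b0, b1, b2, b3, b4, b5) =>
    a0 * (b0 + b1 + b2 + b3 + b4) + a1 * (b0 + b1 + b5) + a2 * (b2 + b5)
      + a3 * (b0 + b1 + b2 + b3 + b4 + b5) + a4 * (b0 + b4) + a5 * (b1 + b2 + b3 + b4 + b5)

/-- The sign `(-1)^n`. -/
def parity (n : ℤ) : ℤ := if n % 2 = 0 then 1 else -1

/-- An odd and `λ₁`-invariant cubic function on the root lattice without zeros in the roots. -/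
def cubic : Q → ℤ
  | (c0, c1, c2, c3, c4, c5) =>
    (c3 + c4) ^ 3 + (c1 + c3 - 5 * c0) ^ 3 + (c2 + c3 - 5 * c5) ^ 3

/-- A `λ₁`-invariant choice of signs that are opposite for opposite roots. -/
def sig (a : Q) : ℤ := if 0 < cubic a then 1 else -1

/-- The structure constants of `e₆`. -/
def strC (a b : Q) : ℤ := parity (cocycle a b) * sig a * sig b * sig (a + b)

/-- The positive roots. -/
def posList : List Q :=
  [(1,0,0,0,0,0), (0,1,0,0,0,0), (0,0,1,0,0,0), (0,0,0,1,0,0), (0,0,0,0,1,0), (0,0,0,0,0,1),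
   (1,0,1,0,0,0), (0,1,0,1,0,0), (0,0,1,1,0,0), (0,0,0,1,1,0), (0,0,0,0,1,1), (1,0,1,1,0,0),
   (0,1,1,1,0,0), (0,1,0,1,1,0), (0,0,1,1,1,0), (0,0,0,1,1,1), (1,1,1,1,0,0), (1,0,1,1,1,0),
   (0,1,1,1,1,0), (0,1,0,1,1,1), (0,0,1,1,1,1), (1,1,1,1,1,0), (1,0,1,1,1,1), (0,1,1,2,1,0),
   (0,1,1,1,1,1), (1,1,1,2,1,0), (1,1,1,1,1,1), (0,1,1,2,1,1), (1,1,2,2,1,0), (1,1,1,2,1,1),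
   (0,1,1,2,2,1), (1,1,2,2,1,1), (1,1,1,2,2,1), (1,1,2,2,2,1), (1,1,2,3,2,1), (1,2,2,3,2,1)]

/-- The roots. -/
def rootList : List Q := posList ++ posList.map (fun a => -a)

/-- The roots of `so(8)`. -/
def so8List : List Q := rootList.filter fun a => a.1 = 0 ∧ a.2.2.2.2.2 = 0

/-- The roots `α^L_{w,±}`. -/
def spinList : List Q := rootList.filter fun a => a.1 = a.2.2.2.2.2 ∧ a.1 ≠ 0

/-- Representatives of the orbits of length three of `λ₁` in the roots of `so(8)`. -/
def repList : List Q :=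
  [(0,0,0,0,1,0), (0,0,0,1,1,0), (0,0,1,1,1,0),
   (0,0,0,0,-1,0), (0,0,0,-1,-1,0), (0,0,-1,-1,-1,0)]

/-- The roots fixed by `λ₁`. -/
def fixList : List Q := rootList.filter fun a => lamQ a = a

/-- The differences between the weights of the representation `27` and its lowest weight. -/
def weightList : List Q :=
  [(0,0,0,0,0,0), (1,0,0,0,0,0), (1,0,1,0,0,0), (1,0,1,1,0,0), (1,1,1,1,0,0), (1,0,1,1,1,0),
   (1,1,1,1,1,0), (1,0,1,1,1,1), (1,1,1,2,1,0), (1,1,1,1,1,1), (1,1,2,2,1,0), (1,1,1,2,1,1),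
   (2,1,2,2,1,0), (1,1,2,2,1,1), (1,1,1,2,2,1), (2,1,2,2,1,1), (1,1,2,2,2,1), (2,1,2,2,2,1),
   (1,1,2,3,2,1), (2,1,2,3,2,1), (1,2,2,3,2,1), (2,2,2,3,2,1), (2,1,3,3,2,1), (2,2,3,3,2,1),
   (2,2,3,4,2,1), (2,2,3,4,3,1), (2,2,3,4,3,2)]

theorem pr_comm (a b : Q) : pr a b = pr b a := by
  simp only [pr]; ring

theorem pr_add_left (a b c : Q) : pr (a + b) c = pr a c + pr b c := by
  simp only [pr, Prod.fst_add, Prod.snd_add]; ring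

theorem pr_add_right (a b c : Q) : pr a (b + c) = pr a b + pr a c := by
  simp only [pr, Prod.fst_add, Prod.snd_add]; ring

theorem pr_neg_left (a b : Q) : pr (-a) b = -pr a b := by
  simp only [pr, Prod.fst_neg, Prod.snd_neg]; ring

theorem pr_neg_right (a b : Q) : pr a (-b) = -pr a b := by
  simp only [pr, Prod.fst_neg, Prod.snd_neg]; ring

theorem pr_lamQ (a b : Q) : pr (lamQ a) (lamQ b) = pr a b := by
  simp only [pr, lamQ]; ring

theorem lamQ_add (a b : Q) : lamQ (a + b) = lamQ a + lamQ b := by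
  simp only [lamQ, Prod.fst_add, Prod.snd_add, Prod.mk_add_mk, Prod.mk.injEq]
  refine ⟨?_, ?_, ?_, ?_, ?_, ?_⟩ <;> ring

theorem lamQ_neg (a : Q) : lamQ (-a) = -lamQ a := by
  obtain ⟨a0, a1, a2, a3, a4, a5⟩ := a
  simp only [lamQ, Prod.neg_mk, Prod.mk.injEq]
  refine ⟨?_, ?_, ?_, ?_, ?_, ?_⟩ <;> first | omega | trivial

theorem lamQ_lamQ_lamQ (a : Q) : lamQ (lamQ (lamQ a)) = a := by
  obtain ⟨a0, a1, a2, a3, a4, a5⟩ := a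
  simp only [lamQ, Prod.mk.injEq]
  refine ⟨?_, ?_, ?_, ?_, ?_, ?_⟩ <;> ring

theorem lamQ_injective : Function.Injective lamQ := fun a b h => by
  rw [← lamQ_lamQ_lamQ a, h, lamQ_lamQ_lamQ]

theorem cocycle_add_left (a b c : Q) : cocycle (a + b) c = cocycle a c + cocycle b c := by
  simp only [cocycle, Prod.fst_add, Prod.snd_add]; ring

theorem cocycle_add_right (a b c : Q) : cocycle a (b + c) = cocycle a b + cocycle a c := by
  simp only [cocycle, Prod.fst_add, Prod.snd_add]; ring

theorem cocycle_neg_left (a b : Q) : cocycle (-a) b = -cocycle a b := by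
  simp only [cocycle, Prod.fst_neg, Prod.snd_neg]; ring

theorem cocycle_neg_right (a b : Q) : cocycle a (-b) = -cocycle a b := by
  simp only [cocycle, Prod.fst_neg, Prod.snd_neg]; ring

theorem parity_add (m n : ℤ) : parity (m + n) = parity m * parity n := by
  unfold parity; split_ifs <;> simp <;> omega

theorem parity_congr {m n : ℤ} (h : (m - n) % 2 = 0) : parity m = parity n := by
  unfold parity; split_ifs <;> first | rfl | omega

theorem cubic_lamQ (a : Q) : cubic (lamQ a) = cubic a := by
  simp only [cubic, lamQ]; ring

theorem cubic_neg (a : Q) : cubic (-a) = -cubic a := by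
  simp only [cubic, Prod.fst_neg, Prod.snd_neg]; ring

theorem sig_lamQ (a : Q) : sig (lamQ a) = sig a := by rw [sig, cubic_lamQ, sig]

theorem sig_mul_self (a : Q) : sig a * sig a = 1 := by
  unfold sig; split_ifs <;> rfl

theorem sig_eq (a : Q) : sig a = 1 ∨ sig a = -1 := by
  unfold sig; split_ifs <;> simp

/-- An odd invariant function can avoid 0 on the roots: λ₁ᵏ a = -a would give a = λ₁³ᵏ a = -a, so no
orbit contains opposite roots. This polynomial is an explicit instance. -/
theorem cubic_ne_zero {a : Q} (ha : a ∈ rootList) : cubic a ≠ 0 := by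
  revert a; decide +kernel

theorem sig_neg {a : Q} (ha : a ∈ rootList) : sig (-a) = -sig a := by
  have := cubic_ne_zero ha
  unfold sig; rw [cubic_neg]; split_ifs <;> first | rfl | omega

/-- The integral form itself is not invariant, only its reduction modulo 2; signs see nothing more.
-/
theorem parity_cocycle_lamQ (a b : Q) :
    parity (cocycle (lamQ a) (lamQ b)) = parity (cocycle a b) := by
  apply parity_congr
  obtain ⟨a0, a1, a2, a3, a4, a5⟩ := a
  obtain ⟨b0, b1, b2, b3, b4, b5⟩ := b
  simp only [cocycle, lamQ]
  ring_nf
  omega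

/-- Behind this is c(a,b) + c(b,a) ≡ (a,b) modulo 2. It makes the constants antisymmetric if (a,b) =
-1, and makes the two products cancel in the commutator if (a,b) = 0. -/
theorem parity_cocycle_comm (a b : Q) :
    parity (cocycle b a) = parity (pr a b) * parity (cocycle a b) := by
  rw [← parity_add]
  apply parity_congr
  obtain ⟨a0, a1, a2, a3, a4, a5⟩ := a
  obtain ⟨b0, b1, b2, b3, b4, b5⟩ := b
  simp only [cocycle, pr]
  ring_nf
  omega

/-- The reason for the invariant choices of `cocycle` and `sig`: λ₁ can act on root vectors without
extra signs. -/
theorem strC_lamQ (a b : Q) : strC (lamQ a) (lamQ b) = strC a b := by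
  simp only [strC, parity_cocycle_lamQ, sig_lamQ, ← lamQ_add]

theorem strC_eq (a b : Q) : strC a b = 1 ∨ strC a b = -1 := by
  have h : parity (cocycle a b) = 1 ∨ parity (cocycle a b) = -1 := by
    unfold parity; split_ifs <;> simp
  unfold strC
  rcases h with h | h <;> rcases sig_eq a with h1 | h1 <;> rcases sig_eq b with h2 | h2 <;>
    rcases sig_eq (a + b) with h3 | h3 <;> simp [h, h1, h2, h3]

theorem pr_self {a : Q} (ha : a ∈ rootList) : pr a a = 2 := by
  revert a; decide +kernel

theorem neg_mem {a : Q} (ha : a ∈ rootList) : -a ∈ rootList := by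
  revert a; decide +kernel

theorem lamQ_mem {a : Q} (ha : a ∈ rootList) : lamQ a ∈ rootList := by
  revert a; decide +kernel



-- In a simply laced system the scalar product of two roots decides whether their sum is a root. All
-- bracket computations below branch along these five cases.
set_option synthInstance.maxSize 1000 in
set_option synthInstance.maxHeartbeats 200000 in
theorem pr_cases {a b : Q} (ha : a ∈ rootList) (hb : b ∈ rootList) :
    a = b ∨ a + b = 0 ∨ (pr a b = -1 ∧ a + b ∈ rootList) ∨ pr a b = 0 ∨ pr a b = 1 := by
  have key : ∀ a ∈ rootList, ∀ b ∈ rootList,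
      a = b ∨ a + b = 0 ∨ (pr a b = -1 ∧ a + b ∈ rootList) ∨ pr a b = 0 ∨ pr a b = 1 := by
    decide +kernel
  exact key a ha b hb

theorem pr_eq_of_add_mem {a b : Q} (ha : a ∈ rootList) (hb : b ∈ rootList)
    (hab : a + b ∈ rootList) : pr a b = -1 := by
  have h := pr_self hab
  rw [pr_add_left, pr_add_right, pr_add_right, pr_self ha, pr_self hb, pr_comm b a] at h
  omega

theorem add_mem_of_pr {a b : Q} (ha : a ∈ rootList) (hb : b ∈ rootList)
    (hab : pr a b = -1) : a + b ∈ rootList := by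
  rcases pr_cases ha hb with h | h | h | h | h
  · rw [h, pr_self hb] at hab; omega
  · rw [eq_neg_of_add_eq_zero_left h, pr_neg_left, pr_self hb] at hab; omega
  · exact h.2
  · omega
  · omega

end E6GS



namespace E6GS

/-! ### The root system in the canonical coordinates of `ℝ⁷` -/

/-- The vector of `ℝ⁷` with doubled coordinates `1, …, 4` and with coordinates `5, 6, 7` in units of
`1/√2`. -/
noncomputable def dv (x : Fin 7 → ℤ) : Fin 7 → ℝ :=
  fun i => if (i : ℕ) < 4 then (x i : ℝ) / 2 else (x i : ℝ) / √2

/-- The integral coordinates of a lattice vector. -/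
def dq : Q → Fin 7 → ℤ
  | (c0, c1, c2, c3, c4, c5) =>
    ![-c0 + 2 * c4 - 2 * c5, -c0 + 2 * c3 - 2 * c4, -c0 + 2 * c1 + 2 * c2 - 2 * c3,
      c0 + 2 * c1 - 2 * c2, c0, c5 - c0, -c5]

/-- The vector of `ℝ⁷` attached to an element of the root lattice. -/
noncomputable def rv (a : Q) : Fin 7 → ℝ := dv (dq a)

theorem sqrt_two_mul_self : (√2 : ℝ) * √2 = 2 := Real.mul_self_sqrt (by norm_num)

theorem dv_injective : Function.Injective dv := fun x y h => by
  funext i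
  have := congrFun h i
  have h2 : (√2 : ℝ) ≠ 0 := by positivity
  unfold dv at this
  split_ifs at this <;> field_simp at this <;> exact_mod_cast this

theorem dq_injective : Function.Injective dq := by
  rintro ⟨a0, a1, a2, a3, a4, a5⟩ ⟨b0, b1, b2, b3, b4, b5⟩ h
  have h0 := congrFun h 0
  have h1 := congrFun h 1
  have h2 := congrFun h 2
  have h3 := congrFun h 3
  have h4 := congrFun h 4
  have h6 := congrFun h 6
  simp [dq] at h0 h1 h2 h3 h4 h6
  simp only [Prod.mk.injEq]
  omega

theorem rv_injective : Function.Injective rv := dv_injective.comp dq_injective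

theorem rv_add (a b : Q) : rv (a + b) = rv a + rv b := by
  obtain ⟨a0, a1, a2, a3, a4, a5⟩ := a
  obtain ⟨b0, b1, b2, b3, b4, b5⟩ := b
  funext i
  fin_cases i <;> simp [rv, dv, dq] <;> ring

theorem rv_neg (a : Q) : rv (-a) = -rv a := by
  obtain ⟨a0, a1, a2, a3, a4, a5⟩ := a
  funext i
  fin_cases i <;> simp [rv, dv, dq] <;> ring

theorem rv_dot (a b : Q) : rv a ⬝ᵥ rv b = pr a b := by
  obtain ⟨a0, a1, a2, a3, a4, a5⟩ := a
  obtain ⟨b0, b1, b2, b3, b4, b5⟩ := b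
  have h : (√2 : ℝ)⁻¹ * (√2)⁻¹ = 1 / 2 := by rw [← mul_inv, sqrt_two_mul_self]; norm_num
  simp [rv, dv, dq, pr, dotProduct, Fin.sum_univ_seven, div_eq_mul_inv]
  linear_combination ((a0 : ℝ) * b0 + (a5 - a0) * (b5 - b0) + a5 * b5) * h

theorem lam_rv (a : Q) : lam ℝ (rv a) = rv (lamQ a) := by
  obtain ⟨a0, a1, a2, a3, a4, a5⟩ := a
  funext i
  fin_cases i <;>
    simp [rv, dv, dq, lamQ, lam, Matrix.mulVec, dotProduct, Fin.sum_univ_seven] <;> ring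

theorem rv_mem_cartan (a : Q) : rv a ∈ cartan ℝ := by
  obtain ⟨a0, a1, a2, a3, a4, a5⟩ := a
  change _ + _ + _ = _
  simp [rv, dv, dq]; ring

/-- The simple roots and the minimal root in lattice coordinates. -/
def αQ : Fin 7 → Q := ![(-1,-2,-2,-3,-2,-1), sQ 0, sQ 2, sQ 3, sQ 4, sQ 5, sQ 1]

theorem α_eq (i : Fin 7) : α i = rv (αQ i) := by
  funext k
  fin_cases i <;> fin_cases k <;> simp [α, rv, dv, dq, αQ, sQ, e] <;> norm_num <;> ring

/-- The root `±e_j ± e_k` in integral coordinates. -/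
def so8Vec (j k : Fin 4) (s t : ℤˣ) : Fin 7 → ℤ :=
  fun i => (if (i : ℕ) = j then 2 * (s : ℤ) else 0) + (if (i : ℕ) = k then 2 * (t : ℤ) else 0)

/-- A root with half-integral components in integral coordinates. -/
def spinVec (s0 s1 s2 s3 : ℤˣ) (x y z : ℤ) : Fin 7 → ℤ := ![s0, s1, s2, s3, x, y, z]

/-- A root `±e_j ± (e₆ - e₇)/√2` in integral coordinates. -/
def vecVec (j : Fin 4) (s t : ℤˣ) : Fin 7 → ℤ :=
  fun i => (if (i : ℕ) = j then 2 * (s : ℤ) else 0) +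
    (if (i : ℕ) = 5 then (t : ℤ) else if (i : ℕ) = 6 then -(t : ℤ) else 0)

theorem dv_so8Vec (j k : Fin 4) (s t : ℤˣ) :
    dv (so8Vec j k s t) = sg s • e (j + 1) + sg t • e (k + 1) := by
  funext i
  have hj := j.2
  have hk := k.2
  simp only [dv, so8Vec, sg, e, Pi.add_apply, Pi.smul_apply, smul_eq_mul, add_left_inj]
  split_ifs <;> first | omega | (push_cast; ring)

theorem dv_spinVec_L (s : Fin 4 → ℤˣ) (t : ℤˣ) :
    dv (spinVec (s 0) (s 1) (s 2) (s 3) t 0 (-t)) =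
      aL ((1 / 2 : ℝ) • ∑ j : Fin 4, sg (s j) • e (j + 1)) t := by
  funext i
  fin_cases i <;> simp [dv, spinVec, aL, sg, e, Fin.sum_univ_four] <;> ring

theorem dv_spinVec_R (s : Fin 4 → ℤˣ) (t : ℤˣ) :
    dv (spinVec (s 0) (s 1) (s 2) (s 3) t (-t) 0) =
      aR ((1 / 2 : ℝ) • ∑ j : Fin 4, sg (s j) • e (j + 1)) t := by
  funext i
  fin_cases i <;> simp [dv, spinVec, aR, sg, e, Fin.sum_univ_four] <;> ring

theorem dv_vecVec (j : Fin 4) (s t : ℤˣ) : dv (vecVec j s t) = aV (sg s • e (j + 1)) t := by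
  funext i
  fin_cases j <;> fin_cases i <;> simp [dv, vecVec, aV, sg, e] <;> ring

/-- The roots `α^R_{w,±}`. -/
def coSpinList : List Q := rootList.filter fun a => a.1 ≠ 0 ∧ a.2.2.2.2.2 = 0

/-- The roots `α^V_{w,±}`. -/
def vecList : List Q := rootList.filter fun a => a.1 = 0 ∧ a.2.2.2.2.2 ≠ 0

/-- The components along e₅, e₆, e₇ are proportional to c₀, c₅ - c₀, -c₅, so the four families of
roots are told apart by the first and last simple coordinates c₀ and c₅. The equality and its three
analogues below are then finite comparisons in integral coordinates. -/
theorem rootsSO8_eq : rootsSO8 = rv '' {a | a ∈ so8List} := by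
  ext v
  constructor
  · rintro ⟨j, k, s, t, hjk, rfl⟩
    have key : ∀ j k : Fin 4, ∀ s t : ℤˣ, j ≠ k → ∃ a ∈ so8List, dq a = so8Vec j k s t := by
      decide +kernel
    obtain ⟨a, ha, h⟩ := key j k s t hjk
    exact ⟨a, ha, by rw [rv, h, dv_so8Vec]⟩
  · rintro ⟨a, ha, rfl⟩
    have key : ∀ a ∈ so8List, ∃ j k : Fin 4, ∃ s t : ℤˣ, j ≠ k ∧ dq a = so8Vec j k s t := by
      decide +kernel
    obtain ⟨j, k, s, t, hjk, h⟩ := key a ha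
    exact ⟨j, k, s, t, hjk, by rw [rv, h, dv_so8Vec]⟩

theorem aL_mem_iff (v : Fin 7 → ℝ) :
    (∃ w ∈ weightsL, ∃ s, v = aL w s) ↔ ∃ a ∈ spinList, rv a = v := by
  constructor
  · rintro ⟨w, ⟨s, hs, rfl⟩, t, rfl⟩
    have key : ∀ s0 s1 s2 s3 t : ℤˣ, s0 * s1 * s2 * s3 = 1 →
        ∃ a ∈ spinList, dq a = spinVec s0 s1 s2 s3 t 0 (-t) := by decide +kernel
    obtain ⟨a, ha, h⟩ := key (s 0) (s 1) (s 2) (s 3) t (by rwa [← Fin.prod_univ_four])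
    exact ⟨a, ha, by rw [rv, h, dv_spinVec_L]⟩
  · rintro ⟨a, ha, rfl⟩
    have key : ∀ a ∈ spinList, ∃ s0 s1 s2 s3 t : ℤˣ, s0 * s1 * s2 * s3 = 1 ∧
        dq a = spinVec s0 s1 s2 s3 t 0 (-t) := by decide +kernel
    obtain ⟨s0, s1, s2, s3, t, hs, h⟩ := key a ha
    exact ⟨_, ⟨![s0, s1, s2, s3], by rw [Fin.prod_univ_four]; exact hs, rfl⟩, t,
      by rw [rv, h, ← dv_spinVec_L]; rfl⟩

theorem aR_mem_iff (v : Fin 7 → ℝ) :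
    (∃ w ∈ weightsR, ∃ s, v = aR w s) ↔ ∃ a ∈ coSpinList, rv a = v := by
  constructor
  · rintro ⟨w, ⟨s, hs, rfl⟩, t, rfl⟩
    have key : ∀ s0 s1 s2 s3 t : ℤˣ, s0 * s1 * s2 * s3 = -1 →
        ∃ a ∈ coSpinList, dq a = spinVec s0 s1 s2 s3 t (-t) 0 := by decide +kernel
    obtain ⟨a, ha, h⟩ := key (s 0) (s 1) (s 2) (s 3) t (by rwa [← Fin.prod_univ_four])
    exact ⟨a, ha, by rw [rv, h, dv_spinVec_R]⟩
  · rintro ⟨a, ha, rfl⟩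
    have key : ∀ a ∈ coSpinList, ∃ s0 s1 s2 s3 t : ℤˣ, s0 * s1 * s2 * s3 = -1 ∧
        dq a = spinVec s0 s1 s2 s3 t (-t) 0 := by decide +kernel
    obtain ⟨s0, s1, s2, s3, t, hs, h⟩ := key a ha
    exact ⟨_, ⟨![s0, s1, s2, s3], by rw [Fin.prod_univ_four]; exact hs, rfl⟩, t,
      by rw [rv, h, ← dv_spinVec_R]; rfl⟩

theorem aV_mem_iff (v : Fin 7 → ℝ) :
    (∃ w ∈ weightsV, ∃ s, v = aV w s) ↔ ∃ a ∈ vecList, rv a = v := by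
  constructor
  · rintro ⟨w, ⟨j, s, rfl⟩, t, rfl⟩
    have key : ∀ j : Fin 4, ∀ s t : ℤˣ, ∃ a ∈ vecList, dq a = vecVec j s t := by decide +kernel
    obtain ⟨a, ha, h⟩ := key j s t
    exact ⟨a, ha, by rw [rv, h, dv_vecVec]⟩
  · rintro ⟨a, ha, rfl⟩
    have key : ∀ a ∈ vecList, ∃ j : Fin 4, ∃ s t : ℤˣ, dq a = vecVec j s t := by decide +kernel
    obtain ⟨j, s, t, h⟩ := key a ha
    exact ⟨_, ⟨j, s, rfl⟩, t, by rw [rv, h, dv_vecVec]⟩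

theorem mem_rootList_iff (a : Q) :
    a ∈ rootList ↔ a ∈ so8List ∨ a ∈ spinList ∨ a ∈ coSpinList ∨ a ∈ vecList := by
  constructor
  · have key : ∀ a ∈ rootList, a ∈ so8List ∨ a ∈ spinList ∨ a ∈ coSpinList ∨ a ∈ vecList := by
      decide +kernel
    exact key a
  · rintro (h | h | h | h) <;> exact List.mem_of_mem_filter h

theorem roots_eq : roots = rv '' {a | a ∈ rootList} := by
  ext v
  have h1 : v ∈ rootsSO8 ↔ ∃ a ∈ so8List, rv a = v := by rw [rootsSO8_eq]; rfl
  have : v ∈ roots ↔ ((v ∈ rootsSO8 ∨ ∃ w ∈ weightsL, ∃ s, v = aL w s) ∨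
      ∃ w ∈ weightsR, ∃ s, v = aR w s) ∨ ∃ w ∈ weightsV, ∃ s, v = aV w s := Iff.rfl
  rw [this, h1, aL_mem_iff, aR_mem_iff, aV_mem_iff]
  simp only [Set.mem_image, Set.mem_ofPred_eq, mem_rootList_iff]
  grind

theorem rv_mem_roots {a : Q} : rv a ∈ roots ↔ a ∈ rootList := by
  rw [roots_eq]; exact rv_injective.mem_set_image

theorem rootList_nodup : rootList.Nodup := by decide +kernel

theorem ncard_image_rv {l : List Q} (h : l.Nodup) : (rv '' {a | a ∈ l}).ncard = l.length := by
  rw [Set.ncard_image_of_injective _ rv_injective, ← List.toFinset_card_of_nodup h,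
    ← Set.ncard_coe_finset]
  congr; ext; simp

theorem roots_ncard : roots.ncard = 72 := by
  rw [roots_eq, ncard_image_rv rootList_nodup]; rfl

theorem αQ_mem (i : Fin 7) : αQ i ∈ rootList := by revert i; decide +kernel

theorem α_mem (i : Fin 7) : α i ∈ roots := by rw [α_eq, rv_mem_roots]; exact αQ_mem i

theorem rv_zero : rv 0 = 0 := by
  have := rv_add 0 0
  rw [add_zero] at this
  exact left_eq_add.mp this

theorem rv_nsmul (n : ℕ) (a : Q) : rv (n • a) = n • rv a := by
  induction n with
  | zero => rw [zero_smul, zero_smul, rv_zero]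
  | succ n ih => rw [succ_nsmul, succ_nsmul, rv_add, ih]

theorem α_zero_eq : α 0 = -(α 1 + 2 • α 2 + 3 • α 3 + 2 • α 4 + α 5 + 2 • α 6) := by
  simp only [α_eq, ← rv_nsmul, ← rv_add, ← rv_neg]
  rfl

theorem ϖ₁_mem : ϖ₁ ∈ cartan ℝ := by
  change _ + _ + _ = _
  simp [ϖ₁, e]; ring

theorem rv_dot_ϖ₁ (a : Q) : rv a ⬝ᵥ ϖ₁ = a.1 := by
  obtain ⟨a0, a1, a2, a3, a4, a5⟩ := a
  have h2 : (√2 : ℝ) ≠ 0 := by positivity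
  simp [rv, dv, dq, ϖ₁, e, dotProduct, Fin.sum_univ_seven]
  field_simp
  ring

theorem α_dot_ϖ₁ (i : Fin 7) (hi : i ≠ 0) : α i ⬝ᵥ ϖ₁ = if i = 1 then 1 else 0 := by
  rw [α_eq, rv_dot_ϖ₁]
  fin_cases i <;> simp [αQ, sQ] at hi ⊢

theorem e_sub_eq : e 1 - e 2 = rv (0,0,0,0,1,0) ∧ e 3 - e 4 = rv (0,0,1,0,0,0) ∧
    e 3 + e 4 = rv (0,1,0,0,0,0) ∧ e 1 - e 3 = rv (0,0,0,1,1,0) ∧ e 2 - e 4 = rv (0,0,1,1,0,0) ∧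
    e 2 + e 4 = rv (0,1,0,1,0,0) ∧ e 1 - e 4 = rv (0,0,1,1,1,0) ∧ e 2 + e 3 = rv (0,1,1,1,0,0) ∧
    e 1 + e 4 = rv (0,1,0,1,1,0) ∧ e 2 - e 3 = rv (0,0,0,1,0,0) ∧ e 1 + e 3 = rv (0,1,1,1,1,0) ∧
    e 1 + e 2 = rv (0,1,1,2,1,0) := by
  refine ⟨?_, ?_, ?_, ?_, ?_, ?_, ?_, ?_, ?_, ?_, ?_, ?_⟩ <;> funext i <;> fin_cases i <;>
    simp [rv, dv, dq, e]

theorem orbitReps_eq : orbitReps = rv '' {a | a ∈ repList} := by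
  obtain ⟨h1, h2, h3, h4, h5, h6, h7, h8, h9, h10, h11, h12⟩ := e_sub_eq
  have h1' : e 2 - e 1 = rv (0,0,0,0,-1,0) := by rw [← neg_sub, h1, ← rv_neg]; rfl
  have h4' : e 3 - e 1 = rv (0,0,0,-1,-1,0) := by rw [← neg_sub, h4, ← rv_neg]; rfl
  have h7' : e 4 - e 1 = rv (0,0,-1,-1,-1,0) := by rw [← neg_sub, h7, ← rv_neg]; rfl
  ext v
  simp only [orbitReps, h1, h4, h7, h1', h4', h7', Set.mem_insert_iff, Set.mem_singleton_iff,
    Set.mem_image, Set.mem_ofPred_eq, repList, List.mem_cons, List.not_mem_nil, or_false,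
    exists_eq_or_imp, exists_eq_left, eq_comm]

theorem fixedRoots_eq : fixedRoots = rv '' {a | a ∈ fixList} := by
  obtain ⟨h1, h2, h3, h4, h5, h6, h7, h8, h9, h10, h11, h12⟩ := e_sub_eq
  have h10' : e 3 - e 2 = rv (0,0,0,-1,0,0) := by rw [← neg_sub, h10, ← rv_neg]; rfl
  have h11' : -rv (0,1,1,1,1,0) = rv (0,-1,-1,-1,-1,0) := by rw [← rv_neg]; rfl
  have h12' : -rv (0,1,1,2,1,0) = rv (0,-1,-1,-2,-1,0) := by rw [← rv_neg]; rfl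
  have key : fixList = [(0,0,0,1,0,0), (0,1,1,1,1,0), (0,1,1,2,1,0), (0,0,0,-1,0,0),
    (0,-1,-1,-1,-1,0), (0,-1,-1,-2,-1,0)] := by decide +kernel
  ext v
  simp only [fixedRoots, h11', h12', h10, h11, h12, h10', Set.mem_insert_iff,
    Set.mem_singleton_iff, Set.mem_image, Set.mem_ofPred_eq, key, List.mem_cons,
    List.not_mem_nil, or_false, exists_eq_or_imp, exists_eq_left, eq_comm]

theorem lam_α : lam ℝ (α 1) = α 0 ∧ lam ℝ (α 2) = α 6 ∧ lam ℝ (α 3) = α 3 ∧ lam ℝ (α 4) = α 2 ∧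
      lam ℝ (α 5) = α 1 ∧ lam ℝ (α 6) = α 4 ∧ lam ℝ (α 0) = α 5 := by
  simp only [α_eq, lam_rv]
  refine ⟨?_, ?_, ?_, ?_, ?_, ?_, ?_⟩ <;> rfl

theorem lam_e_sub : lam ℝ (e 1 - e 2) = e 3 - e 4 ∧ lam ℝ (e 3 - e 4) = e 3 + e 4 ∧
      lam ℝ (e 1 - e 3) = e 2 - e 4 ∧ lam ℝ (e 2 - e 4) = e 2 + e 4 ∧
      lam ℝ (e 1 - e 4) = e 2 + e 3 ∧ lam ℝ (e 2 + e 3) = e 1 + e 4 := by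
  obtain ⟨h1, h2, h3, h4, h5, h6, h7, h8, h9, -⟩ := e_sub_eq
  simp only [h1, h2, h3, h4, h5, h6, h7, h8, h9, lam_rv]
  refine ⟨?_, ?_, ?_, ?_, ?_, ?_⟩ <;> rfl

theorem lam_eq_self_iff (a : Fin 7 → ℝ) (ha : a ∈ roots) : lam ℝ a = a ↔ a ∈ fixedRoots := by
  rw [roots_eq] at ha
  obtain ⟨a, ha, rfl⟩ := ha
  rw [lam_rv, rv_injective.eq_iff, fixedRoots_eq, rv_injective.mem_set_image]
  change _ ↔ a ∈ fixList
  simp only [fixList, List.mem_filter, decide_eq_true_eq]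
  exact ⟨fun h => ⟨ha, h⟩, fun h => h.2⟩

theorem lam_weightsL (w : Fin 7 → ℝ) (hw : w ∈ weightsL) (s : ℤˣ) :
    lam ℝ w ∈ weightsV ∧ lam ℝ (lam ℝ w) ∈ weightsR ∧
      lam ℝ (aL w s) = aV (lam ℝ w) (-s) ∧
      lam ℝ (lam ℝ (aL w s)) = aR (lam ℝ (lam ℝ w)) (-s) := by
  have h1 : lam ℝ (e 5 - e 7) = -(e 6 - e 7) := by
    funext i
    fin_cases i <;> simp [lam, e, Matrix.mulVec, dotProduct, Fin.sum_univ_seven]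
  have h2 : lam ℝ (e 6 - e 7) = e 5 - e 6 := by
    funext i
    fin_cases i <;> simp [lam, e, Matrix.mulVec, dotProduct, Fin.sum_univ_seven]
  have hs : sg (-s) = -sg s := by simp [sg]
  have h3 : ∀ w, lam ℝ (aL w s) = aV (lam ℝ w) (-s) := fun w => by
    rw [aL, aV, map_add, map_smul, h1, hs, neg_div, smul_neg, neg_smul]
  have h4 : ∀ w, lam ℝ (lam ℝ (aL w s)) = aR (lam ℝ (lam ℝ w)) (-s) := fun w => by
    rw [h3, aV, aR, map_add, map_smul, h2]
  obtain ⟨t, ht, rfl⟩ := hw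
  have hv : (1 / 2 : ℝ) • ∑ j : Fin 4, sg (t j) • e (j + 1) =
      ![sg (t 0) / 2, sg (t 1) / 2, sg (t 2) / 2, sg (t 3) / 2, 0, 0, 0] := by
    funext i
    fin_cases i <;> simp [e, Fin.sum_univ_four] <;> ring
  have hl : ∀ a b c d : ℝ, lam ℝ ![a, b, c, d, 0, 0, 0] =
      ![(a + b + c + d) / 2, (a + b - c - d) / 2, (a - b + c - d) / 2, (-a + b + c - d) / 2,
        0, 0, 0] := fun a b c d => by
    funext i
    fin_cases i <;> simp [lam, Matrix.mulVec, dotProduct, Fin.sum_univ_seven] <;> ring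
  rw [hv]
  refine ⟨?_, ?_, h3 _, h4 _⟩
  -- Triality in terms of signs: if the four signs have product 1, exactly one of these row sums is
  -- ±4 and the other three vanish. The second bullet applies λ₁ twice, where all row sums are ±2
  -- and the product of the resulting signs is -1.
  · have key : ∀ t0 t1 t2 t3 : ℤˣ, t0 * t1 * t2 * t3 = 1 → ∃ (j : Fin 4) (s : ℤˣ),
        (t0 + t1 + t2 + t3 : ℤ) = (if j = 0 then 4 * s else 0 : ℤ) ∧
        (t0 + t1 - t2 - t3 : ℤ) = (if j = 1 then 4 * s else 0 : ℤ) ∧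
        (t0 - t1 + t2 - t3 : ℤ) = (if j = 2 then 4 * s else 0 : ℤ) ∧
        (-t0 + t1 + t2 - t3 : ℤ) = (if j = 3 then 4 * s else 0 : ℤ) := by decide +kernel
    obtain ⟨j, s, k0, k1, k2, k3⟩ := key (t 0) (t 1) (t 2) (t 3) (by rwa [← Fin.prod_univ_four])
    refine ⟨j, s, ?_⟩
    have k0' := congrArg (Int.cast : ℤ → ℝ) k0
    have k1' := congrArg (Int.cast : ℤ → ℝ) k1
    have k2' := congrArg (Int.cast : ℤ → ℝ) k2
    have k3' := congrArg (Int.cast : ℤ → ℝ) k3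
    rw [hl]
    fin_cases j <;> simp at k0' k1' k2' k3' <;> funext i <;> fin_cases i <;>
      simp [e, sg] <;> linarith
  · have key : ∀ t0 t1 t2 t3 : ℤˣ, t0 * t1 * t2 * t3 = 1 → ∃ s0 s1 s2 s3 : ℤˣ,
        s0 * s1 * s2 * s3 = -1 ∧
        (t0 + t1 + t2 - t3 : ℤ) = (2 * s0 : ℤ) ∧ (t0 + t1 - t2 + t3 : ℤ) = (2 * s1 : ℤ) ∧
        (t0 - t1 + t2 + t3 : ℤ) = (2 * s2 : ℤ) ∧ (t0 - t1 - t2 - t3 : ℤ) = (2 * s3 : ℤ) := by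
      decide +kernel
    obtain ⟨s0, s1, s2, s3, hs, k0, k1, k2, k3⟩ :=
      key (t 0) (t 1) (t 2) (t 3) (by rwa [← Fin.prod_univ_four])
    refine ⟨![s0, s1, s2, s3], by rw [Fin.prod_univ_four]; exact hs, ?_⟩
    have k0' := congrArg (Int.cast : ℤ → ℝ) k0
    have k1' := congrArg (Int.cast : ℤ → ℝ) k1
    have k2' := congrArg (Int.cast : ℤ → ℝ) k2
    have k3' := congrArg (Int.cast : ℤ → ℝ) k3
    rw [hl, hl]
    simp at k0' k1' k2' k3'
    funext i
    fin_cases i <;> simp [e, sg, Fin.sum_univ_four] <;> linarith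

end E6GS



namespace E6GS

/-! ### The Weyl group and the fundamental alcove -/

/-- The coordinates of a vector of the Cartan subalgebra with respect to the simple roots, where
`r` is a square root of `2`. -/
def simpleCoord {K : Type*} [Field K] (r : K) (u : Fin 7 → K) : Fin 6 → K :=
  let s := (u 4 + u 5 + u 6) / 3
  let c0 := r * (u 4 - s)
  let c5 := -(r * (u 6 - s))
  let c4 := u 0 + c0 / 2 + c5
  let c3 := u 1 + c0 / 2 + c4
  ![c0, (u 2 + u 3 + c3) / 2, (u 2 - u 3 + c0 + c3) / 2, c3, c4, c5]

theorem eq_sum_simpleCoord (u : Fin 7 → ℝ) :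
    u = ∑ i, simpleCoord √2 u i • rv (sQ i) + ((u 4 + u 5 + u 6) / 3) • (e 5 + e 6 + e 7) := by
  have h2 : (√2 : ℝ) ≠ 0 := by positivity
  funext i
  fin_cases i <;> simp [Fin.sum_univ_six, simpleCoord, rv, dv, dq, sQ, e] <;> field_simp <;> ring

/-- ℝ⁷ is spanned by the simple roots and e₅ + e₆ + e₇. The latter is fixed by λ₁ and all
reflections, so identities between these operators reduce to computations in `Q`. -/
theorem end_ext {f g : Module.End ℝ (Fin 7 → ℝ)} (h : ∀ i, f (rv (sQ i)) = g (rv (sQ i)))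
    (h' : f (e 5 + e 6 + e 7) = g (e 5 + e 6 + e 7)) : f = g := by
  refine LinearMap.ext fun u => ?_
  rw [eq_sum_simpleCoord u]
  simp only [map_add, map_sum, map_smul] at h' ⊢
  rw [h']
  simp only [h]

theorem reflection_rv (a b : Q) : reflection (rv a) (rv b) = rv (b - pr b a • a) := by
  have hz : ∀ (n : ℤ) (a : Q), rv (n • a) = (n : ℝ) • rv a := fun n a => by
    let f : Q →+ (Fin 7 → ℝ) := ⟨⟨rv, rv_zero⟩, rv_add⟩
    have := map_zsmul f n a
    rw [Int.cast_smul_eq_zsmul]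
    exact this
  change rv b - (rv b ⬝ᵥ rv a) • rv a = _
  rw [rv_dot, sub_eq_add_neg b, rv_add, rv_neg, hz, sub_eq_add_neg]

theorem e_dot_rv (a : Q) : (e 5 + e 6 + e 7) ⬝ᵥ rv a = 0 := by
  have := rv_mem_cartan a
  change _ + _ + _ = _ at this
  simp [dotProduct, Fin.sum_univ_seven, e]
  exact this

theorem reflection_e (a : Q) : reflection (rv a) (e 5 + e 6 + e 7) = e 5 + e 6 + e 7 := by
  change _ - (_ ⬝ᵥ rv a) • rv a = _
  rw [e_dot_rv, zero_smul, sub_zero]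

theorem lam_e : lam ℝ (e 5 + e 6 + e 7) = e 5 + e 6 + e 7 := by
  funext i
  fin_cases i <;> simp [lam, e, Matrix.mulVec, dotProduct, Fin.sum_univ_seven]

theorem reflection_mem {a : Q} (ha : a ∈ rootList) : reflection (rv a) ∈ weylGroup :=
  Submonoid.subset_closure ⟨_, rv_mem_roots.mpr ha, rfl⟩

/-- Each of the two roots β used here has β + λ₁β + λ₁²β = 0, so its orbit spans an A₂ which λ₁
rotates by a third of a turn; that rotation is the product of the reflections in β and λ₁β. The two
planes are orthogonal and together form the complement of the fixed space of λ₁. -/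
theorem lam_eq_reflections : lam ℝ = reflection (rv (1,1,1,1,0,0)) *
    reflection (rv (lamQ (1,1,1,1,0,0))) * reflection (rv (1,0,1,1,1,0)) *
      reflection (rv (lamQ (1,0,1,1,1,0))) := by
  apply end_ext
  · intro i
    simp only [Module.End.mul_apply, reflection_rv, lam_rv]
    congr 1
    revert i
    decide +kernel
  · simp only [Module.End.mul_apply, reflection_e, lam_e]

theorem lam_mem_weylGroup : lam ℝ ∈ weylGroup := by
  rw [lam_eq_reflections]
  refine mul_mem (mul_mem (mul_mem ?_ ?_) ?_) ?_ <;> apply reflection_mem <;> decide +kernel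

theorem lam_pow_three : lam ℝ ^ 3 = 1 := by
  apply end_ext
  · intro i
    simp only [pow_succ, pow_zero, one_mul, Module.End.mul_apply, lam_rv, lamQ_lamQ_lamQ]
    rfl
  · simp only [pow_succ, pow_zero, one_mul, Module.End.mul_apply, lam_e]
    rfl

theorem orderOf_lam : orderOf (lam ℝ) = 3 := by
  have : Fact (Nat.Prime 3) := ⟨Nat.prime_three⟩
  refine orderOf_eq_prime lam_pow_three fun h => ?_
  have := congrArg (fun f : Module.End ℝ (Fin 7 → ℝ) => f (rv (0,0,0,0,1,0))) h
  simp only [lam_rv, Module.End.one_apply] at this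
  exact absurd (rv_injective this) (by decide)

theorem lam_dot_lam (u v : Fin 7 → ℝ) : lam ℝ u ⬝ᵥ lam ℝ v = u ⬝ᵥ v := by
  simp [lam, Matrix.mulVec, dotProduct, Fin.sum_univ_seven]
  ring

theorem α_zero_dot_ϖ₁ : α 0 ⬝ᵥ ϖ₁ = -1 := by
  rw [α_eq, rv_dot_ϖ₁]; simp [αQ]

theorem lam_apply_cartan {K : Type*} [Field K] {u : Fin 7 → K} (hu : u ∈ cartan K) :
    lam K u ∈ cartan K := by
  change _ + _ + _ = _ at hu ⊢
  simp [lam, Matrix.mulVec, dotProduct, Fin.sum_univ_seven]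
  linear_combination hu

theorem mem_alcove_iff (u : Fin 7 → ℝ) : u ∈ alcove ↔ u ∈ cartan ℝ ∧ 0 < α 1 ⬝ᵥ u ∧
    0 < α 2 ⬝ᵥ u ∧ 0 < α 3 ⬝ᵥ u ∧ 0 < α 4 ⬝ᵥ u ∧ 0 < α 5 ⬝ᵥ u ∧ 0 < α 6 ⬝ᵥ u ∧
      -(α 0 ⬝ᵥ u) < 1 := by
  constructor
  · rintro ⟨h, h1, h2⟩
    exact ⟨h, h1 1 (by decide), h1 2 (by decide), h1 3 (by decide), h1 4 (by decide),
      h1 5 (by decide), h1 6 (by decide), h2⟩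
  · rintro ⟨h, h1, h2, h3, h4, h5, h6, h7⟩
    refine ⟨h, fun i hi => ?_, h7⟩
    fin_cases i
    exacts [absurd rfl hi, h1, h2, h3, h4, h5, h6]

/-- If λ₁αᵢ = αⱼ, then αⱼ · λ₁(u - ϖ₁) = αᵢ · u - αᵢ · ϖ₁. The shift by ±1 occurs only for i = 1 and
i = 0: there it exchanges the roles of the inequality bounded by 1 and one bounded by 0. -/
theorem lam_sub_mem_alcove (u : Fin 7 → ℝ) : lam ℝ (u - ϖ₁) ∈ alcove ↔ u ∈ alcove := by
  obtain ⟨h1, h2, h3, h4, h5, h6, h0⟩ := lam_α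
  have hc : lam ℝ (u - ϖ₁) ∈ cartan ℝ ↔ u ∈ cartan ℝ := by
    constructor
    · intro h
      have h3 := lam_apply_cartan (lam_apply_cartan h)
      have := congrArg (fun f : Module.End ℝ (Fin 7 → ℝ) => f (u - ϖ₁)) lam_pow_three
      simp only [pow_succ, pow_zero, one_mul, Module.End.mul_apply, Module.End.one_apply] at this
      rw [this] at h3
      simpa using add_mem h3 ϖ₁_mem
    · intro h
      exact lam_apply_cartan (sub_mem h ϖ₁_mem)
  have key : ∀ i j, lam ℝ (α i) = α j → α j ⬝ᵥ lam ℝ (u - ϖ₁) = α i ⬝ᵥ u - α i ⬝ᵥ ϖ₁ := by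
    intro i j h
    rw [← h, lam_dot_lam, dotProduct_sub]
  rw [mem_alcove_iff, mem_alcove_iff, hc, key _ _ h1, key _ _ h2, key _ _ h3, key _ _ h4,
    key _ _ h5, key _ _ h6, key _ _ h0, α_zero_dot_ϖ₁, α_dot_ϖ₁ 1 (by decide),
    α_dot_ϖ₁ 2 (by decide), α_dot_ϖ₁ 3 (by decide), α_dot_ϖ₁ 4 (by decide),
    α_dot_ϖ₁ 5 (by decide), α_dot_ϖ₁ 6 (by decide)]
  refine and_congr_right fun _ => ?_
  simp
  constructor
  · rintro ⟨h1, h2, h3, h4, h5, h6, h7⟩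
    refine ⟨?_, ?_, ?_, ?_, ?_, ?_, ?_⟩ <;> linarith
  · rintro ⟨h1, h2, h3, h4, h5, h6, h7⟩
    refine ⟨?_, ?_, ?_, ?_, ?_, ?_, ?_⟩ <;> linarith

theorem lam_surjective_on (u : Fin 7 → ℝ) : lam ℝ (lam ℝ (lam ℝ u)) = u := by
  have := congrArg (fun f : Module.End ℝ (Fin 7 → ℝ) => f u) lam_pow_three
  simpa only [pow_succ, pow_zero, one_mul, Module.End.mul_apply, Module.End.one_apply] using this

theorem lam_image_alcove : (fun u => lam ℝ (u - ϖ₁)) '' alcove = alcove := by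
  ext v
  constructor
  · rintro ⟨u, hu, rfl⟩
    exact (lam_sub_mem_alcove u).mpr hu
  · intro hv
    refine ⟨lam ℝ (lam ℝ v) + ϖ₁, ?_, ?_⟩
    · rw [← lam_sub_mem_alcove, add_sub_cancel_right, lam_surjective_on]; exact hv
    · simp only [add_sub_cancel_right, lam_surjective_on]

/-- The properties of the elements of the Weyl group that determine their action on the alcove. -/
structure IsWeylLike (w : Module.End ℝ (Fin 7 → ℝ)) : Prop where
  map_root : ∀ a ∈ rootList, ∃ b ∈ rootList, w (rv a) = rv b
  map_lattice : ∀ a, ∃ b, w (rv a) = rv b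
  dot : ∀ u v, w u ⬝ᵥ w v = u ⬝ᵥ v
  weight : ∃ b, w ϖ₁ = ϖ₁ + rv b
  map_e : w (e 5 + e 6 + e 7) = e 5 + e 6 + e 7

theorem reflection_mem_rootList {a b : Q} (ha : a ∈ rootList) (hb : b ∈ rootList) :
    b - pr b a • a ∈ rootList := by
  rcases pr_cases hb ha with h | h | ⟨h, h'⟩ | h | h
  · rw [h, pr_self ha, two_smul, sub_add_cancel_left]
    exact neg_mem ha
  · rw [eq_neg_of_add_eq_zero_left h, pr_neg_left, pr_self ha, neg_smul, two_smul]
    simpa using ha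
  · rw [h, neg_smul, one_smul, sub_neg_eq_add]; exact h'
  · rw [h, zero_smul, sub_zero]; exact hb
  · rw [h, one_smul, sub_eq_add_neg]
    exact add_mem_of_pr hb (neg_mem ha) (by rw [pr_neg_right, h])

/-- The conditions hold for reflections and survive composition. For the weight: a reflection in a
subtracts (ϖ₁ · a) a, and ϖ₁ · a is an integer. -/
theorem isWeylLike {w : Module.End ℝ (Fin 7 → ℝ)} (hw : w ∈ weylGroup) : IsWeylLike w := by
  induction hw using Submonoid.closure_induction with
  | mem w hw =>
    obtain ⟨v, hv, rfl⟩ := hw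
    rw [roots_eq] at hv
    obtain ⟨a, ha, rfl⟩ := hv
    refine ⟨fun b hb => ⟨_, reflection_mem_rootList ha hb, reflection_rv a b⟩,
      fun b => ⟨_, reflection_rv a b⟩, fun u v => ?_, ⟨-(a.1 • a), ?_⟩, reflection_e a⟩
    · change (u - (u ⬝ᵥ rv a) • rv a) ⬝ᵥ (v - (v ⬝ᵥ rv a) • rv a) = _
      have h2 : rv a ⬝ᵥ rv a = 2 := by rw [rv_dot, pr_self ha]; norm_num
      rw [sub_dotProduct, dotProduct_sub, dotProduct_sub, smul_dotProduct, smul_dotProduct,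
        dotProduct_smul, dotProduct_smul, h2, dotProduct_comm (rv a) v]
      simp only [smul_eq_mul]
      ring
    · have h := reflection_rv a (-(a.1 • a))
      change ϖ₁ - (ϖ₁ ⬝ᵥ rv a) • rv a = _
      rw [dotProduct_comm, rv_dot_ϖ₁, rv_neg, sub_eq_add_neg]
      congr 2
      let f : Q →+ (Fin 7 → ℝ) := ⟨⟨rv, rv_zero⟩, rv_add⟩
      have := map_zsmul f a.1 a
      rw [Int.cast_smul_eq_zsmul]
      exact this.symm
  | one => exact ⟨fun a ha => ⟨a, ha, rfl⟩, fun a => ⟨a, rfl⟩, fun u v => rfl,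
      ⟨0, by rw [rv_zero, add_zero]; rfl⟩, rfl⟩
  | mul v w _ _ hv hw =>
    refine ⟨fun a ha => ?_, fun a => ?_, fun u u' => ?_, ?_, ?_⟩
    · obtain ⟨b, hb, h⟩ := hw.map_root a ha
      obtain ⟨c, hc, h'⟩ := hv.map_root b hb
      exact ⟨c, hc, by rw [Module.End.mul_apply, h, h']⟩
    · obtain ⟨b, h⟩ := hw.map_lattice a
      obtain ⟨c, h'⟩ := hv.map_lattice b
      exact ⟨c, by rw [Module.End.mul_apply, h, h']⟩
    · rw [Module.End.mul_apply, Module.End.mul_apply, hv.dot, hw.dot]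
    · obtain ⟨b, h⟩ := hw.weight
      obtain ⟨c, h'⟩ := hv.map_lattice b
      obtain ⟨d, h''⟩ := hv.weight
      exact ⟨d + c, by rw [Module.End.mul_apply, h, map_add, h', h'', rv_add, add_assoc]⟩
    · rw [Module.End.mul_apply, hw.map_e, hv.map_e]

/-- `weylGroup` is only a submonoid by definition; inverses are products of the same involutions in
reverse order. -/
theorem exists_inverse {w : Module.End ℝ (Fin 7 → ℝ)} (hw : w ∈ weylGroup) :
    ∃ v ∈ weylGroup, v * w = 1 ∧ w * v = 1 := by
  induction hw using Submonoid.closure_induction with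
  | mem w hw =>
    have hm := Submonoid.subset_closure hw
    obtain ⟨v, hv, rfl⟩ := hw
    rw [roots_eq] at hv
    obtain ⟨a, ha, rfl⟩ := hv
    have : reflection (rv a) * reflection (rv a) = 1 := by
      have h2 : rv a ⬝ᵥ rv a = 2 := by rw [rv_dot, pr_self ha]; norm_num
      refine LinearMap.ext fun u => ?_
      change u - (u ⬝ᵥ rv a) • rv a - ((u - (u ⬝ᵥ rv a) • rv a) ⬝ᵥ rv a) • rv a = u
      rw [sub_dotProduct, smul_dotProduct, h2, smul_eq_mul]
      module
    exact ⟨_, hm, this, this⟩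
  | one => exact ⟨1, one_mem _, one_mul _, one_mul _⟩
  | mul v w _ _ hv hw =>
    obtain ⟨v', hv', h1, h2⟩ := hv
    obtain ⟨w', hw', h3, h4⟩ := hw
    refine ⟨w' * v', mul_mem hw' hv', ?_, ?_⟩
    · rw [mul_assoc, ← mul_assoc v', h1, one_mul, h3]
    · rw [mul_assoc, ← mul_assoc w, h4, one_mul, h2]

theorem rv_dot_eq_sum (a : Q) (u : Fin 7 → ℝ) :
    rv a ⬝ᵥ u = a.1 * (α 1 ⬝ᵥ u) + a.2.1 * (α 6 ⬝ᵥ u) + a.2.2.1 * (α 2 ⬝ᵥ u)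
      + a.2.2.2.1 * (α 3 ⬝ᵥ u) + a.2.2.2.2.1 * (α 4 ⬝ᵥ u) + a.2.2.2.2.2 * (α 5 ⬝ᵥ u) := by
  obtain ⟨a0, a1, a2, a3, a4, a5⟩ := a
  have : rv (a0, a1, a2, a3, a4, a5) = (a0 : ℝ) • α 1 + (a1 : ℝ) • α 6 + (a2 : ℝ) • α 2
      + (a3 : ℝ) • α 3 + (a4 : ℝ) • α 4 + (a5 : ℝ) • α 5 := by
    simp only [α_eq]
    funext i
    fin_cases i <;> simp [αQ, sQ, rv, dv, dq] <;> ring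
  simp only [this, add_dotProduct, smul_dotProduct, smul_eq_mul]

theorem rv_dot_pos {a : Q} (ha : a ∈ posList) {u : Fin 7 → ℝ} (hu : u ∈ alcove) :
    0 < rv a ⬝ᵥ u := by
  obtain ⟨-, h1, h2, h3, h4, h5, h6, -⟩ := (mem_alcove_iff u).mp hu
  have key : ∀ a ∈ posList, 0 ≤ a.1 ∧ 0 ≤ a.2.1 ∧ 0 ≤ a.2.2.1 ∧ 0 ≤ a.2.2.2.1 ∧
      0 ≤ a.2.2.2.2.1 ∧ 0 ≤ a.2.2.2.2.2 ∧ (1 ≤ a.1 ∨ 1 ≤ a.2.1 ∨ 1 ≤ a.2.2.1 ∨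
        1 ≤ a.2.2.2.1 ∨ 1 ≤ a.2.2.2.2.1 ∨ 1 ≤ a.2.2.2.2.2) := by decide +kernel
  have hc : ∀ n : ℤ, 0 ≤ n → (0 : ℝ) ≤ n := fun n hn => by exact_mod_cast hn
  have hc' : ∀ n : ℤ, 1 ≤ n → (0 : ℝ) < n := fun n hn => by exact_mod_cast hn
  obtain ⟨k1, k2, k3, k4, k5, k6, k⟩ := key a ha
  replace k1 := hc _ k1
  replace k2 := hc _ k2
  replace k3 := hc _ k3
  replace k4 := hc _ k4
  replace k5 := hc _ k5
  replace k6 := hc _ k6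
  rw [rv_dot_eq_sum]
  rcases k with k | k | k | k | k | k <;> replace k := hc' _ k <;> positivity

/-- The lattice vector is ρ, which pairs to 1 with every simple root. Divided by the Coxeter number
12 it pairs to 11/12 < 1 with the highest root. -/
theorem alcove_nonempty : alcove.Nonempty := by
  have hz : ∀ i : Fin 7, rv (8, 11, 15, 21, 15, 8) ⬝ᵥ α i = pr (8, 11, 15, 21, 15, 8) (αQ i) :=
    fun i => by rw [α_eq, rv_dot]
  refine ⟨(1 / 12 : ℝ) • rv (8, 11, 15, 21, 15, 8), ?_⟩
  rw [mem_alcove_iff]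
  refine ⟨Submodule.smul_mem _ _ (rv_mem_cartan _), ?_, ?_, ?_, ?_, ?_, ?_, ?_⟩ <;>
    rw [dotProduct_smul, dotProduct_comm, hz]
  rotate_right
  · rw [show pr (8, 11, 15, 21, 15, 8) (αQ 0) = -11 by decide]
    norm_num
  all_goals
    rw [show pr (8, 11, 15, 21, 15, 8) _ = 1 by decide]
    norm_num

theorem mem_posList_of_dot {a : Q} (ha : a ∈ rootList) {u : Fin 7 → ℝ} (hu : u ∈ alcove)
    (h : 0 < rv a ⬝ᵥ u) : a ∈ posList := by
  rw [rootList, List.mem_append, List.mem_map] at ha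
  rcases ha with ha | ⟨b, hb, rfl⟩
  · exact ha
  · have := rv_dot_pos hb hu
    rw [rv_neg, neg_dotProduct] at h
    linarith

/-- Such a w preserves positivity of roots, hence permutes the simple roots by a diagram
automorphism; its action on ϖ₁ modulo the root lattice excludes the nontrivial one. -/
theorem eq_one_of_image_alcove {w : Module.End ℝ (Fin 7 → ℝ)} (hw : w ∈ weylGroup)
    (h : w '' alcove = alcove) : w = 1 := by
  have hpos : ∀ v, IsWeylLike v → v '' alcove = alcove → ∀ a ∈ posList,
      ∃ b ∈ posList, v (rv a) = rv b := by
    intro v hv hC a ha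
    obtain ⟨u, hu⟩ := alcove_nonempty
    obtain ⟨b, hb, hab⟩ := hv.map_root a (List.mem_append_left _ ha)
    have hvu : v u ∈ alcove := by rw [← hC]; exact ⟨u, hu, rfl⟩
    exact ⟨b, mem_posList_of_dot hb hvu (by rw [← hab, hv.dot]; exact rv_dot_pos ha hu), hab⟩
  obtain ⟨v, hv, hvw, hwv⟩ := exists_inverse hw
  have hvC : v '' alcove = alcove := by
    conv_lhs => rw [← h]
    rw [← Set.image_comp]
    have : (v ∘ w : (Fin 7 → ℝ) → (Fin 7 → ℝ)) = id :=
      funext fun u => congrArg (fun f : Module.End ℝ (Fin 7 → ℝ) => f u) hvw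
    rw [this, Set.image_id]
  have hW := isWeylLike hw
  have hV := isWeylLike hv
  -- A nonsimple image would be a sum of two positive roots; applying the inverse, the simple root
  -- would be one too, against its height 1.
  have hsimple : ∀ i, ∃ j, w (rv (sQ i)) = rv (sQ j) := by
    intro i
    have hi : sQ i ∈ posList := by revert i; decide +kernel
    obtain ⟨b, hb, hwb⟩ := hpos w hW h _ hi
    have key : ∀ b ∈ posList, (∃ j, b = sQ j) ∨ ∃ c ∈ posList, ∃ d ∈ posList, b = c + d := by
      decide +kernel
    rcases key b hb with ⟨j, rfl⟩ | ⟨c, hc, d, hd, rfl⟩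
    · exact ⟨j, hwb⟩
    · obtain ⟨c', hc', hvc⟩ := hpos v hV hvC c hc
      obtain ⟨d', hd', hvd⟩ := hpos v hV hvC d hd
      have : rv (sQ i) = rv (c' + d') := by
        have h1 := congrArg (fun f : Module.End ℝ (Fin 7 → ℝ) => f (rv (sQ i))) hvw
        simp only [Module.End.mul_apply, Module.End.one_apply, hwb, rv_add, map_add, hvc,
          hvd] at h1
        rw [rv_add]; exact h1.symm
      have h2 := rv_injective this
      have ht : ∀ a ∈ posList,
          1 ≤ a.1 + a.2.1 + a.2.2.1 + a.2.2.2.1 + a.2.2.2.2.1 + a.2.2.2.2.2 := by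
        decide +kernel
      have hs : ∀ i, (sQ i).1 + (sQ i).2.1 + (sQ i).2.2.1 + (sQ i).2.2.2.1 + (sQ i).2.2.2.2.1
          + (sQ i).2.2.2.2.2 = 1 := by decide +kernel
      have h3 := hs i
      have h4 := ht _ hc'
      have h5 := ht _ hd'
      rw [h2] at h3
      simp only [Prod.fst_add, Prod.snd_add] at h3
      omega
  choose π hπ using hsimple
  have hpr : ∀ i j, pr (sQ (π i)) (sQ (π j)) = pr (sQ i) (sQ j) := by
    intro i j
    have := hW.dot (rv (sQ i)) (rv (sQ j))
    rw [hπ, hπ, rv_dot, rv_dot] at this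
    exact_mod_cast this
  obtain ⟨b, hb⟩ := hW.weight
  have hϖ : ∀ i, (sQ i).1 = (sQ (π i)).1 + pr (sQ (π i)) b := by
    intro i
    have := hW.dot (rv (sQ i)) ϖ₁
    rw [hπ, hb, dotProduct_add, rv_dot_ϖ₁, rv_dot_ϖ₁, rv_dot] at this
    exact_mod_cast this.symm
  have hinj : ∀ i j, π i = π j → i = j := by
    intro i j hij
    have h1 := hpr i j
    rw [hij, pr_self (by generalize π j = k; revert k; decide +kernel)] at h1
    have key : ∀ i j : Fin 6, 2 = pr (sQ i) (sQ j) → i = j := by decide +kernel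
    exact key i j h1
  -- Since w ϖ₁ is the fundamental weight at the node π 0, the lattice contains a vector b equal to
  -- the difference of two fundamental weights. Only the nodes 0 and 4 have the class of ϖ₁ modulo
  -- the root lattice.
  have h0 : π 0 = 0 ∨ π 0 = 4 := by
    have hsurj : Function.Bijective π := Finite.injective_iff_bijective.mp fun i j => hinj i j
    have hδ : ∀ j, pr (sQ j) b = (if j = π 0 then 1 else 0) - (if j = 0 then 1 else 0) := by
      intro j
      obtain ⟨i, rfl⟩ := hsurj.2 j
      have h1 := hϖ i
      have h2 : ∀ k, (sQ k).1 = if k = 0 then 1 else 0 := by decide +kernel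
      rw [h2, h2] at h1
      have h3 : (π i = π 0) ↔ i = 0 := ⟨hinj _ _, fun h => by rw [h]⟩
      simp only [h3]
      omega
    obtain ⟨b0, b1, b2, b3, b4, b5⟩ := b
    have e0 := hδ 0
    have e2 := hδ 2
    have e4 := hδ 4
    have e5 := hδ 5
    generalize π 0 = k at *
    fin_cases k <;> simp [sQ, pr] at e0 e2 e4 e5 ⊢ <;> omega
  -- Node 4 is not an end of the diagram, so adjacency forces π 0 = 0; following the edges from
  -- there fixes the other nodes.
  have hid : ∀ i, π i = i := by
    set_option synthInstance.maxSize 1000 in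
    set_option synthInstance.maxHeartbeats 200000 in
    have key : ∀ p0 : Fin 6, (p0 = 0 ∨ p0 = 4) → ∀ p2, pr (sQ p0) (sQ p2) = -1 →
        ∀ p3, pr (sQ p2) (sQ p3) = -1 → pr (sQ p0) (sQ p3) = 0 →
        ∀ p4, pr (sQ p3) (sQ p4) = -1 → pr (sQ p2) (sQ p4) = 0 →
        ∀ p5, pr (sQ p4) (sQ p5) = -1 → pr (sQ p3) (sQ p5) = 0 →
        ∀ p1, pr (sQ p3) (sQ p1) = -1 → pr (sQ p2) (sQ p1) = 0 → pr (sQ p4) (sQ p1) = 0 →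
          [p0, p1, p2, p3, p4, p5] = [0, 1, 2, 3, 4, 5] := by decide +kernel
    have h := key (π 0) h0 (π 2) (hpr 0 2) (π 3) (hpr 2 3) (hpr 0 3)
      (π 4) (hpr 3 4) (hpr 2 4) (π 5) (hpr 4 5) (hpr 3 5) (π 1) (hpr 3 1) (hpr 2 1) (hpr 4 1)
    simp only [List.cons.injEq, and_true] at h
    obtain ⟨k0, k1, k2, k3, k4, k5⟩ := h
    intro i
    fin_cases i <;> assumption
  refine end_ext (fun i => ?_) hW.map_e
  rw [hπ, hid]; rfl

theorem weylGroup_alcove_iff (w : Module.End ℝ (Fin 7 → ℝ)) (hw : w ∈ weylGroup) :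
    (fun u => w (u - ϖ₁)) '' alcove = alcove ↔ w = lam ℝ := by
  constructor
  · intro h
    -- λ₁² is the inverse of λ₁, so the translation by ϖ₁ cancels and a linear map preserving the
    -- alcove remains.
    have h1 : (w * (lam ℝ * lam ℝ)) '' alcove = alcove := by
      conv_lhs => rw [← lam_image_alcove]
      rw [← Set.image_comp]
      convert h using 2
      funext u
      simp only [Function.comp_apply, Module.End.mul_apply, lam_surjective_on]
    have h2 := eq_one_of_image_alcove
      (mul_mem hw (mul_mem lam_mem_weylGroup lam_mem_weylGroup)) h1
    have h3 := lam_pow_three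
    calc w = w * lam ℝ ^ 3 := by rw [h3, mul_one]
      _ = w * (lam ℝ * lam ℝ) * lam ℝ := by rw [pow_succ, pow_two, ← mul_assoc]
      _ = lam ℝ := by rw [h2, one_mul]
  · rintro rfl
    exact lam_image_alcove

end E6GS



namespace E6GS

/-! ### Linear algebra -/

section Linear

variable {V : Type*} [AddCommGroup V] [Module ℂ V]

theorem aeval_mem {T : Module.End ℂ V} {N : Submodule ℂ V} (hN : ∀ x ∈ N, T x ∈ N)
    (p : Polynomial ℂ) {x : V} (hx : x ∈ N) : Polynomial.aeval T p x ∈ N := by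
  have hpow : ∀ n : ℕ, (T ^ n) x ∈ N := by
    intro n
    induction n with
    | zero => simpa using hx
    | succ n ih => rw [pow_succ']; exact hN _ ih
  rw [Polynomial.aeval_eq_sum_range, LinearMap.sum_apply]
  exact sum_mem fun i _ => N.smul_mem _ (hpow i)

theorem aeval_apply_eigen {T : Module.End ℂ V} {x : V} {c : ℂ} (hx : T x = c • x)
    (p : Polynomial ℂ) : Polynomial.aeval T p x = p.eval c • x := by
  by_cases h : x = 0
  · simp [h]
  · exact Module.End.aeval_apply_of_hasEigenvector
      ⟨Module.End.mem_eigenspace_iff.mpr hx, h⟩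

/-- An invariant subspace contains the weight components of its elements. -/
theorem sum_filter_mem {ι : Type*} [Fintype ι] {T : Module.End ℂ V} {N : Submodule ℂ V}
    (hN : ∀ x ∈ N, T x ∈ N) {v : ι → V} {c : ι → ℂ} (hv : ∀ i, T (v i) = c i • v i)
    {a : ι → ℂ} (ha : ∑ i, a i • v i ∈ N) (μ : ℂ) :
    ∑ i with c i = μ, a i • v i ∈ N := by
  classical
  -- The Lagrange polynomial that is 1 at μ and 0 at all other weights, evaluated at T, is the
  -- projection onto weight μ. The node μ is inserted because it need not occur among the weights.
  let s : Finset ℂ := insert μ (Finset.univ.image c)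
  have h := aeval_mem hN (Lagrange.basis s id μ) ha
  convert h
  rw [map_sum, Finset.sum_filter]
  refine Finset.sum_congr rfl fun i _ => ?_
  rw [map_smul, aeval_apply_eigen (hv i)]
  split_ifs with hi
  · have := Lagrange.eval_basis_self (s := s) (v := id) (Set.injOn_id _) (i := μ)
      (Finset.mem_insert_self _ _)
    rw [hi]
    simp only [id] at this
    rw [this, one_smul]
  · have := Lagrange.eval_basis_of_ne (s := s) (v := id) (i := μ) (j := c i) (Ne.symm hi)
      (Finset.mem_insert_of_mem (Finset.mem_image_of_mem _ (Finset.mem_univ i)))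
    simp only [id] at this
    rw [this, zero_smul, smul_zero]

/-- Nonzero vectors with distinct weights are linearly independent. -/
theorem linearIndependent_of_weights {ι : Type*} [Fintype ι] (T : Module.End ℂ V)
    {v : ι → V} {c : ι → ℂ} (hv : ∀ i, T (v i) = c i • v i) (hc : Function.Injective c)
    (h0 : ∀ i, v i ≠ 0) : LinearIndependent ℂ v := by
  classical
  rw [Fintype.linearIndependent_iff]
  intro a ha i
  have h := sum_filter_mem (T := T) (N := ⊥) (by simp) hv (a := a) (by simpa using ha) (c i)
  have hi : (Finset.univ.filter fun j => c j = c i) = {i} := by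
    ext j; simp [hc.eq_iff]
  rw [hi, Finset.sum_singleton, Submodule.mem_bot, smul_eq_zero] at h
  exact h.resolve_right (h0 i)

/-- A family with a dual family for a bilinear form is linearly independent. -/
theorem linearIndependent_of_dual {ι : Type*} (B : V →ₗ[ℂ] V →ₗ[ℂ] ℂ) (v w : ι → V)
    (h1 : ∀ i, B (v i) (w i) ≠ 0) (h2 : ∀ i j, i ≠ j → B (v i) (w j) = 0) :
    LinearIndependent ℂ v := by
  rw [linearIndependent_iff']
  intro s a ha i hi
  have h := congrArg (fun x => B x (w i)) ha
  simp only [map_sum, map_smul, LinearMap.sum_apply, LinearMap.smul_apply, map_zero,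
    LinearMap.zero_apply] at h
  rw [Finset.sum_eq_single_of_mem i hi fun j _ hj => by rw [h2 j i hj, smul_zero]] at h
  exact (smul_eq_zero.mp h).resolve_right (h1 i)

/-- Linearly independent families in independent subspaces of a space whose dimension is at most the
number of their members are bases of the intersections with these subspaces. -/
theorem span_eq_of_card_le [FiniteDimensional ℂ V] {ι₀ ι₁ ι₂ : Type*} [Fintype ι₀] [Fintype ι₁]
    [Fintype ι₂] {G₀ G₁ G₂ S : Submodule ℂ V} (h01 : Disjoint G₀ G₁) (h2 : Disjoint (G₀ ⊔ G₁) G₂)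
    {v₀ : ι₀ → V} {v₁ : ι₁ → V} {v₂ : ι₂ → V} (l₀ : LinearIndependent ℂ v₀)
    (l₁ : LinearIndependent ℂ v₁) (l₂ : LinearIndependent ℂ v₂)
    (m₀ : ∀ i, v₀ i ∈ S ⊓ G₀) (m₁ : ∀ i, v₁ i ∈ S ⊓ G₁) (m₂ : ∀ i, v₂ i ∈ S ⊓ G₂)
    (hS : Module.finrank ℂ S ≤ Fintype.card ι₀ + Fintype.card ι₁ + Fintype.card ι₂) :
    (Submodule.span ℂ (Set.range v₀) = S ⊓ G₀ ∧ Submodule.span ℂ (Set.range v₁) = S ⊓ G₁ ∧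
      Submodule.span ℂ (Set.range v₂) = S ⊓ G₂) ∧ (S ⊓ G₀) ⊔ (S ⊓ G₁) ⊔ (S ⊓ G₂) = S ∧
      Module.finrank ℂ S = Fintype.card ι₀ + Fintype.card ι₁ + Fintype.card ι₂ := by
  have d01 : Disjoint (S ⊓ G₀) (S ⊓ G₁) := h01.mono inf_le_right inf_le_right
  have d2 : Disjoint ((S ⊓ G₀) ⊔ (S ⊓ G₁)) (S ⊓ G₂) :=
    h2.mono (sup_le_sup inf_le_right inf_le_right) inf_le_right
  have e1 := Submodule.finrank_sup_add_finrank_inf_eq (S ⊓ G₀) (S ⊓ G₁)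
  have e2 := Submodule.finrank_sup_add_finrank_inf_eq ((S ⊓ G₀) ⊔ (S ⊓ G₁)) (S ⊓ G₂)
  rw [d01.eq_bot, finrank_bot] at e1
  rw [d2.eq_bot, finrank_bot] at e2
  have hle : (S ⊓ G₀) ⊔ (S ⊓ G₁) ⊔ (S ⊓ G₂) ≤ S :=
    sup_le (sup_le inf_le_left inf_le_left) inf_le_left
  have e3 := Submodule.finrank_mono hle
  have s0 : Submodule.span ℂ (Set.range v₀) ≤ S ⊓ G₀ := by
    rw [Submodule.span_le]; rintro _ ⟨i, rfl⟩; exact m₀ i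
  have s1 : Submodule.span ℂ (Set.range v₁) ≤ S ⊓ G₁ := by
    rw [Submodule.span_le]; rintro _ ⟨i, rfl⟩; exact m₁ i
  have s2 : Submodule.span ℂ (Set.range v₂) ≤ S ⊓ G₂ := by
    rw [Submodule.span_le]; rintro _ ⟨i, rfl⟩; exact m₂ i
  have f0 := Submodule.finrank_mono s0
  have f1 := Submodule.finrank_mono s1
  have f2 := Submodule.finrank_mono s2
  rw [finrank_span_eq_card l₀] at f0
  rw [finrank_span_eq_card l₁] at f1
  rw [finrank_span_eq_card l₂] at f2
  refine ⟨⟨?_, ?_, ?_⟩, ?_, by omega⟩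
  · exact Submodule.eq_of_le_of_finrank_le s0 (by rw [finrank_span_eq_card l₀]; omega)
  · exact Submodule.eq_of_le_of_finrank_le s1 (by rw [finrank_span_eq_card l₁]; omega)
  · exact Submodule.eq_of_le_of_finrank_le s2 (by rw [finrank_span_eq_card l₂]; omega)
  · exact Submodule.eq_of_le_of_finrank_le hle (by omega)

end Linear

/-! ### Evaluation of brackets of sparse combinations -/

section Engine

set_option linter.unusedSectionVars false

variable {G : Type*} [DecidableEq G] {L : Type*} [LieRing L] [LieAlgebra ℂ L]

/-- The number `x + y τ`. -/
def qnum (τ : ℂ) (x : ℤ × ℤ) : ℂ := x.1 + x.2 * τ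

/-- The product of `x + y τ` and `z + w τ`, where `τ² = b τ - 1`. -/
def qmul (b : ℤ) (x y : ℤ × ℤ) : ℤ × ℤ :=
  (x.1 * y.1 - x.2 * y.2, x.1 * y.2 + x.2 * y.1 + b * (x.2 * y.2))

theorem qnum_qmul {τ : ℂ} {b : ℤ} (hτ : τ * τ = b * τ - 1) (x y : ℤ × ℤ) :
    qnum τ (qmul b x y) = qnum τ x * qnum τ y := by
  simp only [qnum, qmul]
  push_cast
  linear_combination (-(x.2 : ℂ) * y.2) * hτ

/-- The value of a formal linear combination. -/
def lval (τ : ℂ) (ev : G → L) (l : List ((ℤ × ℤ) × G)) : L :=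
  (l.map fun t => qnum τ t.1 • ev t.2).sum

/-- Add a term to a formal linear combination. -/
def addTerm (t : (ℤ × ℤ) × G) : List ((ℤ × ℤ) × G) → List ((ℤ × ℤ) × G)
  | [] => [t]
  | u :: l => if t.2 = u.2 then (t.1 + u.1, u.2) :: l else u :: addTerm t l

/-- Collect the terms of a formal linear combination. -/
def collect (l : List ((ℤ × ℤ) × G)) : List ((ℤ × ℤ) × G) := l.foldr addTerm []

/-- A formal linear combination all of whose coefficients vanish. -/
def isNull (l : List ((ℤ × ℤ) × G)) : Bool := (collect l).all fun t => t.1 == 0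

/-- The scalar multiple of a formal linear combination. -/
def lsmul (b : ℤ) (x : ℤ × ℤ) (l : List ((ℤ × ℤ) × G)) : List ((ℤ × ℤ) × G) :=
  l.map fun t => (qmul b x t.1, t.2)

/-- The bracket of two formal linear combinations. -/
def lbr (b : ℤ) (br : G → G → List (ℤ × G)) (l m : List ((ℤ × ℤ) × G)) :
    List ((ℤ × ℤ) × G) :=
  l.flatMap fun t => m.flatMap fun u =>
    (br t.2 u.2).map fun s => (qmul b (s.1, 0) (qmul b t.1 u.1), s.2)

variable {τ : ℂ} {b : ℤ} {ev : G → L}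

theorem lval_cons (t : (ℤ × ℤ) × G) (l : List ((ℤ × ℤ) × G)) :
    lval τ ev (t :: l) = qnum τ t.1 • ev t.2 + lval τ ev l := rfl

theorem lval_append (l m : List ((ℤ × ℤ) × G)) :
    lval τ ev (l ++ m) = lval τ ev l + lval τ ev m := by
  simp only [lval, List.map_append, List.sum_append]

theorem lval_addTerm (t : (ℤ × ℤ) × G) (l : List ((ℤ × ℤ) × G)) :
    lval τ ev (addTerm t l) = qnum τ t.1 • ev t.2 + lval τ ev l := by
  induction l with
  | nil => rfl
  | cons u l ih =>
    unfold addTerm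
    split_ifs with h
    · rw [lval_cons, lval_cons, h, ← add_assoc, ← add_smul]
      congr 2
      simp only [qnum, Prod.fst_add, Prod.snd_add]; push_cast; ring
    · rw [lval_cons, ih, lval_cons]; abel

theorem lval_collect (l : List ((ℤ × ℤ) × G)) : lval τ ev (collect l) = lval τ ev l := by
  induction l with
  | nil => rfl
  | cons t l ih =>
    change lval τ ev (addTerm t (collect l)) = _
    rw [lval_addTerm, ih, lval_cons]

/-- A sufficient criterion that needs no independence of the values `ev`; identities in an abstract
Lie algebra thereby become Boolean computations on lists. -/
theorem lval_eq_zero {l : List ((ℤ × ℤ) × G)} (h : isNull l = true) : lval τ ev l = 0 := by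
  rw [← lval_collect]
  unfold isNull at h
  generalize collect l = m at h
  induction m with
  | nil => rfl
  | cons t m ih =>
    rw [List.all_cons, Bool.and_eq_true, beq_iff_eq] at h
    rw [lval_cons, ih h.2, h.1]
    simp [qnum]

theorem lval_lsmul (hτ : τ * τ = b * τ - 1) (x : ℤ × ℤ) (l : List ((ℤ × ℤ) × G)) :
    lval τ ev (lsmul b x l) = qnum τ x • lval τ ev l := by
  induction l with
  | nil => simp [lsmul, lval]
  | cons t l ih =>
    change lval τ ev ((qmul b x t.1, t.2) :: lsmul b x l) = _
    rw [lval_cons, ih, lval_cons, smul_add, qnum_qmul hτ, mul_smul]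

/-- The predicate `ok` confines the claim to generators for which the bracket table is correct;
symbols of lattice vectors that are not roots are thus excluded. -/
theorem lval_lbr (hτ : τ * τ = b * τ - 1) {br : G → G → List (ℤ × G)} {ok : G → Prop}
    (hbr : ∀ x y, ok x → ok y →
      ⁅ev x, ev y⁆ = ((br x y).map fun s => (s.1 : ℂ) • ev s.2).sum)
    {l m : List ((ℤ × ℤ) × G)} (hl : ∀ t ∈ l, ok t.2) (hm : ∀ t ∈ m, ok t.2) :
    lval τ ev (lbr b br l m) = ⁅lval τ ev l, lval τ ev m⁆ := by
  have key : ∀ (k : List (ℤ × G)) (x y : ℤ × ℤ),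
      lval τ ev (k.map fun s => (qmul b (s.1, 0) (qmul b x y), s.2)) =
        (qnum τ x * qnum τ y) • (k.map fun s => (s.1 : ℂ) • ev s.2).sum := by
    intro k x y
    induction k with
    | nil => simp [lval]
    | cons s k ih =>
      rw [List.map_cons, lval_cons, ih, List.map_cons, List.sum_cons, smul_add, qnum_qmul hτ,
        qnum_qmul hτ, smul_smul]
      congr 2
      simp [qnum, mul_comm]
  induction l with
  | nil => simp [lbr, lval]
  | cons t l ih =>
    have h1 : lbr b br (t :: l) m = (m.flatMap fun u =>
        (br t.2 u.2).map fun s => (qmul b (s.1, 0) (qmul b t.1 u.1), s.2)) ++ lbr b br l m := by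
      simp [lbr]
    rw [h1, lval_append, ih fun u hu => hl u (List.mem_cons_of_mem _ hu), lval_cons, add_lie]
    congr 1
    have ht := hl t List.mem_cons_self
    clear ih h1 hl
    induction m with
    | nil => simp [lval]
    | cons u m ih =>
      rw [List.flatMap_cons, lval_append, ih fun v hv => hm v (List.mem_cons_of_mem _ hv),
        lval_cons, lie_add, key, ← hbr _ _ ht (hm u List.mem_cons_self),
        smul_lie (qnum τ t.1) (ev t.2) (qnum τ u.1 • ev u.2), lie_smul, smul_smul]

/-- An identity `[l, m] = n` that is verified by collecting terms. -/
theorem lie_lval_eq (hτ : τ * τ = b * τ - 1) {br : G → G → List (ℤ × G)} {ok : G → Prop}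
    (hbr : ∀ x y, ok x → ok y →
      ⁅ev x, ev y⁆ = ((br x y).map fun s => (s.1 : ℂ) • ev s.2).sum)
    {l m n : List ((ℤ × ℤ) × G)} (hl : ∀ t ∈ l, ok t.2) (hm : ∀ t ∈ m, ok t.2)
    (h : isNull (lbr b br l m ++ lsmul b (-1, 0) n) = true) :
    ⁅lval τ ev l, lval τ ev m⁆ = lval τ ev n := by
  have h1 := lval_eq_zero (τ := τ) (ev := ev) h
  rw [lval_append, lval_lbr hτ hbr hl hm, lval_lsmul hτ] at h1
  have h2 : qnum τ (-1, 0) = -1 := by simp [qnum]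
  rw [h2, neg_one_smul] at h1
  exact add_neg_eq_zero.mp h1

end Engine

/-! ### Lie algebras with Chevalley generators -/

section Chevalley

open LieSubalgebra Set

variable {ι : Type*} [Finite ι] {L₁ L₂ : Type*} [LieRing L₁] [LieAlgebra ℂ L₁]
  [FiniteDimensional ℂ L₁] [LieRing L₂] [LieAlgebra ℂ L₂] [FiniteDimensional ℂ L₂]

/-- If every nonzero ideal of a Lie algebra with a basis meets the Cartan subalgebra, then this Lie
algebra is a quotient of every Lie algebra that is generated by elements with the same relations. -/
theorem exists_lieHom {H : LieSubalgebra ℂ L₁} (b : LieAlgebra.Basis ι H)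
    (hb : ∀ I : LieIdeal ℂ L₁, I ≠ ⊥ → ∃ x ∈ I, x ∈ H ∧ x ≠ 0)
    {h e f : ι → L₂} (hlin : LinearIndependent ℂ h) (ef : ∀ i, ⁅e i, f i⁆ = h i)
    (hh : ∀ i j, ⁅h i, h j⁆ = 0) (he : ∀ i j, ⁅h j, e i⁆ = b.A i j • e i)
    (hf : ∀ i j, ⁅h j, f i⁆ = -b.A i j • f i) (hef : ∀ i j, i ≠ j → ⁅e i, f j⁆ = 0) :
    ∃ φ : lieSpan ℂ L₂ (range e ∪ range f) →ₗ⁅ℂ⁆ L₁,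
      (∀ i (hi : e i ∈ lieSpan ℂ L₂ (range e ∪ range f)), φ ⟨e i, hi⟩ = b.e i) ∧
      (∀ i (hi : f i ∈ lieSpan ℂ L₂ (range e ∪ range f)), φ ⟨f i, hi⟩ = b.f i) := by
  classical
  let E : ι → L₁ × L₂ := fun i => (b.e i, e i)
  let F : ι → L₁ × L₂ := fun i => (b.f i, f i)
  -- Goursat's idea: D will be the graph of the homomorphism, read from the second factor to the
  -- first. It remains to show that D contains no (x, 0) with x ≠ 0.
  let D : LieSubalgebra ℂ (L₁ × L₂) := lieSpan ℂ (L₁ × L₂) (range E ∪ range F)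
  have hE : ∀ i, E i ∈ D := fun i => subset_lieSpan (Or.inl ⟨i, rfl⟩)
  have hF : ∀ i, F i ∈ D := fun i => subset_lieSpan (Or.inr ⟨i, rfl⟩)
  have hEF : ∀ i, ⁅E i, F i⁆ = ((b.h i, h i) : L₁ × L₂) := fun i =>
    Prod.ext (b.sl2 i).lie_e_f (ef i)
  have hHD : ∀ i, ((b.h i, h i) : L₁ × L₂) ∈ D := fun i => hEF i ▸ D.lie_mem (hE i) (hF i)
  let e' : ι → D := fun i => ⟨E i, hE i⟩
  let f' : ι → D := fun i => ⟨F i, hF i⟩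
  let h' : ι → D := fun i => ⟨_, hHD i⟩
  have : IsAddTorsionFree L₁ := .of_isTorsionFree ℂ L₁
  have two : ∀ i, b.A i i = 2 := b.A_diag_eq_two
  -- The relations hold in both components, so D has Chevalley generators of its own. What is used
  -- of them is that their Cartan subalgebra is self-normalizing and spanned by the pairs of
  -- coroots.
  let bD : LieAlgebra.Basis ι (lieSpan ℂ D (range h')) :=
    { A := b.A
      h := h'
      e := e'
      f := f'
      cartan_eq_lieSpan := rfl
      span_ef := by
        have := lieSpan_lieSpan_coe_preimage (R := ℂ) (s := range E ∪ range F)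
        have hpre : (Subtype.val ⁻¹' (range E ∪ range F) : Set D) = range e' ∪ range f' := by
          ext x
          simp [e', f', Subtype.ext_iff]
        rw [← hpre]
        exact this
      linInd := .of_comp D.toSubmodule.subtype (.of_comp (LinearMap.fst ℂ L₁ L₂) b.linInd)
      nondegen := b.nondegen
      sl2 := fun i =>
        { h_ne_zero := fun h0 => (b.sl2 i).h_ne_zero (congrArg (fun x : D => x.1.1) h0)
          lie_e_f := Subtype.ext (hEF i)
          lie_h_e_nsmul := Subtype.ext (Prod.ext (b.sl2 i).lie_h_e_nsmul (by
            change ⁅h i, e i⁆ = 2 • e i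
            rw [he, two, ofNat_smul_eq_nsmul]))
          lie_h_f_nsmul := Subtype.ext (Prod.ext (b.sl2 i).lie_h_f_nsmul (by
            change ⁅h i, f i⁆ = -(2 • f i)
            rw [hf, two, neg_smul, ofNat_smul_eq_nsmul])) }
      lie_h_h := fun i j => Subtype.ext (Prod.ext (b.lie_h_h i j) (hh i j))
      lie_h_e := fun i j => Subtype.ext (Prod.ext (b.lie_h_e i j) (he i j))
      lie_h_f := fun i j => Subtype.ext (Prod.ext (b.lie_h_f i j) (hf i j))
      lie_e_f_ne := fun i j hij => Subtype.ext (Prod.ext (b.lie_e_f_ne i j hij) (hef i j hij)) }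
  have := Fintype.ofFinite ι
  have hcartan : (lieSpan ℂ D (range h')).IsCartanSubalgebra := bD.isCartanSubalgebra
  have hfst : ∀ y : L₁, ∃ y' : L₂, (y, y') ∈ D := by
    intro y
    have hy : y ∈ lieSpan ℂ L₁ (range b.e ∪ range b.f) := by rw [b.span_ef]; trivial
    induction hy using lieSpan_induction with
    | mem y hy =>
      rcases hy with ⟨i, rfl⟩ | ⟨i, rfl⟩
      exacts [⟨_, hE i⟩, ⟨_, hF i⟩]
    | zero => exact ⟨0, D.zero_mem⟩
    | add u v _ _ hu hv =>
      obtain ⟨u', hu⟩ := hu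
      obtain ⟨v', hv⟩ := hv
      exact ⟨_, D.add_mem hu hv⟩
    | smul t u _ hu =>
      obtain ⟨u', hu⟩ := hu
      exact ⟨_, D.smul_mem t hu⟩
    | lie u v _ _ hu hv =>
      obtain ⟨u', hu⟩ := hu
      obtain ⟨v', hv⟩ := hv
      exact ⟨_, D.lie_mem hu hv⟩
  -- These x form an ideal since D projects onto L₁. If it is nonzero, it contains some x ≠ 0 in the
  -- Cartan subalgebra.
  have hbot : ∀ x : L₁, ((x, 0) : L₁ × L₂) ∈ D → x = 0 := by
    let I : LieIdeal ℂ L₁ :=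
      { carrier := {x | ((x, 0) : L₁ × L₂) ∈ D}
        zero_mem' := D.zero_mem
        add_mem' := fun {x y} hx hy => by
          have := D.add_mem hx hy
          rwa [Prod.mk_add_mk, add_zero] at this
        smul_mem' := fun c x hx => by
          have := D.smul_mem c hx
          rwa [Prod.smul_mk, smul_zero] at this
        lie_mem := fun {y x} hx => by
          obtain ⟨y', hy⟩ := hfst y
          have := D.lie_mem hy hx
          have h0 : ⁅(y, y'), ((x, 0) : L₁ × L₂)⁆ = (⁅y, x⁆, 0) := Prod.ext rfl (lie_zero y')
          rw [h0] at this
          exact this }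
    suffices I = ⊥ by
      intro x hx
      have : x ∈ I := hx
      rw [‹I = ⊥›] at this
      exact this
    by_contra hI
    obtain ⟨x, hxI, hxH, hx0⟩ := hb I hI
    have hcomm : ∀ i, ⁅b.h i, x⁆ = 0 := by
      intro i
      rw [← LieSubalgebra.mem_toSubmodule, b.coe_cartan_eq_span] at hxH
      clear hxI hx0
      induction hxH using Submodule.span_induction with
      | mem v hv => obtain ⟨j, rfl⟩ := hv; exact b.lie_h_h i j
      | zero => exact lie_zero _
      | add u v _ _ hu hv => rw [lie_add, hu, hv, add_zero]
      | smul t u _ hu => rw [lie_smul, hu, smul_zero]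
    let z : D := ⟨(x, 0), hxI⟩
    have hspan := bD.coe_cartan_eq_span
    -- (x, 0) commutes with the Cartan subalgebra of D, so it normalizes it and lies in it. Then (x,
    -- 0) is a combination of coroot pairs, whose second components are independent; hence x = 0.
    have hz : z ∈ lieSpan ℂ D (range h') := by
      rw [← hcartan.self_normalizing, LieSubalgebra.mem_normalizer_iff']
      intro y hy
      have : ⁅y, z⁆ = 0 := by
        rw [← LieSubalgebra.mem_toSubmodule, hspan] at hy
        induction hy using Submodule.span_induction with
        | mem v hv =>
          obtain ⟨j, rfl⟩ := hv
          exact Subtype.ext (Prod.ext (hcomm j) (lie_zero (h j)))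
        | zero => exact zero_lie _
        | add u v _ _ hu hv => rw [add_lie, hu, hv, add_zero]
        | smul t u _ hu => rw [smul_lie, hu, smul_zero]
      rw [this]
      exact zero_mem _
    rw [← LieSubalgebra.mem_toSubmodule, hspan] at hz
    obtain ⟨c, hc⟩ := (Submodule.mem_span_range_iff_exists_fun ℂ).mp hz
    have hval : ∑ i, c i • ((b.h i, h i) : L₁ × L₂) = (x, 0) := by
      have := congrArg D.toSubmodule.subtype hc
      rw [map_sum] at this
      exact this
    have h1 : ∑ i, c i • b.h i = x := by
      have := congrArg (LinearMap.fst ℂ L₁ L₂) hval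
      rw [map_sum] at this
      exact this
    have h2 : ∑ i, c i • h i = 0 := by
      have := congrArg (LinearMap.snd ℂ L₁ L₂) hval
      rw [map_sum] at this
      exact this
    have h3 := Fintype.linearIndependent_iff.mp hlin c h2
    exact hx0 (by rw [← h1]; simp [h3])
  let p₁ : D →ₗ⁅ℂ⁆ L₁ := (LieHom.fst ℂ L₁ L₂).comp D.incl
  let p₂ : D →ₗ⁅ℂ⁆ L₂ := (LieHom.snd ℂ L₁ L₂).comp D.incl
  have hinj : Function.Injective p₂ := by
    rintro ⟨⟨x, y⟩, hx⟩ ⟨⟨x', y'⟩, hx'⟩ hxy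
    have hy : y = y' := hxy
    subst hy
    have := hbot (x - x') (by
      have := D.sub_mem hx hx'
      rwa [Prod.mk_sub_mk, sub_self] at this)
    rw [sub_eq_zero] at this
    subst this
    rfl
  have hle : lieSpan ℂ L₂ (range e ∪ range f) ≤ p₂.range := by
    rw [lieSpan_le]
    rintro _ (⟨i, rfl⟩ | ⟨i, rfl⟩)
    exacts [⟨e' i, rfl⟩, ⟨f' i, rfl⟩]
  let q := LieEquiv.ofInjective p₂ hinj
  refine ⟨(p₁.comp q.symm.toLieHom).comp (LieSubalgebra.inclusion hle), fun i hi => ?_,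
    fun i hi => ?_⟩
  · have : q.symm (LieSubalgebra.inclusion hle ⟨e i, hi⟩) = e' i := by
      rw [← q.symm_apply_apply (e' i)]; rfl
    exact congrArg p₁ this
  · have : q.symm (LieSubalgebra.inclusion hle ⟨f i, hi⟩) = f' i := by
      rw [← q.symm_apply_apply (f' i)]; rfl
    exact congrArg p₁ this

end Chevalley

end E6GS



namespace E6GS

/-! ### The representation of dimension `27` -/

/-- The pairing of a root `a` with the weight that differs by `d` from the lowest weight. -/
def wt (a d : Q) : ℤ := pr a d - a.1

theorem wt_add_left (a b d : Q) : wt (a + b) d = wt a d + wt b d := by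
  simp only [wt, pr_add_left, Prod.fst_add]; ring

theorem wt_add_right (a d b : Q) : wt a (d + b) = wt a d + pr a b := by
  simp only [wt, pr_add_right]; ring

theorem wt_neg (a d : Q) : wt (-a) d = -wt a d := by
  simp only [wt, pr_neg_left, Prod.fst_neg]; ring

/-- The representation is minuscule: no root string through a weight has length above two, so a root
vector moves a weight vector exactly when the pairing is -1. -/
theorem wt_facts : ∀ a ∈ rootList, ∀ d ∈ weightList, -1 ≤ wt a d ∧ wt a d ≤ 1 ∧
    (d + a ∈ weightList ↔ wt a d = -1) := by
  decide +kernel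

/-- This is c(a,a) ≡ (a,a)/2. It causes the sign in [E_a, E_{-a}] that the oddness of `sig`
compensates. -/
theorem parity_cocycle_self {a : Q} (ha : a ∈ rootList) : parity (cocycle a a) = -1 := by
  revert a; decide +kernel

/-- The weights of the representation `27`. -/
abbrev Wt : Type := {d : Q // d ∈ weightList}

instance : DecidableEq Wt := fun a b => decidable_of_iff (a.1 = b.1) Subtype.ext_iff.symm

instance : Finite Wt := List.finite_toSet weightList

instance : Module.Finite ℂ (Matrix Wt Wt ℂ) := Module.Finite.matrix

noncomputable instance : LieRing (Matrix Wt Wt ℂ) := LieRing.ofAssociativeRing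

noncomputable instance : LieAlgebra ℂ (Matrix Wt Wt ℂ) := LieAlgebra.ofAssociativeAlgebra

/-- The root vectors in the representation `27`. -/
noncomputable def modE (a : Q) : Matrix Wt Wt ℂ := fun ν μ =>
  if ν.1 = μ.1 + a then ((sig a * parity (cocycle a μ.1) : ℤ) : ℂ) else 0

/-- The Cartan subalgebra in the representation `27`. -/
noncomputable def modH (a : Q) : Matrix Wt Wt ℂ := Matrix.diagonal fun μ => (wt a μ.1 : ℂ)

theorem modE_mul_modE {b : Q} (a : Q) (hb : b ∈ rootList) (ν μ : Wt) :
    (modE a * modE b) ν μ = if wt b μ.1 = -1 ∧ ν.1 = μ.1 + b + a then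
      ((sig a * sig b * parity (cocycle a (μ.1 + b) + cocycle b μ.1) : ℤ) : ℂ) else 0 := by
  rw [Matrix.mul_apply]
  have h := (wt_facts b hb μ.1 μ.2).2.2
  by_cases hw : wt b μ.1 = -1
  · rw [Finset.sum_eq_single (⟨μ.1 + b, h.mpr hw⟩ : Wt)]
    · simp only [modE, hw, true_and, if_true]
      split_ifs
      · rw [parity_add]; push_cast; ring
      · rw [zero_mul]
    · intro κ _ hκ
      have : κ.1 ≠ μ.1 + b := fun h' => hκ (Subtype.ext h')
      simp only [modE, if_neg this, mul_zero]
    · intro h'; exact absurd (Finset.mem_univ _) h'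
  · rw [if_neg fun h' => hw h'.1]
    refine Finset.sum_eq_zero fun κ _ => ?_
    have : κ.1 ≠ μ.1 + b := fun h' => hw (h.mp (h' ▸ κ.2))
    simp only [modE, if_neg this, mul_zero]

theorem lie_modH_modE (u a : Q) : ⁅modH u, modE a⁆ = (pr u a : ℂ) • modE a := by
  rw [Ring.lie_def]
  ext ν μ
  rw [Matrix.sub_apply, modH, Matrix.diagonal_mul, Matrix.mul_diagonal, Matrix.smul_apply,
    smul_eq_mul]
  simp only [modE]
  split_ifs with h
  · rw [h, wt_add_right]; push_cast; ring
  · simp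

theorem lie_modH_modH (u v : Q) : ⁅modH u, modH v⁆ = 0 := by
  rw [Ring.lie_def, modH, modH, Matrix.diagonal_mul_diagonal, Matrix.diagonal_mul_diagonal,
    sub_eq_zero]
  congr 1; funext i; ring

/-- On a vector of weight μ at most one of the two products is nonzero: the first if the pairing
with a is 1, the second if it is -1. Both products act by 1 there, so the commutator acts by the
pairing itself. -/
theorem lie_modE_neg {a : Q} (ha : a ∈ rootList) : ⁅modE a, modE (-a)⁆ = modH a := by
  rw [Ring.lie_def]
  ext ν μ
  obtain ⟨h1, h2, -⟩ := wt_facts a ha μ.1 μ.2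
  rw [Matrix.sub_apply, modE_mul_modE a (neg_mem ha), modE_mul_modE (-a) ha, modH,
    Matrix.diagonal_apply, wt_neg, neg_add_cancel_right, add_neg_cancel_right]
  have hp1 : parity (cocycle a (μ.1 + -a) + cocycle (-a) μ.1) = -1 := by
    rw [← parity_cocycle_self ha]
    apply parity_congr
    rw [cocycle_add_right, cocycle_neg_right, cocycle_neg_left]; omega
  have hp2 : parity (cocycle (-a) (μ.1 + a) + cocycle a μ.1) = -1 := by
    rw [← parity_cocycle_self ha]
    apply parity_congr
    rw [cocycle_add_right, cocycle_neg_left, cocycle_neg_left]; omega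
  have hs := sig_mul_self a
  rw [hp1, hp2, sig_neg ha, show sig a * -sig a * -1 = sig a * sig a by ring,
    show -sig a * sig a * -1 = sig a * sig a by ring, hs]
  have hνμ : ν.1 = μ.1 ↔ ν = μ := Subtype.ext_iff.symm
  simp only [hνμ]
  by_cases h : ν = μ
  · subst h
    simp only [and_true, if_true]
    have : wt a ν.1 = -1 ∨ wt a ν.1 = 0 ∨ wt a ν.1 = 1 := by omega
    rcases this with h | h | h <;> simp [h]
  · simp [h]

/-- If μ + a + b is a weight, the pairings of μ with a and b add up to -1, so one is -1 and the
other 0: exactly one order of the two steps is possible. The sign rule of `parity_cocycle_comm`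
makes the two orders agree with one constant. -/
theorem lie_modE_add {a b : Q} (ha : a ∈ rootList) (hb : b ∈ rootList) (hab : pr a b = -1) :
    ⁅modE a, modE b⁆ = (strC a b : ℂ) • modE (a + b) := by
  rw [Ring.lie_def]
  ext ν μ
  obtain ⟨ha1, ha2, -⟩ := wt_facts a ha μ.1 μ.2
  obtain ⟨hb1, hb2, -⟩ := wt_facts b hb μ.1 μ.2
  have h3 := (wt_facts _ (add_mem_of_pr ha hb hab) μ.1 μ.2).2.2
  rw [wt_add_left] at h3
  rw [Matrix.sub_apply, modE_mul_modE a hb, modE_mul_modE b ha, Matrix.smul_apply, smul_eq_mul,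
    add_assoc, add_assoc, add_comm b a]
  simp only [modE]
  by_cases h : ν.1 = μ.1 + (a + b)
  · have h4 : wt a μ.1 + wt b μ.1 = -1 := h3.mp (h ▸ ν.2)
    have hp1 : parity (cocycle a (μ.1 + b) + cocycle b μ.1) =
        parity (cocycle a b) * parity (cocycle (a + b) μ.1) := by
      rw [cocycle_add_right, cocycle_add_left, ← parity_add]; congr 1; ring
    have hp2 : parity (cocycle b (μ.1 + a) + cocycle a μ.1) =
        -(parity (cocycle a b) * parity (cocycle (a + b) μ.1)) := by
      rw [cocycle_add_right, cocycle_add_left,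
        show cocycle b μ.1 + cocycle b a + cocycle a μ.1 =
          cocycle b a + (cocycle a μ.1 + cocycle b μ.1) by ring, parity_add,
        parity_cocycle_comm a b, hab]
      rw [show parity (-1) = -1 from rfl]; ring
    have hs := sig_mul_self (a + b)
    have hS : strC a b * (sig (a + b) * parity (cocycle (a + b) μ.1)) =
        sig a * sig b * (parity (cocycle a b) * parity (cocycle (a + b) μ.1)) := by
      rw [strC]
      linear_combination (sig a * sig b * parity (cocycle a b) * parity (cocycle (a + b) μ.1)) * hs
    rw [hp1, hp2, if_pos h, ← Int.cast_mul, hS]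
    simp only [h, and_true]
    have : (wt a μ.1 = -1 ∧ wt b μ.1 = 0) ∨ (wt a μ.1 = 0 ∧ wt b μ.1 = -1) := by omega
    rcases this with ⟨h5, h6⟩ | ⟨h5, h6⟩
    · rw [if_neg (by omega), if_pos h5]
      push_cast; ring
    · rw [if_pos h6, if_neg (by omega)]
      push_cast; ring
  · simp [h]

/-- If (a,b) = 0, both orders lead from μ to μ + a + b with equal signs, or neither does. If (a,b) =
1, neither does, as a pairing -2 would be required. -/
theorem lie_modE_zero {a b : Q} (ha : a ∈ rootList) (hb : b ∈ rootList) (hab : 0 ≤ pr a b) :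
    ⁅modE a, modE b⁆ = 0 := by
  rcases pr_cases ha hb with rfl | h | h | h | h
  · exact lie_self (modE a)
  · rw [eq_neg_of_add_eq_zero_left h, pr_neg_left, pr_self hb] at hab; omega
  · omega
  all_goals
    rw [Ring.lie_def]
    ext ν μ
    rw [Matrix.sub_apply, modE_mul_modE a hb, modE_mul_modE b ha, Matrix.zero_apply, add_assoc,
      add_assoc, add_comm b a, sub_eq_zero]
    by_cases hν : ν.1 = μ.1 + (a + b)
    · have k1 : wt b μ.1 = -1 → wt a μ.1 + pr a b = -1 := fun h' => by
        have h1 := (wt_facts b hb μ.1 μ.2).2.2.mpr h'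
        rw [← wt_add_right]
        refine (wt_facts a ha _ h1).2.2.mp ?_
        rw [add_assoc, add_comm b a, ← hν]; exact ν.2
      have k2 : wt a μ.1 = -1 → wt b μ.1 + pr a b = -1 := fun h' => by
        have h1 := (wt_facts a ha μ.1 μ.2).2.2.mpr h'
        rw [pr_comm, ← wt_add_right]
        refine (wt_facts b hb _ h1).2.2.mp ?_
        rw [add_assoc, ← hν]; exact ν.2
      obtain ⟨ha1, -, -⟩ := wt_facts a ha μ.1 μ.2
      obtain ⟨hb1, -, -⟩ := wt_facts b hb μ.1 μ.2
      simp only [hν, and_true]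
      by_cases hw : wt a μ.1 = -1
      · have := k2 hw
        first
        | omega
        | (rw [if_pos (by omega), if_pos hw]
           have hp : parity (cocycle a (μ.1 + b) + cocycle b μ.1) =
              parity (cocycle b (μ.1 + a) + cocycle a μ.1) := by
            rw [cocycle_add_right, cocycle_add_right, parity_add, parity_add, parity_add,
              parity_add, parity_cocycle_comm a b, h, show parity 0 = 1 from rfl]
            ring
           rw [hp, mul_comm (sig a)])
      · rw [if_neg hw, if_neg fun h' => hw (by have := k1 h'; omega)]
    · simp [hν]

/-- The diagonal entries at six of the weights already form an invertible system. -/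
theorem linearIndependent_modH : LinearIndependent ℂ fun i => modH (sQ i) := by
  rw [Fintype.linearIndependent_iff]
  intro c hc
  have key : ∀ d (hd : d ∈ weightList), ∑ i, c i * (wt (sQ i) d : ℂ) = 0 := by
    intro d hd
    have := congrFun (congrFun hc ⟨d, hd⟩) ⟨d, hd⟩
    simpa [Matrix.sum_apply, modH] using this
  have k0 := key (0,0,0,0,0,0) (by decide)
  have k1 := key (1,0,0,0,0,0) (by decide)
  have k2 := key (1,0,1,0,0,0) (by decide)
  have k3 := key (1,0,1,1,0,0) (by decide)
  have k4 := key (1,1,1,1,0,0) (by decide)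
  have k5 := key (1,0,1,1,1,0) (by decide)
  have hw : ∀ d, (∑ i, c i * (wt (sQ i) d : ℂ)) = c 0 * wt (1,0,0,0,0,0) d +
      c 1 * wt (0,1,0,0,0,0) d + c 2 * wt (0,0,1,0,0,0) d + c 3 * wt (0,0,0,1,0,0) d +
      c 4 * wt (0,0,0,0,1,0) d + c 5 * wt (0,0,0,0,0,1) d := fun d => by
    rw [Fin.sum_univ_six]; rfl
  rw [hw] at k0 k1 k2 k3 k4 k5
  norm_num [wt, pr] at k0 k1 k2 k3 k4 k5
  have c2 : c 2 = 0 := by linear_combination -k1 + k0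
  have c3 : c 3 = 0 := by linear_combination -k2 + c2
  have c4 : c 4 = 0 := by linear_combination (-1 / 2 : ℂ) * (k3 + k4) + c3 / 2
  have c1 : c 1 = 0 := by linear_combination -k3 - c4 + c3
  have c5 : c 5 = 0 := by linear_combination -k5 - c1 + c4
  intro i
  fin_cases i <;> assumption

/-! ### Chevalley bases with `λ₁`-invariant structure constants -/

theorem lie_mem_span {L : Type*} [LieRing L] [LieAlgebra ℂ L] {s : Set L} {N : Submodule ℂ L}
    (h : ∀ x ∈ s, ∀ y ∈ s, ⁅x, y⁆ ∈ N) {x y : L} (hx : x ∈ Submodule.span ℂ s)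
    (hy : y ∈ Submodule.span ℂ s) : ⁅x, y⁆ ∈ N := by
  induction hx using Submodule.span_induction with
  | mem x hxs =>
    induction hy using Submodule.span_induction with
    | mem y hys => exact h x hxs y hys
    | zero => rw [lie_zero]; exact N.zero_mem
    | add u v _ _ hu hv => rw [lie_add]; exact N.add_mem hu hv
    | smul c u _ hu => rw [lie_smul]; exact N.smul_mem c hu
  | zero => rw [zero_lie]; exact N.zero_mem
  | add u v _ _ hu hv => rw [add_lie]; exact N.add_mem hu hv
  | smul c u _ hu => rw [smul_lie]; exact N.smul_mem c hu

/-- The space spanned by a set that is closed under brackets up to linear combinations. -/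
def lieSubalgebraOfSpan {L : Type*} [LieRing L] [LieAlgebra ℂ L] (s : Set L)
    (h : ∀ x ∈ s, ∀ y ∈ s, ⁅x, y⁆ ∈ Submodule.span ℂ s) : LieSubalgebra ℂ L where
  __ := Submodule.span ℂ s
  lie_mem' := fun hx hy => lie_mem_span h hx hy

variable {g : Type*} [LieRing g] [LieAlgebra ℂ g]

/-- A Chevalley basis of a Lie algebra of type `E₆`, with structure constants `strC`. The root
vectors are indexed by the root lattice. -/
structure Chev (h : (Fin 7 → ℂ) →ₗ[ℂ] g) (X : Q → g) : Prop where
  degenerate : h (cx (e 5 + e 6 + e 7)) = 0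
  X_eq_zero : ∀ a ∉ rootList, X a = 0
  lie_h_h : ∀ u v, ⁅h u, h v⁆ = 0
  lie_h_X : ∀ u a, ⁅h u, X a⁆ = (cx (rv a) ⬝ᵥ u) • X a
  lie_X_neg : ∀ a ∈ rootList, ⁅X a, X (-a)⁆ = h (cx (rv a))
  lie_X_X : ∀ a ∈ rootList, ∀ b ∈ rootList, pr a b = -1 → ⁅X a, X b⁆ = (strC a b : ℂ) • X (a + b)
  lie_X_X_zero : ∀ a ∈ rootList, ∀ b ∈ rootList, 0 ≤ pr a b → ⁅X a, X b⁆ = 0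
  h_injective : ∀ u ∈ cartan ℂ, h u = 0 → u = 0
  X_ne_zero : ∀ a ∈ rootList, X a ≠ 0
  isCartan : ∃ H : LieSubalgebra ℂ g, H.IsCartanSubalgebra ∧ H.toSubmodule = LinearMap.range h
  span_eq_top : Submodule.span ℂ (Set.range h ∪ X '' {a | a ∈ rootList}) = ⊤

theorem simpleCoord_rv (a : Q) (i : Fin 6) :
    simpleCoord (√2 : ℂ) (cx (rv a)) i = (a.coord i : ℂ) := by
  obtain ⟨a0, a1, a2, a3, a4, a5⟩ := a
  have h2 : ((√2 : ℝ) : ℂ) ≠ 0 := by exact_mod_cast (by positivity : (√2 : ℝ) ≠ 0)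
  fin_cases i <;> simp [simpleCoord, cx, rv, dv, dq, Q.coord] <;> field_simp <;> ring

theorem cx_rv_dot (a : Q) (u : Fin 7 → ℂ) :
    cx (rv a) ⬝ᵥ u = ∑ i, simpleCoord (√2 : ℂ) u i * (pr (sQ i) a : ℂ) := by
  obtain ⟨a0, a1, a2, a3, a4, a5⟩ := a
  have h2 : ((√2 : ℝ) : ℂ) * √2 = 2 := by exact_mod_cast sqrt_two_mul_self
  have h3 : ((√2 : ℝ) : ℂ)⁻¹ = √2 / 2 := by
    have h0 : ((√2 : ℝ) : ℂ) ≠ 0 := by exact_mod_cast (by positivity : (√2 : ℝ) ≠ 0)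
    field_simp
    rw [pow_two, h2]
  simp [simpleCoord, cx, rv, dv, dq, sQ, pr, dotProduct, Fin.sum_univ_seven, Fin.sum_univ_six,
    div_eq_mul_inv, h3]
  ring

/-- The coordinates with respect to the simple roots as a linear map. -/
noncomputable def simpleCoordMap : (Fin 7 → ℂ) →ₗ[ℂ] (Fin 6 → ℂ) where
  toFun := simpleCoord (√2 : ℂ)
  map_add' u v := by
    funext i
    fin_cases i <;> simp [simpleCoord] <;> ring
  map_smul' c u := by
    funext i
    fin_cases i <;> simp [simpleCoord] <;> ring

theorem eq_zero_of_simpleCoord {u : Fin 7 → ℂ} (hu : u ∈ cartan ℂ)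
    (h : ∀ i, simpleCoord (√2 : ℂ) u i = 0) : u = 0 := by
  have hu' : u 4 + u 5 + u 6 = 0 := hu
  have h2 : ((√2 : ℝ) : ℂ) ≠ 0 := by exact_mod_cast (by positivity : (√2 : ℝ) ≠ 0)
  have h0 := h 0
  have h1 := h 1
  have h3 := h 3
  have h22 := h 2
  have h4 := h 4
  have h5 := h 5
  have e0 : u 4 = 0 := by
    have h0 : (√2 : ℂ) * (u 4 - (u 4 + u 5 + u 6) / 3) = 0 := h 0
    rw [hu', zero_div, sub_zero] at h0
    exact (mul_eq_zero.mp h0).resolve_left h2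
  have e6 : u 6 = 0 := by
    have h5 : -((√2 : ℂ) * (u 6 - (u 4 + u 5 + u 6) / 3)) = 0 := h 5
    rw [hu', zero_div, sub_zero, neg_eq_zero] at h5
    exact (mul_eq_zero.mp h5).resolve_left h2
  have e5 : u 5 = 0 := by linear_combination hu' - e0 - e6
  have h4 : u 0 + _ / 2 + _ = 0 := h 4
  have h3 : u 1 + _ / 2 + _ = 0 := h 3
  have h22 : (u 2 - u 3 + _ + _) / 2 = 0 := h 2
  have h1 : (u 2 + u 3 + _) / 2 = 0 := h 1
  simp only [e0, e5, e6, sub_zero, add_zero, zero_div, mul_zero, neg_zero] at h4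
  simp only [e0, e5, e6, h4, sub_zero, add_zero, zero_div, mul_zero, neg_zero] at h3
  simp only [e0, e5, e6, h4, h3, sub_zero, add_zero, zero_div, mul_zero, neg_zero] at h1 h22
  funext i
  fin_cases i
  · exact h4
  · exact h3
  · change u 2 = 0
    linear_combination h1 + h22
  · change u 3 = 0
    linear_combination h1 - h22
  · exact e0
  · exact e5
  · exact e6

theorem sQ_mem (i : Fin 6) : sQ i ∈ rootList := by revert i; decide +kernel

/-- Lattice vectors that are obtained from simple roots by adding simple roots. -/
theorem root_induction {P : Q → Prop} (h0 : ∀ i, P (sQ i))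
    (h1 : ∀ i, ∀ a ∈ posList, sQ i + a ∈ posList → P a → P (sQ i + a)) :
    ∀ a ∈ posList, P a := by
  have key : ∀ a ∈ posList, (∃ i, a = sQ i) ∨ ∃ i, ∃ b ∈ posList, a = sQ i + b := by
    decide +kernel
  let ht : Q → ℤ := fun a => a.1 + a.2.1 + a.2.2.1 + a.2.2.2.1 + a.2.2.2.2.1 + a.2.2.2.2.2
  have hpos : ∀ a ∈ posList, 0 ≤ ht a := by decide +kernel
  have hs : ∀ i, ht (sQ i) = 1 := by decide +kernel
  have hadd : ∀ a b, ht (a + b) = ht a + ht b := fun a b => by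
    simp only [ht, Prod.fst_add, Prod.snd_add]; ring
  suffices ∀ n : ℕ, ∀ a ∈ posList, ht a ≤ n → P a from
    fun a ha => this (ht a).toNat a ha (Int.self_le_toNat _)
  intro n
  induction n with
  | zero =>
    intro a ha hn
    rcases key a ha with ⟨i, rfl⟩ | ⟨i, b, hb, rfl⟩
    · exact h0 i
    · have := hpos b hb
      rw [hadd, hs] at hn
      push_cast at hn
      omega
  | succ n ih =>
    intro a ha hn
    rcases key a ha with ⟨i, rfl⟩ | ⟨i, b, hb, rfl⟩
    · exact h0 i
    · rw [hadd, hs] at hn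
      push_cast at hn
      exact h1 i b hb ha (ih b hb (by omega))

theorem strC_ne_zero (a b : Q) : (strC a b : ℂ) ≠ 0 := by
  rcases strC_eq a b with h | h <;> simp [h]

theorem neg_add_mem_aux {a : Q} (ha : a ∈ posList) : a ∈ rootList ∧ -a ∈ rootList :=
  ⟨List.mem_append_left _ ha, neg_mem (List.mem_append_left _ ha)⟩

/-- The Lie algebra of the representation `27`. -/
noncomputable def modLie : LieSubalgebra ℂ (Matrix Wt Wt ℂ) := LieSubalgebra.lieSpan ℂ (Matrix Wt Wt ℂ)
  (Set.range (fun i => modE (sQ i)) ∪ Set.range (fun i => modE (-sQ i)))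

theorem modE_mem_lieSpan {a : Q} (ha : a ∈ rootList) :
    modE a ∈ modLie := by
  let M := modLie
  have key : ∀ a ∈ rootList, ∀ b ∈ rootList, a + b ∈ rootList → modE a ∈ M → modE b ∈ M →
      modE (a + b) ∈ M := by
    intro a ha b hb hab h1 h2
    have := M.smul_mem (strC a b : ℂ)⁻¹ (M.lie_mem h1 h2)
    rwa [lie_modE_add ha hb (pr_eq_of_add_mem ha hb hab), smul_smul,
      inv_mul_cancel₀ (strC_ne_zero _ _), one_smul] at this
  rw [rootList, List.mem_append, List.mem_map] at ha
  rcases ha with ha | ⟨b, hb, rfl⟩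
  · refine root_induction (P := fun a => modE a ∈ M)
      (fun i => LieSubalgebra.subset_lieSpan (Or.inl ⟨i, rfl⟩)) (fun i a ha hia h => ?_) a ha
    exact key _ (sQ_mem i) _ (neg_add_mem_aux ha).1 (neg_add_mem_aux hia).1
      (LieSubalgebra.subset_lieSpan (Or.inl ⟨i, rfl⟩)) h
  · refine root_induction (P := fun a => modE (-a) ∈ M)
      (fun i => LieSubalgebra.subset_lieSpan (Or.inr ⟨i, rfl⟩)) (fun i a ha hia h => ?_) b hb
    have h2 := (neg_add_mem_aux hia).2
    rw [neg_add] at h2 ⊢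
    exact key _ (neg_mem (sQ_mem i)) _ (neg_add_mem_aux ha).2 h2
      (LieSubalgebra.subset_lieSpan (Or.inr ⟨i, rfl⟩)) h

/-- The order of the indices follows the convention [h_j, e_i] = A_ij e_i. -/
theorem cartanMatrix_E₆ : ∀ i j, CartanMatrix.E₆ i j = pr (sQ j) (sQ i) := by
  intro i j
  fin_cases i <;> fin_cases j <;> rfl

/-- The Chevalley generators of the given algebra lie below those of the matrix algebra `modLie`;
the root vectors are the images of the matrices `modE a`, which transports all brackets with their
signs. -/
theorem exists_chev (hg : IsOfType CartanMatrix.E₆ g) :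
    ∃ (h : (Fin 7 → ℂ) →ₗ[ℂ] g) (X : Q → g), Chev h X := by
  obtain ⟨hfin, hsimple, H, b, hA⟩ := hg
  have hI : ∀ I : LieIdeal ℂ g, I ≠ ⊥ → ∃ x ∈ I, x ∈ H ∧ x ≠ 0 := by
    intro I hI
    have := (hsimple.eq_bot_or_eq_top I).resolve_left hI
    refine ⟨b.h 0, by rw [this]; trivial, ?_, (b.sl2 0).h_ne_zero⟩
    exact (b.h' 0).2
  have hpr := cartanMatrix_E₆
  have hpr2 : ∀ i j, i ≠ j → 0 ≤ pr (sQ i) (-sQ j) := by decide +kernel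
  obtain ⟨φ, hφe, hφf⟩ : ∃ φ : modLie →ₗ⁅ℂ⁆ g,
      (∀ i (hi : modE (sQ i) ∈ modLie), φ ⟨modE (sQ i), hi⟩ = b.e i) ∧
      ∀ i (hi : modE (-sQ i) ∈ modLie), φ ⟨modE (-sQ i), hi⟩ = b.f i := exists_lieHom b hI
    (h := fun i => modH (sQ i)) (e := fun i => modE (sQ i)) (f := fun i => modE (-sQ i))
    linearIndependent_modH (fun i => lie_modE_neg (sQ_mem i)) (fun i j => lie_modH_modH _ _)
    (fun i j => by rw [lie_modH_modE, hA, hpr, Int.cast_smul_eq_zsmul])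
    (fun i j => by
      rw [lie_modH_modE, hA, hpr, pr_neg_right, Int.cast_smul_eq_zsmul])
    (fun i j hij => lie_modE_zero (sQ_mem i) (neg_mem (sQ_mem j)) (hpr2 i j hij))
  have hHM : ∀ i, modH (sQ i) ∈ modLie := fun i => by
    rw [← lie_modE_neg (sQ_mem i)]
    exact modLie.lie_mem (modE_mem_lieSpan (sQ_mem i)) (modE_mem_lieSpan (neg_mem (sQ_mem i)))
  have hφh : ∀ i, φ ⟨modH (sQ i), hHM i⟩ = b.h i := by
    intro i
    rw [← (b.sl2 i).lie_e_f, ← hφe i (modE_mem_lieSpan (sQ_mem i)),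
      ← hφf i (modE_mem_lieSpan (neg_mem (sQ_mem i))), ← LieHom.map_lie]
    exact congrArg φ (Subtype.ext (lie_modE_neg (sQ_mem i)).symm :
      (⟨modH (sQ i), hHM i⟩ : modLie) = ⁅(⟨modE (sQ i), modE_mem_lieSpan (sQ_mem i)⟩ : modLie),
        (⟨modE (-sQ i), modE_mem_lieSpan (neg_mem (sQ_mem i))⟩ : modLie)⁆)
  let X : Q → g := fun a => if ha : a ∈ rootList then φ ⟨modE a, modE_mem_lieSpan ha⟩ else 0
  have hX : ∀ a (ha : a ∈ rootList), X a = φ ⟨modE a, modE_mem_lieSpan ha⟩ := fun a ha =>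
    dif_pos ha
  let h : (Fin 7 → ℂ) →ₗ[ℂ] g := (Fintype.linearCombination ℂ b.h).comp simpleCoordMap
  have hh : ∀ u, h u = ∑ i, simpleCoord (√2 : ℂ) u i • b.h i := fun u => rfl
  have hhrv : ∀ a, h (cx (rv a)) = ∑ i, (a.coord i : ℂ) • b.h i := fun a => by
    rw [hh]; simp only [simpleCoord_rv]
  have hbX : ∀ i a, ⁅b.h i, X a⁆ = (pr (sQ i) a : ℂ) • X a := by
    intro i a
    by_cases ha : a ∈ rootList
    · rw [hX a ha, ← hφh, ← LieHom.map_lie, ← map_smul]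
      exact congrArg φ (Subtype.ext (lie_modH_modE (sQ i) a) :
        ⁅(⟨modH (sQ i), hHM i⟩ : modLie), (⟨modE a, modE_mem_lieSpan ha⟩ : modLie)⁆ =
          (pr (sQ i) a : ℂ) • (⟨modE a, modE_mem_lieSpan ha⟩ : modLie))
    · have : X a = 0 := dif_neg ha
      rw [this, lie_zero, smul_zero]
  have hrange : H.toSubmodule = LinearMap.range h := by
    rw [b.coe_cartan_eq_span]
    apply le_antisymm
    · rw [Submodule.span_le]
      rintro _ ⟨i, rfl⟩
      refine ⟨cx (rv (sQ i)), ?_⟩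
      rw [hhrv, Finset.sum_eq_single i]
      · have : ∀ i, (sQ i).coord i = 1 := by decide +kernel
        rw [this]; simp
      · intro j _ hj
        have : ∀ i j, j ≠ i → (sQ i).coord j = 0 := by decide +kernel
        rw [this i j hj]; simp
      · intro hi; exact absurd (Finset.mem_univ _) hi
    · rintro _ ⟨u, rfl⟩
      rw [hh]
      exact Submodule.sum_mem _ fun i _ =>
        Submodule.smul_mem _ _ (Submodule.subset_span ⟨i, rfl⟩)
  have lie_h_h : ∀ u v, ⁅h u, h v⁆ = 0 := by
    intro u v
    rw [hh, hh]
    simp only [sum_lie, lie_sum, smul_lie, lie_smul, b.lie_h_h, smul_zero,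
      Finset.sum_const_zero]
  have lie_h_X : ∀ u a, ⁅h u, X a⁆ = (cx (rv a) ⬝ᵥ u) • X a := by
    intro u a
    rw [hh, sum_lie, cx_rv_dot, Finset.sum_smul]
    refine Finset.sum_congr rfl fun i _ => ?_
    rw [smul_lie, hbX, smul_smul]
  have lie_X_neg : ∀ a ∈ rootList, ⁅X a, X (-a)⁆ = h (cx (rv a)) := by
    intro a ha
    have hmod : modH a = ∑ i, (a.coord i : ℂ) • modH (sQ i) := by
      ext ν μ
      rw [Matrix.sum_apply]
      simp only [modH, Matrix.smul_apply, Matrix.diagonal_apply]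
      by_cases hνμ : ν = μ
      · simp only [if_pos hνμ]
        obtain ⟨a0, a1, a2, a3, a4, a5⟩ := a
        simp [wt, pr, sQ, Q.coord, Fin.sum_univ_six]
        ring
      · simp [hνμ]
    have hm : modH a ∈ modLie := by
      rw [← lie_modE_neg ha]
      exact modLie.lie_mem (modE_mem_lieSpan ha) (modE_mem_lieSpan (neg_mem ha))
    have h1 : (⟨modH a, hm⟩ : modLie) = ∑ i, (a.coord i : ℂ) • (⟨modH (sQ i), hHM i⟩ : modLie) := by
      apply Subtype.ext
      have := map_sum modLie.toSubmodule.subtype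
        (fun i => (a.coord i : ℂ) • (⟨modH (sQ i), hHM i⟩ : modLie)) Finset.univ
      exact hmod.trans this.symm
    rw [hX a ha, hX _ (neg_mem ha), ← LieHom.map_lie, hhrv]
    have h2 : ⁅(⟨modE a, modE_mem_lieSpan ha⟩ : modLie),
        (⟨modE (-a), modE_mem_lieSpan (neg_mem ha)⟩ : modLie)⁆ = (⟨modH a, hm⟩ : modLie) := Subtype.ext (lie_modE_neg ha)
    rw [h2, h1]
    have := map_sum (φ : modLie →ₗ[ℂ] g)
        (fun i => (a.coord i : ℂ) • (⟨modH (sQ i), hHM i⟩ : modLie)) Finset.univ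
    refine this.trans (Finset.sum_congr rfl fun i _ => ?_)
    rw [map_smul]
    congr 1
    exact hφh i
  have h_inj : ∀ u ∈ cartan ℂ, h u = 0 → u = 0 := by
    intro u hu h0
    rw [hh] at h0
    exact eq_zero_of_simpleCoord hu (Fintype.linearIndependent_iff.mp b.linInd _ h0)
  have lie_X_X : ∀ a ∈ rootList, ∀ b ∈ rootList, pr a b = -1 →
      ⁅X a, X b⁆ = (strC a b : ℂ) • X (a + b) := by
    intro a ha b hb hab
    rw [hX a ha, hX b hb, hX _ (add_mem_of_pr ha hb hab), ← LieHom.map_lie, ← map_smul]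
    exact congrArg φ (Subtype.ext (lie_modE_add ha hb hab) :
      ⁅(⟨modE a, modE_mem_lieSpan ha⟩ : modLie), (⟨modE b, modE_mem_lieSpan hb⟩ : modLie)⁆ =
        (strC a b : ℂ) • (⟨modE (a + b), modE_mem_lieSpan (add_mem_of_pr ha hb hab)⟩ : modLie))
  have lie_X_X_zero : ∀ a ∈ rootList, ∀ b ∈ rootList, 0 ≤ pr a b → ⁅X a, X b⁆ = 0 := by
    intro a ha b hb hab
    rw [hX a ha, hX b hb, ← LieHom.map_lie]
    exact (congrArg φ (Subtype.ext (lie_modE_zero ha hb hab) :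
      ⁅(⟨modE a, modE_mem_lieSpan ha⟩ : modLie), (⟨modE b, modE_mem_lieSpan hb⟩ : modLie)⁆ = 0)).trans
        (map_zero φ)
  -- By the bracket relations the span is a subalgebra, and it contains the generators.
  have hspan : Submodule.span ℂ (Set.range h ∪ X '' {a | a ∈ rootList}) = ⊤ := by
    have hmem : ∀ {a}, a ∈ rootList →
        X a ∈ Submodule.span ℂ (Set.range h ∪ X '' {a | a ∈ rootList}) := fun ha =>
      Submodule.subset_span (Or.inr ⟨_, ha, rfl⟩)
    have hmem' : ∀ u, h u ∈ Submodule.span ℂ (Set.range h ∪ X '' {a | a ∈ rootList}) := fun u =>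
      Submodule.subset_span (Or.inl ⟨u, rfl⟩)
    let S := lieSubalgebraOfSpan (Set.range h ∪ X '' {a | a ∈ rootList}) (by
      rintro _ (⟨u, rfl⟩ | ⟨a, ha, rfl⟩) _ (⟨v, rfl⟩ | ⟨b, hb, rfl⟩)
      · rw [lie_h_h]; exact zero_mem _
      · rw [lie_h_X]; exact Submodule.smul_mem _ _ (hmem hb)
      · rw [← lie_skew, lie_h_X]; exact Submodule.neg_mem _ (Submodule.smul_mem _ _ (hmem ha))
      · have ha' : a ∈ rootList := ha
        have hb' : b ∈ rootList := hb
        rcases pr_cases ha' hb' with hab | hab | hab | hab | hab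
        · rw [hab, lie_self]; exact zero_mem _
        · rw [eq_neg_of_add_eq_zero_right hab, lie_X_neg a ha]; exact hmem' _
        · rw [lie_X_X a ha b hb hab.1]; exact Submodule.smul_mem _ _ (hmem hab.2)
        · rw [lie_X_X_zero a ha b hb (by omega)]; exact zero_mem _
        · rw [lie_X_X_zero a ha b hb (by omega)]; exact zero_mem _)
    have hS : S = ⊤ := by
      rw [eq_top_iff, ← b.span_ef, LieSubalgebra.lieSpan_le]
      rintro _ (⟨i, rfl⟩ | ⟨i, rfl⟩)
      · rw [← hφe i (modE_mem_lieSpan (sQ_mem i)), ← hX _ (sQ_mem i)]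
        exact hmem (sQ_mem i)
      · rw [← hφf i (modE_mem_lieSpan (neg_mem (sQ_mem i))), ← hX _ (neg_mem (sQ_mem i))]
        exact hmem (neg_mem (sQ_mem i))
    have := congrArg LieSubalgebra.toSubmodule hS
    exact this
  refine ⟨h, X, ?_, fun a ha => dif_neg ha, lie_h_h, lie_h_X, lie_X_neg, lie_X_X, lie_X_X_zero,
    h_inj, ?_, ⟨H, b.isCartanSubalgebra, hrange⟩, hspan⟩
  · rw [hh]
    refine Finset.sum_eq_zero fun i _ => ?_
    have : simpleCoord (√2 : ℂ) (cx (e 5 + e 6 + e 7)) i = 0 := by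
      fin_cases i <;> simp [simpleCoord, cx, e] <;> norm_num
    rw [this, zero_smul]
  -- A vanishing root vector would make the coroot [X a, X (-a)] vanish, so a = 0.
  · intro a ha h0
    have h1 := lie_X_neg a ha
    rw [h0, zero_lie] at h1
    have h2 := h_inj (cx (rv a)) (by
      have := rv_mem_cartan a
      change _ + _ + _ = _ at this ⊢
      simp only [cx]
      exact_mod_cast this) h1.symm
    have h3 : rv a = rv 0 := by
      rw [rv_zero]
      funext i
      exact Complex.ofReal_eq_zero.mp (congrFun h2 i)
    rw [rv_injective h3] at ha
    revert ha
    decide +kernel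

end E6GS



namespace E6GS

/-! ### The linear structure of a Chevalley basis -/

theorem cx_rv_dot_cx_rv (a b : Q) : cx (rv a) ⬝ᵥ cx (rv b) = (pr a b : ℂ) := by
  have h := rv_dot a b
  simp only [dotProduct, cx] at h ⊢
  exact_mod_cast congrArg (fun x : ℝ => (x : ℂ)) h

theorem cx_rv_mem (a : Q) : cx (rv a) ∈ cartan ℂ := by
  have h : _ + _ + _ = _ := rv_mem_cartan a
  change _ + _ + _ = _
  simp only [cx]
  exact_mod_cast congrArg (fun x : ℝ => (x : ℂ)) h

theorem cx_add (u v : Fin 7 → ℝ) : cx (u + v) = cx u + cx v := by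
  funext i; simp [cx]

theorem cx_lam (u : Fin 7 → ℝ) : lam ℂ (cx u) = cx (lam ℝ u) := by
  funext i
  fin_cases i <;> simp [lam, cx, Matrix.mulVec, dotProduct, Fin.sum_univ_seven]

theorem lam_dot_lam_complex (u v : Fin 7 → ℂ) : lam ℂ u ⬝ᵥ lam ℂ v = u ⬝ᵥ v := by
  simp [lam, Matrix.mulVec, dotProduct, Fin.sum_univ_seven]
  ring

theorem lam_lam_lam_complex (u : Fin 7 → ℂ) : lam ℂ (lam ℂ (lam ℂ u)) = u := by
  funext i
  fin_cases i <;> simp [lam, Matrix.mulVec, dotProduct, Fin.sum_univ_seven] <;> ring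

theorem eq_sum_simpleCoord_complex (u : Fin 7 → ℂ) :
    u = ∑ i, simpleCoord (√2 : ℂ) u i • cx (rv (sQ i)) +
      ((u 4 + u 5 + u 6) / 3) • cx (e 5 + e 6 + e 7) := by
  have h2 : ((√2 : ℝ) : ℂ) ≠ 0 := by exact_mod_cast (by positivity : (√2 : ℝ) ≠ 0)
  funext i
  fin_cases i <;> simp [Fin.sum_univ_six, simpleCoord, cx, rv, dv, dq, sQ, e] <;> field_simp <;>
    ring

theorem eq_sum_of_mem_cartan {u : Fin 7 → ℂ} (hu : u ∈ cartan ℂ) :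
    u = ∑ i, simpleCoord (√2 : ℂ) u i • cx (rv (sQ i)) := by
  have h : u 4 + u 5 + u 6 = 0 := hu
  have := eq_sum_simpleCoord_complex u
  rwa [h, zero_div, zero_smul, add_zero] at this

theorem eq_sum_coord (a : Q) : cx (rv a) = ∑ i, (a.coord i : ℂ) • cx (rv (sQ i)) := by
  have := eq_sum_of_mem_cartan (cx_rv_mem a)
  simpa only [simpleCoord_rv] using this

/-- The constant is twice the Coxeter number; it is what the factor 1/24 of `form` cancels. -/
theorem sum_roots_pr : ∀ i j, ((rootList.map fun a => pr (sQ i) a * pr (sQ j) a).sum) =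
    24 * pr (sQ i) (sQ j) := by decide +kernel

/-- A lattice vector that separates the roots. -/
def regular : Q := (-17, 11, 13, -14, 13, -13)

theorem regular_nodup : (rootList.map (pr regular)).Nodup := by decide +kernel

theorem pr_regular_ne_zero : ∀ a ∈ rootList, pr regular a ≠ 0 := by decide +kernel

/-- The type of roots. -/
abbrev RT : Type := {a : Q // a ∈ rootList}

instance : Fintype RT := Fintype.ofFinset rootList.toFinset fun _ => List.mem_toFinset

theorem sum_RT {M : Type*} [AddCommMonoid M] (f : Q → M) :
    ∑ a : RT, f a = (rootList.map f).sum := by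
  rw [← List.sum_toFinset _ rootList_nodup]
  exact Finset.sum_subtype _ (fun _ => List.mem_toFinset) f |>.symm

theorem card_RT : Fintype.card RT = 72 := by
  have := sum_RT (fun _ => (1 : ℕ))
  rw [Finset.sum_const, smul_eq_mul, mul_one] at this
  exact this.trans (by decide +kernel)

theorem pr_regular_injective : Function.Injective fun a : RT => pr regular a := by
  intro a b h
  exact Subtype.ext (List.inj_on_of_nodup_map regular_nodup a.2 b.2 h)

theorem pr_self_ne_zero {c : Q} (hc : c ≠ 0) : pr c c ≠ 0 := by
  intro h
  have h1 := rv_dot c c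
  rw [h, Int.cast_zero, dotProduct_self_eq_zero, ← rv_zero] at h1
  exact hc (rv_injective h1)

variable {g : Type*} [LieRing g] [LieAlgebra ℂ g] {h : (Fin 7 → ℂ) →ₗ[ℂ] g} {X : Q → g}

namespace Chev

variable (C : Chev h X)
include C

theorem h_eq_sum (u : Fin 7 → ℂ) :
    h u = ∑ i, simpleCoord (√2 : ℂ) u i • h (cx (rv (sQ i))) := by
  conv_lhs => rw [eq_sum_simpleCoord_complex u]
  rw [map_add, map_smul, C.degenerate, smul_zero, add_zero, map_sum]
  simp only [map_smul]

theorem lie_hv_X (a b : Q) : ⁅h (cx (rv a)), X b⁆ = (pr a b : ℂ) • X b := by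
  rw [C.lie_h_X, cx_rv_dot_cx_rv, pr_comm]

theorem linearIndependent_X : LinearIndependent ℂ fun a : RT => X a := by
  refine linearIndependent_of_weights (LieAlgebra.ad ℂ g (h (cx (rv regular))))
    (c := fun a : RT => (pr regular a : ℂ)) (fun a => C.lie_hv_X _ _) ?_ fun a => C.X_ne_zero _ a.2
  intro a b hab
  exact pr_regular_injective (Int.cast_injective hab)

theorem linearIndependent_h : LinearIndependent ℂ fun i => h (cx (rv (sQ i))) := by
  rw [Fintype.linearIndependent_iff]
  intro c hc
  have h1 : h (∑ i, c i • cx (rv (sQ i))) = 0 := by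
    rw [map_sum]; simpa only [map_smul] using hc
  have h2 := C.h_injective _ (Submodule.sum_mem _ fun i _ =>
    Submodule.smul_mem _ _ (cx_rv_mem _)) h1
  have h3 := congrArg simpleCoordMap h2
  rw [map_sum, map_zero] at h3
  intro i
  have h4 := congrFun h3 i
  rw [Finset.sum_apply, Finset.sum_eq_single i] at h4
  · rw [map_smul, Pi.smul_apply] at h4
    have h5 : simpleCoordMap (cx (rv (sQ i))) i = ((sQ i).coord i : ℂ) := simpleCoord_rv _ _
    have h6 : ∀ i, (sQ i).coord i = 1 := by decide +kernel
    simpa [h5, h6] using h4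
  · intro j _ hj
    rw [map_smul, Pi.smul_apply]
    have h5 : simpleCoordMap (cx (rv (sQ j))) i = ((sQ j).coord i : ℂ) := simpleCoord_rv _ _
    have h6 : ∀ i j, j ≠ i → (sQ j).coord i = 0 := by decide +kernel
    rw [h5, h6 i j hj]; simp
  · intro hi; exact absurd (Finset.mem_univ _) hi

theorem range_h : LinearMap.range h = Submodule.span ℂ (Set.range fun i => h (cx (rv (sQ i)))) := by
  apply le_antisymm
  · rintro _ ⟨u, rfl⟩
    rw [C.h_eq_sum]
    exact Submodule.sum_mem _ fun i _ => Submodule.smul_mem _ _ (Submodule.subset_span ⟨i, rfl⟩)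
  · rw [Submodule.span_le]
    rintro _ ⟨i, rfl⟩
    exact ⟨_, rfl⟩

theorem disjoint : Disjoint (LinearMap.range h)
    (Submodule.span ℂ (Set.range fun a : RT => X a)) := by
  rw [Submodule.disjoint_def]
  rintro _ ⟨u, rfl⟩ hx
  obtain ⟨d, hd⟩ := (Submodule.mem_span_range_iff_exists_fun ℂ).mp hx
  have h1 : ⁅h (cx (rv regular)), ∑ a : RT, d a • X a⁆ = 0 := by rw [hd, C.lie_h_h]
  simp only [lie_sum, lie_smul, C.lie_hv_X, smul_smul] at h1
  have h2 := Fintype.linearIndependent_iff.mp C.linearIndependent_X _ h1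
  rw [← hd]
  refine Finset.sum_eq_zero fun a _ => ?_
  have h3 : (pr regular a : ℂ) ≠ 0 := by exact_mod_cast pr_regular_ne_zero a a.2
  rw [(mul_eq_zero.mp (h2 a)).resolve_right h3, zero_smul]

omit [LieRing g] [LieAlgebra ℂ g] C in
theorem image_X : X '' {a | a ∈ rootList} = Set.range fun a : RT => X a := by
  ext x
  constructor
  · rintro ⟨a, ha, rfl⟩; exact ⟨⟨a, ha⟩, rfl⟩
  · rintro ⟨a, rfl⟩; exact ⟨a, a.2, rfl⟩

theorem isCompl : IsCompl (LinearMap.range h) (Submodule.span ℂ (Set.range fun a : RT => X a)) := by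
  refine ⟨C.disjoint, codisjoint_iff.mpr ?_⟩
  have := C.span_eq_top
  rw [image_X, Submodule.span_union] at this
  have h2 : Submodule.span ℂ (Set.range h) = LinearMap.range h := Submodule.span_eq (LinearMap.range h)
  rwa [h2] at this

/-- The Chevalley basis as a basis of the vector space. -/
noncomputable def basis : Module.Basis (Fin 6 ⊕ RT) ℂ g :=
  Module.Basis.mk (v := Sum.elim (fun i => h (cx (rv (sQ i)))) fun a : RT => X a)
    (C.linearIndependent_h.sum_type C.linearIndependent_X (by
      rw [← C.range_h]; exact C.disjoint))
    (by
      rw [Set.Sum.elim_range, Submodule.span_union, ← C.range_h]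
      exact C.isCompl.codisjoint.eq_top.ge)

theorem basis_inl (i : Fin 6) : C.basis (.inl i) = h (cx (rv (sQ i))) := by
  rw [basis, Module.Basis.mk_apply]; rfl

theorem basis_inr (a : RT) : C.basis (.inr a) = X a := by
  rw [basis, Module.Basis.mk_apply]; rfl

theorem finrank : Module.finrank ℂ g = 78 := by
  rw [Module.finrank_eq_card_basis C.basis, Fintype.card_sum, card_RT]; rfl

theorem hom_ext {M : Type*} [AddCommGroup M] [Module ℂ M] {f k : g →ₗ[ℂ] M}
    (h1 : ∀ u, f (h u) = k (h u)) (h2 : ∀ a ∈ rootList, f (X a) = k (X a)) : f = k := by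
  refine LinearMap.ext_on C.span_eq_top ?_
  rintro _ (⟨u, rfl⟩ | ⟨a, ha, rfl⟩)
  · exact h1 u
  · exact h2 a ha

/-! ### The Killing form -/

/-- The Chevalley basis diagonalizes both adjoint maps, so the trace is a sum over the roots. -/
theorem killingForm_h_h (u v : Fin 7 → ℂ) : killingForm ℂ g (h u) (h v) =
    ∑ a : RT, (cx (rv a) ⬝ᵥ u) * (cx (rv a) ⬝ᵥ v) := by
  classical
  rw [killingForm_apply_apply, LinearMap.trace_eq_matrix_trace ℂ C.basis, Matrix.trace,
    Fintype.sum_sum_type]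
  simp only [Matrix.diag_apply, LinearMap.toMatrix_apply, basis_inl, basis_inr,
    LinearMap.comp_apply, LieAlgebra.ad_apply, C.lie_h_h, C.lie_h_X, lie_zero, map_zero,
    Finsupp.coe_zero, Pi.zero_apply, Finset.sum_const_zero, zero_add, lie_smul, map_smul,
    Finsupp.smul_apply, smul_eq_mul]
  refine Finset.sum_congr rfl fun a _ => ?_
  rw [← C.basis_inr a, Module.Basis.repr_self, Finsupp.single_eq_same]
  ring

theorem form_h_h {u v : Fin 7 → ℂ} (hu : u ∈ cartan ℂ) (hv : v ∈ cartan ℂ) :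
    form (h u) (h v) = u ⬝ᵥ v := by
  rw [form, C.killingForm_h_h]
  have key : ∀ i j, ∑ a : RT, (cx (rv a) ⬝ᵥ cx (rv (sQ i))) * (cx (rv a) ⬝ᵥ cx (rv (sQ j))) =
      24 * (cx (rv (sQ i)) ⬝ᵥ cx (rv (sQ j))) := by
    intro i j
    simp only [cx_rv_dot_cx_rv]
    have h1 := sum_RT fun a => pr (sQ i) a * pr (sQ j) a
    rw [sum_roots_pr] at h1
    have h2 := congrArg (fun n : ℤ => (n : ℂ)) h1
    push_cast at h2
    rw [← h2]
    refine Finset.sum_congr rfl fun a _ => ?_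
    rw [pr_comm a.1, pr_comm a.1]
  rw [eq_sum_of_mem_cartan hu, eq_sum_of_mem_cartan hv]
  generalize simpleCoord (√2 : ℂ) u = x
  generalize simpleCoord (√2 : ℂ) v = y
  simp only [dotProduct_sum, sum_dotProduct, dotProduct_smul, smul_dotProduct, smul_eq_mul,
    Finset.sum_mul_sum]
  rw [Finset.sum_comm]
  simp only [Finset.mul_sum]
  rw [Finset.sum_congr rfl fun i _ => Finset.sum_comm]
  have : ∀ i j, ∑ a : RT, 1 / 24 * (x i * (cx (rv a) ⬝ᵥ cx (rv (sQ i))) *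
      (y j * (cx (rv a) ⬝ᵥ cx (rv (sQ j))))) =
      x i * (y j * (cx (rv (sQ i)) ⬝ᵥ cx (rv (sQ j)))) := by
    intro i j
    have h1 := congrArg (fun z => 1 / 24 * (x i * y j) * z) (key i j)
    simp only [Finset.mul_sum] at h1
    rw [show x i * (y j * (cx (rv (sQ i)) ⬝ᵥ cx (rv (sQ j)))) = 1 / 24 * (x i * y j) *
      (24 * (cx (rv (sQ i)) ⬝ᵥ cx (rv (sQ j)))) by ring, ← h1]
    exact Finset.sum_congr rfl fun a _ => by ring
  simp only [this]
  rw [Finset.sum_comm]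
  exact Finset.sum_congr rfl fun i _ => Finset.sum_congr rfl fun j _ => by ring

omit C in
theorem form_lie (x y z : g) : form ⁅x, y⁆ z = form x ⁅y, z⁆ := by
  rw [form, form, LieModule.traceForm_apply_lie_apply]

omit C in
theorem form_comm (x y : g) : form x y = form y x := by
  rw [form, form, LieModule.traceForm_comm]

omit C in
theorem form_smul_left (c : ℂ) (x y : g) : form (c • x) y = c * form x y := by
  simp only [form, map_smul, LinearMap.smul_apply, smul_eq_mul]; ring

omit C in
theorem form_smul_right (c : ℂ) (x y : g) : form x (c • y) = c * form x y := by
  simp only [form, map_smul, smul_eq_mul]; ring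

omit C in
theorem form_add_left (x y z : g) : form (x + y) z = form x z + form y z := by
  simp only [form, map_add, LinearMap.add_apply]; ring

omit C in
theorem form_add_right (x y z : g) : form x (y + z) = form x y + form x z := by
  simp only [form, map_add]; ring

/-- X a is half of [h_a, X a]; invariance moves h_a next to h u, with which it commutes. -/
theorem form_h_X (u : Fin 7 → ℂ) (a : Q) : form (h u) (X a) = 0 := by
  by_cases ha : a ∈ rootList
  · have h1 := form_lie (h u) (h (cx (rv a))) (X a)
    rw [C.lie_h_h, C.lie_hv_X, pr_self ha, form_smul_right] at h1
    have h2 : form (0 : g) (X a) = 0 := by simp [form]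
    rw [h2] at h1
    push_cast at h1
    linear_combination -h1 / 2
  · rw [C.X_eq_zero a ha]; simp [form]

/-- Inserting the element h_{a+b} between the two vectors multiplies the form by (a+b, a+b), which
is nonzero by definiteness. -/
theorem form_X_X {a b : Q} (hab : a + b ≠ 0) : form (X a) (X b) = 0 := by
  have h1 := form_lie (X a) (h (cx (rv (a + b)))) (X b)
  rw [← lie_skew, C.lie_hv_X, C.lie_hv_X, form_smul_right, ← neg_smul, form_smul_left] at h1
  have h2 : ((pr (a + b) (a + b) : ℤ) : ℂ) * form (X a) (X b) = 0 := by
    rw [pr_add_right]; push_cast; linear_combination -h1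
  exact (mul_eq_zero.mp h2).resolve_left (by exact_mod_cast pr_self_ne_zero hab)

theorem form_X_neg {a : Q} (ha : a ∈ rootList) : form (X a) (X (-a)) = 1 := by
  have h1 := form_lie (X a) (X (-a)) (h (cx (rv a)))
  rw [C.lie_X_neg a ha, C.form_h_h (cx_rv_mem a) (cx_rv_mem a), cx_rv_dot_cx_rv, pr_self ha,
    ← lie_skew, C.lie_hv_X, pr_neg_right, pr_self ha, ← neg_smul, form_smul_right] at h1
  push_cast at h1
  linear_combination -h1 / 2

/-! ### The automorphism -/

/-- The linear extension of `λ₁`. -/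
noncomputable def autLin : g →ₗ[ℂ] g :=
  C.basis.constr ℂ (Sum.elim (fun i => h (lam ℂ (cx (rv (sQ i))))) fun a : RT => X (lamQ a))

theorem autLin_h (u : Fin 7 → ℂ) : C.autLin (h u) = h (lam ℂ u) := by
  conv_rhs => rw [eq_sum_simpleCoord_complex u]
  rw [C.h_eq_sum, map_sum, map_add, map_smul, cx_lam, lam_e, map_add, map_smul, C.degenerate,
    smul_zero, add_zero, map_sum, map_sum]
  refine Finset.sum_congr rfl fun i _ => ?_
  rw [map_smul, map_smul, map_smul, ← C.basis_inl, autLin, Module.Basis.constr_basis]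
  rfl

theorem autLin_X (a : Q) : C.autLin (X a) = X (lamQ a) := by
  by_cases ha : a ∈ rootList
  · rw [show X a = C.basis (.inr ⟨a, ha⟩) from (C.basis_inr ⟨a, ha⟩).symm, autLin,
      Module.Basis.constr_basis]
    rfl
  · have : lamQ a ∉ rootList := fun h' => ha (by
      have := lamQ_mem (lamQ_mem h')
      rwa [lamQ_lamQ_lamQ] at this)
    rw [C.X_eq_zero a ha, C.X_eq_zero _ this, map_zero]

theorem autLin_autLin_autLin (x : g) : C.autLin (C.autLin (C.autLin x)) = x := by
  have : C.autLin ∘ₗ C.autLin ∘ₗ C.autLin = LinearMap.id := by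
    refine C.hom_ext (fun u => ?_) fun a _ => ?_
    · simp only [LinearMap.comp_apply, C.autLin_h, lam_lam_lam_complex, LinearMap.id_apply]
    · simp only [LinearMap.comp_apply, C.autLin_X, lamQ_lamQ_lamQ, LinearMap.id_apply]
  exact LinearMap.congr_fun this x

theorem lie_X_cases {a b : Q} (ha : a ∈ rootList) (hb : b ∈ rootList) :
    (a + b = 0 ∧ ⁅X a, X b⁆ = h (cx (rv a))) ∨
    (a + b ∈ rootList ∧ pr a b = -1 ∧ ⁅X a, X b⁆ = (strC a b : ℂ) • X (a + b)) ∨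
    (0 ≤ pr a b ∧ ⁅X a, X b⁆ = 0) := by
  rcases pr_cases ha hb with hab | hab | hab | hab | hab
  · subst hab
    exact Or.inr (Or.inr ⟨by rw [pr_self ha]; norm_num, lie_self _⟩)
  · refine Or.inl ⟨hab, ?_⟩
    rw [eq_neg_of_add_eq_zero_right hab, C.lie_X_neg a ha]
  · exact Or.inr (Or.inl ⟨hab.2, hab.1, C.lie_X_X a ha b hb hab.1⟩)
  · exact Or.inr (Or.inr ⟨hab.ge, C.lie_X_X_zero a ha b hb hab.ge⟩)
  · exact Or.inr (Or.inr ⟨by omega, C.lie_X_X_zero a ha b hb (by omega)⟩)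

/-- Both sides are bilinear, so the spanning vectors suffice. There λ₁ preserves the scalar
products, hence the case distinction for brackets, and `strC_lamQ` gives equal constants. -/
theorem autLin_lie (x y : g) : C.autLin ⁅x, y⁆ = ⁅C.autLin x, C.autLin y⁆ := by
  have hdot : ∀ a u, cx (rv (lamQ a)) ⬝ᵥ lam ℂ u = cx (rv a) ⬝ᵥ u := fun a u => by
    rw [← lam_rv, ← cx_lam, lam_dot_lam_complex]
  have hhX : ∀ u a, C.autLin ⁅h u, X a⁆ = ⁅C.autLin (h u), C.autLin (X a)⁆ := fun u a => by
    rw [C.lie_h_X, map_smul, C.autLin_h, C.autLin_X, C.lie_h_X, hdot]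
  let B₁ : g →ₗ[ℂ] g →ₗ[ℂ] g := (LieModule.toEnd ℂ g g : g →ₗ[ℂ] Module.End ℂ g).compr₂ C.autLin
  let B₂ : g →ₗ[ℂ] g →ₗ[ℂ] g :=
    (LieModule.toEnd ℂ g g : g →ₗ[ℂ] Module.End ℂ g).compl₁₂ C.autLin C.autLin
  have : B₁ = B₂ := by
    refine C.hom_ext (fun u => C.hom_ext (fun v => ?_) fun b _ => ?_)
      fun a ha => C.hom_ext (fun u => ?_) fun b hb => ?_
    · change C.autLin ⁅h u, h v⁆ = ⁅C.autLin (h u), C.autLin (h v)⁆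
      rw [C.lie_h_h, map_zero, C.autLin_h, C.autLin_h, C.lie_h_h]
    · exact hhX u b
    · change C.autLin ⁅X a, h u⁆ = ⁅C.autLin (X a), C.autLin (h u)⁆
      rw [← lie_skew, map_neg, hhX, lie_skew]
    · change C.autLin ⁅X a, X b⁆ = ⁅C.autLin (X a), C.autLin (X b)⁆
      rw [C.autLin_X, C.autLin_X]
      rcases C.lie_X_cases ha hb with ⟨h1, h2⟩ | ⟨-, h1, h2⟩ | ⟨h1, h2⟩
      · rw [h2, eq_neg_of_add_eq_zero_right h1, lamQ_neg, C.lie_X_neg _ (lamQ_mem ha), C.autLin_h,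
          cx_lam, lam_rv]
      · rw [h2, map_smul, C.autLin_X, C.lie_X_X _ (lamQ_mem ha) _ (lamQ_mem hb)
          (by rw [pr_lamQ, h1]), strC_lamQ, lamQ_add]
      · rw [h2, map_zero, C.lie_X_X_zero _ (lamQ_mem ha) _ (lamQ_mem hb) (by rw [pr_lamQ]; exact h1)]
  exact LinearMap.congr_fun₂ this x y

/-- The automorphism `λ₁`. -/
noncomputable def aut : g ≃ₗ⁅ℂ⁆ g where
  __ := C.autLin
  map_lie' := C.autLin_lie _ _
  invFun x := C.autLin (C.autLin x)
  left_inv x := C.autLin_autLin_autLin x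
  right_inv x := C.autLin_autLin_autLin x

theorem aut_h (u : Fin 7 → ℂ) : C.aut (h u) = h (lam ℂ u) := C.autLin_h u

theorem aut_X (a : Q) : C.aut (X a) = X (lamQ a) := C.autLin_X a

theorem aut_aut_aut (x : g) : C.aut (C.aut (C.aut x)) = x := C.autLin_autLin_autLin x

theorem exists_aut_ne : ∃ x, C.aut x ≠ x := by
  refine ⟨h (cx (rv (sQ 0))), fun h1 => ?_⟩
  rw [C.aut_h, cx_lam, lam_rv, ← sub_eq_zero, ← map_sub] at h1
  have h2 := C.h_injective _ (Submodule.sub_mem _ (cx_rv_mem _) (cx_rv_mem _)) h1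
  have h3 : rv (lamQ (sQ 0)) = rv (sQ 0) := by
    funext i
    have := congrFun (sub_eq_zero.mp h2) i
    exact Complex.ofReal_injective this
  exact absurd (rv_injective h3) (by decide)

end Chev

/-! ### The root vectors as a function on `ℝ⁷` -/

open Classical in
/-- The root vector of a vector in `ℝ⁷`. -/
noncomputable def rootVec (X : Q → g) (v : Fin 7 → ℝ) : g :=
  if hv : ∃ a, rv a = v then X hv.choose else 0

omit [LieAlgebra ℂ g] in
theorem rootVec_rv (X : Q → g) (a : Q) : rootVec X (rv a) = X a := by
  have hv : ∃ b, rv b = rv a := ⟨a, rfl⟩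
  rw [rootVec, dif_pos hv, rv_injective hv.choose_spec]

omit [LieAlgebra ℂ g] in
theorem rootVec_image (X : Q → g) : rootVec X '' roots = Set.range fun a : RT => X a := by
  rw [roots_eq, Set.image_image]
  ext x
  constructor
  · rintro ⟨a, ha, rfl⟩; exact ⟨⟨a, ha⟩, (rootVec_rv X a).symm⟩
  · rintro ⟨a, rfl⟩; exact ⟨a, a.2, rootVec_rv X a⟩

theorem Chev.rootVec_lam (C : Chev h X) (v : Fin 7 → ℝ) :
    C.aut (rootVec X v) = rootVec X (lam ℝ v) := by
  by_cases hv : ∃ a, rv a = v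
  · obtain ⟨a, rfl⟩ := hv
    rw [lam_rv, rootVec_rv, rootVec_rv, C.aut_X]
  · have : ¬∃ a, rv a = lam ℝ v := fun ⟨a, ha⟩ => hv ⟨lamQ (lamQ a), by
      rw [← lam_rv, ← lam_rv, ha, lam_surjective_on]⟩
    rw [rootVec, rootVec, dif_neg hv, dif_neg this, map_zero]

theorem Chev.isChevalleyBasis (C : Chev h X) : IsChevalleyBasis h (rootVec X) where
  h_injective := C.h_injective
  h_degenerate := C.degenerate
  isCartan := C.isCartan
  E_of_not_root v hv := by
    by_cases h1 : ∃ a, rv a = v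
    · obtain ⟨a, rfl⟩ := h1
      rw [rootVec_rv, C.X_eq_zero]
      rwa [rv_mem_roots] at hv
    · rw [rootVec, dif_neg h1]
  linearIndependent := by
    let f : RT ≃ roots := Equiv.ofBijective (fun a => ⟨rv a, rv_mem_roots.mpr a.2⟩)
      ⟨fun a b hab => Subtype.ext (rv_injective (congrArg Subtype.val hab)), fun ⟨v, hv⟩ => by
        rw [roots_eq] at hv
        obtain ⟨a, ha, rfl⟩ := hv
        exact ⟨⟨a, ha⟩, rfl⟩⟩
    rw [← linearIndependent_equiv f]
    have : ((fun a : roots => rootVec X a) ∘ f) = fun a : RT => X a := by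
      funext a
      exact rootVec_rv X a
    rw [this]
    exact C.linearIndependent_X
  isCompl := by rw [rootVec_image]; exact C.isCompl
  lie_h_h := C.lie_h_h
  lie_h_E u v hv := by
    rw [roots_eq] at hv
    obtain ⟨a, -, rfl⟩ := hv
    rw [rootVec_rv, C.lie_h_X]
  lie_E_neg v hv := by
    rw [roots_eq] at hv
    obtain ⟨a, ha, rfl⟩ := hv
    rw [← rv_neg, rootVec_rv, rootVec_rv, C.lie_X_neg a ha]
  lie_E_E v hv w hw hvw := by
    rw [roots_eq] at hv hw
    obtain ⟨a, ha, rfl⟩ := hv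
    obtain ⟨b, hb, rfl⟩ := hw
    rw [← rv_add] at hvw ⊢
    rw [rootVec_rv, rootVec_rv, rootVec_rv, C.lie_X_X a ha b hb
      (pr_eq_of_add_mem ha hb (rv_mem_roots.mp hvw))]
    rcases strC_eq a b with h1 | h1 <;> rw [h1] <;> simp
  lie_E_E_zero v hv w hw hvw hvw' := by
    rw [roots_eq] at hv hw
    obtain ⟨a, ha, rfl⟩ := hv
    obtain ⟨b, hb, rfl⟩ := hw
    rw [← rv_add] at hvw hvw'
    rw [rootVec_rv, rootVec_rv]
    rcases C.lie_X_cases ha hb with ⟨h1, -⟩ | ⟨h1, -, -⟩ | ⟨-, h1⟩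
    · rw [h1, rv_zero] at hvw; exact absurd rfl hvw
    · exact absurd (rv_mem_roots.mpr h1) hvw'
    · exact h1

end E6GS



namespace E6GS

/-! ### The grading -/

theorem ω_isPrimitiveRoot : IsPrimitiveRoot ω 3 := by
  have := Complex.isPrimitiveRoot_exp 3 (by norm_num)
  rwa [Nat.cast_ofNat] at this

theorem ω_pow_three : ω ^ 3 = 1 := ω_isPrimitiveRoot.pow_eq_one

theorem one_add_ω : 1 + ω + ω ^ 2 = 0 := by
  have h := ω_isPrimitiveRoot.geom_sum_eq_zero (by norm_num)
  simpa [Finset.sum_range_succ] using h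

/-- The character `k ↦ ω^k` of `ℤ/3`. -/
noncomputable def chi (k : ZMod 3) : ℂ := ω ^ k.val

theorem chi_add (k l : ZMod 3) : chi (k + l) = chi k * chi l := by
  have h := pow_mod_orderOf ω (k.val + l.val)
  rw [← ω_isPrimitiveRoot.eq_orderOf] at h
  rw [chi, chi, chi, ← pow_add, ZMod.val_add, h]

theorem chi_zero : chi 0 = 1 := by simp [chi]

theorem chi_pow_three (k : ZMod 3) : chi k ^ 3 = 1 := by
  rw [chi, ← pow_mul, mul_comm, pow_mul, ω_pow_three, one_pow]

theorem chi_injective : Function.Injective chi := fun k l h =>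
  ZMod.val_injective 3 (ω_isPrimitiveRoot.pow_inj (ZMod.val_lt k) (ZMod.val_lt l) h)

theorem one_add_chi {k : ZMod 3} (hk : k ≠ 0) : 1 + chi k + chi k ^ 2 = 0 := by
  have h1 : chi k - 1 ≠ 0 := fun h => hk (chi_injective (by rw [chi_zero]; linear_combination h))
  have h2 : (chi k - 1) * (1 + chi k + chi k ^ 2) = 0 := by
    linear_combination chi_pow_three k
  exact (mul_eq_zero.mp h2).resolve_left h1

theorem chi_inv (k : ZMod 3) : (chi k)⁻¹ = chi k ^ 2 := by
  refine (eq_inv_of_mul_eq_one_left ?_).symm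
  linear_combination chi_pow_three k

theorem inv_sqrt_three_mul_self : (1 / (√3 : ℂ)) * (1 / (√3 : ℂ)) = 1 / 3 := by
  have h : (√3 : ℝ) * √3 = 3 := Real.mul_self_sqrt (by norm_num)
  have h2 : ((√3 : ℝ) : ℂ) * √3 = 3 := by exact_mod_cast congrArg (fun x : ℝ => (x : ℂ)) h
  rw [div_mul_div_comm, h2, one_mul]

theorem one_div_sqrt_three_ne_zero : (1 / (√3 : ℂ)) ≠ 0 := by
  intro h
  have := inv_sqrt_three_mul_self
  rw [h] at this
  norm_num at this

variable {g : Type*} [LieRing g] [LieAlgebra ℂ g]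

/-- The Killing form as a bilinear map. -/
noncomputable def formB : g →ₗ[ℂ] g →ₗ[ℂ] ℂ := (1 / 24 : ℂ) • killingForm ℂ g

theorem formB_apply (x y : g) : formB x y = form x y := rfl

theorem mem_grade {Λ : g ≃ₗ⁅ℂ⁆ g} {k : ZMod 3} {x : g} : x ∈ grade Λ k ↔ Λ x = chi k • x := Iff.rfl

theorem mem_grade_zero {Λ : g ≃ₗ⁅ℂ⁆ g} {x : g} : x ∈ grade Λ 0 ↔ Λ x = x := by
  rw [mem_grade, chi_zero, one_smul]

theorem fixedSubalgebra_toSubmodule (Λ : g ≃ₗ⁅ℂ⁆ g) :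
    (fixedSubalgebra Λ).toSubmodule = grade Λ 0 := by
  ext x
  exact mem_grade_zero.symm

theorem lie_mem_grade {Λ : g ≃ₗ⁅ℂ⁆ g} {k l : ZMod 3} {x y : g} (hx : x ∈ grade Λ k)
    (hy : y ∈ grade Λ l) : ⁅x, y⁆ ∈ grade Λ (k + l) := by
  rw [mem_grade] at *
  rw [LieEquiv.map_lie, hx, hy, smul_lie, lie_smul, smul_smul, chi_add]

/-- The Killing form is invariant under automorphisms, while Λ multiplies this value by ω^(k+l) ≠ 1.
-/
theorem form_eq_zero_of_grade {Λ : g ≃ₗ⁅ℂ⁆ g} {k l : ZMod 3} (hkl : k + l ≠ 0) {x y : g}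
    (hx : x ∈ grade Λ k) (hy : y ∈ grade Λ l) : form x y = 0 := by
  rw [mem_grade] at *
  have h1 : form (Λ x) (Λ y) = form x y := by
    rw [form, form, LieAlgebra.killingForm_of_equiv_apply]
  rw [hx, hy, Chev.form_smul_left, Chev.form_smul_right, ← mul_assoc, ← chi_add] at h1
  have h2 : chi (k + l) - 1 ≠ 0 := fun h => hkl (chi_injective (by
    rw [chi_zero]; linear_combination h))
  have h3 : (chi (k + l) - 1) * form x y = 0 := by linear_combination h1
  exact (mul_eq_zero.mp h3).resolve_left h2

theorem iSupIndep_grade (Λ : g ≃ₗ⁅ℂ⁆ g) : iSupIndep (grade Λ) := by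
  have h := (Module.End.eigenspaces_iSupIndep (Λ : g →ₗ[ℂ] g)).comp chi_injective
  convert h using 1
  funext k
  ext x
  exact Module.End.mem_eigenspace_iff.symm

/-- A subspace that is stable under an automorphism of order three is the sum of its
homogeneous components. -/
theorem iSup_inf_grade {Λ : g ≃ₗ⁅ℂ⁆ g} (hΛ : ∀ x, Λ (Λ (Λ x)) = x) {S : Submodule ℂ g}
    (hS : ∀ x ∈ S, Λ x ∈ S) : ⨆ k, S ⊓ grade Λ k = S := by
  refine le_antisymm (iSup_le fun k => inf_le_left) fun x hx => ?_
  -- These are the Fourier projections, with `chi k ^ 2` in the role of the inverse of `chi k`;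
  -- their sum over k is x because 1 + ω + ω² = 0.
  have key : ∀ k, (1 / 3 : ℂ) • (x + chi k ^ 2 • Λ x + chi k • Λ (Λ x)) ∈ S ⊓ grade Λ k := by
    intro k
    refine ⟨S.smul_mem _ (S.add_mem (S.add_mem hx (S.smul_mem _ (hS _ hx)))
      (S.smul_mem _ (hS _ (hS _ hx)))), ?_⟩
    rw [SetLike.mem_coe, mem_grade]
    simp only [map_smul, map_add, hΛ]
    have h3 := chi_pow_three k
    linear_combination (norm := module) (-(1 / 3 : ℂ) * h3) • Λ x
  have h0 := key 0
  have h1 := key 1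
  have h2 := key 2
  have e1 : chi 1 = ω := by simp [chi, ZMod.val_one]
  have e2 : chi 2 = ω ^ 2 := rfl
  have h4 := one_add_ω
  have h5 : ω ^ 4 = ω := by linear_combination ω * ω_pow_three
  have hsum : x = (1 / 3 : ℂ) • (x + chi 0 ^ 2 • Λ x + chi 0 • Λ (Λ x)) +
      (1 / 3 : ℂ) • (x + chi 1 ^ 2 • Λ x + chi 1 • Λ (Λ x)) +
      (1 / 3 : ℂ) • (x + chi 2 ^ 2 • Λ x + chi 2 • Λ (Λ x)) := by
    rw [chi_zero, e1, e2, ← pow_mul, h5]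
    linear_combination (norm := module) (-(1 / 3 : ℂ) * h4) • Λ x + (-(1 / 3 : ℂ) * h4) • Λ (Λ x)
  rw [hsum]
  exact Submodule.add_mem _ (Submodule.add_mem _ (Submodule.mem_iSup_of_mem 0 h0)
    (Submodule.mem_iSup_of_mem 1 h1)) (Submodule.mem_iSup_of_mem 2 h2)

theorem isInternal_grade {Λ : g ≃ₗ⁅ℂ⁆ g} (hΛ : ∀ x, Λ (Λ (Λ x)) = x) :
    DirectSum.IsInternal (grade Λ) := by
  rw [DirectSum.isInternal_submodule_iff_iSupIndep_and_iSup_eq_top]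
  refine ⟨iSupIndep_grade Λ, ?_⟩
  have := iSup_inf_grade hΛ (S := ⊤) fun _ _ => trivial
  simpa only [top_inf_eq] using this

theorem disjoint_grade (Λ : g ≃ₗ⁅ℂ⁆ g) : Disjoint (grade Λ 0) (grade Λ 1) ∧
    Disjoint (grade Λ 0 ⊔ grade Λ 1) (grade Λ 2) := by
  have h := iSupIndep_grade Λ
  refine ⟨h.pairwiseDisjoint (by decide), ?_⟩
  have h2 := (h 2).symm
  refine h2.mono_left (sup_le ?_ ?_)
  · exact le_iSup₂_of_le 0 (by decide) le_rfl
  · exact le_iSup₂_of_le 1 (by decide) le_rfl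

/-! ### The orbit sums -/

/-- A linear combination of the root vectors in an orbit of `λ₁`. -/
noncomputable def orb (X : Q → g) (z : ℂ) (a : Q) : g :=
  X a + z • X (lamQ a) + z ^ 2 • X (lamQ (lamQ a))

theorem t_rv (X : Q → g) (k : ZMod 3) (a : Q) :
    t (rootVec X) k (rv a) = (1 / (√3 : ℂ)) • orb X (chi k)⁻¹ a := by
  have h : ω ^ (2 * k.val) = chi k ^ 2 := by rw [chi, ← pow_mul, mul_comm]
  rw [t, orb, lam_rv, lam_rv, rootVec_rv, rootVec_rv, rootVec_rv, h, inv_pow]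
  rfl

theorem E0_rv (X : Q → g) (a : Q) : E0 (rootVec X) (rv a) = orb X 1 a := by
  rw [E0, orb, lam_rv, lam_rv, rootVec_rv, rootVec_rv, rootVec_rv, one_pow, one_smul, one_smul]

set_option synthInstance.maxSize 1000 in
set_option synthInstance.maxHeartbeats 200000 in
theorem orbit_distinct : ∀ a ∈ repList ++ spinList, ∀ b ∈ repList ++ spinList, b ≠ -a →
    a + b ≠ 0 ∧ a + lamQ b ≠ 0 ∧ a + lamQ (lamQ b) ≠ 0 ∧ lamQ a + b ≠ 0 ∧
      lamQ (lamQ a) + b ≠ 0 := by decide +kernel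

set_option synthInstance.maxSize 1000 in
set_option synthInstance.maxHeartbeats 200000 in
theorem orbit_free : ∀ a ∈ repList ++ spinList, a ∈ rootList ∧ lamQ a ≠ a := by decide +kernel

set_option synthInstance.maxSize 1000 in
set_option synthInstance.maxHeartbeats 200000 in
theorem fix_rep_distinct : ∀ a ∈ repList, ∀ b ∈ fixList,
    a + b ≠ 0 ∧ lamQ a + b ≠ 0 ∧ lamQ (lamQ a) + b ≠ 0 := by decide +kernel

set_option synthInstance.maxSize 1000 in
set_option synthInstance.maxHeartbeats 200000 in
theorem fix_mem : ∀ a ∈ fixList, a ∈ rootList ∧ a ∈ so8List ∧ lamQ a = a := by decide +kernel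

theorem rep_mem_so8 : ∀ a ∈ repList, a ∈ so8List := by decide +kernel

set_option synthInstance.maxSize 1000 in
set_option synthInstance.maxHeartbeats 200000 in
theorem so8_mem : ∀ a ∈ so8List, a ∈ rootList ∧ lamQ a ∈ so8List := by decide +kernel

theorem rep_neg : ∀ a ∈ repList, -a ∈ repList := by decide +kernel

theorem fix_neg : ∀ a ∈ fixList, -a ∈ fixList := by decide +kernel

theorem spin_neg : ∀ a ∈ spinList, -a ∈ spinList := by decide +kernel

theorem rep_nodup : repList.Nodup := by decide +kernel

theorem fix_nodup : fixList.Nodup := by decide +kernel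

theorem spin_nodup : spinList.Nodup := by decide +kernel

theorem rep_not_spin : ∀ a ∈ repList, a ∉ spinList := by decide +kernel

namespace Chev

variable {h : (Fin 7 → ℂ) →ₗ[ℂ] g} {X : Q → g} (C : Chev h X)
include C

theorem aut_orb {z : ℂ} (hz : z ^ 3 = 1) (a : Q) : C.aut (orb X z a) = z ^ 2 • orb X z a := by
  simp only [orb, map_add, map_smul, C.aut_X, lamQ_lamQ_lamQ]
  linear_combination (norm := module) (-hz) • X (lamQ a) + (-z * hz) • X (lamQ (lamQ a))

theorem t_mem_grade (k : ZMod 3) (a : Q) : t (rootVec X) k (rv a) ∈ grade C.aut k := by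
  rw [t_rv]
  refine Submodule.smul_mem _ _ ?_
  rw [mem_grade, C.aut_orb (by rw [inv_pow, chi_pow_three, inv_one]), inv_pow, ← chi_inv, inv_inv]

theorem form_h_orb (u : Fin 7 → ℂ) (z : ℂ) (a : Q) : form (h u) (orb X z a) = 0 := by
  simp only [orb, form_add_right, form_smul_right, C.form_h_X, mul_zero, add_zero]

theorem form_h_t (u : Fin 7 → ℂ) (k : ZMod 3) (a : Q) :
    form (h u) (t (rootVec X) k (rv a)) = 0 := by
  rw [t_rv, form_smul_right, C.form_h_orb, mul_zero]

/-- Only the three pairs of opposite roots contribute, namely 1 + zw + (zw)². -/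
theorem form_orb_neg {z w : ℂ} (hzw : z * w = 1) {a : Q} (ha : a ∈ rootList) (ha' : lamQ a ≠ a) :
    form (orb X z a) (orb X w (-a)) = 3 := by
  have h1 : ∀ b, b ∈ rootList → lamQ b ≠ b → form (X b) (X (lamQ (-b))) = 0 := fun b _ hb =>
    C.form_X_X fun h' => hb (by rw [lamQ_neg, ← sub_eq_add_neg, sub_eq_zero] at h'; exact h'.symm)
  have h2 : ∀ b, b ∈ rootList → lamQ b ≠ b → form (X (lamQ b)) (X (-b)) = 0 := fun b _ hb =>
    C.form_X_X fun h' => hb (by rw [← sub_eq_add_neg, sub_eq_zero] at h'; exact h')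
  have m1 := lamQ_mem ha
  have m2 := lamQ_mem m1
  have n1 : lamQ (lamQ a) ≠ lamQ a := fun h' => ha' (lamQ_injective h')
  have n2 : lamQ (lamQ (lamQ a)) ≠ lamQ (lamQ a) := fun h' => n1 (lamQ_injective h')
  have k1 := h1 a ha ha'
  have k2 := h1 _ m1 n1
  have k3 := h1 _ m2 n2
  have k4 := h2 a ha ha'
  have k5 := h2 _ m1 n1
  have k6 := h2 _ m2 n2
  have k7 := C.form_X_neg ha
  have k8 := C.form_X_neg m1
  have k9 := C.form_X_neg m2
  simp only [lamQ_neg, lamQ_lamQ_lamQ] at k1 k2 k3 k4 k5 k6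
  simp only [orb, form_add_right, form_add_left, form_smul_right, form_smul_left, lamQ_neg, k1, k2,
    k3, k4, k5, k6, k7, k8, k9]
  linear_combination (2 + z * w) * hzw

/-- None of the nine pairs of roots is opposite. Five are covered by `orbit_distinct`, the other
four are λ₁-translates of these. -/
theorem form_orb_eq_zero {z w : ℂ} {a b : Q} (ha : a ∈ repList ++ spinList)
    (hb : b ∈ repList ++ spinList) (hab : b ≠ -a) : form (orb X z a) (orb X w b) = 0 := by
  obtain ⟨h1, h2, h3, h4, h5⟩ := orbit_distinct a ha b hb hab
  have hl : ∀ {c d : Q}, c + d ≠ 0 → lamQ c + lamQ d ≠ 0 := fun {c d} hcd h' => hcd (by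
    rw [← lamQ_add] at h'
    exact lamQ_injective (h'.trans (by decide)))
  have h6 := hl h1
  have h7 := hl h2
  have h8 := hl h4
  have h9 := hl h6
  simp only [orb, form_add_right, form_add_left, form_smul_right, form_smul_left, C.form_X_X h1,
    C.form_X_X h2, C.form_X_X h3, C.form_X_X h4, C.form_X_X h5, C.form_X_X h6, C.form_X_X h7,
    C.form_X_X h8, C.form_X_X h9, mul_zero, add_zero]

theorem form_orb_fix {z : ℂ} {a b : Q} (ha : a ∈ repList) (hb : b ∈ fixList) :
    form (orb X z a) (X b) = 0 := by
  obtain ⟨h1, h2, h3⟩ := fix_rep_distinct a ha b hb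
  simp only [orb, form_add_left, form_smul_left, C.form_X_X h1, C.form_X_X h2, C.form_X_X h3,
    mul_zero, add_zero]

theorem form_t_neg {k l : ZMod 3} (hkl : k + l = 0) {a : Q} (ha : a ∈ repList ++ spinList) :
    form (t (rootVec X) k (rv a)) (t (rootVec X) l (rv (-a))) = 1 := by
  obtain ⟨h1, h2⟩ := orbit_free a ha
  rw [t_rv, t_rv, form_smul_left, form_smul_right, C.form_orb_neg _ h1 h2, ← mul_assoc,
    inv_sqrt_three_mul_self]
  · norm_num
  · rw [← mul_inv, ← chi_add, hkl, chi_zero, inv_one]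

theorem form_t_eq_zero (k l : ZMod 3) {a b : Q} (ha : a ∈ repList ++ spinList)
    (hb : b ∈ repList ++ spinList) (hab : b ≠ -a) :
    form (t (rootVec X) k (rv a)) (t (rootVec X) l (rv b)) = 0 := by
  rw [t_rv, t_rv, form_smul_left, form_smul_right, C.form_orb_eq_zero ha hb hab, mul_zero, mul_zero]

omit C in
theorem hα₂_eq (k : ZMod 3) : hα₂ h k = h ((1 / (√3 : ℂ)) •
    (cx (rv (sQ 2)) + chi k • cx (rv (sQ 4)) + chi k ^ 2 • cx (rv (sQ 1)))) := by
  have h1 : ω ^ (2 * k.val) = chi k ^ 2 := by rw [chi, ← pow_mul, mul_comm]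
  rw [hα₂, α_eq, α_eq, α_eq, h1]
  rfl

omit C in
theorem h₅_eq (k : ZMod 3) : h₅ h k = h ((1 / (√3 : ℂ)) •
    (cx (e 5) + chi k • cx (e 6) + chi k ^ 2 • cx (e 7))) := by
  have h1 : ω ^ (2 * k.val) = chi k ^ 2 := by rw [chi, ← pow_mul, mul_comm]
  rw [h₅, h1]
  rfl

omit C in
theorem hα₂_mem_cartan (k : ZMod 3) : (1 / (√3 : ℂ)) •
    (cx (rv (sQ 2)) + chi k • cx (rv (sQ 4)) + chi k ^ 2 • cx (rv (sQ 1))) ∈ cartan ℂ :=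
  Submodule.smul_mem _ _ (Submodule.add_mem _ (Submodule.add_mem _ (cx_rv_mem _)
    (Submodule.smul_mem _ _ (cx_rv_mem _))) (Submodule.smul_mem _ _ (cx_rv_mem _)))

omit C in
theorem h₅_mem_cartan {k : ZMod 3} (hk : k ≠ 0) : (1 / (√3 : ℂ)) •
    (cx (e 5) + chi k • cx (e 6) + chi k ^ 2 • cx (e 7)) ∈ cartan ℂ := by
  refine Submodule.smul_mem _ _ ?_
  change _ + _ + _ = _
  simp [cx, e]
  exact one_add_chi hk

theorem hα₂_mem_grade (k : ZMod 3) : hα₂ h k ∈ grade C.aut k := by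
  rw [mem_grade, hα₂_eq, C.aut_h, ← map_smul]
  congr 1
  rw [map_smul, map_add, map_add, map_smul, map_smul, cx_lam, cx_lam, cx_lam, lam_rv, lam_rv,
    lam_rv, smul_comm]
  congr 1
  have e1 : lamQ (sQ 2) = sQ 1 := by decide
  have e2 : lamQ (sQ 4) = sQ 2 := by decide
  have e3 : lamQ (sQ 1) = sQ 4 := by decide
  rw [e1, e2, e3]
  linear_combination (norm := module) (-chi_pow_three k) • cx (rv (sQ 1))

theorem h₅_mem_grade (k : ZMod 3) : h₅ h k ∈ grade C.aut k := by
  rw [mem_grade, h₅_eq, C.aut_h, ← map_smul]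
  congr 1
  rw [map_smul, map_add, map_add, map_smul, map_smul, cx_lam, cx_lam, cx_lam, smul_comm]
  congr 1
  have e1 : lam ℝ (e 5) = e 7 := by
    funext i; fin_cases i <;> simp [lam, e, Matrix.mulVec, dotProduct, Fin.sum_univ_seven]
  have e2 : lam ℝ (e 6) = e 5 := by
    funext i; fin_cases i <;> simp [lam, e, Matrix.mulVec, dotProduct, Fin.sum_univ_seven]
  have e3 : lam ℝ (e 7) = e 6 := by
    funext i; fin_cases i <;> simp [lam, e, Matrix.mulVec, dotProduct, Fin.sum_univ_seven]
  rw [e1, e2, e3]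
  linear_combination (norm := module) (-chi_pow_three k) • cx (e 7)

theorem form_hα₂_hα₂ {k l : ZMod 3} (hkl : k + l = 0) : form (hα₂ h k) (hα₂ h l) = 2 := by
  have h1 : chi k * chi l = 1 := by rw [← chi_add, hkl, chi_zero]
  rw [hα₂_eq, hα₂_eq, C.form_h_h (hα₂_mem_cartan k) (hα₂_mem_cartan l)]
  simp only [dotProduct_smul, smul_dotProduct, dotProduct_add, add_dotProduct, cx_rv_dot_cx_rv,
    smul_eq_mul]
  have e : pr (sQ 2) (sQ 2) = 2 ∧ pr (sQ 2) (sQ 4) = 0 ∧ pr (sQ 2) (sQ 1) = 0 ∧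
    pr (sQ 4) (sQ 2) = 0 ∧ pr (sQ 4) (sQ 4) = 2 ∧ pr (sQ 4) (sQ 1) = 0 ∧
    pr (sQ 1) (sQ 2) = 0 ∧ pr (sQ 1) (sQ 4) = 0 ∧ pr (sQ 1) (sQ 1) = 2 := by decide
  obtain ⟨e1, e2, e3, e4, e5, e6, e7, e8, e9⟩ := e
  rw [e1, e2, e3, e4, e5, e6, e7, e8, e9]
  have h3 := inv_sqrt_three_mul_self
  push_cast
  linear_combination (2 / 3 : ℂ) * (2 + chi k * chi l) * h1 +
    2 * (1 + chi k * chi l + chi k ^ 2 * chi l ^ 2) * h3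

theorem form_h₅_h₅ {k l : ZMod 3} (hk : k ≠ 0) (hkl : k + l = 0) : form (h₅ h k) (h₅ h l) = 1 := by
  have h1 : chi k * chi l = 1 := by rw [← chi_add, hkl, chi_zero]
  have hl : l ≠ 0 := by rintro rfl; rw [add_zero] at hkl; exact hk hkl
  rw [h₅_eq, h₅_eq, C.form_h_h (h₅_mem_cartan hk) (h₅_mem_cartan hl), smul_dotProduct,
    dotProduct_smul, smul_eq_mul, smul_eq_mul, ← mul_assoc, inv_sqrt_three_mul_self]
  simp [cx, e, dotProduct, Fin.sum_univ_seven]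
  linear_combination (1 / 3 : ℂ) * (2 + chi k * chi l) * h1

theorem form_hα₂_h₅ (k : ZMod 3) {l : ZMod 3} (hl : l ≠ 0) : form (hα₂ h k) (h₅ h l) = 0 := by
  rw [hα₂_eq, h₅_eq, C.form_h_h (hα₂_mem_cartan k) (h₅_mem_cartan hl)]
  simp [cx, e, dotProduct, Fin.sum_univ_seven, rv, dv, dq, sQ]

end Chev

end E6GS



namespace E6GS

/-! ### The index sets -/

theorem weightsL_apply_four {w : Fin 7 → ℝ} (hw : w ∈ weightsL) : w 4 = 0 := by
  obtain ⟨s, -, rfl⟩ := hw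
  simp [Fin.sum_univ_four, e]

theorem neg_mem_weightsL {w : Fin 7 → ℝ} (hw : w ∈ weightsL) : -w ∈ weightsL := by
  obtain ⟨s, hs, rfl⟩ := hw
  refine ⟨-s, ?_, ?_⟩
  · rw [Fin.prod_univ_four] at *
    simpa using hs
  · simp [Fin.sum_univ_four, sg]

theorem aL_neg (w : Fin 7 → ℝ) (s : ℤˣ) : aL (-w) (-s) = -aL w s := by
  simp only [aL, sg, Units.val_neg]
  push_cast
  module

theorem aL_injective {w v : Fin 7 → ℝ} (hw : w ∈ weightsL) (hv : v ∈ weightsL) {s r : ℤˣ}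
    (h : aL w s = aL v r) : w = v ∧ s = r := by
  have h4 := congrFun h 4
  have h2 : (√2 : ℝ) ≠ 0 := by positivity
  have hs : sg s = sg r := by
    simpa [aL, weightsL_apply_four hw, weightsL_apply_four hv, e] using h4
  refine ⟨?_, ?_⟩
  · simp only [aL, hs] at h
    exact add_right_cancel h
  · refine Units.ext ?_
    unfold sg at hs
    exact_mod_cast hs

theorem exists_spin {w : Fin 7 → ℝ} (hw : w ∈ weightsL) (s : ℤˣ) :
    ∃ a ∈ spinList, rv a = aL w s := (aL_mem_iff _).mp ⟨w, hw, s, rfl⟩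

theorem exists_rep {v : Fin 7 → ℝ} (hv : v ∈ orbitReps) : ∃ a ∈ repList, rv a = v := by
  rw [orbitReps_eq] at hv; exact hv

theorem exists_fix {v : Fin 7 → ℝ} (hv : v ∈ fixedRoots) : ∃ a ∈ fixList, rv a = v := by
  rw [fixedRoots_eq] at hv; exact hv

instance : Finite orbitReps := by
  rw [orbitReps_eq]; exact (Set.Finite.image _ (List.finite_toSet repList)).to_subtype

instance : Finite fixedRoots := by
  rw [fixedRoots_eq]; exact (Set.Finite.image _ (List.finite_toSet fixList)).to_subtype

theorem range_aL : Set.range (fun p : weightsL × ℤˣ => aL p.1 p.2) = rv '' {a | a ∈ spinList} := by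
  ext v
  rw [Set.mem_image]
  refine Iff.trans ?_ (aL_mem_iff v)
  constructor
  · rintro ⟨⟨⟨w, hw⟩, s⟩, rfl⟩; exact ⟨w, hw, s, rfl⟩
  · rintro ⟨w, hw, s, rfl⟩; exact ⟨⟨⟨w, hw⟩, s⟩, rfl⟩

theorem aL_pair_injective : Function.Injective fun p : weightsL × ℤˣ => aL p.1 p.2 := by
  rintro ⟨⟨w, hw⟩, s⟩ ⟨⟨v, hv⟩, r⟩ h
  obtain ⟨rfl, rfl⟩ := aL_injective hw hv h
  rfl

instance : Finite (weightsL × ℤˣ) := by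
  have : Finite (Set.range fun p : weightsL × ℤˣ => aL p.1 p.2) := by
    rw [range_aL]; exact (Set.Finite.image _ (List.finite_toSet spinList)).to_subtype
  exact Finite.of_injective (fun p => (⟨aL p.1 p.2, p, rfl⟩ :
    Set.range fun p : weightsL × ℤˣ => aL p.1 p.2)) fun p q h =>
      aL_pair_injective (congrArg Subtype.val h)

noncomputable instance : Fintype orbitReps := Fintype.ofFinite _

noncomputable instance : Fintype fixedRoots := Fintype.ofFinite _

noncomputable instance : Fintype (weightsL × ℤˣ) := Fintype.ofFinite _

theorem card_orbitReps : Fintype.card orbitReps = 6 := by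
  rw [← Nat.card_eq_fintype_card, Nat.card_coe_set_eq, orbitReps_eq, ncard_image_rv rep_nodup]
  rfl

theorem card_fixedRoots : Fintype.card fixedRoots = 6 := by
  rw [← Nat.card_eq_fintype_card, Nat.card_coe_set_eq, fixedRoots_eq, ncard_image_rv fix_nodup]
  decide +kernel

theorem card_weightsL : Fintype.card (weightsL × ℤˣ) = 16 := by
  rw [← Nat.card_eq_fintype_card, ← Nat.card_range_of_injective aL_pair_injective,
    Nat.card_coe_set_eq, range_aL, ncard_image_rv spin_nodup]
  decide +kernel

/-! ### The subalgebra `so(8)` -/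

variable {g : Type*} [LieRing g] [LieAlgebra ℂ g]

theorem so8List_neg : ∀ a ∈ so8List, -a ∈ so8List := by decide +kernel

set_option synthInstance.maxSize 1000 in
set_option synthInstance.maxHeartbeats 200000 in
theorem mem_so8List_iff : ∀ a ∈ rootList, a ∈ so8List ↔ a.1 = 0 ∧ a.2.2.2.2.2 = 0 := by
  decide +kernel

theorem cx_smul (c : ℝ) (u : Fin 7 → ℝ) : cx (c • u) = (c : ℂ) • cx u := by
  funext i; simp [cx]

namespace Chev

variable {h : (Fin 7 → ℂ) →ₗ[ℂ] g} {X : Q → g} (C : Chev h X)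
include C

theorem finiteDimensional : FiniteDimensional ℂ g := Module.Basis.finiteDimensional_of_finite C.basis

omit C in
theorem X_mem_so8 {a : Q} (ha : a ∈ so8List) : X a ∈ so8 (rootVec X) :=
  LieSubalgebra.subset_lieSpan ⟨rv a, by rw [rootsSO8_eq]; exact ⟨a, ha, rfl⟩, rootVec_rv X a⟩

theorem h_mem_so8 {a : Q} (ha : a ∈ so8List) : h (cx (rv a)) ∈ so8 (rootVec X) := by
  rw [← C.lie_X_neg a (so8_mem a ha).1]
  exact LieSubalgebra.lie_mem _ (X_mem_so8 ha) (X_mem_so8 (so8List_neg a ha))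

omit C in
/-- Generators of the vector space `so(8)`. -/
theorem h_mem_span_so8 {u : Fin 7 → ℂ} (h4 : u 4 = 0) (h5 : u 5 = 0) (h6 : u 6 = 0) :
    h u ∈ Submodule.span ℂ (Set.range (fun i : Fin 4 => h (cx (e (i + 1)))) ∪
      X '' {a | a ∈ so8List}) := by
  have hu : u = u 0 • cx (e 1) + u 1 • cx (e 2) + u 2 • cx (e 3) + u 3 • cx (e 4) := by
    funext i
    fin_cases i <;> simp [cx, e, h4, h5, h6]
  have hm : ∀ i : Fin 4, h (cx (e (i + 1))) ∈ Submodule.span ℂ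
      (Set.range (fun i : Fin 4 => h (cx (e (i + 1)))) ∪ X '' {a | a ∈ so8List}) := fun i =>
    Submodule.subset_span (Or.inl ⟨i, rfl⟩)
  rw [hu]
  simp only [map_add, map_smul]
  exact Submodule.add_mem _ (Submodule.add_mem _ (Submodule.add_mem _
    (Submodule.smul_mem _ _ (hm 0)) (Submodule.smul_mem _ _ (hm 1)))
    (Submodule.smul_mem _ _ (hm 2))) (Submodule.smul_mem _ _ (hm 3))

omit C in
theorem so8List_rv {a : Q} (ha : a ∈ so8List) : rv a 4 = 0 ∧ rv a 5 = 0 ∧ rv a 6 = 0 := by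
  obtain ⟨h0, h5⟩ := (mem_so8List_iff a (so8_mem a ha).1).mp ha
  obtain ⟨a0, a1, a2, a3, a4, a5⟩ := a
  simp only at h0 h5
  subst h0 h5
  refine ⟨?_, ?_, ?_⟩ <;> simp [rv, dv, dq]

theorem so8_le : (so8 (rootVec X)).toSubmodule ≤
    Submodule.span ℂ (Set.range (fun i : Fin 4 => h (cx (e (i + 1)))) ∪ X '' {a | a ∈ so8List}) := by
  set N := Submodule.span ℂ (Set.range (fun i : Fin 4 => h (cx (e (i + 1)))) ∪
    X '' {a | a ∈ so8List}) with hN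
  have hX : ∀ {a}, a ∈ so8List → X a ∈ N := fun ha => Submodule.subset_span (Or.inr ⟨_, ha, rfl⟩)
  let S := lieSubalgebraOfSpan (Set.range (fun i : Fin 4 => h (cx (e (i + 1)))) ∪
      X '' {a | a ∈ so8List}) (by
    rw [← hN]
    rintro _ (⟨i, rfl⟩ | ⟨a, ha, rfl⟩) _ (⟨j, rfl⟩ | ⟨b, hb, rfl⟩)
    · rw [C.lie_h_h]; exact zero_mem _
    · rw [C.lie_h_X]; exact Submodule.smul_mem _ _ (hX hb)
    · rw [← lie_skew, C.lie_h_X]; exact Submodule.neg_mem _ (Submodule.smul_mem _ _ (hX ha))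
    · have ha' := (so8_mem a ha).1
      have hb' := (so8_mem b hb).1
      rcases C.lie_X_cases ha' hb' with ⟨-, h2⟩ | ⟨h1, -, h2⟩ | ⟨-, h2⟩
      · rw [h2]
        obtain ⟨h4, h5, h6⟩ := so8List_rv ha
        exact h_mem_span_so8 (by simp [cx, h4]) (by simp [cx, h5]) (by simp [cx, h6])
      · rw [h2]
        refine Submodule.smul_mem _ _ (hX ((mem_so8List_iff _ h1).mpr ?_))
        obtain ⟨k1, k2⟩ := (mem_so8List_iff a ha').mp ha
        obtain ⟨k3, k4⟩ := (mem_so8List_iff b hb').mp hb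
        simp [k1, k2, k3, k4]
      · rw [h2]; exact zero_mem _)
  have : so8 (rootVec X) ≤ S := by
    rw [so8, LieSubalgebra.lieSpan_le]
    rintro _ ⟨v, hv, rfl⟩
    rw [rootsSO8_eq] at hv
    obtain ⟨a, ha, rfl⟩ := hv
    rw [rootVec_rv]
    exact hX ha
  exact this

/-- Only the bound by the number of spanning vectors is needed here; equality follows in
`so8_decomposition` from 28 independent vectors. -/
theorem finrank_so8_le : Module.finrank ℂ (so8 (rootVec X)) ≤ 28 := by
  classical
  have := C.finiteDimensional
  refine (Submodule.finrank_mono C.so8_le).trans ?_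
  have hs : Set.range (fun i : Fin 4 => h (cx (e (i + 1)))) ∪ X '' {a | a ∈ so8List} =
      ((Finset.univ.image fun i : Fin 4 => h (cx (e (i + 1)))) ∪ so8List.toFinset.image X :
        Finset g) := by
    ext x; simp
  rw [hs]
  refine (finrank_span_finset_le_card _).trans ((Finset.card_union_le _ _).trans ?_)
  have h1 : (Finset.univ.image fun i : Fin 4 => h (cx (e (i + 1)))).card ≤ 4 :=
    Finset.card_image_le.trans (by simp)
  have h2 : (so8List.toFinset.image X).card ≤ 24 :=
    Finset.card_image_le.trans ((List.toFinset_card_le _).trans (by decide +kernel))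
  omega

theorem aut_mem_so8 (x : g) (hx : x ∈ so8 (rootVec X)) : C.aut x ∈ so8 (rootVec X) := by
  have : so8 (rootVec X) ≤ (so8 (rootVec X)).comap C.aut.toLieHom := by
    conv_lhs => rw [so8]
    rw [LieSubalgebra.lieSpan_le]
    rintro _ ⟨v, hv, rfl⟩
    rw [rootsSO8_eq] at hv
    obtain ⟨a, ha, rfl⟩ := hv
    change C.aut (rootVec X (rv a)) ∈ so8 (rootVec X)
    rw [rootVec_rv, C.aut_X]
    exact X_mem_so8 (so8_mem a ha).2
  exact this hx

/-- so(8) is orthogonal to the Cartan elements whose first four coordinates vanish; pairing with e₅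
- e₆ and e₆ - e₇ determines the last three coordinates of u. -/
theorem so8_of_h_mem {u : Fin 7 → ℂ} (hu : u ∈ cartan ℂ) (hs : h u ∈ so8 (rootVec X)) :
    u 4 = 0 ∧ u 5 = 0 ∧ u 6 = 0 := by
  have key : ∀ v ∈ cartan ℂ, v 0 = 0 → v 1 = 0 → v 2 = 0 → v 3 = 0 → v ⬝ᵥ u = 0 := by
    intro v hv h0 h1 h2 h3
    rw [← C.form_h_h hv hu]
    have hle : (so8 (rootVec X)).toSubmodule ≤ LinearMap.ker (formB (h v)) := by
      refine C.so8_le.trans (Submodule.span_le.mpr ?_)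
      rintro _ (⟨i, rfl⟩ | ⟨a, -, rfl⟩)
      · have hi : cx (e (i + 1)) ∈ cartan ℂ := by
          change _ + _ + _ = _
          fin_cases i <;> simp [cx, e]
        change form _ _ = 0
        rw [C.form_h_h hv hi]
        fin_cases i <;> simp [cx, e, dotProduct, Fin.sum_univ_seven, h0, h1, h2, h3]
      · exact C.form_h_X v a
    exact hle hs
  have hu' : u 4 + u 5 + u 6 = 0 := hu
  have k1 := key (cx (e 5 - e 6)) (by change _ + _ + _ = _; simp [cx, e]) (by simp [cx, e])
    (by simp [cx, e]) (by simp [cx, e]) (by simp [cx, e])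
  have k2 := key (cx (e 6 - e 7)) (by change _ + _ + _ = _; simp [cx, e]) (by simp [cx, e])
    (by simp [cx, e]) (by simp [cx, e]) (by simp [cx, e])
  simp [cx, e, dotProduct, Fin.sum_univ_seven] at k1 k2
  refine ⟨?_, ?_, ?_⟩
  · linear_combination (hu' + 2 * k1 + k2) / 3
  · linear_combination (hu' - k1 + k2) / 3
  · linear_combination (hu' - k1 - 2 * k2) / 3

theorem h_mem_so8Fixed_iff {u : Fin 7 → ℂ} (hu : u ∈ cartan ℂ) :
    h u ∈ so8Fixed (rootVec X) C.aut ↔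
      u 0 = u 1 + u 2 ∧ u 3 = 0 ∧ u 4 = 0 ∧ u 5 = 0 ∧ u 6 = 0 := by
  constructor
  · rintro ⟨hs, hf⟩
    obtain ⟨h4, h5, h6⟩ := C.so8_of_h_mem hu hs
    have hf' : C.aut (h u) = h u := hf
    rw [C.aut_h, ← sub_eq_zero, ← map_sub] at hf'
    have h0 := C.h_injective _ (Submodule.sub_mem _ (lam_apply_cartan hu) hu) hf'
    have k1 := congrFun h0 0
    have k3 := congrFun h0 3
    simp [lam, Matrix.mulVec, dotProduct, Fin.sum_univ_seven] at k1 k3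
    refine ⟨?_, ?_, h4, h5, h6⟩
    · linear_combination -2 * k1 + (k1 - k3) / 2
    · linear_combination (k1 - k3) / 2
  · rintro ⟨h0, h3, h4, h5, h6⟩
    obtain ⟨-, -, -, -, -, -, -, -, -, -, hb, ha⟩ := e_sub_eq
    have hu2 : u = u 1 • cx (rv (0,1,1,2,1,0)) + u 2 • cx (rv (0,1,1,1,1,0)) := by
      rw [← ha, ← hb]
      funext i
      fin_cases i <;> simp [cx, e, h0, h3, h4, h5, h6]
    have m1 : ∀ a ∈ fixList, h (cx (rv a)) ∈ so8Fixed (rootVec X) C.aut := by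
      intro a ha
      refine ⟨C.h_mem_so8 (fix_mem a ha).2.1, ?_⟩
      change C.aut (h (cx (rv a))) = h (cx (rv a))
      rw [C.aut_h, cx_lam, lam_rv, (fix_mem a ha).2.2]
    rw [hu2, map_add, map_smul, map_smul]
    exact LieSubalgebra.add_mem _ (LieSubalgebra.smul_mem _ _ (m1 _ (by decide +kernel)))
      (LieSubalgebra.smul_mem _ _ (m1 _ (by decide +kernel)))

/-! ### The generalized sine bases -/

omit C in
theorem basisG2_inl (i : Fin 2) : basisG2 h (rootVec X) (.inl i) =
    h (cx (rv (![(0,0,0,3,0,0), (0,1,1,0,1,0)] i))) := by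
  have e1 : ((0,0,0,3,0,0) : Q) = 3 • sQ 3 := by decide
  have e2 : ((0,1,1,0,1,0) : Q) = sQ 2 + sQ 4 + sQ 1 := by decide
  fin_cases i
  · change h (cx ((3 : ℝ) • α 3)) = h (cx (rv (0,0,0,3,0,0)))
    rw [e1, rv_nsmul, α_eq, ← Nat.cast_smul_eq_nsmul ℝ]
    rfl
  · change h (cx (α 2 + α 4 + α 6)) = h (cx (rv (0,1,1,0,1,0)))
    rw [e2, rv_add, rv_add, α_eq, α_eq, α_eq]
    rfl

/-- Linear independence of the bases of `g₂` and `V`. -/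
theorem linearIndependent_zero :
    LinearIndependent ℂ (Sum.elim (basisG2 h (rootVec X)) (basisJ (rootVec X) 0)) := by
  -- The dual family: opposite roots for the root vectors, and for the two coroots the two
  -- λ₁-invariant lattice vectors with pairing matrix 3 times the identity.
  let w : (Fin 2 ⊕ orbitReps ⊕ fixedRoots) ⊕ (weightsL × ℤˣ) → g :=
    Sum.elim (Sum.elim (fun i => h (cx (rv (![(0,1,1,2,1,0), (0,2,2,3,2,0)] i))))
      (Sum.elim (fun a => E0 (rootVec X) (-a)) fun a => rootVec X (-a)))
      fun p => t (rootVec X) 0 (-aL p.1 p.2)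
  have hhh : ∀ i j : Fin 2, pr (![(0,0,0,3,0,0), (0,1,1,0,1,0)] i)
      (![(0,1,1,2,1,0), (0,2,2,3,2,0)] j) = if i = j then 3 else 0 := by decide
  have fix_ne : ∀ a b : Q, b ≠ a → a + -b ≠ 0 := fun a b hab h' => hab (by
    rw [← sub_eq_add_neg, sub_eq_zero] at h'; exact h'.symm)
  have spin_fix : ∀ a ∈ fixList, ∀ b ∈ spinList, a + b ≠ 0 ∧ a + lamQ b ≠ 0 ∧
      a + lamQ (lamQ b) ≠ 0 := by
    intro a ha b hb
    have key : ∀ a ∈ fixList, ∀ b ∈ spinList, a + b ≠ 0 := by decide +kernel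
    have h1 := (fix_mem a ha).2.2
    have h0 : lamQ 0 = 0 := by decide
    refine ⟨key a ha b hb, fun h' => ?_, fun h' => ?_⟩
    · rw [← h1, ← lamQ_add] at h'
      exact key a ha b hb (lamQ_injective (h'.trans h0.symm))
    · have h2 : lamQ (lamQ a) = a := by rw [h1, h1]
      rw [← h2, ← lamQ_add, ← lamQ_add] at h'
      exact key a ha b hb (lamQ_injective ((lamQ_injective (h'.trans h0.symm)).trans h0.symm))
  have form_fix_orb : ∀ a ∈ fixList, ∀ b ∈ repList ++ spinList, ∀ z, form (orb X z b) (X a) = 0 := by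
    intro a ha b hb z
    rcases List.mem_append.mp hb with hb | hb
    · exact C.form_orb_fix hb ha
    · obtain ⟨h1, h2, h3⟩ := spin_fix a ha b hb
      rw [add_comm] at h1 h2 h3
      simp only [orb, form_add_left, form_smul_left, C.form_X_X h1, C.form_X_X h2, C.form_X_X h3,
        mul_zero, add_zero]
  have t0 : ∀ a, t (rootVec X) 0 (rv a) = (1 / (√3 : ℂ)) • orb X 1 a := fun a => by
    rw [t_rv, chi_zero, inv_one]
  have hrs : ∀ {a}, a ∈ repList → a ∈ repList ++ spinList := fun ha => List.mem_append_left _ ha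
  have hss : ∀ {a}, a ∈ spinList → a ∈ repList ++ spinList := fun ha => List.mem_append_right _ ha
  refine linearIndependent_of_dual formB _ w ?_ ?_
  · rintro ((i | ⟨v, hv⟩ | ⟨v, hv⟩) | ⟨⟨v, hv⟩, s⟩) <;> rw [formB_apply]
    · change form (basisG2 h (rootVec X) (.inl i)) (h (cx (rv _))) ≠ 0
      rw [basisG2_inl, C.form_h_h (cx_rv_mem _) (cx_rv_mem _), cx_rv_dot_cx_rv, hhh, if_pos rfl]
      norm_num
    · obtain ⟨a, ha, rfl⟩ := exists_rep hv
      obtain ⟨h1, h2⟩ := orbit_free a (hrs ha)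
      change form (E0 (rootVec X) (rv a)) (E0 (rootVec X) (-rv a)) ≠ 0
      rw [← rv_neg, E0_rv, E0_rv, C.form_orb_neg (one_mul 1) h1 h2]
      norm_num
    · obtain ⟨a, ha, rfl⟩ := exists_fix hv
      change form (rootVec X (rv a)) (rootVec X (-rv a)) ≠ 0
      rw [← rv_neg, rootVec_rv, rootVec_rv, C.form_X_neg (fix_mem a ha).1]
      norm_num
    · obtain ⟨a, ha, ha'⟩ := exists_spin hv s
      change form (t (rootVec X) 0 (aL v s)) (t (rootVec X) 0 (-aL v s)) ≠ 0
      rw [← ha', ← rv_neg, C.form_t_neg (add_zero 0) (hss ha)]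
      norm_num
  · rintro ((i | ⟨v, hv⟩ | ⟨v, hv⟩) | ⟨⟨v, hv⟩, s⟩) ((j | ⟨v', hv'⟩ | ⟨v', hv'⟩) | ⟨⟨v', hv'⟩, s'⟩) hij
      <;> rw [formB_apply]
    · change form (basisG2 h (rootVec X) (.inl i)) (h (cx (rv _))) = 0
      have : i ≠ j := fun h' => hij (by rw [h'])
      rw [basisG2_inl, C.form_h_h (cx_rv_mem _) (cx_rv_mem _), cx_rv_dot_cx_rv, hhh, if_neg this]
      norm_num
    · obtain ⟨b, hb, rfl⟩ := exists_rep hv'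
      change form (basisG2 h (rootVec X) (.inl i)) (E0 (rootVec X) (-rv b)) = 0
      rw [basisG2_inl, ← rv_neg, E0_rv, C.form_h_orb]
    · obtain ⟨b, hb, rfl⟩ := exists_fix hv'
      change form (basisG2 h (rootVec X) (.inl i)) (rootVec X (-rv b)) = 0
      rw [basisG2_inl, ← rv_neg, rootVec_rv, C.form_h_X]
    · obtain ⟨b, hb, hb'⟩ := exists_spin hv' s'
      change form (basisG2 h (rootVec X) (.inl i)) (t (rootVec X) 0 (-aL v' s')) = 0
      rw [basisG2_inl, ← hb', ← rv_neg, C.form_h_t]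
    · obtain ⟨a, ha, rfl⟩ := exists_rep hv
      change form (E0 (rootVec X) (rv a)) (h _) = 0
      rw [E0_rv, form_comm, C.form_h_orb]
    · obtain ⟨a, ha, rfl⟩ := exists_rep hv
      obtain ⟨b, hb, rfl⟩ := exists_rep hv'
      change form (E0 (rootVec X) (rv a)) (E0 (rootVec X) (-rv b)) = 0
      rw [← rv_neg, E0_rv, E0_rv]
      refine C.form_orb_eq_zero (hrs ha) (hrs (rep_neg b hb)) fun h' => hij ?_
      rw [neg_inj] at h'
      subst h'; rfl
    · obtain ⟨a, ha, rfl⟩ := exists_rep hv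
      obtain ⟨b, hb, rfl⟩ := exists_fix hv'
      change form (E0 (rootVec X) (rv a)) (rootVec X (-rv b)) = 0
      rw [← rv_neg, E0_rv, rootVec_rv, form_fix_orb _ (fix_neg b hb) _ (hrs ha)]
    · obtain ⟨a, ha, rfl⟩ := exists_rep hv
      obtain ⟨b, hb, hb'⟩ := exists_spin hv' s'
      change form (E0 (rootVec X) (rv a)) (t (rootVec X) 0 (-aL v' s')) = 0
      rw [← hb', ← rv_neg, E0_rv, t0, form_smul_right, C.form_orb_eq_zero (hrs ha)
        (hss (spin_neg b hb)), mul_zero]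
      intro h'
      rw [neg_inj] at h'
      subst h'
      exact rep_not_spin _ ha hb
    · obtain ⟨a, ha, rfl⟩ := exists_fix hv
      change form (rootVec X (rv a)) (h _) = 0
      rw [rootVec_rv, form_comm, C.form_h_X]
    · obtain ⟨a, ha, rfl⟩ := exists_fix hv
      obtain ⟨b, hb, rfl⟩ := exists_rep hv'
      change form (rootVec X (rv a)) (E0 (rootVec X) (-rv b)) = 0
      rw [← rv_neg, E0_rv, rootVec_rv, form_comm, form_fix_orb _ ha _ (hrs (rep_neg b hb))]
    · obtain ⟨a, ha, rfl⟩ := exists_fix hv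
      obtain ⟨b, hb, rfl⟩ := exists_fix hv'
      change form (rootVec X (rv a)) (rootVec X (-rv b)) = 0
      rw [← rv_neg, rootVec_rv, rootVec_rv]
      refine C.form_X_X (fix_ne a b fun h' => hij ?_)
      subst h'; rfl
    · obtain ⟨a, ha, rfl⟩ := exists_fix hv
      obtain ⟨b, hb, hb'⟩ := exists_spin hv' s'
      change form (rootVec X (rv a)) (t (rootVec X) 0 (-aL v' s')) = 0
      rw [← hb', ← rv_neg, rootVec_rv, t0, form_smul_right, form_comm,
        form_fix_orb _ ha _ (hss (spin_neg b hb)), mul_zero]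
    · obtain ⟨a, ha, ha'⟩ := exists_spin hv s
      change form (t (rootVec X) 0 (aL v s)) (h _) = 0
      rw [← ha', form_comm, C.form_h_t]
    · obtain ⟨a, ha, ha'⟩ := exists_spin hv s
      obtain ⟨b, hb, rfl⟩ := exists_rep hv'
      change form (t (rootVec X) 0 (aL v s)) (E0 (rootVec X) (-rv b)) = 0
      rw [← ha', ← rv_neg, E0_rv, t0, form_smul_left, C.form_orb_eq_zero (hss ha)
        (hrs (rep_neg b hb)), mul_zero]
      intro h'
      rw [neg_inj] at h'
      subst h'
      exact rep_not_spin _ hb ha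
    · obtain ⟨a, ha, ha'⟩ := exists_spin hv s
      obtain ⟨b, hb, rfl⟩ := exists_fix hv'
      change form (t (rootVec X) 0 (aL v s)) (rootVec X (-rv b)) = 0
      rw [← ha', ← rv_neg, rootVec_rv, t0, form_smul_left,
        form_fix_orb _ (fix_neg b hb) _ (hss ha), mul_zero]
    · obtain ⟨a, ha, ha'⟩ := exists_spin hv s
      obtain ⟨b, hb, hb'⟩ := exists_spin hv' s'
      change form (t (rootVec X) 0 (aL v s)) (t (rootVec X) 0 (-aL v' s')) = 0
      rw [← ha', ← hb', ← rv_neg]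
      refine C.form_t_eq_zero 0 0 (hss ha) (hss (spin_neg b hb)) fun h' => hij ?_
      rw [neg_inj] at h'
      subst h'
      obtain ⟨rfl, rfl⟩ := aL_injective hv hv' (ha'.symm.trans hb')
      rfl

/-- The family of degree -k with opposite roots is dual to this one under the Killing form. -/
theorem linearIndependent_basisGrade {k : ZMod 3} (hk : k ≠ 0) :
    LinearIndependent ℂ (basisGrade h (rootVec X) k) := by
  have hk' : -k ≠ 0 := neg_ne_zero.mpr hk
  have hkk : k + -k = 0 := add_neg_cancel k
  let w : (weightsL × ℤˣ) ⊕ Unit ⊕ (Unit ⊕ orbitReps) → g :=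
    Sum.elim (fun p => t (rootVec X) (-k) (-aL p.1 p.2)) (Sum.elim (fun _ => h₅ h (-k))
      (Sum.elim (fun _ => hα₂ h (-k)) fun a => t (rootVec X) (-k) (-a)))
  have hrs : ∀ {a}, a ∈ repList → a ∈ repList ++ spinList := fun ha => List.mem_append_left _ ha
  have hss : ∀ {a}, a ∈ spinList → a ∈ repList ++ spinList := fun ha => List.mem_append_right _ ha
  refine linearIndependent_of_dual formB _ w ?_ ?_
  · rintro (⟨⟨v, hv⟩, s⟩ | _ | _ | ⟨v, hv⟩) <;> rw [formB_apply]
    · obtain ⟨a, ha, ha'⟩ := exists_spin hv s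
      change form (t (rootVec X) k (aL v s)) (t (rootVec X) (-k) (-aL v s)) ≠ 0
      rw [← ha', ← rv_neg, C.form_t_neg hkk (hss ha)]
      norm_num
    · change form (h₅ h k) (h₅ h (-k)) ≠ 0
      rw [C.form_h₅_h₅ hk hkk]
      norm_num
    · change form (hα₂ h k) (hα₂ h (-k)) ≠ 0
      rw [C.form_hα₂_hα₂ hkk]
      norm_num
    · obtain ⟨a, ha, rfl⟩ := exists_rep hv
      change form (t (rootVec X) k (rv a)) (t (rootVec X) (-k) (-rv a)) ≠ 0
      rw [← rv_neg, C.form_t_neg hkk (hrs ha)]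
      norm_num
  · rintro (⟨⟨v, hv⟩, s⟩ | _ | _ | ⟨v, hv⟩) (⟨⟨v', hv'⟩, s'⟩ | _ | _ | ⟨v', hv'⟩) hij <;>
      rw [formB_apply]
    · obtain ⟨a, ha, ha'⟩ := exists_spin hv s
      obtain ⟨b, hb, hb'⟩ := exists_spin hv' s'
      change form (t (rootVec X) k (aL v s)) (t (rootVec X) (-k) (-aL v' s')) = 0
      rw [← ha', ← hb', ← rv_neg]
      refine C.form_t_eq_zero k (-k) (hss ha) (hss (spin_neg b hb)) fun h' => hij ?_
      rw [neg_inj] at h'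
      subst h'
      obtain ⟨rfl, rfl⟩ := aL_injective hv hv' (ha'.symm.trans hb')
      rfl
    · obtain ⟨a, ha, ha'⟩ := exists_spin hv s
      change form (t (rootVec X) k (aL v s)) (h _) = 0
      rw [← ha', form_comm, C.form_h_t]
    · obtain ⟨a, ha, ha'⟩ := exists_spin hv s
      change form (t (rootVec X) k (aL v s)) (h _) = 0
      rw [← ha', form_comm, C.form_h_t]
    · obtain ⟨a, ha, ha'⟩ := exists_spin hv s
      obtain ⟨b, hb, rfl⟩ := exists_rep hv'
      change form (t (rootVec X) k (aL v s)) (t (rootVec X) (-k) (-rv b)) = 0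
      rw [← ha', ← rv_neg]
      refine C.form_t_eq_zero k (-k) (hss ha) (hrs (rep_neg b hb)) fun h' => ?_
      rw [neg_inj] at h'
      subst h'
      exact rep_not_spin _ hb ha
    · obtain ⟨b, hb, hb'⟩ := exists_spin hv' s'
      change form (h _) (t (rootVec X) (-k) (-aL v' s')) = 0
      rw [← hb', ← rv_neg, C.form_h_t]
    · exact absurd rfl hij
    · change form (h₅ h k) (hα₂ h (-k)) = 0
      rw [form_comm, C.form_hα₂_h₅ _ hk]
    · obtain ⟨b, hb, rfl⟩ := exists_rep hv'
      change form (h _) (t (rootVec X) (-k) (-rv b)) = 0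
      rw [← rv_neg, C.form_h_t]
    · obtain ⟨b, hb, hb'⟩ := exists_spin hv' s'
      change form (h _) (t (rootVec X) (-k) (-aL v' s')) = 0
      rw [← hb', ← rv_neg, C.form_h_t]
    · change form (hα₂ h k) (h₅ h (-k)) = 0
      rw [C.form_hα₂_h₅ _ hk']
    · exact absurd rfl hij
    · obtain ⟨b, hb, rfl⟩ := exists_rep hv'
      change form (h _) (t (rootVec X) (-k) (-rv b)) = 0
      rw [← rv_neg, C.form_h_t]
    · obtain ⟨a, ha, rfl⟩ := exists_rep hv
      obtain ⟨b, hb, hb'⟩ := exists_spin hv' s'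
      change form (t (rootVec X) k (rv a)) (t (rootVec X) (-k) (-aL v' s')) = 0
      rw [← hb', ← rv_neg]
      refine C.form_t_eq_zero k (-k) (hrs ha) (hss (spin_neg b hb)) fun h' => ?_
      rw [neg_inj] at h'
      subst h'
      exact rep_not_spin _ ha hb
    · obtain ⟨a, ha, rfl⟩ := exists_rep hv
      change form (t (rootVec X) k (rv a)) (h _) = 0
      rw [form_comm, C.form_h_t]
    · obtain ⟨a, ha, rfl⟩ := exists_rep hv
      change form (t (rootVec X) k (rv a)) (h _) = 0
      rw [form_comm, C.form_h_t]
    · obtain ⟨a, ha, rfl⟩ := exists_rep hv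
      obtain ⟨b, hb, rfl⟩ := exists_rep hv'
      change form (t (rootVec X) k (rv a)) (t (rootVec X) (-k) (-rv b)) = 0
      rw [← rv_neg]
      refine C.form_t_eq_zero k (-k) (hrs ha) (hrs (rep_neg b hb)) fun h' => hij ?_
      rw [neg_inj] at h'
      subst h'; rfl

theorem basisG2_mem (i : Fin 2 ⊕ orbitReps ⊕ fixedRoots) :
    basisG2 h (rootVec X) i ∈ (so8 (rootVec X)).toSubmodule ⊓ grade C.aut 0 := by
  rw [← fixedSubalgebra_toSubmodule]
  change _ ∈ so8Fixed (rootVec X) C.aut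
  rcases i with i | ⟨v, hv⟩ | ⟨v, hv⟩
  · rw [basisG2_inl, C.h_mem_so8Fixed_iff (cx_rv_mem _)]
    fin_cases i <;> simp [cx, rv, dv, dq] <;> norm_num
  · obtain ⟨a, ha, rfl⟩ := exists_rep hv
    change E0 (rootVec X) (rv a) ∈ _
    have h0 := rep_mem_so8 a ha
    have h1 := (so8_mem a h0).2
    have h2 := (so8_mem _ h1).2
    rw [E0_rv]
    refine ⟨?_, ?_⟩
    · simp only [orb, one_pow, one_smul]
      exact LieSubalgebra.add_mem _ (LieSubalgebra.add_mem _ (X_mem_so8 h0) (X_mem_so8 h1))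
        (X_mem_so8 h2)
    · change C.aut _ = _
      rw [C.aut_orb (one_pow 3), one_pow, one_smul]
  · obtain ⟨a, ha, rfl⟩ := exists_fix hv
    change rootVec X (rv a) ∈ _
    rw [rootVec_rv]
    refine ⟨X_mem_so8 (fix_mem a ha).2.1, ?_⟩
    change C.aut _ = _
    rw [C.aut_X, (fix_mem a ha).2.2]

theorem basisJ_mem (k : ZMod 3) (p : weightsL × ℤˣ) : basisJ (rootVec X) k p ∈ grade C.aut k := by
  obtain ⟨⟨w, hw⟩, s⟩ := p
  obtain ⟨a, ha, ha'⟩ := exists_spin hw s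
  change t (rootVec X) k (aL w s) ∈ _
  rw [← ha']
  exact C.t_mem_grade k a

omit C in
theorem t_mem_so8 (k : ZMod 3) {a : Q} (ha : a ∈ so8List) :
    t (rootVec X) k (rv a) ∈ so8 (rootVec X) := by
  have h1 := (so8_mem a ha).2
  have h2 := (so8_mem _ h1).2
  rw [t_rv]
  exact LieSubalgebra.smul_mem _ _ (LieSubalgebra.add_mem _ (LieSubalgebra.add_mem _ (X_mem_so8 ha)
    (LieSubalgebra.smul_mem _ _ (X_mem_so8 h1))) (LieSubalgebra.smul_mem _ _ (X_mem_so8 h2)))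

theorem basis7_mem (k : ZMod 3) (i : Unit ⊕ orbitReps) :
    basis7 h (rootVec X) k i ∈ (so8 (rootVec X)).toSubmodule ⊓ grade C.aut k := by
  rcases i with _ | ⟨v, hv⟩
  · refine ⟨?_, C.hα₂_mem_grade k⟩
    change hα₂ h k ∈ so8 (rootVec X)
    have m1 : h (cx (rv (sQ 1))) ∈ so8 (rootVec X) := C.h_mem_so8 (by decide +kernel)
    have m2 : h (cx (rv (sQ 2))) ∈ so8 (rootVec X) := C.h_mem_so8 (by decide +kernel)
    have m4 : h (cx (rv (sQ 4))) ∈ so8 (rootVec X) := C.h_mem_so8 (by decide +kernel)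
    rw [hα₂_eq, map_smul, map_add, map_add, map_smul, map_smul]
    exact LieSubalgebra.smul_mem _ _ (LieSubalgebra.add_mem _ (LieSubalgebra.add_mem _ m2
      (LieSubalgebra.smul_mem _ _ m4)) (LieSubalgebra.smul_mem _ _ m1))
  · obtain ⟨a, ha, rfl⟩ := exists_rep hv
    exact ⟨t_mem_so8 k (rep_mem_so8 a ha), C.t_mem_grade k a⟩

theorem basisGrade_mem (k : ZMod 3) (i : (weightsL × ℤˣ) ⊕ Unit ⊕ (Unit ⊕ orbitReps)) :
    basisGrade h (rootVec X) k i ∈ grade C.aut k := by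
  rcases i with p | _ | i
  · exact C.basisJ_mem k p
  · exact C.h₅_mem_grade k
  · exact (C.basis7_mem k i).2

theorem linearIndependent_basis7 {k : ZMod 3} (hk : k ≠ 0) :
    LinearIndependent ℂ (basis7 h (rootVec X) k) :=
  (C.linearIndependent_basisGrade hk).comp (Sum.inr ∘ Sum.inr)
    (Sum.inr_injective.comp Sum.inr_injective)

theorem linearIndependent_basisG2 : LinearIndependent ℂ (basisG2 h (rootVec X)) :=
  C.linearIndependent_zero.comp Sum.inl Sum.inl_injective

theorem linearIndependent_basisJ : LinearIndependent ℂ (basisJ (rootVec X) 0) :=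
  C.linearIndependent_zero.comp Sum.inr Sum.inr_injective

omit C in
theorem card_basisG2 : Fintype.card (Fin 2 ⊕ orbitReps ⊕ fixedRoots) = 14 := by
  rw [Fintype.card_sum, Fintype.card_sum, card_orbitReps, card_fixedRoots]; rfl

omit C in
theorem card_basis7 : Fintype.card (Unit ⊕ orbitReps) = 7 := by
  rw [Fintype.card_sum, card_orbitReps]; rfl

omit C in
theorem card_basisGrade : Fintype.card ((weightsL × ℤˣ) ⊕ Unit ⊕ (Unit ⊕ orbitReps)) = 24 := by
  rw [Fintype.card_sum, Fintype.card_sum, card_basis7, card_weightsL]; rfl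

/-- The independent families have 14 + 7 + 7 members, and the dimension is at most 28; so each spans
its eigenspace. -/
theorem so8_decomposition :
    (Submodule.span ℂ (Set.range (basisG2 h (rootVec X))) =
        (so8 (rootVec X)).toSubmodule ⊓ grade C.aut 0 ∧
      Submodule.span ℂ (Set.range (basis7 h (rootVec X) 1)) =
        (so8 (rootVec X)).toSubmodule ⊓ grade C.aut 1 ∧
      Submodule.span ℂ (Set.range (basis7 h (rootVec X) 2)) =
        (so8 (rootVec X)).toSubmodule ⊓ grade C.aut 2) ∧
    Module.finrank ℂ (so8 (rootVec X)) = 28 := by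
  have := C.finiteDimensional
  obtain ⟨h1, h2⟩ := disjoint_grade C.aut
  obtain ⟨k1, -, k3⟩ := span_eq_of_card_le (S := (so8 (rootVec X)).toSubmodule) h1 h2
    C.linearIndependent_basisG2 (C.linearIndependent_basis7 (k := 1) (by decide))
    (C.linearIndependent_basis7 (k := 2) (by decide)) C.basisG2_mem (C.basis7_mem 1) (C.basis7_mem 2)
    (by rw [card_basisG2, card_basis7]; exact C.finrank_so8_le)
  refine ⟨k1, ?_⟩
  rw [card_basisG2, card_basis7] at k3
  exact k3

/-- The same count with 14 + 16, 24 and 24 vectors in dimension 78. -/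
theorem decomposition :
    Submodule.span ℂ (Set.range (Sum.elim (basisG2 h (rootVec X)) (basisJ (rootVec X) 0))) =
        grade C.aut 0 ∧
      Submodule.span ℂ (Set.range (basisGrade h (rootVec X) 1)) = grade C.aut 1 ∧
      Submodule.span ℂ (Set.range (basisGrade h (rootVec X) 2)) = grade C.aut 2 := by
  have := C.finiteDimensional
  obtain ⟨h1, h2⟩ := disjoint_grade C.aut
  obtain ⟨k1, -, -⟩ := span_eq_of_card_le (S := (⊤ : Submodule ℂ g)) h1 h2
    C.linearIndependent_zero (C.linearIndependent_basisGrade (k := 1) (by decide))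
    (C.linearIndependent_basisGrade (k := 2) (by decide))
    (fun i => by
      rw [top_inf_eq]
      rcases i with i | p
      · exact (C.basisG2_mem i).2
      · exact C.basisJ_mem 0 p)
    (fun i => by rw [top_inf_eq]; exact C.basisGrade_mem 1 i)
    (fun i => by rw [top_inf_eq]; exact C.basisGrade_mem 2 i)
    (by rw [Fintype.card_sum, card_basisG2, card_basisGrade, card_weightsL, finrank_top, C.finrank])
  simpa only [top_inf_eq] using k1

end Chev

end E6GS



namespace E6GS

/-! ### Isomorphisms from generators and relations -/

section Generators

open LieSubalgebra Set

variable {ι : Type*} [Finite ι] {L₁ L₂ : Type*} [LieRing L₁] [LieAlgebra ℂ L₁]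
  [FiniteDimensional ℂ L₁] [LieRing L₂] [LieAlgebra ℂ L₂] [FiniteDimensional ℂ L₂]

-- Bracketing a relation between the h_j with each nonzero e_i yields a linear system with the
-- Cartan matrix, which is invertible.
omit [FiniteDimensional ℂ L₂] in
theorem linearIndependent_of_relations {A : Matrix ι ι ℤ} (hA : A.Nondegenerate) {h e : ι → L₂}
    (he0 : ∀ i, e i ≠ 0) (he : ∀ i j, ⁅h j, e i⁆ = A i j • e i) : LinearIndependent ℂ h := by
  classical
  have := Fintype.ofFinite ι
  rw [Fintype.linearIndependent_iff]
  intro c hc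
  have h1 : (A.map (Int.cast : ℤ → ℂ)).mulVec c = 0 := by
    funext i
    have h2 : (∑ j, (A i j : ℂ) * c j) • e i = 0 := by
      have h3 := congrArg (fun x => ⁅x, e i⁆) hc
      simp only [sum_lie, smul_lie, zero_lie, he] at h3
      rw [Finset.sum_smul, ← h3]
      refine Finset.sum_congr rfl fun j _ => ?_
      rw [← Int.cast_smul_eq_zsmul ℂ, smul_smul, mul_comm]
    exact (smul_eq_zero.mp h2).resolve_right (he0 i)
  have h4 : (A.map (Int.cast : ℤ → ℂ)).det ≠ 0 := by
    have h5 := Matrix.nondegenerate_iff_det_ne_zero.mp hA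
    have h6 : (A.map (Int.cast : ℤ → ℂ)).det = ((A.det : ℤ) : ℂ) :=
      (RingHom.map_det (Int.castRingHom ℂ) A).symm
    rw [h6]
    exact_mod_cast h5
  exact fun i => congrFun (Matrix.eq_zero_of_mulVec_eq_zero h4 h1) i

theorem exists_surjective_lieHom {H : LieSubalgebra ℂ L₁} (b : LieAlgebra.Basis ι H)
    (hb : ∀ I : LieIdeal ℂ L₁, I ≠ ⊥ → ∃ x ∈ I, x ∈ H ∧ x ≠ 0)
    {e f : ι → L₂} (he0 : ∀ i, e i ≠ 0) (he : ∀ i j, ⁅⁅e j, f j⁆, e i⁆ = b.A i j • e i)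
    (hf : ∀ i j, ⁅⁅e j, f j⁆, f i⁆ = -b.A i j • f i) (hef : ∀ i j, i ≠ j → ⁅e i, f j⁆ = 0) :
    ∃ φ : lieSpan ℂ L₂ (range e ∪ range f) →ₗ⁅ℂ⁆ L₁, Function.Surjective φ := by
  obtain ⟨φ, h1, h2⟩ := exists_lieHom b hb (h := fun i => ⁅e i, f i⁆) (e := e) (f := f)
    (linearIndependent_of_relations b.nondegen he0 he) (fun _ => rfl)
    -- The coroots commute automatically: by the Leibniz rule h_i acts on [e_j, f_j] through two
    -- opposite multiples.
    (fun i j => by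
      rw [← lie_skew, ← neg_eq_zero, neg_neg, leibniz_lie, he, hf, smul_lie, lie_smul, neg_smul,
        add_neg_cancel]) he hf hef
  refine ⟨φ, ?_⟩
  have h3 : φ.range = ⊤ := by
    rw [eq_top_iff, ← b.span_ef, lieSpan_le]
    rintro _ (⟨i, rfl⟩ | ⟨i, rfl⟩)
    · exact ⟨_, h1 i (subset_lieSpan (Or.inl ⟨i, rfl⟩))⟩
    · exact ⟨_, h2 i (subset_lieSpan (Or.inr ⟨i, rfl⟩))⟩
  intro x
  have : x ∈ φ.range := by rw [h3]; trivial
  exact this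

/-- The generated subalgebra maps onto L₁ and is contained in N, whose dimension is at most that of
L₁. So it equals N and the surjection is bijective. -/
theorem nonempty_lieEquiv {H : LieSubalgebra ℂ L₁} (b : LieAlgebra.Basis ι H)
    (hb : ∀ I : LieIdeal ℂ L₁, I ≠ ⊥ → ∃ x ∈ I, x ∈ H ∧ x ≠ 0)
    {e f : ι → L₂} (he0 : ∀ i, e i ≠ 0) (he : ∀ i j, ⁅⁅e j, f j⁆, e i⁆ = b.A i j • e i)
    (hf : ∀ i j, ⁅⁅e j, f j⁆, f i⁆ = -b.A i j • f i) (hef : ∀ i j, i ≠ j → ⁅e i, f j⁆ = 0)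
    {N : LieSubalgebra ℂ L₂} (heN : ∀ i, e i ∈ N) (hfN : ∀ i, f i ∈ N)
    (hN : Module.finrank ℂ N ≤ Module.finrank ℂ L₁) : Nonempty (N ≃ₗ⁅ℂ⁆ L₁) := by
  obtain ⟨φ, hφ⟩ := exists_surjective_lieHom b hb he0 he hf hef
  have hle : lieSpan ℂ L₂ (range e ∪ range f) ≤ N := by
    rw [lieSpan_le]
    rintro _ (⟨i, rfl⟩ | ⟨i, rfl⟩)
    exacts [heN i, hfN i]
  have h1 := LinearMap.finrank_le_finrank_of_surjective (f := φ.toLinearMap) hφ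
  have h2 : (lieSpan ℂ L₂ (range e ∪ range f)).toSubmodule = N.toSubmodule :=
    Submodule.eq_of_le_of_finrank_le hle (hN.trans h1)
  have h3 : lieSpan ℂ L₂ (range e ∪ range f) = N := LieSubalgebra.toSubmodule_injective h2
  subst h3
  have h4 : Function.Injective φ.toLinearMap :=
    (LinearMap.injective_iff_surjective_of_finrank_eq_finrank (le_antisymm hN h1)).mpr hφ
  exact ⟨LieEquiv.ofBijective φ ⟨h4, hφ⟩⟩

/-- A product with an abelian Lie algebra of dimension two. -/
theorem nonempty_prod_lieEquiv {S : Type*} [LieRing S] [LieAlgebra ℂ S] [FiniteDimensional ℂ S]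
    {F : LieSubalgebra ℂ L₂} (ψ : S →ₗ⁅ℂ⁆ F) (c₀ c₁ : F) (h0 : ∀ x, ⁅ψ x, c₀⁆ = 0)
    (h1 : ∀ x, ⁅ψ x, c₁⁆ = 0) (h01 : ⁅c₀, c₁⁆ = 0)
    (hinj : ∀ x (s t : ℂ), ψ x + (s • c₀ + t • c₁) = 0 → x = 0 ∧ s = 0 ∧ t = 0)
    (hF : Module.finrank ℂ F ≤ Module.finrank ℂ S + 2) : Nonempty (F ≃ₗ⁅ℂ⁆ (S × TwoTrivial)) := by
  have hfin : FiniteDimensional ℂ TwoTrivial := inferInstanceAs (FiniteDimensional ℂ (Fin 2 → ℂ))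
  let φ : (S × TwoTrivial) →ₗ⁅ℂ⁆ F :=
    { toFun := fun p => ψ p.1 + (p.2 0 • c₀ + p.2 1 • c₁)
      map_add' := fun p q => by
        have e0 : (p + q).2 0 = p.2 0 + q.2 0 := rfl
        have e1 : (p + q).2 1 = p.2 1 + q.2 1 := rfl
        rw [e0, e1, Prod.fst_add, map_add]
        module
      map_smul' := fun s p => by
        have e0 : (s • p).2 0 = s * p.2 0 := rfl
        have e1 : (s • p).2 1 = s * p.2 1 := rfl
        rw [e0, e1, Prod.smul_fst, map_smul, RingHom.id_apply]
        module
      map_lie' := fun {p q} => by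
        have e0 : ⁅p, q⁆.2 0 = 0 := rfl
        have e1 : ⁅p, q⁆.2 1 = 0 := rfl
        have e2 : ⁅p, q⁆.1 = ⁅p.1, q.1⁆ := rfl
        have h10 : ⁅c₁, c₀⁆ = 0 := by rw [← lie_skew, h01, neg_zero]
        have h0' : ∀ x, ⁅c₀, ψ x⁆ = 0 := fun x => by rw [← lie_skew, h0, neg_zero]
        have h1' : ∀ x, ⁅c₁, ψ x⁆ = 0 := fun x => by rw [← lie_skew, h1, neg_zero]
        change ψ ⁅p, q⁆.1 + (⁅p, q⁆.2 0 • c₀ + ⁅p, q⁆.2 1 • c₁) = _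
        rw [e0, e1, e2, LieHom.map_lie]
        simp only [add_lie, lie_add, smul_lie, lie_smul, h0, h1, h0', h1', h01, h10, lie_self,
          smul_zero, add_zero, zero_add, zero_smul] }
  have hφ : Function.Injective (φ : (S × TwoTrivial) →ₗ[ℂ] F) := by
    rw [injective_iff_map_eq_zero]
    rintro ⟨x, z⟩ hx
    obtain ⟨k1, k2, k3⟩ := hinj x (z 0) (z 1) hx
    refine Prod.ext k1 (funext fun i => ?_)
    fin_cases i
    exacts [k2, k3]
  have hS : Module.finrank ℂ (S × TwoTrivial) = Module.finrank ℂ S + 2 := by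
    have : Module.finrank ℂ TwoTrivial = 2 := (Module.finrank_fin_fun ℂ : Module.finrank ℂ (Fin 2 → ℂ) = 2)
    rw [Module.finrank_prod, this]
  have hle := LinearMap.finrank_le_finrank_of_injective hφ
  have hsurj := (LinearMap.injective_iff_surjective_of_finrank_eq_finrank
    (le_antisymm hle (hF.trans hS.ge))).mp hφ
  exact ⟨(LieEquiv.ofBijective φ ⟨hφ, hsurj⟩).symm⟩

end Generators

/-- The coefficient of a generator in a formal linear combination. -/
def lcoef {G : Type*} [DecidableEq G] (y : G) : List ((ℤ × ℤ) × G) → ℤ × ℤ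
  | [] => 0
  | t :: l => if t.2 = y then t.1 + lcoef y l else lcoef y l

/-- The functional φ reads off the coefficient of y, so one coefficient 1 certifies a nonzero value.
-/
theorem lval_ne_zero {G L : Type*} [DecidableEq G] [LieRing L] [LieAlgebra ℂ L] {τ : ℂ}
    {ev : G → L} {ok : G → Prop} (φ : L →ₗ[ℂ] ℂ) (y : G)
    (hφ : ∀ x, ok x → φ (ev x) = if x = y then 1 else 0) {l : List ((ℤ × ℤ) × G)}
    (hl : ∀ t ∈ l, ok t.2) (h : lcoef y l = (1, 0)) : lval τ ev l ≠ 0 := by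
  have key : ∀ l : List ((ℤ × ℤ) × G), (∀ t ∈ l, ok t.2) →
      φ (lval τ ev l) = qnum τ (lcoef y l) := by
    intro l
    induction l with
    | nil => intro _; simp [lval, lcoef, qnum]
    | cons t l ih =>
      intro hl
      have h1 := ih fun u hu => hl u (List.mem_cons_of_mem _ hu)
      rw [lval_cons, map_add, map_smul, h1, hφ _ (hl t List.mem_cons_self), lcoef]
      split_ifs
      · simp only [qnum, Prod.fst_add, Prod.snd_add, smul_eq_mul]
        push_cast; ring
      · simp
  intro h0
  have h1 := key l hl
  rw [h0, h, map_zero] at h1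
  simp [qnum] at h1

/-! ### The orthogonal Lie algebra -/

section Orthogonal

attribute [local instance] LieRing.ofAssociativeRing

/-- The brackets of the matrix units. -/
def mbr (x y : Fin 8 × Fin 8) : List (ℤ × (Fin 8 × Fin 8)) :=
  (if x.2 = y.1 then [(1, (x.1, y.2))] else []) ++ (if y.2 = x.1 then [(-1, (y.1, x.2))] else [])

/-- The matrix units. -/
noncomputable def mev (x : Fin 8 × Fin 8) : Matrix (Fin 8) (Fin 8) ℂ := Matrix.single x.1 x.2 1

theorem lie_mev (x y : Fin 8 × Fin 8) :
    ⁅mev x, mev y⁆ = ((mbr x y).map fun s => (s.1 : ℂ) • mev s.2).sum := by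
  rw [Ring.lie_def, mbr, List.map_append, List.sum_append, sub_eq_add_neg]
  congr 1
  · split_ifs with h
    · simp [mev, h]
    · simp [mev, h]
  · split_ifs with h
    · simp [mev, h, ← Matrix.single_neg]
    · simp [mev, h]

/-- The isotropic vector `ε_{2a} ± i ε_{2a+1}`. -/
def isoVec (a : Fin 4) (s : ℤ) : List ((ℤ × ℤ) × Fin 8) :=
  [((1, 0), ⟨2 * a, by omega⟩), ((0, s), ⟨2 * a + 1, by omega⟩)]

/-- The skew-symmetric matrix `u vᵀ - v uᵀ`. -/
def wedge (u v : List ((ℤ × ℤ) × Fin 8)) : List ((ℤ × ℤ) × (Fin 8 × Fin 8)) :=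
  u.flatMap fun s => v.flatMap fun t =>
    [(qmul 0 s.1 t.1, (s.2, t.2)), (-qmul 0 s.1 t.1, (t.2, s.2))]

/-- The positive simple root vectors of `so(8)`. -/
def soE : Fin 4 → List ((ℤ × ℤ) × (Fin 8 × Fin 8)) :=
  ![wedge (isoVec 2 1) (isoVec 3 1), wedge (isoVec 2 1) (isoVec 3 (-1)),
    wedge (isoVec 1 1) (isoVec 2 (-1)), wedge (isoVec 0 1) (isoVec 1 (-1))]

/-- The negative simple root vectors of `so(8)`. -/
def soF : Fin 4 → List ((ℤ × ℤ) × (Fin 8 × Fin 8)) :=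
  ![wedge (isoVec 3 (-1)) (isoVec 2 (-1)), wedge (isoVec 3 1) (isoVec 2 (-1)),
    wedge (isoVec 2 1) (isoVec 1 (-1)), wedge (isoVec 1 1) (isoVec 0 (-1))]

/-- The Cartan matrix of type `D₄`. -/
def cartanD4 : Matrix (Fin 4) (Fin 4) ℤ := !![2, 0, -1, 0; 0, 2, -1, 0; -1, -1, 2, -1; 0, 0, -1, 2]

/-- Here τ = i, so b = 0. The factor 4 comes from two contractions of an isotropic vector with its
conjugate, each equal to 2; it is removed later by dividing the negative generators by 4. -/
theorem soE_relation : ∀ i j, isNull (lbr 0 mbr (lbr 0 mbr (soE j) (soF j)) (soE i) ++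
    lsmul 0 (-1, 0) (lsmul 0 (4 * cartanD4 i j, 0) (soE i))) = true := by
  decide +kernel

theorem soF_relation : ∀ i j, isNull (lbr 0 mbr (lbr 0 mbr (soE j) (soF j)) (soF i) ++
    lsmul 0 (-1, 0) (lsmul 0 (-4 * cartanD4 i j, 0) (soF i))) = true := by
  decide +kernel

theorem soEF_relation : ∀ i j, i ≠ j → isNull (lbr 0 mbr (soE i) (soF j)) = true := by
  decide +kernel

theorem lval_mem_so {l : List ((ℤ × ℤ) × (Fin 8 × Fin 8))}
    (h : isNull (l.map (fun t => (t.1, (t.2.2, t.2.1))) ++ l) = true) :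
    lval Complex.I mev l ∈ LieAlgebra.Orthogonal.so (Fin 8) ℂ := by
  rw [LieAlgebra.Orthogonal.mem_so, eq_neg_iff_add_eq_zero]
  have h1 := lval_eq_zero (τ := Complex.I) (ev := mev) h
  rw [lval_append] at h1
  rw [← h1]
  congr 1
  clear h h1
  induction l with
  | nil => simp [lval]
  | cons t l ih =>
    rw [List.map_cons, lval_cons, lval_cons, Matrix.transpose_add, ih, Matrix.transpose_smul]
    congr 2
    simp [mev]

/-- A skew matrix is determined by its 28 entries above the diagonal. -/
theorem finrank_so_le : Module.finrank ℂ (LieAlgebra.Orthogonal.so (Fin 8) ℂ) ≤ 28 := by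
  let f : LieAlgebra.Orthogonal.so (Fin 8) ℂ →ₗ[ℂ] ({p : Fin 8 × Fin 8 // p.1 < p.2} → ℂ) :=
    { toFun := fun M p => M.1 p.1.1 p.1.2
      map_add' := fun M N => rfl
      map_smul' := fun c M => rfl }
  have hf : Function.Injective f := by
    rw [injective_iff_map_eq_zero]
    rintro ⟨M, hM⟩ h0
    rw [LieAlgebra.Orthogonal.mem_so] at hM
    have hsk : ∀ i j, M j i = -M i j := fun i j => congrFun (congrFun hM i) j
    have hlt : ∀ i j, i < j → M i j = 0 := fun i j hij => congrFun h0 ⟨(i, j), hij⟩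
    apply Subtype.ext
    change M = 0
    ext i j
    rcases lt_trichotomy i j with hij | hij | hij
    · exact hlt i j hij
    · subst hij
      have := hsk i i
      change M i i = 0
      linear_combination this / 2
    · rw [hsk, hlt j i hij, neg_zero]; rfl
  have h1 := LinearMap.finrank_le_finrank_of_injective hf
  rw [Module.finrank_fintype_fun_eq_card] at h1
  exact h1.trans (by decide +kernel)

theorem nonempty_so_lieEquiv {L₁ : Type*} [LieRing L₁] [LieAlgebra ℂ L₁] [FiniteDimensional ℂ L₁]
    {H : LieSubalgebra ℂ L₁} (b : LieAlgebra.Basis (Fin 4) H) (hA : b.A = cartanD4)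
    (hb : ∀ I : LieIdeal ℂ L₁, I ≠ ⊥ → ∃ x ∈ I, x ∈ H ∧ x ≠ 0) (hL : Module.finrank ℂ L₁ = 28) :
    Nonempty (LieAlgebra.Orthogonal.so (Fin 8) ℂ ≃ₗ⁅ℂ⁆ L₁) := by
  have hτ : Complex.I * Complex.I = ((0 : ℤ) : ℂ) * Complex.I - 1 := by
    rw [Complex.I_mul_I]; push_cast; ring
  have hbr : ∀ x y, True → True → ⁅mev x, mev y⁆ = _ := fun x y _ _ => lie_mev x y
  have hok : ∀ l : List ((ℤ × ℤ) × (Fin 8 × Fin 8)), ∀ t ∈ l, True := fun _ _ _ => trivial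
  have hq : ∀ n : ℤ, qnum Complex.I (n, 0) = n := fun n => by simp [qnum]
  have hh : ∀ j, ⁅lval Complex.I mev (soE j), (1 / 4 : ℂ) • lval Complex.I mev (soF j)⁆ =
      (1 / 4 : ℂ) • lval Complex.I mev (lbr 0 mbr (soE j) (soF j)) := fun j => by
    rw [lie_smul, lval_lbr hτ hbr (hok _) (hok _)]
  refine nonempty_lieEquiv b hb (e := fun i => lval Complex.I mev (soE i))
    (f := fun i => (1 / 4 : ℂ) • lval Complex.I mev (soF i)) (fun i => ?_) (fun i j => ?_)
    (fun i j => ?_) (fun i j hij => ?_) (fun i => ?_) (fun i => ?_) (finrank_so_le.trans hL.ge)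
  -- The position of the product of the two leading terms in each wedge, where the coefficient is 1.
  · let y : Fin 8 × Fin 8 := ![(4, 6), (4, 6), (2, 4), (0, 2)] i
    let φ : Matrix (Fin 8) (Fin 8) ℂ →ₗ[ℂ] ℂ :=
      { toFun := fun M => M y.1 y.2
        map_add' := fun _ _ => rfl
        map_smul' := fun _ _ => rfl }
    have hy : ∀ i, lcoef (![(4, 6), (4, 6), (2, 4), (0, 2)] i) (soE i) = (1, 0) := by decide +kernel
    refine lval_ne_zero φ y (ok := fun _ => True) (fun x _ => ?_) (hok _) (hy i)
    change Matrix.single x.1 x.2 (1 : ℂ) y.1 y.2 = _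
    rw [Matrix.single_apply]
    simp only [Prod.ext_iff]
  · rw [hh, smul_lie, lie_lval_eq hτ hbr (hok _) (hok _) (soE_relation i j), lval_lsmul hτ, hq, hA,
      smul_smul, ← Int.cast_smul_eq_zsmul ℂ]
    congr 1; push_cast; ring
  · rw [hh, smul_lie, lie_smul, lie_lval_eq hτ hbr (hok _) (hok _) (soF_relation i j),
      lval_lsmul hτ, hq, hA, smul_smul, smul_smul, ← Int.cast_smul_eq_zsmul ℂ, smul_smul]
    congr 1; push_cast; ring
  · rw [lie_smul, ← lval_lbr hτ hbr (hok _) (hok _), lval_eq_zero (soEF_relation i j hij), smul_zero]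
  · refine lval_mem_so ?_
    revert i; decide +kernel
  · refine LieSubalgebra.smul_mem _ _ (lval_mem_so ?_)
    revert i; decide +kernel

end Orthogonal

end E6GS



namespace E6GS

variable {g : Type*} [LieRing g] [LieAlgebra ℂ g]

/-! ### Ideals of subalgebras with a weight decomposition. -/

theorem lieSpan_preimage_eq_top {S : LieSubalgebra ℂ g} {s : Set g}
    (hS : S = LieSubalgebra.lieSpan ℂ g s) :
    LieSubalgebra.lieSpan ℂ S (Subtype.val ⁻¹' s) = ⊤ := by
  subst hS
  exact LieSubalgebra.lieSpan_lieSpan_coe_preimage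

/-- A nonzero ideal of a subalgebra with a weight decomposition meets its Cartan subalgebra. -/
theorem exists_mem_ideal {S : LieSubalgebra ℂ g} {κ : Type*} [Fintype κ] (T : S) (v : κ → g)
    (hspan : S.toSubmodule ≤ Submodule.span ℂ (Set.range v)) (c : κ → ℂ)
    (hT : ∀ i, ⁅(T : g), v i⁆ = c i • v i) (hc : ∀ i j, c i = c j → c i ≠ 0 → i = j)
    (K : Submodule ℂ g) (h0 : ∀ i, c i = 0 → v i ∈ K)
    (h1 : ∀ i, c i ≠ 0 → ∃ y ∈ S, ⁅v i, y⁆ ∈ K ∧ ⁅v i, y⁆ ≠ 0)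
    {I : LieIdeal ℂ S} (hI : I ≠ ⊥) : ∃ x ∈ I, (x : g) ∈ K ∧ x ≠ 0 := by
  classical
  obtain ⟨x, hxI, hx0⟩ := Submodule.exists_mem_ne_zero_of_ne_bot
    (fun h => hI ((LieSubmodule.toSubmodule_eq_bot I).mp h))
  let N : Submodule ℂ g := I.toSubmodule.map S.toSubmodule.subtype
  have hN : ∀ y ∈ N, LieAlgebra.ad ℂ g (T : g) y ∈ N := by
    rintro _ ⟨y, hy, rfl⟩
    exact ⟨(⁅T, (y : S)⁆ : S), I.lie_mem hy, rfl⟩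
  obtain ⟨a, ha⟩ := (Submodule.mem_span_range_iff_exists_fun ℂ).mp (hspan x.2)
  -- If x has a nonzero component of nonzero weight, projection to that weight puts a root vector
  -- into I, and a bracket carries it into K. Otherwise x has weight zero and lies in K itself.
  by_cases h : ∃ i, c i ≠ 0 ∧ a i • v i ≠ 0
  · obtain ⟨i, hci, hai⟩ := h
    have h2 := sum_filter_mem hN hT (a := a) (by rw [ha]; exact ⟨x, hxI, rfl⟩) (c i)
    have h3 : (Finset.univ.filter fun j => c j = c i) = {i} := by
      ext j
      simp only [Finset.mem_filter, Finset.mem_univ, true_and, Finset.mem_singleton]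
      exact ⟨fun hj => (hc i j hj.symm hci).symm, fun hj => by rw [hj]⟩
    rw [h3, Finset.sum_singleton] at h2
    obtain ⟨y, hy, hyK, hy0⟩ := h1 i hci
    obtain ⟨z, hz, hz'⟩ : ∃ z : S, z ∈ I ∧ (z : g) = a i • v i := h2
    have hai' : a i ≠ 0 := fun h' => hai (by rw [h', zero_smul])
    refine ⟨⁅z, (⟨y, hy⟩ : S)⁆, ?_, ?_, ?_⟩
    · rw [← lie_skew]; exact I.neg_mem (I.lie_mem hz)
    · change ⁅(z : g), y⁆ ∈ K
      rw [hz', smul_lie]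
      exact K.smul_mem _ hyK
    · intro h'
      have h4 : ⁅(z : g), y⁆ = 0 := congrArg Subtype.val h'
      rw [hz', smul_lie] at h4
      exact hy0 ((smul_eq_zero.mp h4).resolve_left hai')
  · push Not at h
    refine ⟨x, hxI, ?_, hx0⟩
    rw [← ha]
    refine K.sum_mem fun i _ => ?_
    by_cases hci : c i = 0
    · exact K.smul_mem _ (h0 i hci)
    · rw [h i hci]; exact K.zero_mem

theorem mem_cartan_of_mem_span {S : LieSubalgebra ℂ g} {ι : Type*} [Finite ι]
    {H : LieSubalgebra ℂ S} (b : LieAlgebra.Basis ι H) {x : S}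
    (hx : (x : g) ∈ Submodule.span ℂ (Set.range fun i => (b.h i : g))) : x ∈ H := by
  have h1 := b.coe_cartan_eq_span
  rw [← LieSubalgebra.mem_toSubmodule, h1]
  have h2 : (Set.range fun i => (b.h i : g)) = S.toSubmodule.subtype '' Set.range b.h := by
    rw [← Set.range_comp]; rfl
  rw [h2, ← Submodule.map_span] at hx
  obtain ⟨y, hy, hyx⟩ := hx
  have : y = x := Subtype.ext hyx
  rwa [← this]

/-! ### Brackets of the Chevalley basis -/

/-- The Chevalley generators: the simple coroots and the root vectors. -/
abbrev EG : Type := Fin 6 ⊕ Q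

instance : DecidableEq EG := instDecidableEqSum

/-- The brackets of the Chevalley basis. -/
def ebr : EG → EG → List (ℤ × EG)
  | .inl _, .inl _ => []
  | .inl i, .inr a => [(pr (sQ i) a, .inr a)]
  | .inr a, .inl i => [(-pr (sQ i) a, .inr a)]
  | .inr a, .inr b =>
    if a + b = 0 then (List.finRange 6).map fun i => (a.coord i, .inl i)
    else if pr a b = -1 then [(strC a b, .inr (a + b))] else []

/-- The value of a Chevalley generator. -/
noncomputable def eev (h : (Fin 7 → ℂ) →ₗ[ℂ] g) (X : Q → g) : EG → g
  | .inl i => h (cx (rv (sQ i)))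
  | .inr a => X a

/-- The Chevalley generators that do not vanish. -/
def eok : EG → Prop
  | .inl _ => True
  | .inr a => a ∈ rootList

instance : DecidablePred eok
  | .inl _ => isTrue trivial
  | .inr a => inferInstanceAs (Decidable (a ∈ rootList))

theorem zero_not_mem_rootList : (0 : Q) ∉ rootList := by decide +kernel

/-- The simple roots of `so(8)`. -/
def dQ (i : Fin 4) : Q := sQ (![1, 2, 3, 4] i)

theorem dQ_mem : ∀ i, dQ i ∈ so8List := by decide +kernel

theorem pr_dQ : ∀ i j, pr (dQ j) (dQ i) = cartanD4 i j := by
  intro i j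
  fin_cases i <;> fin_cases j <;> rfl

theorem pr_dQ_neg : ∀ i j, i ≠ j → 0 ≤ pr (dQ i) (-dQ j) := by decide +kernel

/-- A vector of the lattice of `so(8)` that separates its roots. -/
def regularD4 : Q := (0, 1, 6, 4, 10, 0)

theorem regularD4_nodup : (so8List.map (pr regularD4)).Nodup := by decide +kernel

theorem pr_regularD4_ne_zero : ∀ a ∈ so8List, pr regularD4 a ≠ 0 := by decide +kernel

theorem so8List_coord_nonneg : ∀ a ∈ posList, 0 ≤ a.1 ∧ 0 ≤ a.2.2.2.2.2 := by decide +kernel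

theorem eq_dQ_of_mem : ∀ i, sQ i ∈ so8List → ∃ j, sQ i = dQ j := by
  intro i hi
  fin_cases i
  · exact absurd hi (by decide +kernel)
  exacts [⟨0, rfl⟩, ⟨1, rfl⟩, ⟨2, rfl⟩, ⟨3, rfl⟩, absurd hi (by decide +kernel)]

theorem sQ_coord_nonneg : ∀ i, 0 ≤ (sQ i).1 ∧ 0 ≤ (sQ i).2.2.2.2.2 := by decide +kernel

theorem mem_rootList_of_mem_posList {a : Q} (ha : a ∈ posList) : a ∈ rootList :=
  List.mem_append_left _ ha

/-- Coordinates of positive roots are nonnegative, so the vanishing of the first and last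
coordinates of a sum passes to the summands. This keeps the height induction inside D₄. -/
theorem so8List_of_add {i : Fin 6} {a : Q} (ha : a ∈ posList) (hia : sQ i + a ∈ posList)
    (h : sQ i + a ∈ so8List) : sQ i ∈ so8List ∧ a ∈ so8List := by
  obtain ⟨h1, h2⟩ := (mem_so8List_iff _ (mem_rootList_of_mem_posList hia)).mp h
  obtain ⟨h3, h4⟩ := so8List_coord_nonneg a ha
  obtain ⟨h5, h6⟩ := sQ_coord_nonneg i
  simp only [Prod.fst_add, Prod.snd_add] at h1 h2
  exact ⟨(mem_so8List_iff _ (sQ_mem i)).mpr ⟨by omega, by omega⟩,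
    (mem_so8List_iff _ (mem_rootList_of_mem_posList ha)).mpr ⟨by omega, by omega⟩⟩

namespace Chev

variable {h : (Fin 7 → ℂ) →ₗ[ℂ] g} {X : Q → g} (C : Chev h X)
include C

omit C in
theorem h_rv (a : Q) : h (cx (rv a)) = ∑ i, (a.coord i : ℂ) • h (cx (rv (sQ i))) := by
  rw [eq_sum_coord a, map_sum]
  simp only [map_smul]

theorem lie_eev (x y : EG) (hx : eok x) (hy : eok y) :
    ⁅eev h X x, eev h X y⁆ = ((ebr x y).map fun s => (s.1 : ℂ) • eev h X s.2).sum := by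
  rcases x with i | a <;> rcases y with j | b
  · simp [eev, ebr, C.lie_h_h]
  · simp [eev, ebr, C.lie_hv_X]
  · simp only [eev, ebr, List.map_cons, List.map_nil, List.sum_cons, List.sum_nil, add_zero]
    rw [← lie_skew, C.lie_hv_X]
    push_cast
    rw [neg_smul]
  · have ha : a ∈ rootList := hx
    have hb : b ∈ rootList := hy
    simp only [eev, ebr]
    rcases C.lie_X_cases ha hb with ⟨h1, h2⟩ | ⟨h1, h3, h2⟩ | ⟨h1, h2⟩
    · rw [h2, if_pos h1, h_rv, List.map_map, ← List.ofFn_eq_map, List.sum_ofFn]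
      rfl
    · have : a + b ≠ 0 := fun h' => zero_not_mem_rootList (h' ▸ h1)
      rw [h2, if_neg this, if_pos h3]
      simp [eev]
    · have : a + b ≠ 0 := fun h' => by
        rw [eq_neg_of_add_eq_zero_right h', pr_neg_right, pr_self ha] at h1
        omega
      rw [h2, if_neg this, if_neg (by omega)]
      simp

/-- Pairing with the opposite root vector serves as the coordinate functional of X a. -/
theorem eev_functional {a : Q} (ha : a ∈ rootList) (x : EG) (hx : eok x) :
    (formB : g →ₗ[ℂ] g →ₗ[ℂ] ℂ) (X (-a)) (eev h X x) = if x = .inr a then 1 else 0 := by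
  rw [formB_apply]
  rcases x with i | b
  · simp only [eev, reduceCtorEq, if_false]
    rw [form_comm, C.form_h_X]
  · simp only [eev, Sum.inr.injEq]
    split_ifs with hab
    · subst hab; rw [form_comm, C.form_X_neg ha]
    · refine C.form_X_X fun h' => hab ?_
      rw [neg_add_eq_sub, sub_eq_zero] at h'
      exact h'

theorem lval_eev_ne_zero {τ : ℂ} {a : Q} (ha : a ∈ rootList) {l : List ((ℤ × ℤ) × EG)}
    (hl : ∀ t ∈ l, eok t.2) (hc : lcoef (.inr a) l = (1, 0)) : lval τ (eev h X) l ≠ 0 :=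
  lval_ne_zero (formB (X (-a))) (.inr a) (C.eev_functional ha) hl hc

/-! ### The structure of `so(8)` -/

/-- A subalgebra that contains the simple root vectors contains `so(8)`. -/
theorem X_mem_of_simple {M : LieSubalgebra ℂ g} (h1 : ∀ i, X (dQ i) ∈ M) (h2 : ∀ i, X (-dQ i) ∈ M)
    {a : Q} (ha : a ∈ so8List) : X a ∈ M := by
  have key : ∀ a ∈ rootList, ∀ b ∈ rootList, a + b ∈ rootList → X a ∈ M → X b ∈ M →
      X (a + b) ∈ M := by
    intro a ha b hb hab h1 h2
    have := M.smul_mem (strC a b : ℂ)⁻¹ (M.lie_mem h1 h2)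
    rwa [C.lie_X_X a ha b hb (pr_eq_of_add_mem ha hb hab), smul_smul,
      inv_mul_cancel₀ (strC_ne_zero _ _), one_smul] at this
  have ha' := (so8_mem a ha).1
  rw [rootList, List.mem_append, List.mem_map] at ha'
  rcases ha' with ha' | ⟨b, hb, rfl⟩
  · refine root_induction (P := fun a => a ∈ so8List → X a ∈ M) (fun i hi => ?_)
      (fun i a hap hia ih hi => ?_) a ha' ha
    · obtain ⟨j, hj⟩ := eq_dQ_of_mem i hi
      rw [hj]; exact h1 j
    · obtain ⟨k1, k2⟩ := so8List_of_add hap hia hi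
      obtain ⟨j, hj⟩ := eq_dQ_of_mem i k1
      refine key _ (sQ_mem i) _ (mem_rootList_of_mem_posList hap) (mem_rootList_of_mem_posList hia)
        ?_ (ih k2)
      rw [hj]; exact h1 j
  · have hb' := so8List_neg _ ha
    rw [neg_neg] at hb'
    refine root_induction (P := fun a => a ∈ so8List → X (-a) ∈ M) (fun i hi => ?_)
      (fun i a hap hia ih hi => ?_) b hb hb'
    · obtain ⟨j, hj⟩ := eq_dQ_of_mem i hi
      rw [hj]; exact h2 j
    · obtain ⟨k1, k2⟩ := so8List_of_add hap hia hi
      obtain ⟨j, hj⟩ := eq_dQ_of_mem i k1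
      have k3 := neg_mem (mem_rootList_of_mem_posList hia)
      rw [neg_add] at k3 ⊢
      refine key _ (neg_mem (sQ_mem i)) _ (neg_mem (mem_rootList_of_mem_posList hap)) k3 ?_ (ih k2)
      rw [hj]; exact h2 j

theorem so8_eq_lieSpan : so8 (rootVec X) = LieSubalgebra.lieSpan ℂ g
    (Set.range (fun i => X (dQ i)) ∪ Set.range fun i => X (-dQ i)) := by
  apply le_antisymm
  · rw [so8, LieSubalgebra.lieSpan_le]
    rintro _ ⟨v, hv, rfl⟩
    rw [rootsSO8_eq] at hv
    obtain ⟨a, ha, rfl⟩ := hv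
    rw [rootVec_rv]
    exact C.X_mem_of_simple (fun i => LieSubalgebra.subset_lieSpan (Or.inl ⟨i, rfl⟩))
      (fun i => LieSubalgebra.subset_lieSpan (Or.inr ⟨i, rfl⟩)) ha
  · rw [LieSubalgebra.lieSpan_le]
    rintro _ (⟨i, rfl⟩ | ⟨i, rfl⟩)
    · exact X_mem_so8 (dQ_mem i)
    · exact X_mem_so8 (so8List_neg _ (dQ_mem i))

/-- The simple coroots of `so(8)`. -/
noncomputable def so8h (i : Fin 4) : so8 (rootVec X) := ⟨h (cx (rv (dQ i))), C.h_mem_so8 (dQ_mem i)⟩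

omit C in
/-- The positive simple root vectors of `so(8)`. -/
noncomputable def so8e (X : Q → g) (i : Fin 4) : so8 (rootVec X) := ⟨X (dQ i), X_mem_so8 (dQ_mem i)⟩

omit C in
/-- The negative simple root vectors of `so(8)`. -/
noncomputable def so8f (X : Q → g) (i : Fin 4) : so8 (rootVec X) :=
  ⟨X (-dQ i), X_mem_so8 (so8List_neg _ (dQ_mem i))⟩

theorem linearIndependent_so8h : LinearIndependent ℂ C.so8h := by
  refine .of_comp (so8 (rootVec X)).toSubmodule.subtype ?_
  exact C.linearIndependent_h.comp (![1, 2, 3, 4] : Fin 4 → Fin 6) (by decide)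

/-- The generators of `so(8)`. -/
noncomputable def so8Basis :
    LieAlgebra.Basis (Fin 4) (LieSubalgebra.lieSpan ℂ (so8 (rootVec X)) (Set.range C.so8h)) where
  A := cartanD4
  h := C.so8h
  e := so8e X
  f := so8f X
  cartan_eq_lieSpan := rfl
  span_ef := by
    rw [← lieSpan_preimage_eq_top C.so8_eq_lieSpan]
    congr 1
    ext x
    simp [so8e, so8f, Subtype.ext_iff]
  linInd := C.linearIndependent_so8h
  nondegen := by
    rw [Matrix.nondegenerate_iff_det_ne_zero]
    decide +kernel
  sl2 i :=
    { h_ne_zero := C.linearIndependent_so8h.ne_zero i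
      lie_e_f := Subtype.ext (C.lie_X_neg _ (so8_mem _ (dQ_mem i)).1)
      lie_h_e_nsmul := Subtype.ext (by
        change ⁅h (cx (rv (dQ i))), X (dQ i)⁆ = 2 • X (dQ i)
        rw [C.lie_hv_X, pr_self (so8_mem _ (dQ_mem i)).1, Int.cast_smul_eq_zsmul,
          ofNat_smul_eq_nsmul])
      lie_h_f_nsmul := Subtype.ext (by
        change ⁅h (cx (rv (dQ i))), X (-dQ i)⁆ = -(2 • X (-dQ i))
        rw [C.lie_hv_X, pr_neg_right, pr_self (so8_mem _ (dQ_mem i)).1, Int.cast_smul_eq_zsmul,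
          neg_smul, ofNat_smul_eq_nsmul]) }
  lie_h_h i j := Subtype.ext (C.lie_h_h _ _)
  lie_h_e i j := Subtype.ext (by
    change ⁅h (cx (rv (dQ j))), X (dQ i)⁆ = cartanD4 i j • X (dQ i)
    rw [C.lie_hv_X, pr_dQ, Int.cast_smul_eq_zsmul])
  lie_h_f i j := Subtype.ext (by
    change ⁅h (cx (rv (dQ j))), X (-dQ i)⁆ = -cartanD4 i j • X (-dQ i)
    rw [C.lie_hv_X, pr_neg_right, pr_dQ, Int.cast_smul_eq_zsmul])
  lie_e_f_ne i j hij := Subtype.ext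
    (C.lie_X_X_zero _ (so8_mem _ (dQ_mem i)).1 _ (neg_mem (so8_mem _ (dQ_mem j)).1)
      (pr_dQ_neg i j hij))

theorem h_cx_e_mem (i : Fin 4) : h (cx (e (i + 1))) ∈
    Submodule.span ℂ (Set.range fun i => (C.so8Basis.h i : g)) := by
  have hm : ∀ i, h (cx (rv (dQ i))) ∈ Submodule.span ℂ (Set.range fun i => (C.so8Basis.h i : g)) :=
    fun i => Submodule.subset_span ⟨i, rfl⟩
  -- The coefficients invert e₃ + e₄, e₃ - e₄, e₂ - e₃, e₁ - e₂, the simple roots in the order of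
  -- `dQ`.
  have key : e (i + 1) = ∑ j, (![![1/2, 1/2, 1, 1], ![1/2, 1/2, 1, 0], ![1/2, 1/2, 0, 0],
      ![1/2, -1/2, 0, 0]] i j : ℝ) • rv (dQ j) := by
    obtain ⟨h1, h2, h3, -, -, -, -, -, -, h10, -, -⟩ := e_sub_eq
    have d0 : rv (dQ 0) = e 3 + e 4 := h3.symm
    have d1 : rv (dQ 1) = e 3 - e 4 := h2.symm
    have d2 : rv (dQ 2) = e 2 - e 3 := h10.symm
    have d3 : rv (dQ 3) = e 1 - e 2 := h1.symm
    rw [Fin.sum_univ_four, d0, d1, d2, d3]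
    fin_cases i <;> simp <;> module
  have hsum : ∀ c : Fin 4 → ℝ, cx (∑ j, c j • rv (dQ j)) = ∑ j, (c j : ℂ) • cx (rv (dQ j)) := by
    intro c
    rw [Fin.sum_univ_four, Fin.sum_univ_four]
    simp only [cx_add, cx_smul]
  rw [key, hsum, map_sum]
  refine Submodule.sum_mem _ fun j _ => ?_
  rw [map_smul]
  exact Submodule.smul_mem _ _ (hm j)

/-- The element of `regularD4` has distinct nonzero eigenvalues on the 24 root vectors, and brackets
of opposite ones are nonzero coroots. -/
theorem so8_ideal_meets (I : LieIdeal ℂ (so8 (rootVec X))) (hI : I ≠ ⊥) :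
    ∃ x ∈ I, x ∈ LieSubalgebra.lieSpan ℂ (so8 (rootVec X)) (Set.range C.so8h) ∧ x ≠ 0 := by
  have hreg : h (cx (rv regularD4)) ∈ so8 (rootVec X) := by
    have e1 : regularD4 = 1 • dQ 0 + 6 • dQ 1 + 4 • dQ 2 + 10 • dQ 3 := by decide +kernel
    have hc : ∀ (n : ℕ) i, h (cx (rv (n • dQ i))) ∈ so8 (rootVec X) := fun n i => by
      rw [rv_nsmul, ← Nat.cast_smul_eq_nsmul ℝ, cx_smul, map_smul]
      exact LieSubalgebra.smul_mem _ _ (C.h_mem_so8 (dQ_mem i))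
    rw [e1, rv_add, rv_add, rv_add, cx_add, cx_add, cx_add, map_add, map_add, map_add]
    exact LieSubalgebra.add_mem _ (LieSubalgebra.add_mem _ (LieSubalgebra.add_mem _ (hc _ _)
      (hc _ _)) (hc _ _)) (hc _ _)
  let ST := {a : Q // a ∈ so8List}
  have : Fintype ST := Fintype.ofFinset so8List.toFinset fun _ => List.mem_toFinset
  let v : Fin 4 ⊕ ST → g := Sum.elim (fun i => h (cx (e (i + 1)))) fun a => X a
  let c : Fin 4 ⊕ ST → ℂ := Sum.elim (fun _ => 0) fun a => (pr regularD4 a : ℂ)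
  have hc0 : ∀ a : ST, c (.inr a) ≠ 0 := fun a => by
    have := pr_regularD4_ne_zero a a.2
    change (pr regularD4 a : ℂ) ≠ 0
    exact_mod_cast this
  obtain ⟨x, hx, hxK, hx0⟩ := exists_mem_ideal (S := so8 (rootVec X))
    ⟨h (cx (rv regularD4)), hreg⟩ v (by
      refine C.so8_le.trans (Submodule.span_mono ?_)
      rintro _ (⟨i, rfl⟩ | ⟨a, ha, rfl⟩)
      · exact ⟨.inl i, rfl⟩
      · exact ⟨.inr ⟨a, ha⟩, rfl⟩) c
    (by
      rintro (i | a)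
      · change ⁅h _, h _⁆ = (0 : ℂ) • _
        rw [C.lie_h_h, zero_smul]
      · exact C.lie_hv_X _ _)
    (by
      rintro (i | a) (j | b) hij hi
      · exact absurd rfl hi
      · exact absurd rfl hi
      · exact absurd hij (hc0 a)
      · have h1 : pr regularD4 a = pr regularD4 b := Int.cast_injective hij
        rw [Subtype.ext (List.inj_on_of_nodup_map regularD4_nodup a.2 b.2 h1)])
    (Submodule.span ℂ (Set.range fun i => (C.so8Basis.h i : g)))
    (by
      rintro (i | a) hi
      · exact C.h_cx_e_mem i
      · exact absurd hi (hc0 a))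
    (by
      rintro (i | a) hi
      · exact absurd rfl hi
      · have ha := so8_mem a a.2
        refine ⟨X (-a), X_mem_so8 (so8List_neg a a.2), ?_⟩
        change ⁅X a, X (-a)⁆ ∈ _ ∧ ⁅X a, X (-a)⁆ ≠ 0
        rw [C.lie_X_neg a ha.1]
        refine ⟨?_, fun h0 => ?_⟩
        · obtain ⟨h4, h5, h6⟩ := so8List_rv a.2
          have h7 : cx (rv a) = ∑ i : Fin 4, (rv a i.castSucc.castSucc.castSucc : ℂ) • cx (e (i + 1)) := by
            funext i
            rw [Fin.sum_univ_four]
            fin_cases i <;> simp [cx, e, h4, h5, h6]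
          rw [h7, map_sum]
          refine Submodule.sum_mem _ fun i _ => ?_
          rw [map_smul]
          exact Submodule.smul_mem _ _ (C.h_cx_e_mem i)
        · have h1 := C.form_h_h (cx_rv_mem a) (cx_rv_mem a)
          rw [h0, cx_rv_dot_cx_rv, pr_self ha.1] at h1
          simp [form] at h1)
    hI
  exact ⟨x, hx, mem_cartan_of_mem_span C.so8Basis hxK, hx0⟩

theorem nonempty_so8_lieEquiv :
    Nonempty (so8 (rootVec X) ≃ₗ⁅ℂ⁆ LieAlgebra.Orthogonal.so (Fin 8) ℂ) := by
  have := C.finiteDimensional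
  obtain ⟨φ⟩ := nonempty_so_lieEquiv C.so8Basis rfl C.so8_ideal_meets C.so8_decomposition.2
  exact ⟨φ.symm⟩

end Chev

end E6GS



namespace E6GS

/-! ### Lie algebras with a given Cartan matrix -/

section Relations

open LieSubalgebra Set

variable {ι : Type*} [Finite ι] {L : Type*} [LieRing L] [LieAlgebra ℂ L]

/-- Generators that satisfy the Chevalley relations. -/
noncomputable def basisOfRelations (A : Matrix ι ι ℤ) (hA : A.Nondegenerate) (hA2 : ∀ i, A i i = 2)
    (e f : ι → L) (he0 : ∀ i, e i ≠ 0) (he : ∀ i j, ⁅⁅e j, f j⁆, e i⁆ = A i j • e i)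
    (hf : ∀ i j, ⁅⁅e j, f j⁆, f i⁆ = -A i j • f i) (hef : ∀ i j, i ≠ j → ⁅e i, f j⁆ = 0)
    (hspan : lieSpan ℂ L (range e ∪ range f) = ⊤) :
    LieAlgebra.Basis ι (lieSpan ℂ L (range fun i => ⁅e i, f i⁆)) where
  A := A
  h := fun i => ⁅e i, f i⁆
  e := e
  f := f
  cartan_eq_lieSpan := rfl
  span_ef := hspan
  linInd := linearIndependent_of_relations hA he0 he
  nondegen := hA
  sl2 i :=
    { h_ne_zero := (linearIndependent_of_relations hA he0 he).ne_zero i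
      lie_e_f := rfl
      lie_h_e_nsmul := by rw [he, hA2, ofNat_smul_eq_nsmul]
      lie_h_f_nsmul := by rw [hf, hA2, neg_smul, ofNat_smul_eq_nsmul] }
  lie_h_h i j := by
    rw [← lie_skew, ← neg_eq_zero, neg_neg, leibniz_lie, he, hf, smul_lie, lie_smul, neg_smul,
      add_neg_cancel]
  lie_h_e := he
  lie_h_f := hf
  lie_e_f_ne := hef

/-- As the Cartan matrix is invertible, the nonzero Cartan element does not annihilate every e_i; so
I contains some e_i and hence h_i. Since no entry of the matrix vanishes, h_i recovers all e_j and
f_j. -/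
theorem ideal_eq_top {H : LieSubalgebra ℂ L} (b : LieAlgebra.Basis ι H)
    (hA : ∀ i j, b.A i j ≠ 0) {I : LieIdeal ℂ L} (hI : ∃ x ∈ I, x ∈ H ∧ x ≠ 0) : I = ⊤ := by
  classical
  have := Fintype.ofFinite ι
  obtain ⟨x, hxI, hxH, hx0⟩ := hI
  rw [← LieSubalgebra.mem_toSubmodule, b.coe_cartan_eq_span,
    Submodule.mem_span_range_iff_exists_fun] at hxH
  obtain ⟨c, rfl⟩ := hxH
  have hint : ∀ {n : ℤ} {y : L}, n ≠ 0 → n • y ∈ I → y ∈ I := fun {n y} hn hy => by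
    have h1 := I.smul_mem (n : ℂ)⁻¹ hy
    rwa [← Int.cast_smul_eq_zsmul ℂ, smul_smul, inv_mul_cancel₀ (Int.cast_ne_zero.mpr hn),
      one_smul] at h1
  obtain ⟨i, hi⟩ : ∃ i, b.e i ∈ I := by
    by_contra! hcon
    refine hx0 ?_
    have h1 : ∀ i, ∑ j, (b.A i j : ℂ) * c j = 0 := fun i => by
      by_contra h2
      refine hcon i ?_
      have h3 : ⁅∑ j, c j • b.h j, b.e i⁆ = (∑ j, (b.A i j : ℂ) * c j) • b.e i := by
        rw [sum_lie, Finset.sum_smul]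
        refine Finset.sum_congr rfl fun j _ => ?_
        rw [smul_lie, b.lie_h_e, ← Int.cast_smul_eq_zsmul ℂ, smul_smul, mul_comm]
      have h4 : ⁅∑ j, c j • b.h j, b.e i⁆ ∈ I := by
        rw [← lie_skew]; exact I.neg_mem (I.lie_mem hxI)
      rw [h3] at h4
      have h5 := I.smul_mem (∑ j, (b.A i j : ℂ) * c j)⁻¹ h4
      rwa [smul_smul, inv_mul_cancel₀ h2, one_smul] at h5
    have h4 : (b.A.map (Int.cast : ℤ → ℂ)).det ≠ 0 := by
      have h5 := Matrix.nondegenerate_iff_det_ne_zero.mp b.nondegen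
      have h6 : (b.A.map (Int.cast : ℤ → ℂ)).det = ((b.A.det : ℤ) : ℂ) :=
        (RingHom.map_det (Int.castRingHom ℂ) b.A).symm
      rw [h6]
      exact_mod_cast h5
    have h7 : c = 0 := Matrix.eq_zero_of_mulVec_eq_zero h4 (funext h1)
    simp [h7]
  have hh : b.h i ∈ I := by
    rw [← (b.sl2 i).lie_e_f, ← lie_skew]; exact I.neg_mem (I.lie_mem hi)
  have hle : lieSpan ℂ L (range b.e ∪ range b.f) ≤ I.toLieSubalgebra := by
    rw [lieSpan_le]
    rintro _ (⟨j, rfl⟩ | ⟨j, rfl⟩)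
    · refine hint (hA j i) ?_
      rw [← b.lie_h_e, ← lie_skew]; exact I.neg_mem (I.lie_mem hh)
    · refine hint (neg_ne_zero.mpr (hA j i)) ?_
      rw [← b.lie_h_f, ← lie_skew]; exact I.neg_mem (I.lie_mem hh)
  rw [b.span_ef] at hle
  rw [eq_top_iff]
  exact fun y _ => hle (by trivial : y ∈ (⊤ : LieSubalgebra ℂ L))

end Relations

/-! ### Formal linear combinations of the Chevalley generators -/

/-- The brackets with the Cartan subalgebra. -/
def hl (a : Q) : List ((ℤ × ℤ) × EG) := (List.finRange 6).map fun i => ((a.coord i, 0), .inl i)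

/-- The generator of the invariant part of `so(8)` that is attached to an orbit. -/
def g2l (a : Q) : List ((ℤ × ℤ) × EG) :=
  if lamQ a = a then [((1, 0), .inr a)]
  else [((1, 0), .inr a), ((1, 0), .inr (lamQ a)), ((1, 0), .inr (lamQ (lamQ a)))]

/-- Representatives of the orbits in the roots of `so(8)`. -/
def g2List : List Q := repList ++ fixList

/-- The simple roots of `g₂`. -/
def gQ (i : Fin 2) : Q := sQ (![3, 4] i)

/-- The vectors of the representation of dimension `7`. -/
def vl (i : Fin 7) : List ((ℤ × ℤ) × EG) :=
  if i = 3 then [((1, 0), .inl 2), ((-1, -1), .inl 4), ((0, 1), .inl 1)]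
  else
    let a : Q := ![(0,0,1,1,1,0), (0,0,0,1,1,0), (0,0,0,0,1,0), 0,
      (0,0,0,0,-1,0), (0,0,0,-1,-1,0), (0,0,-1,-1,-1,0)] i
    [((1, 0), .inr a), ((0, 1), .inr (lamQ a)), ((-1, -1), .inr (lamQ (lamQ a)))]

/-- An element of the Cartan subalgebra of `g₂` that separates the roots. -/
def regularG2 : Q := (0, 5, 5, 8, 5, 0)

theorem g2l_ok : ∀ a ∈ g2List, ∀ t ∈ g2l a, eok t.2 := by decide +kernel

theorem gQ_mem : ∀ i, gQ i ∈ g2List := by decide +kernel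

theorem gQ_neg_mem : ∀ i, -gQ i ∈ g2List := by decide +kernel

theorem g2List_neg : ∀ a ∈ g2List, -a ∈ g2List := by decide +kernel

theorem g2l_coef : ∀ a ∈ g2List, lcoef (.inr a) (g2l a) = (1, 0) := by decide +kernel

theorem g2List_mem : ∀ a ∈ g2List, a ∈ rootList ∧ a ∈ so8List := by
  set_option synthInstance.maxSize 1000 in
  set_option synthInstance.maxHeartbeats 200000 in
  decide +kernel

theorem vl_ok : ∀ i, ∀ t ∈ vl i, eok t.2 := by decide +kernel

/-- Folding of D₄: the central node gives the long simple root vector, the sum over the orbit of the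
three outer nodes the short one. Now b = -1, so τ is a primitive cube root of unity. -/
theorem g2_relation_e : ∀ i j, isNull (lbr (-1) ebr (lbr (-1) ebr (g2l (gQ j)) (g2l (-gQ j)))
    (g2l (gQ i)) ++ lsmul (-1) (-1, 0) (lsmul (-1) (CartanMatrix.G₂ i j, 0) (g2l (gQ i)))) = true := by
  decide +kernel

theorem g2_relation_f : ∀ i j, isNull (lbr (-1) ebr (lbr (-1) ebr (g2l (gQ j)) (g2l (-gQ j)))
    (g2l (-gQ i)) ++ lsmul (-1) (-1, 0) (lsmul (-1) (-CartanMatrix.G₂ i j, 0) (g2l (-gQ i)))) =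
      true := by
  decide +kernel

theorem g2_relation_ef : ∀ i j, i ≠ j →
    isNull (lbr (-1) ebr (g2l (gQ i)) (g2l (-gQ j))) = true := by
  decide +kernel

theorem regularG2_nodup : (g2List.map (pr regularG2)).Nodup := by decide +kernel

theorem pr_regularG2_ne_zero : ∀ a ∈ g2List, pr regularG2 a ≠ 0 := by decide +kernel

theorem g2_lie_regular : ∀ a ∈ g2List, isNull (lbr (-1) ebr (hl regularG2) (g2l a) ++
    lsmul (-1) (-1, 0) (lsmul (-1) (pr regularG2 a, 0) (g2l a))) = true := by
  decide +kernel

theorem g2_lie_neg_lie : ∀ a ∈ g2List, isNull (lbr (-1) ebr (lbr (-1) ebr (g2l a) (g2l (-a))) (g2l a)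
    ++ lsmul (-1) (-1, 0) (lsmul (-1) (2, 0) (g2l a))) = true := by
  decide +kernel

/-- The sum of an orbit. -/
def orbitSum (a : Q) : Q := if lamQ a = a then a else a + lamQ a + lamQ (lamQ a)

/-- The bracket is the coroot given by the orbit sum. As the orbit sum is λ₁-invariant in D₄, its
central coordinate and one outer coordinate are its coefficients in the two simple coroots. -/
theorem g2_lie_neg : ∀ a ∈ g2List, isNull (lbr (-1) ebr (g2l a) (g2l (-a)) ++
    lsmul (-1) (-1, 0) (lsmul (-1) ((orbitSum a).coord 3, 0) (lbr (-1) ebr (g2l (gQ 0)) (g2l (-gQ 0)))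
      ++ lsmul (-1) ((orbitSum a).coord 1, 0) (lbr (-1) ebr (g2l (gQ 1)) (g2l (-gQ 1))))) = true := by
  decide +kernel

/-- The successive brackets that yield the root vectors of `g₂`. -/
def g2Steps : List (Q × Q × Q × ℤ) :=
  [(gQ 0, (0,0,0,0,1,0), (0,0,0,1,1,0), -1), (gQ 1, (0,0,0,1,1,0), (0,0,1,1,1,0), 2),
   (gQ 1, (0,0,1,1,1,0), (0,1,1,1,1,0), 3), (gQ 0, (0,1,1,1,1,0), (0,1,1,2,1,0), 1),
   (-gQ 0, (0,0,0,0,-1,0), (0,0,0,-1,-1,0), 1), (-gQ 1, (0,0,0,-1,-1,0), (0,0,-1,-1,-1,0), -2),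
   (-gQ 1, (0,0,-1,-1,-1,0), (0,-1,-1,-1,-1,0), -3),
   (-gQ 0, (0,-1,-1,-1,-1,0), (0,-1,-1,-2,-1,0), -1)]

/-- The factors ±1, ±2, ±3 reflect the positions in the root strings of g₂; being nonzero, they can
be divided out. -/
theorem g2Steps_spec : ∀ s ∈ g2Steps, s.1 ∈ g2List ∧ s.2.1 ∈ g2List ∧ s.2.2.2 ≠ 0 ∧
    isNull (lbr (-1) ebr (g2l s.1) (g2l s.2.1) ++
      lsmul (-1) (-1, 0) (lsmul (-1) (s.2.2.2, 0) (g2l s.2.2.1))) = true := by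
  decide +kernel

/-- The product of x + yτ with its conjugate (x - y) - yτ is x² - xy + y², a positive definite form.
-/
theorem qnum_ne_zero {τ : ℂ} (hτ : τ * τ = ((-1 : ℤ) : ℂ) * τ - 1) {x : ℤ × ℤ} (hx : x ≠ 0) :
    qnum τ x ≠ 0 := by
  intro h0
  have h1 := qnum_qmul hτ x (x.1 - x.2, -x.2)
  rw [h0, zero_mul] at h1
  have h2 : qmul (-1) x (x.1 - x.2, -x.2) = (x.1 * x.1 - x.1 * x.2 + x.2 * x.2, 0) := by
    simp only [qmul, Prod.mk.injEq]
    constructor <;> ring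
  rw [h2] at h1
  simp only [qnum, Int.cast_zero, zero_mul, add_zero] at h1
  have h3 : x.1 * x.1 - x.1 * x.2 + x.2 * x.2 = 0 := by exact_mod_cast h1
  have h4 : x.1 = 0 := by nlinarith [sq_nonneg (x.1 - 2 * x.2), sq_nonneg x.1]
  have h5 : x.2 = 0 := by nlinarith [sq_nonneg (x.2 - 2 * x.1), sq_nonneg x.2]
  exact hx (Prod.ext h4 h5)

theorem ω_mul_self : ω * ω = ((-1 : ℤ) : ℂ) * ω - 1 := by
  push_cast; linear_combination one_add_ω

theorem chi_inv_mul_self {k : ZMod 3} (hk : k ≠ 0) :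
    (chi k)⁻¹ * (chi k)⁻¹ = ((-1 : ℤ) : ℂ) * (chi k)⁻¹ - 1 := by
  rw [chi_inv]; push_cast
  linear_combination (chi k) * chi_pow_three k + one_add_chi hk

end E6GS



namespace E6GS

variable {g : Type*} [LieRing g] [LieAlgebra ℂ g]

/-! ### Chevalley generators of the invariant part of so(8). -/

namespace Chev

variable {h : (Fin 7 → ℂ) →ₗ[ℂ] g} {X : Q → g} (C : Chev h X)
include C

omit C in
theorem lval_hl (τ : ℂ) (a : Q) : lval τ (eev h X) (hl a) = h (cx (rv a)) := by
  rw [h_rv, lval, hl, List.map_map, ← List.ofFn_eq_map, List.sum_ofFn]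
  refine Finset.sum_congr rfl fun i _ => ?_
  simp [qnum, eev]

omit C in
theorem lval_g2l (τ : ℂ) (a : Q) :
    lval τ (eev h X) (g2l a) = if lamQ a = a then X a else orb X 1 a := by
  unfold g2l
  split_ifs with ha
  · simp [lval, qnum, eev]
  · simp [lval, qnum, eev, orb, add_assoc]

omit C in
theorem g2l_mem_so8Fixed (C : Chev h X) (τ : ℂ) {a : Q} (ha : a ∈ g2List) :
    lval τ (eev h X) (g2l a) ∈ so8Fixed (rootVec X) C.aut := by
  have h0 := (g2List_mem a ha).2
  have h1 := (so8_mem a h0).2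
  have h2 := (so8_mem _ h1).2
  rw [lval_g2l]
  split_ifs with hl
  · exact ⟨X_mem_so8 h0, by change C.aut (X a) = X a; rw [C.aut_X, hl]⟩
  · refine ⟨?_, ?_⟩
    · exact LieSubalgebra.add_mem _ (LieSubalgebra.add_mem _ (X_mem_so8 h0)
        (LieSubalgebra.smul_mem _ _ (X_mem_so8 h1))) (LieSubalgebra.smul_mem _ _ (X_mem_so8 h2))
    · change C.aut _ = _
      rw [C.aut_orb (one_pow 3), one_pow, one_smul]

theorem regularG2_mem : h (cx (rv regularG2)) ∈ so8Fixed (rootVec X) C.aut := by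
  rw [C.h_mem_so8Fixed_iff (cx_rv_mem _)]
  have hd : dq regularG2 = ![10, 6, 4, 0, 0, 0, 0] := by decide +kernel
  refine ⟨?_, ?_, ?_, ?_, ?_⟩ <;> simp [cx, rv, dv, hd]
  norm_num

/-- The generators of `g₂`. -/
noncomputable def g2e (i : Fin 2) : so8Fixed (rootVec X) C.aut :=
  ⟨lval ω (eev h X) (g2l (gQ i)), C.g2l_mem_so8Fixed ω (gQ_mem i)⟩

/-- The generators of `g₂`. -/
noncomputable def g2f (i : Fin 2) : so8Fixed (rootVec X) C.aut :=
  ⟨lval ω (eev h X) (g2l (-gQ i)), C.g2l_mem_so8Fixed ω (gQ_neg_mem i)⟩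

omit C in
theorem lval_lsmul_int {τ : ℂ} (hτ : τ * τ = ((-1 : ℤ) : ℂ) * τ - 1) (n : ℤ)
    (l : List ((ℤ × ℤ) × EG)) :
    lval τ (eev h X) (lsmul (-1) (n, 0) l) = n • lval τ (eev h X) l := by
  rw [lval_lsmul hτ, ← Int.cast_smul_eq_zsmul ℂ]
  simp [qnum]

theorem lie_lval {τ : ℂ} (hτ : τ * τ = ((-1 : ℤ) : ℂ) * τ - 1) {l m n : List ((ℤ × ℤ) × EG)}
    (hl : ∀ t ∈ l, eok t.2) (hm : ∀ t ∈ m, eok t.2)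
    (h0 : isNull (lbr (-1) ebr l m ++ lsmul (-1) (-1, 0) n) = true) :
    ⁅lval τ (eev h X) l, lval τ (eev h X) m⁆ = lval τ (eev h X) n :=
  lie_lval_eq hτ C.lie_eev hl hm h0

theorem lie_lval_lval {τ : ℂ} (hτ : τ * τ = ((-1 : ℤ) : ℂ) * τ - 1)
    {l m n p : List ((ℤ × ℤ) × EG)} (hl : ∀ t ∈ l, eok t.2) (hm : ∀ t ∈ m, eok t.2)
    (hn : ∀ t ∈ n, eok t.2) (hlm : ∀ t ∈ lbr (-1) ebr l m, eok t.2)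
    (h0 : isNull (lbr (-1) ebr (lbr (-1) ebr l m) n ++ lsmul (-1) (-1, 0) p) = true) :
    ⁅⁅lval τ (eev h X) l, lval τ (eev h X) m⁆, lval τ (eev h X) n⁆ = lval τ (eev h X) p := by
  rw [← lval_lbr hτ C.lie_eev hl hm]
  exact C.lie_lval hτ hlm hn h0

end Chev

theorem g2_lbr_ok : ∀ a ∈ g2List, ∀ t ∈ lbr (-1) ebr (g2l a) (g2l (-a)), eok t.2 := by
  decide +kernel

namespace Chev

variable {h : (Fin 7 → ℂ) →ₗ[ℂ] g} {X : Q → g} (C : Chev h X)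
include C

/-- The fixed part is spanned by the 14 vectors of `basisG2`; the two coroots are brackets of
generators, and `g2Steps` reaches the remaining root vectors. -/
theorem g2_span : LieSubalgebra.lieSpan ℂ (so8Fixed (rootVec X) C.aut)
    (Set.range C.g2e ∪ Set.range C.g2f) = ⊤ := by
  set s : Set g := (Set.range fun i => (C.g2e i : g)) ∪ Set.range fun i => (C.g2f i : g) with hs
  have hS : so8Fixed (rootVec X) C.aut = LieSubalgebra.lieSpan ℂ g s := by
    apply le_antisymm
    · set M := LieSubalgebra.lieSpan ℂ g s with hM
      have he : ∀ i, lval ω (eev h X) (g2l (gQ i)) ∈ M := fun i =>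
        LieSubalgebra.subset_lieSpan (Or.inl ⟨i, rfl⟩)
      have hf : ∀ i, lval ω (eev h X) (g2l (-gQ i)) ∈ M := fun i =>
        LieSubalgebra.subset_lieSpan (Or.inr ⟨i, rfl⟩)
      have hlie : ∀ i, isNull (lbr (-1) ebr (g2l (gQ i)) (g2l (-gQ i)) ++
          lsmul (-1) (-1, 0) (hl (orbitSum (gQ i)))) = true := by decide +kernel
      have hh : ∀ i, h (cx (rv (orbitSum (gQ i)))) ∈ M := fun i => by
        have := M.lie_mem (he i) (hf i)
        rwa [C.lie_lval ω_mul_self (g2l_ok _ (gQ_mem i)) (g2l_ok _ (gQ_neg_mem i))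
          (n := hl (orbitSum (gQ i))) (hlie i), lval_hl] at this
      have step : ∀ s ∈ g2Steps, lval ω (eev h X) (g2l s.1) ∈ M →
          lval ω (eev h X) (g2l s.2.1) ∈ M → lval ω (eev h X) (g2l s.2.2.1) ∈ M := by
        intro s hs h1 h2
        obtain ⟨k1, k2, k3, k4⟩ := g2Steps_spec s hs
        have h3 := M.lie_mem h1 h2
        rw [C.lie_lval ω_mul_self (g2l_ok _ k1) (g2l_ok _ k2) k4, lval_lsmul_int ω_mul_self,
          ← Int.cast_smul_eq_zsmul ℂ] at h3
        have h4 := M.smul_mem (s.2.2.2 : ℂ)⁻¹ h3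
        rwa [smul_smul, inv_mul_cancel₀ (Int.cast_ne_zero.mpr k3), one_smul] at h4
      have hall : ∀ a ∈ g2List, lval ω (eev h X) (g2l a) ∈ M := by
        have a0 := he 0
        have a1 := he 1
        have b0 := hf 0
        have b1 := hf 1
        have a2 := step _ (by decide : (gQ 0, (0,0,0,0,1,0), (0,0,0,1,1,0), -1) ∈ g2Steps) a0 a1
        have a3 := step _ (by decide : (gQ 1, (0,0,0,1,1,0), (0,0,1,1,1,0), 2) ∈ g2Steps) a1 a2
        have a4 := step _ (by decide : (gQ 1, (0,0,1,1,1,0), (0,1,1,1,1,0), 3) ∈ g2Steps) a1 a3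
        have a5 := step _ (by decide : (gQ 0, (0,1,1,1,1,0), (0,1,1,2,1,0), 1) ∈ g2Steps) a0 a4
        have b2 := step _ (by decide : (-gQ 0, (0,0,0,0,-1,0), (0,0,0,-1,-1,0), 1) ∈ g2Steps) b0 b1
        have b3 := step _
          (by decide : (-gQ 1, (0,0,0,-1,-1,0), (0,0,-1,-1,-1,0), -2) ∈ g2Steps) b1 b2
        have b4 := step _
          (by decide : (-gQ 1, (0,0,-1,-1,-1,0), (0,-1,-1,-1,-1,0), -3) ∈ g2Steps) b1 b3
        have b5 := step _
          (by decide : (-gQ 0, (0,-1,-1,-1,-1,0), (0,-1,-1,-2,-1,0), -1) ∈ g2Steps) b0 b4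
        have hcover : ∀ a ∈ g2List, a ∈ [gQ 0, gQ 1, (0,0,0,1,1,0), (0,0,1,1,1,0), (0,1,1,1,1,0),
          (0,1,1,2,1,0), -gQ 0, -gQ 1, (0,0,0,-1,-1,0), (0,0,-1,-1,-1,0), (0,-1,-1,-1,-1,0),
          (0,-1,-1,-2,-1,0)] := by decide +kernel
        intro a ha
        have := hcover a ha
        simp only [List.mem_cons, List.not_mem_nil, or_false] at this
        rcases this with rfl | rfl | rfl | rfl | rfl | rfl | rfl | rfl | rfl | rfl | rfl | rfl <;>
          assumption
      have hle : (so8Fixed (rootVec X) C.aut).toSubmodule ≤ M.toSubmodule := by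
        have h1 : (so8Fixed (rootVec X) C.aut).toSubmodule =
            (so8 (rootVec X)).toSubmodule ⊓ grade C.aut 0 := by
          rw [← fixedSubalgebra_toSubmodule]; rfl
        rw [h1, ← C.so8_decomposition.1.1, Submodule.span_le]
        rintro _ ⟨i | ⟨v, hv⟩ | ⟨v, hv⟩, rfl⟩
        · have e1 : ((0,0,0,3,0,0) : Q) = 3 • orbitSum (gQ 0) := by decide +kernel
          have e2 : ((0,1,1,0,1,0) : Q) = orbitSum (gQ 1) := by decide +kernel
          rw [basisG2_inl, e1, e2]
          fin_cases i
          · change h (cx (rv (3 • orbitSum (gQ 0)))) ∈ M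
            rw [rv_nsmul, ← Nat.cast_smul_eq_nsmul ℝ, cx_smul, map_smul]
            exact M.smul_mem _ (hh 0)
          · exact hh 1
        · obtain ⟨a, ha, rfl⟩ := exists_rep hv
          have h2 := hall a (List.mem_append_left _ ha)
          rw [lval_g2l, if_neg (orbit_free a (List.mem_append_left _ ha)).2] at h2
          change E0 (rootVec X) (rv a) ∈ M
          rwa [E0_rv]
        · obtain ⟨a, ha, rfl⟩ := exists_fix hv
          have h2 := hall a (List.mem_append_right _ ha)
          rw [lval_g2l, if_pos (fix_mem a ha).2.2] at h2
          change rootVec X (rv a) ∈ M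
          rwa [rootVec_rv]
      exact hle
    · rw [LieSubalgebra.lieSpan_le]
      rintro _ (⟨i, rfl⟩ | ⟨i, rfl⟩)
      exacts [(C.g2e i).2, (C.g2f i).2]
  rw [← lieSpan_preimage_eq_top hS]
  congr 1
  ext x
  simp only [hs, Set.mem_preimage, Set.mem_union, Set.mem_range, Subtype.ext_iff]

/-- The Chevalley generators of `g₂`. -/
noncomputable def g2Basis : LieAlgebra.Basis (Fin 2) (LieSubalgebra.lieSpan ℂ
    (so8Fixed (rootVec X) C.aut) (Set.range fun i => ⁅C.g2e i, C.g2f i⁆)) :=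
  basisOfRelations CartanMatrix.G₂ (by rw [Matrix.nondegenerate_iff_det_ne_zero]; decide +kernel)
    (by decide) C.g2e C.g2f
    (fun i h0 => C.lval_eev_ne_zero (τ := ω) (g2List_mem _ (gQ_mem i)).1 (g2l_ok _ (gQ_mem i))
      (g2l_coef _ (gQ_mem i)) (congrArg Subtype.val h0))
    (fun i j => Subtype.ext ((C.lie_lval_lval ω_mul_self (g2l_ok _ (gQ_mem j))
      (g2l_ok _ (gQ_neg_mem j)) (g2l_ok _ (gQ_mem i)) (g2_lbr_ok _ (gQ_mem j))
      (g2_relation_e i j)).trans (lval_lsmul_int ω_mul_self _ _)))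
    (fun i j => Subtype.ext ((C.lie_lval_lval ω_mul_self (g2l_ok _ (gQ_mem j))
      (g2l_ok _ (gQ_neg_mem j)) (g2l_ok _ (gQ_neg_mem i)) (g2_lbr_ok _ (gQ_mem j))
      (g2_relation_f i j)).trans (lval_lsmul_int ω_mul_self _ _)))
    (fun i j hij => Subtype.ext (by
      change ⁅lval ω (eev h X) (g2l (gQ i)), lval ω (eev h X) (g2l (-gQ j))⁆ = 0
      rw [← lval_lbr ω_mul_self C.lie_eev (g2l_ok _ (gQ_mem i)) (g2l_ok _ (gQ_neg_mem j)),
        lval_eq_zero (g2_relation_ef i j hij)]))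
    C.g2_span

end Chev

end E6GS



namespace E6GS

variable {g : Type*} [LieRing g] [LieAlgebra ℂ g]

/-! ### Weights and ladder operators of the 7-dimensional modules. -/

/-- The weights of the representation of dimension `7` on the regular element. -/
def vwt : Fin 7 → ℤ := ![5, 3, 2, 0, -2, -3, -5]

theorem vwt_injective : Function.Injective vwt := by decide +kernel

theorem vl_weight : ∀ i, isNull (lbr (-1) ebr (hl regularG2) (vl i) ++
    lsmul (-1) (-1, 0) (lsmul (-1) (vwt i, 0) (vl i))) = true := by decide +kernel

/-- The generators that lead from a vector of the chain to the following one. -/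
def vdown : Fin 6 → Fin 2 := ![1, 0, 1, 1, 0, 1]

/-- All factors are nonzero in ℤ[τ], so the chain can be traversed in both directions. The same
table serves both modules, with τ = ω² and τ = ω. -/
theorem vl_down : ∀ i : Fin 6, isNull (lbr (-1) ebr (g2l (-gQ (vdown i))) (vl i.castSucc) ++
    lsmul (-1) (-1, 0) (lsmul (-1) (![(0, -1), (-1, 0), (0, -1), (-2, -2), (1, 0), (-1, -1)] i)
      (vl i.succ))) = true := by decide +kernel

theorem vl_up : ∀ i : Fin 6, isNull (lbr (-1) ebr (g2l (gQ (vdown i))) (vl i.succ) ++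
    lsmul (-1) (-1, 0) (lsmul (-1) (![(1, 1), (-1, 0), (2, 2), (0, 1), (1, 0), (0, 1)] i)
      (vl i.castSucc))) = true := by decide +kernel

theorem vl_highest : ∀ j, isNull (lbr (-1) ebr (g2l (gQ j)) (vl 0)) = true := by decide +kernel

theorem vl_highest_weight : ∀ j, isNull (lbr (-1) ebr (lbr (-1) ebr (g2l (gQ j)) (g2l (-gQ j)))
    (vl 0) ++ lsmul (-1) (-1, 0) (lsmul (-1) (if j = 1 then 1 else 0, 0) (vl 0))) = true := by
  decide +kernel

theorem hl_ok (a : Q) : ∀ t ∈ hl a, eok t.2 := by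
  intro t ht
  obtain ⟨i, -, rfl⟩ := List.mem_map.mp ht
  trivial

/-- The roots that occur in the representation of dimension `7`. -/
def vQ (i : Fin 7) : Q :=
  ![(0,0,1,1,1,0), (0,0,0,1,1,0), (0,0,0,0,1,0), 0,
    (0,0,0,0,-1,0), (0,0,0,-1,-1,0), (0,0,-1,-1,-1,0)] i

theorem vQ_mem : ∀ i, i ≠ 3 → vQ i ∈ repList := by decide +kernel

theorem exists_vQ : ∀ a ∈ repList, ∃ i, i ≠ 3 ∧ vQ i = a := by
  intro a ha
  simp only [repList, List.mem_cons, List.not_mem_nil, or_false] at ha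
  rcases ha with rfl | rfl | rfl | rfl | rfl | rfl
  exacts [⟨2, by decide, rfl⟩, ⟨1, by decide, rfl⟩, ⟨0, by decide, rfl⟩, ⟨4, by decide, rfl⟩,
    ⟨5, by decide, rfl⟩, ⟨6, by decide, rfl⟩]

namespace Chev

variable {h : (Fin 7 → ℂ) →ₗ[ℂ] g} {X : Q → g} (C : Chev h X)
include C

omit C in
theorem so8Fixed_toSubmodule (E : (Fin 7 → ℝ) → g) (Λ : g ≃ₗ⁅ℂ⁆ g) :
    (so8Fixed E Λ).toSubmodule = (so8 E).toSubmodule ⊓ grade Λ 0 := by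
  rw [← fixedSubalgebra_toSubmodule]; rfl

/-- The element of `regularG2` separates the twelve roots. The bracket of opposite root vectors is
nonzero because it acts on the first of them by 2. -/
theorem g2_ideal_meets (I : LieIdeal ℂ (so8Fixed (rootVec X) C.aut)) (hI : I ≠ ⊥) :
    ∃ x ∈ I, x ∈ LieSubalgebra.lieSpan ℂ (so8Fixed (rootVec X) C.aut)
      (Set.range fun i => ⁅C.g2e i, C.g2f i⁆) ∧ x ≠ 0 := by
  let ST := {a : Q // a ∈ g2List}
  have : Fintype ST := Fintype.ofFinset g2List.toFinset fun _ => List.mem_toFinset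
  let v : Fin 2 ⊕ ST → g := Sum.elim (fun i => ((⁅C.g2e i, C.g2f i⁆ : so8Fixed (rootVec X) C.aut) : g))
    fun a => lval ω (eev h X) (g2l a)
  let c : Fin 2 ⊕ ST → ℂ := Sum.elim (fun _ => 0) fun a => (pr regularG2 a : ℂ)
  have hc0 : ∀ a : ST, c (.inr a) ≠ 0 := fun a => by
    have := pr_regularG2_ne_zero a a.2
    change (pr regularG2 a : ℂ) ≠ 0
    exact_mod_cast this
  have hh : ∀ i, ((⁅C.g2e i, C.g2f i⁆ : so8Fixed (rootVec X) C.aut) : g) =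
      h (cx (rv (orbitSum (gQ i)))) := fun i => by
    have hlie : ∀ i, isNull (lbr (-1) ebr (g2l (gQ i)) (g2l (-gQ i)) ++
        lsmul (-1) (-1, 0) (hl (orbitSum (gQ i)))) = true := by decide +kernel
    rw [← lval_hl ω]
    exact C.lie_lval ω_mul_self (g2l_ok _ (gQ_mem i)) (g2l_ok _ (gQ_neg_mem i)) (hlie i)
  obtain ⟨x, hx, hxK, hx0⟩ := exists_mem_ideal (S := so8Fixed (rootVec X) C.aut)
    ⟨h (cx (rv regularG2)), C.regularG2_mem⟩ v (by
      rw [so8Fixed_toSubmodule, ← C.so8_decomposition.1.1, Submodule.span_le]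
      rintro _ ⟨i | ⟨w, hw⟩ | ⟨w, hw⟩, rfl⟩
      · have e1 : ((0,0,0,3,0,0) : Q) = 3 • orbitSum (gQ 0) := by decide +kernel
        have e2 : ((0,1,1,0,1,0) : Q) = orbitSum (gQ 1) := by decide +kernel
        rw [basisG2_inl, e1, e2]
        fin_cases i
        · change h (cx (rv (3 • orbitSum (gQ 0)))) ∈ Submodule.span ℂ (Set.range v)
          rw [rv_nsmul, ← Nat.cast_smul_eq_nsmul ℝ, cx_smul, map_smul, ← hh]
          exact Submodule.smul_mem _ _ (Submodule.subset_span ⟨.inl 0, rfl⟩)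
        · change h (cx (rv (orbitSum (gQ 1)))) ∈ Submodule.span ℂ (Set.range v)
          rw [← hh]
          exact Submodule.subset_span ⟨.inl 1, rfl⟩
      · obtain ⟨a, ha, rfl⟩ := exists_rep hw
        refine Submodule.subset_span ⟨.inr ⟨a, List.mem_append_left _ ha⟩, ?_⟩
        change lval ω (eev h X) (g2l a) = E0 (rootVec X) (rv a)
        rw [lval_g2l, if_neg (orbit_free a (List.mem_append_left _ ha)).2, E0_rv]
      · obtain ⟨a, ha, rfl⟩ := exists_fix hw
        refine Submodule.subset_span ⟨.inr ⟨a, List.mem_append_right _ ha⟩, ?_⟩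
        change lval ω (eev h X) (g2l a) = rootVec X (rv a)
        rw [lval_g2l, if_pos (fix_mem a ha).2.2, rootVec_rv]) c
    (by
      rintro (i | a)
      · change ⁅h _, ((⁅C.g2e i, C.g2f i⁆ : so8Fixed (rootVec X) C.aut) : g)⁆ = (0 : ℂ) • _
        rw [hh, C.lie_h_h, zero_smul]
      · change ⁅h _, lval ω (eev h X) (g2l a)⁆ = (pr regularG2 a : ℂ) • lval ω (eev h X) (g2l a)
        rw [← lval_hl ω, C.lie_lval ω_mul_self (hl_ok _) (g2l_ok a a.2) (g2_lie_regular a a.2),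
          lval_lsmul_int ω_mul_self, Int.cast_smul_eq_zsmul])
    (by
      rintro (i | a) (j | b) hij hi
      · exact absurd rfl hi
      · exact absurd rfl hi
      · exact absurd hij (hc0 a)
      · have h1 : pr regularG2 a = pr regularG2 b := Int.cast_injective hij
        rw [Subtype.ext (List.inj_on_of_nodup_map regularG2_nodup a.2 b.2 h1)])
    (Submodule.span ℂ (Set.range fun i => (C.g2Basis.h i : g)))
    (by
      rintro (i | a) hi
      · exact Submodule.subset_span ⟨i, rfl⟩
      · exact absurd hi (hc0 a))
    (by
      rintro (i | a) hi
      · exact absurd rfl hi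
      · have hn := g2List_neg a a.2
        refine ⟨lval ω (eev h X) (g2l (-a)), C.g2l_mem_so8Fixed ω hn, ?_, fun h0 => ?_⟩
        · change ⁅lval ω (eev h X) (g2l a), lval ω (eev h X) (g2l (-a))⁆ ∈ _
          have hm : ∀ i, lval ω (eev h X) (lbr (-1) ebr (g2l (gQ i)) (g2l (-gQ i))) ∈
              Submodule.span ℂ (Set.range fun i => (C.g2Basis.h i : g)) := fun i => by
            rw [lval_lbr ω_mul_self C.lie_eev (g2l_ok _ (gQ_mem i)) (g2l_ok _ (gQ_neg_mem i))]
            exact Submodule.subset_span ⟨i, rfl⟩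
          rw [C.lie_lval ω_mul_self (g2l_ok _ a.2) (g2l_ok _ hn) (g2_lie_neg a a.2), lval_append,
            lval_lsmul_int ω_mul_self, lval_lsmul_int ω_mul_self]
          exact Submodule.add_mem _ (zsmul_mem (hm 0) _) (zsmul_mem (hm 1) _)
        · have h1 := C.lie_lval_lval ω_mul_self (g2l_ok _ a.2) (g2l_ok _ hn) (g2l_ok _ a.2)
            (g2_lbr_ok a a.2) (g2_lie_neg_lie a a.2)
          change ⁅lval ω (eev h X) (g2l a), lval ω (eev h X) (g2l (-a))⁆ = 0 at h0
          rw [h0, zero_lie, lval_lsmul_int ω_mul_self, ofNat_smul_eq_nsmul] at h1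
          have h2 : lval ω (eev h X) (g2l a) = 0 := by
            rw [← Nat.cast_smul_eq_nsmul ℂ] at h1
            exact (smul_eq_zero.mp h1.symm).resolve_left (by norm_num)
          exact C.lval_eev_ne_zero (g2List_mem a a.2).1 (g2l_ok a a.2) (g2l_coef a a.2) h2)
    hI
  exact ⟨x, hx, mem_cartan_of_mem_span C.g2Basis hxK, hx0⟩

theorem isOfType_so8Fixed : IsOfType CartanMatrix.G₂ (so8Fixed (rootVec X) C.aut) := by
  have := C.finiteDimensional
  have hA : ∀ i j, C.g2Basis.A i j ≠ 0 := by
    intro i j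
    change CartanMatrix.G₂ i j ≠ 0
    fin_cases i <;> fin_cases j <;> simp [CartanMatrix.G₂]
  refine ⟨inferInstance, ⟨fun I => ?_, fun hab => ?_⟩, _, C.g2Basis, rfl⟩
  · by_cases hI : I = ⊥
    · exact Or.inl hI
    · exact Or.inr (ideal_eq_top C.g2Basis hA (C.g2_ideal_meets I hI))
  · refine (C.g2Basis.sl2 0).h_ne_zero ?_
    rw [← (C.g2Basis.sl2 0).lie_e_f]
    exact hab.trivial _ _

/-! ### The representations of dimension `7` -/

omit C in
theorem lval_vl {k : ZMod 3} (hk : k ≠ 0) (i : Fin 7) : lval (chi k)⁻¹ (eev h X) (vl i) =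
    if i = 3 then h (cx (rv (sQ 2)) + chi k • cx (rv (sQ 4)) + chi k ^ 2 • cx (rv (sQ 1)))
    else orb X (chi k)⁻¹ (vQ i) := by
  have h1 : qnum (chi k)⁻¹ (-1, -1) = chi k := by
    simp only [qnum]; rw [chi_inv]; push_cast; linear_combination -one_add_chi hk
  have h2 : qnum (chi k)⁻¹ (-1, -1) = ((chi k)⁻¹) ^ 2 := by
    rw [h1, chi_inv]; linear_combination (-chi k) * chi_pow_three k
  have h3 : qnum (chi k)⁻¹ (0, 1) = (chi k)⁻¹ := by simp [qnum]
  have h4 : qnum (chi k)⁻¹ (1, 0) = 1 := by simp [qnum]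
  unfold vl
  split_ifs with hi
  · simp only [lval, List.map_cons, List.map_nil, List.sum_cons, List.sum_nil, add_zero, h1, h3, h4,
      eev, map_add, map_smul, one_smul, add_assoc]
    rw [chi_inv]
  · simp only [lval, List.map_cons, List.map_nil, List.sum_cons, List.sum_nil, add_zero, h2, h3, h4,
      eev, one_smul, add_assoc, orb]
    rfl

theorem span_vl {k : ZMod 3} (hk : k ≠ 0) :
    Submodule.span ℂ (Set.range fun i => lval (chi k)⁻¹ (eev h X) (vl i)) =
      (so8Grade (rootVec X) C.aut k).toSubmodule := by
  have hd : (so8Grade (rootVec X) C.aut k).toSubmodule =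
      Submodule.span ℂ (Set.range (basis7 h (rootVec X) k)) := by
    obtain ⟨⟨-, h1, h2⟩, -⟩ := C.so8_decomposition
    have : k = 0 ∨ k = 1 ∨ k = 2 := by revert k; decide
    rcases this with rfl | rfl | rfl
    · exact absurd rfl hk
    · exact h1.symm
    · exact h2.symm
  rw [hd]
  apply le_antisymm
  · rw [Submodule.span_le]
    rintro _ ⟨i, rfl⟩
    have key : ∀ (x : g), (1 / (√3 : ℂ)) • x ∈ Submodule.span ℂ (Set.range (basis7 h (rootVec X) k)) →
        x ∈ Submodule.span ℂ (Set.range (basis7 h (rootVec X) k)) := fun x hx => by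
      have := Submodule.smul_mem _ (1 / (√3 : ℂ))⁻¹ hx
      rwa [smul_smul, inv_mul_cancel₀ one_div_sqrt_three_ne_zero, one_smul] at this
    refine key _ ?_
    change (1 / (√3 : ℂ)) • lval (chi k)⁻¹ (eev h X) (vl i) ∈ _
    rw [lval_vl hk]
    split_ifs with hi
    · rw [← map_smul, ← hα₂_eq]
      exact Submodule.subset_span ⟨.inl (), rfl⟩
    · rw [← t_rv]
      exact Submodule.subset_span ⟨.inr ⟨rv (vQ i), by
        rw [orbitReps_eq]; exact ⟨_, vQ_mem i hi, rfl⟩⟩, rfl⟩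
  · rw [Submodule.span_le]
    rintro _ ⟨_ | ⟨v, hv⟩, rfl⟩
    · change hα₂ h k ∈ _
      rw [hα₂_eq, map_smul]
      refine Submodule.smul_mem _ _ (Submodule.subset_span ⟨3, ?_⟩)
      change lval (chi k)⁻¹ (eev h X) (vl 3) = _
      rw [lval_vl hk, if_pos rfl]
    · obtain ⟨a, ha, rfl⟩ := exists_rep hv
      obtain ⟨i, hi, rfl⟩ := exists_vQ a ha
      change t (rootVec X) k (rv (vQ i)) ∈ _
      rw [t_rv]
      refine Submodule.smul_mem _ _ (Submodule.subset_span ⟨i, ?_⟩)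
      change lval (chi k)⁻¹ (eev h X) (vl i) = _
      rw [lval_vl hk, if_neg hi]

/-- A nonzero submodule is stable under the regular element and contains one of the seven weight
vectors, as their weights differ; raising and lowering then produces all of them. The top vector has
weight 1 at the short vertex and 0 at the long one. -/
theorem isFundamental {k : ZMod 3} (hk : k ≠ 0) :
    IsFundamental C.g2Basis 1 (so8Grade (rootVec X) C.aut k) := by
  have hτ := chi_inv_mul_self hk
  set τ := (chi k)⁻¹ with hτdef
  -- The elements of g₂ have rational integers as coefficients, so the value of τ may be adapted to
  -- the module.
  have hτω : ∀ a, lval ω (eev h X) (g2l a) = lval τ (eev h X) (g2l a) := fun a => by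
    rw [lval_g2l, lval_g2l]
  have hmem : ∀ i, lval τ (eev h X) (vl i) ∈ so8Grade (rootVec X) C.aut k := fun i => by
    rw [← LieSubmodule.mem_toSubmodule, ← C.span_vl hk]
    exact Submodule.subset_span ⟨i, rfl⟩
  have hv0 : lval τ (eev h X) (vl 0) ≠ 0 :=
    C.lval_eev_ne_zero (a := vQ 0) (by decide +kernel) (vl_ok 0) (by decide +kernel)
  have hne : (⟨_, hmem 0⟩ : so8Grade (rootVec X) C.aut k) ≠ 0 := fun h0 =>
    hv0 (congrArg Subtype.val h0)
  have : Nontrivial (so8Grade (rootVec X) C.aut k) := ⟨_, _, hne⟩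
  refine ⟨LieModule.IsIrreducible.mk fun N hN => ?_, ⟨_, hmem 0⟩, hne, fun j => ?_, fun j => ?_⟩
  · obtain ⟨x, hxN, hx0⟩ := Submodule.exists_mem_ne_zero_of_ne_bot
      (fun h => hN ((LieSubmodule.toSubmodule_eq_bot N).mp h))
    let N' : Submodule ℂ g := N.toSubmodule.map (so8Grade (rootVec X) C.aut k).toSubmodule.subtype
    have hN' : ∀ z ∈ so8Fixed (rootVec X) C.aut, ∀ y ∈ N', ⁅z, y⁆ ∈ N' := by
      rintro z hz _ ⟨y, hy, rfl⟩
      exact ⟨_, N.lie_mem (x := ⟨z, hz⟩) hy, rfl⟩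
    have hT : ∀ i, LieAlgebra.ad ℂ g (h (cx (rv regularG2))) (lval τ (eev h X) (vl i)) =
        (vwt i : ℂ) • lval τ (eev h X) (vl i) := fun i => by
      change ⁅h (cx (rv regularG2)), _⁆ = _
      rw [← lval_hl τ, C.lie_lval hτ (hl_ok _) (vl_ok i) (vl_weight i), lval_lsmul_int hτ,
        Int.cast_smul_eq_zsmul]
    have hxs : (x : g) ∈ Submodule.span ℂ (Set.range fun i => lval τ (eev h X) (vl i)) := by
      rw [C.span_vl hk]; exact x.2
    obtain ⟨a, ha⟩ := (Submodule.mem_span_range_iff_exists_fun ℂ).mp hxs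
    have hxg : (x : g) ≠ 0 := fun h0 => hx0 (Subtype.ext h0)
    obtain ⟨i, hai⟩ : ∃ i, a i ≠ 0 := by
      by_contra! hcon
      exact hxg (by rw [← ha]; simp [hcon])
    have hi : lval τ (eev h X) (vl i) ∈ N' := by
      have h2 := sum_filter_mem (hN' _ C.regularG2_mem) hT (a := a)
        (by rw [ha]; exact ⟨x, hxN, rfl⟩) (vwt i : ℂ)
      have h3 : (Finset.univ.filter fun j => (vwt j : ℂ) = vwt i) = {i} := by
        ext j
        simp only [Finset.mem_filter, Finset.mem_univ, true_and, Finset.mem_singleton,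
          Int.cast_inj, vwt_injective.eq_iff]
      rw [h3, Finset.sum_singleton] at h2
      have h4 := Submodule.smul_mem _ (a i)⁻¹ h2
      rwa [smul_smul, inv_mul_cancel₀ hai, one_smul] at h4
    have hcancel : ∀ (c : ℤ × ℤ) (l : List ((ℤ × ℤ) × EG)), c ≠ 0 →
        lval τ (eev h X) (lsmul (-1) c l) ∈ N' → lval τ (eev h X) l ∈ N' := fun c l hc hl => by
      rw [lval_lsmul hτ] at hl
      have h4 := Submodule.smul_mem _ (qnum τ c)⁻¹ hl
      rwa [smul_smul, inv_mul_cancel₀ (qnum_ne_zero hτ hc), one_smul] at h4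
    have hdown : ∀ i : Fin 6, lval τ (eev h X) (vl i.castSucc) ∈ N' →
        lval τ (eev h X) (vl i.succ) ∈ N' := fun i hi => by
      refine hcancel (![(0, -1), (-1, 0), (0, -1), (-2, -2), (1, 0), (-1, -1)] i) _
        (by clear hi; revert i; decide) ?_
      rw [← C.lie_lval hτ (g2l_ok _ (gQ_neg_mem _)) (vl_ok _) (vl_down i)]
      exact hN' _ (C.g2l_mem_so8Fixed τ (gQ_neg_mem _)) _ hi
    have hup : ∀ i : Fin 6, lval τ (eev h X) (vl i.succ) ∈ N' →
        lval τ (eev h X) (vl i.castSucc) ∈ N' := fun i hi => by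
      refine hcancel (![(1, 1), (-1, 0), (2, 2), (0, 1), (1, 0), (0, 1)] i) _
        (by clear hi; revert i; decide) ?_
      rw [← C.lie_lval hτ (g2l_ok _ (gQ_mem _)) (vl_ok _) (vl_up i)]
      exact hN' _ (C.g2l_mem_so8Fixed τ (gQ_mem _)) _ hi
    have h0 : ∀ i : Fin 7, lval τ (eev h X) (vl i) ∈ N' → lval τ (eev h X) (vl 0) ∈ N' := by
      intro i
      induction i using Fin.induction with
      | zero => exact id
      | succ i ih => exact fun hi => ih (hup i hi)
    have hall : ∀ i : Fin 7, lval τ (eev h X) (vl i) ∈ N' := by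
      intro j
      induction j using Fin.induction with
      | zero => exact h0 i hi
      | succ j ih => exact hdown j ih
    rw [← LieSubmodule.toSubmodule_eq_top, eq_top_iff]
    rintro ⟨y, hy⟩ -
    have hyN : y ∈ N' := by
      rw [← LieSubmodule.mem_toSubmodule, ← C.span_vl hk] at hy
      refine Submodule.span_le.mpr ?_ hy
      rintro _ ⟨i, rfl⟩
      exact hall i
    obtain ⟨z, hz, hzy⟩ := hyN
    have : z = ⟨y, hy⟩ := Subtype.ext hzy
    rwa [← this]
  · apply Subtype.ext
    change ⁅lval ω (eev h X) (g2l (gQ j)), lval τ (eev h X) (vl 0)⁆ = 0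
    rw [hτω, ← lval_lbr hτ C.lie_eev (g2l_ok _ (gQ_mem j)) (vl_ok 0), lval_eq_zero (vl_highest j)]
  · apply Subtype.ext
    change ⁅⁅lval ω (eev h X) (g2l (gQ j)), lval ω (eev h X) (g2l (-gQ j))⁆,
      lval τ (eev h X) (vl 0)⁆ = _
    rw [hτω, hτω, C.lie_lval_lval hτ (g2l_ok _ (gQ_mem j)) (g2l_ok _ (gQ_neg_mem j)) (vl_ok 0)
      (g2_lbr_ok _ (gQ_mem j)) (vl_highest_weight j), lval_lsmul_int hτ]
    split_ifs
    · rw [one_smul]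
    · rw [zero_smul]; rfl

end Chev

end E6GS



namespace E6GS

variable {g : Type*} [LieRing g] [LieAlgebra ℂ g]

/-! ### Centralizers and generators of the full fixed algebra. -/

theorem lie_eq_zero_of_mem_lieSpan {s : Set g} {c : g} (hs : ∀ x ∈ s, ⁅x, c⁆ = 0) {x : g}
    (hx : x ∈ LieSubalgebra.lieSpan ℂ g s) : ⁅x, c⁆ = 0 := by
  induction hx using LieSubalgebra.lieSpan_induction with
  | mem x hx => exact hs x hx
  | zero => exact zero_lie c
  | add x y _ _ hx hy => rw [add_lie, hx, hy, add_zero]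
  | smul r x _ hx => rw [smul_lie, hx, smul_zero]
  | lie x y _ _ hx hy => rw [lie_lie, hx, hy, lie_zero, lie_zero, sub_zero]

/-- For a bracket, invariance moves c next to an element that commutes with it; so orthogonality has
to be known for generators only. -/
theorem form_eq_zero_of_mem_lieSpan {s : Set g} {c : g} (hs : ∀ x ∈ s, ⁅x, c⁆ = 0)
    (hf : ∀ x ∈ s, form x c = 0) {x : g} (hx : x ∈ LieSubalgebra.lieSpan ℂ g s) : form x c = 0 := by
  induction hx using LieSubalgebra.lieSpan_induction with
  | mem x hx => exact hf x hx
  | zero => simp [form]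
  | add x y _ _ hx hy => rw [Chev.form_add_left, hx, hy, add_zero]
  | smul r x _ hx => rw [Chev.form_smul_left, hx, mul_zero]
  | lie x y _ hym _ _ =>
    rw [Chev.form_lie, lie_eq_zero_of_mem_lieSpan hs hym]
    simp [form]

/-! ### Generators of the invariant subalgebra -/

/-- A combination of three invariant generators. -/
def fixl (n : ℤ) (x y : ℤ × ℤ) : List ((ℤ × ℤ) × EG) :=
  g2l (n • sQ 4) ++ (lsmul (-1) x (g2l (n • (1,1,1,1,1,0))) ++ lsmul (-1) y (g2l (n • (1,1,2,2,2,1))))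

/-- The positive simple root vectors of the invariant subalgebra. -/
def fixE : Fin 4 → List ((ℤ × ℤ) × EG) :=
  ![fixl 1 (-1, 0) (1, 0), fixl 1 (1, 1) (0, 1), g2l (sQ 3), fixl 1 (0, -1) (-1, -1)]

/-- Multiples of the negative simple root vectors of the invariant subalgebra. -/
def fixF : Fin 4 → List ((ℤ × ℤ) × EG) :=
  ![fixl (-1) (-1, 0) (1, 0), fixl (-1) (0, -1) (-1, -1), g2l (-sQ 3), fixl (-1) (1, 1) (0, 1)]

/-- The factors by which the brackets of the generators differ from the simple coroots. -/
def fixK : Fin 4 → ℤ := ![9, 9, 1, 9]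

/-- The center of the invariant subalgebra. -/
def fixZ : Fin 2 → List ((ℤ × ℤ) × EG) :=
  ![g2l (-(1,1,2,2,1,1)) ++ lsmul (-1) (-1, 0) (g2l (-(1,1,1,2,2,1))),
    g2l (1,1,2,2,1,1) ++ lsmul (-1) (-1, 0) (g2l (1,1,1,2,2,1))]

theorem fixE_ok : ∀ i, ∀ t ∈ fixE i, eok t.2 := by decide +kernel

theorem fixF_ok : ∀ i, ∀ t ∈ fixF i, eok t.2 := by decide +kernel

theorem fixZ_ok : ∀ i, ∀ t ∈ fixZ i, eok t.2 := by decide +kernel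

theorem fix_lbr_ok : ∀ i, ∀ t ∈ lbr (-1) ebr (fixE i) (fixF i), eok t.2 := by decide +kernel

/-- The three orbits in `fixl` have the same sum α₂ + α₄ + α₆, so their vectors share a weight for
the Cartan subalgebra of g₂. Up to a sign in the middle, `fixE` takes their three Fourier
combinations with coefficients 1, ω, ω², and `fixF` the conjugate ones; these are the outer nodes of
D₄, and E_{α₃} is the central one. -/
theorem fix_relation_e : ∀ i j, isNull (lbr (-1) ebr (lbr (-1) ebr (fixE j) (fixF j)) (fixE i) ++
    lsmul (-1) (-1, 0) (lsmul (-1) (fixK j * cartanD4 i j, 0) (fixE i))) = true := by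
  decide +kernel

theorem fix_relation_f : ∀ i j, isNull (lbr (-1) ebr (lbr (-1) ebr (fixE j) (fixF j)) (fixF i) ++
    lsmul (-1) (-1, 0) (lsmul (-1) (-(fixK j * cartanD4 i j), 0) (fixF i))) = true := by
  decide +kernel

theorem fix_relation_ef : ∀ i j, i ≠ j → isNull (lbr (-1) ebr (fixE i) (fixF j)) = true := by
  decide +kernel

/-- The orbits in `fixZ` have sum zero, that is, weight zero for g₂; the differences commute with
all generators. -/
theorem fix_lie_center : ∀ i j, isNull (lbr (-1) ebr (fixE i) (fixZ j)) = true ∧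
    isNull (lbr (-1) ebr (fixF i) (fixZ j)) = true := by
  decide +kernel

theorem fixZ_lie : isNull (lbr (-1) ebr (fixZ 0) (fixZ 1)) = true := by decide +kernel

theorem fixE_coef : ∀ i, lcoef (.inr (sQ (![4, 4, 3, 4] i))) (fixE i) = (1, 0) := by decide +kernel

end E6GS



namespace E6GS

variable {g : Type*} [LieRing g] [LieAlgebra ℂ g]

/-! ### The fixed algebra and the dropped subalgebra as so(8) ⊕ ℂ². -/

namespace Chev

variable {h : (Fin 7 → ℂ) →ₗ[ℂ] g} {X : Q → g} (C : Chev h X)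
include C

theorem finrank_grade : Module.finrank ℂ (grade C.aut 0) = 30 ∧
    Module.finrank ℂ (grade C.aut 1) = 24 ∧ Module.finrank ℂ (grade C.aut 2) = 24 := by
  obtain ⟨h0, h1, h2⟩ := C.decomposition
  refine ⟨?_, ?_, ?_⟩
  · rw [← h0, finrank_span_eq_card C.linearIndependent_zero, Fintype.card_sum, card_basisG2,
      card_weightsL]
  · rw [← h1, finrank_span_eq_card (C.linearIndependent_basisGrade (by decide)), card_basisGrade]
  · rw [← h2, finrank_span_eq_card (C.linearIndependent_basisGrade (by decide)), card_basisGrade]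

omit C in
theorem mem_fixedSubalgebra_g2l (C : Chev h X) (a : Q) :
    lval ω (eev h X) (g2l a) ∈ fixedSubalgebra C.aut := by
  rw [lval_g2l]
  change C.aut _ = _
  split_ifs with hl
  · rw [C.aut_X, hl]
  · rw [C.aut_orb (one_pow 3), one_pow, one_smul]

theorem fixl_mem (n : ℤ) (x y : ℤ × ℤ) : lval ω (eev h X) (fixl n x y) ∈ fixedSubalgebra C.aut := by
  rw [fixl, lval_append, lval_append, lval_lsmul ω_mul_self, lval_lsmul ω_mul_self]
  exact LieSubalgebra.add_mem _ (C.mem_fixedSubalgebra_g2l _) (LieSubalgebra.add_mem _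
    (LieSubalgebra.smul_mem _ _ (C.mem_fixedSubalgebra_g2l _))
    (LieSubalgebra.smul_mem _ _ (C.mem_fixedSubalgebra_g2l _)))

theorem fixE_mem (i : Fin 4) : lval ω (eev h X) (fixE i) ∈ fixedSubalgebra C.aut := by
  have h0 : fixE 0 = fixl 1 (-1, 0) (1, 0) := rfl
  have h1 : fixE 1 = fixl 1 (1, 1) (0, 1) := rfl
  have h2 : fixE 2 = g2l (sQ 3) := rfl
  have h3 : fixE 3 = fixl 1 (0, -1) (-1, -1) := rfl
  match i with
  | 0 => rw [h0]; exact C.fixl_mem _ _ _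
  | 1 => rw [h1]; exact C.fixl_mem _ _ _
  | 2 => rw [h2]; exact C.mem_fixedSubalgebra_g2l _
  | 3 => rw [h3]; exact C.fixl_mem _ _ _

theorem fixF_mem (i : Fin 4) : lval ω (eev h X) (fixF i) ∈ fixedSubalgebra C.aut := by
  have h0 : fixF 0 = fixl (-1) (-1, 0) (1, 0) := rfl
  have h1 : fixF 1 = fixl (-1) (0, -1) (-1, -1) := rfl
  have h2 : fixF 2 = g2l (-sQ 3) := rfl
  have h3 : fixF 3 = fixl (-1) (1, 1) (0, 1) := rfl
  match i with
  | 0 => rw [h0]; exact C.fixl_mem _ _ _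
  | 1 => rw [h1]; exact C.fixl_mem _ _ _
  | 2 => rw [h2]; exact C.mem_fixedSubalgebra_g2l _
  | 3 => rw [h3]; exact C.fixl_mem _ _ _

omit C in
theorem lval_fixZ : lval ω (eev h X) (fixZ 0) = orb X 1 (-(1,1,2,2,1,1)) - orb X 1 (-(1,1,1,2,2,1)) ∧
    lval ω (eev h X) (fixZ 1) = orb X 1 (1,1,2,2,1,1) - orb X 1 (1,1,1,2,2,1) := by
  have h1 : qnum ω (-1, 0) = -1 := by simp [qnum]
  have e0 : fixZ 0 = g2l (-(1,1,2,2,1,1)) ++ lsmul (-1) (-1, 0) (g2l (-(1,1,1,2,2,1))) := rfl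
  have e1 : fixZ 1 = g2l (1,1,2,2,1,1) ++ lsmul (-1) (-1, 0) (g2l (1,1,1,2,2,1)) := rfl
  rw [e0, e1, lval_append, lval_append, lval_lsmul ω_mul_self, lval_lsmul ω_mul_self, lval_g2l,
    lval_g2l, lval_g2l, lval_g2l, if_neg (by decide +kernel), if_neg (by decide +kernel),
    if_neg (by decide +kernel), if_neg (by decide +kernel), h1, neg_one_smul, neg_one_smul,
    sub_eq_add_neg, sub_eq_add_neg]
  exact ⟨rfl, rfl⟩

theorem fixZ_mem (i : Fin 2) : lval ω (eev h X) (fixZ i) ∈ fixedSubalgebra C.aut := by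
  have h1 : ∀ a, orb X 1 a ∈ fixedSubalgebra C.aut := fun a => by
    change C.aut _ = _
    rw [C.aut_orb (one_pow 3), one_pow, one_smul]
  fin_cases i
  · change lval ω (eev h X) (fixZ 0) ∈ _
    rw [lval_fixZ.1]; exact LieSubalgebra.sub_mem _ (h1 _) (h1 _)
  · change lval ω (eev h X) (fixZ 1) ∈ _
    rw [lval_fixZ.2]; exact LieSubalgebra.sub_mem _ (h1 _) (h1 _)

omit C in
theorem form_sub_left (x y z : g) : form (x - y) z = form x z - form y z := by
  rw [sub_eq_add_neg, form_add_left, ← neg_one_smul ℂ y, form_smul_left]; ring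

omit C in
theorem form_sub_right (x y z : g) : form x (y - z) = form x y - form x z := by
  rw [form_comm, form_sub_left, form_comm y, form_comm z]

/-- The two central vectors form a hyperbolic pair, 6 being 3 for each of the two orbits. Hence
nothing orthogonal to both is a nonzero combination of them. -/
theorem form_fixZ : form (lval ω (eev h X) (fixZ 0)) (lval ω (eev h X) (fixZ 0)) = 0 ∧
    form (lval ω (eev h X) (fixZ 1)) (lval ω (eev h X) (fixZ 1)) = 0 ∧
    form (lval ω (eev h X) (fixZ 1)) (lval ω (eev h X) (fixZ 0)) = 6 := by
  have hA : ((1,1,2,2,1,1) : Q) ∈ spinList := by decide +kernel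
  have hB : ((1,1,1,2,2,1) : Q) ∈ spinList := by decide +kernel
  have mA : ((1,1,2,2,1,1) : Q) ∈ repList ++ spinList := List.mem_append_right _ hA
  have mB : ((1,1,1,2,2,1) : Q) ∈ repList ++ spinList := List.mem_append_right _ hB
  have nA : -((1,1,2,2,1,1) : Q) ∈ repList ++ spinList := List.mem_append_right _ (spin_neg _ hA)
  have nB : -((1,1,1,2,2,1) : Q) ∈ repList ++ spinList := List.mem_append_right _ (spin_neg _ hB)
  obtain ⟨fA, fA'⟩ := orbit_free _ mA
  obtain ⟨fB, fB'⟩ := orbit_free _ mB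
  rw [lval_fixZ.1, lval_fixZ.2]
  simp only [form_sub_left, form_sub_right]
  refine ⟨?_, ?_, ?_⟩
  · rw [C.form_orb_eq_zero nA nA (by decide), C.form_orb_eq_zero nA nB (by decide),
      C.form_orb_eq_zero nB nA (by decide), C.form_orb_eq_zero nB nB (by decide)]
    ring
  · rw [C.form_orb_eq_zero mA mA (by decide), C.form_orb_eq_zero mA mB (by decide),
      C.form_orb_eq_zero mB mA (by decide), C.form_orb_eq_zero mB mB (by decide)]
    ring
  · rw [C.form_orb_neg (one_mul 1) fA fA', C.form_orb_eq_zero mA nB (by decide),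
      C.form_orb_eq_zero mB nA (by decide), C.form_orb_neg (one_mul 1) fB fB']
    ring

/-- The fixed points form `so(8) ⊕ ℂ²`. -/
theorem nonempty_fixed_lieEquiv :
    Nonempty (fixedSubalgebra C.aut ≃ₗ⁅ℂ⁆ (LieAlgebra.Orthogonal.so (Fin 8) ℂ × TwoTrivial)) := by
  have := C.finiteDimensional
  obtain ⟨φ₀⟩ := C.nonempty_so8_lieEquiv
  let e : Fin 4 → g := fun i => lval ω (eev h X) (fixE i)
  let f : Fin 4 → g := fun i => (fixK i : ℂ)⁻¹ • lval ω (eev h X) (fixF i)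
  let z : Fin 2 → g := fun i => lval ω (eev h X) (fixZ i)
  have hK : ∀ i, (fixK i : ℂ) ≠ 0 := fun i => by
    have : fixK i ≠ 0 := by revert i; decide
    exact_mod_cast this
  have he0 : ∀ i, e i ≠ 0 := fun i => C.lval_eev_ne_zero (sQ_mem _) (fixE_ok i) (fixE_coef i)
  have he : ∀ i j, ⁅⁅e j, f j⁆, e i⁆ = cartanD4 i j • e i := fun i j => by
    change ⁅⁅_, _ • _⁆, _⁆ = _
    rw [lie_smul, smul_lie, C.lie_lval_lval ω_mul_self (fixE_ok j) (fixF_ok j) (fixE_ok i)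
      (fix_lbr_ok j) (fix_relation_e i j), lval_lsmul_int ω_mul_self, mul_smul,
      ← Int.cast_smul_eq_zsmul ℂ (fixK j), inv_smul_smul₀ (hK j)]
  have hf : ∀ i j, ⁅⁅e j, f j⁆, f i⁆ = -cartanD4 i j • f i := fun i j => by
    change ⁅⁅_, _ • _⁆, _ • _⁆ = _
    rw [lie_smul, lie_smul, smul_lie, C.lie_lval_lval ω_mul_self (fixE_ok j) (fixF_ok j) (fixF_ok i)
      (fix_lbr_ok j) (fix_relation_f i j), lval_lsmul_int ω_mul_self, ← mul_neg, mul_smul,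
      ← Int.cast_smul_eq_zsmul ℂ (fixK j), inv_smul_smul₀ (hK j), smul_comm]
  have hef : ∀ i j, i ≠ j → ⁅e i, f j⁆ = 0 := fun i j hij => by
    change ⁅_, _ • _⁆ = _
    rw [lie_smul, ← lval_lbr ω_mul_self C.lie_eev (fixE_ok i) (fixF_ok j),
      lval_eq_zero (fix_relation_ef i j hij), smul_zero]
  set s : Set g := Set.range e ∪ Set.range f with hs
  set M := LieSubalgebra.lieSpan ℂ g s with hM
  have hsz : ∀ j, ∀ x ∈ s, ⁅x, z j⁆ = 0 := by
    rintro j _ (⟨i, rfl⟩ | ⟨i, rfl⟩)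
    · change ⁅lval ω (eev h X) (fixE i), lval ω (eev h X) (fixZ j)⁆ = 0
      rw [← lval_lbr ω_mul_self C.lie_eev (fixE_ok i) (fixZ_ok j),
        lval_eq_zero (fix_lie_center i j).1]
    · change ⁅_ • lval ω (eev h X) (fixF i), lval ω (eev h X) (fixZ j)⁆ = 0
      rw [smul_lie, ← lval_lbr ω_mul_self C.lie_eev (fixF_ok i) (fixZ_ok j),
        lval_eq_zero (fix_lie_center i j).2, smul_zero]
  have hdiag : ∀ i, cartanD4 i i = 2 := by decide +kernel
  -- By the diagonal relations a nonzero multiple of each generator x is a bracket [y, x], and x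
  -- commutes with z j.
  have hsf : ∀ j, ∀ x ∈ s, form x (z j) = 0 := by
    intro j x hx
    have h2 : ∀ (y : g) (n : ℤ), n ≠ 0 → n • x = ⁅y, x⁆ → form x (z j) = 0 := fun y n hn hy => by
      have h3 : form (n • x) (z j) = 0 := by
        rw [hy, form_lie, hsz j x hx]; simp [form]
      rw [← Int.cast_smul_eq_zsmul ℂ, form_smul_left] at h3
      exact (mul_eq_zero.mp h3).resolve_left (Int.cast_ne_zero.mpr hn)
    rcases hx with ⟨i, rfl⟩ | ⟨i, rfl⟩
    · exact h2 _ _ (by rw [hdiag]; decide) (he i i).symm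
    · exact h2 _ _ (by rw [hdiag]; decide) (hf i i).symm
  have hMz : ∀ j, ∀ x ∈ M, ⁅x, z j⁆ = 0 := fun j x hx => lie_eq_zero_of_mem_lieSpan (hsz j) hx
  have hMf : ∀ j, ∀ x ∈ M, form x (z j) = 0 := fun j x hx =>
    form_eq_zero_of_mem_lieSpan (hsz j) (hsf j) hx
  obtain ⟨f00, f11, f10⟩ := C.form_fixZ
  have f01 : form (z 0) (z 1) = 6 := by rw [form_comm]; exact f10
  have hind : ∀ x ∈ M, ∀ a b : ℂ, x + (a • z 0 + b • z 1) = 0 → x = 0 ∧ a = 0 ∧ b = 0 := by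
    intro x hx a b hab
    have h0 : form (x + (a • z 0 + b • z 1)) (z 0) = 0 := by rw [hab]; simp [form]
    have h1 : form (x + (a • z 0 + b • z 1)) (z 1) = 0 := by rw [hab]; simp [form]
    simp only [form_add_left, form_smul_left] at h0 h1
    rw [hMf 0 x hx, show form (z 0) (z 0) = 0 from f00, show form (z 1) (z 0) = 6 from f10] at h0
    rw [hMf 1 x hx, show form (z 1) (z 1) = 0 from f11, f01] at h1
    have hb : b = 0 := by linear_combination h0 / 6
    have ha : a = 0 := by linear_combination h1 / 6
    rw [ha, hb, zero_smul, zero_smul, add_zero, add_zero] at hab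
    exact ⟨hab, ha, hb⟩
  have hMF : M ≤ fixedSubalgebra C.aut := by
    rw [LieSubalgebra.lieSpan_le]
    rintro _ (⟨i, rfl⟩ | ⟨i, rfl⟩)
    · exact C.fixE_mem i
    · exact LieSubalgebra.smul_mem _ _ (C.fixF_mem i)
  have hF : Module.finrank ℂ (fixedSubalgebra C.aut) = 30 := by
    have := C.finrank_grade.1
    rwa [← fixedSubalgebra_toSubmodule] at this
  -- M and the two central vectors are independent in the 30-dimensional fixed algebra. So dim M ≤
  -- 28, the bound under which the relations of D₄ identify M.
  have hMr : Module.finrank ℂ M + 2 ≤ 30 := by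
    let ρ : (M × (Fin 2 → ℂ)) →ₗ[ℂ] fixedSubalgebra C.aut :=
      { toFun := fun p => ⟨p.1 + (p.2 0 • z 0 + p.2 1 • z 1), LieSubalgebra.add_mem _ (hMF p.1.2)
          (LieSubalgebra.add_mem _ (LieSubalgebra.smul_mem _ _ (C.fixZ_mem 0))
            (LieSubalgebra.smul_mem _ _ (C.fixZ_mem 1)))⟩
        map_add' := fun p q => Subtype.ext (by
          change (p.1 : g) + q.1 + ((p.2 0 + q.2 0) • z 0 + (p.2 1 + q.2 1) • z 1) =
            p.1 + (p.2 0 • z 0 + p.2 1 • z 1) + (q.1 + (q.2 0 • z 0 + q.2 1 • z 1))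
          module)
        map_smul' := fun c p => Subtype.ext (by
          change c • (p.1 : g) + ((c * p.2 0) • z 0 + (c * p.2 1) • z 1) =
            c • (p.1 + (p.2 0 • z 0 + p.2 1 • z 1))
          module) }
    have hρ : Function.Injective ρ := by
      rw [injective_iff_map_eq_zero]
      rintro ⟨x, y⟩ hxy
      obtain ⟨k1, k2, k3⟩ := hind x x.2 (y 0) (y 1) (congrArg Subtype.val hxy)
      refine Prod.ext (Subtype.ext k1) (funext fun i => ?_)
      fin_cases i
      exacts [k2, k3]
    have := LinearMap.finrank_le_finrank_of_injective hρ
    rwa [Module.finrank_prod, Module.finrank_fin_fun, hF] at this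
  obtain ⟨φ⟩ := nonempty_lieEquiv C.so8Basis C.so8_ideal_meets he0 he hf hef (N := M)
    (fun i => LieSubalgebra.subset_lieSpan (Or.inl ⟨i, rfl⟩))
    (fun i => LieSubalgebra.subset_lieSpan (Or.inr ⟨i, rfl⟩))
    (by rw [C.so8_decomposition.2]; omega)
  let χ : LieAlgebra.Orthogonal.so (Fin 8) ℂ ≃ₗ⁅ℂ⁆ M := φ₀.symm.trans φ.symm
  have hso : Module.finrank ℂ (LieAlgebra.Orthogonal.so (Fin 8) ℂ) = 28 := by
    rw [← C.so8_decomposition.2]; exact φ₀.symm.toLinearEquiv.finrank_eq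
  refine nonempty_prod_lieEquiv ((LieSubalgebra.inclusion hMF).comp χ.toLieHom)
    ⟨z 0, C.fixZ_mem 0⟩ ⟨z 1, C.fixZ_mem 1⟩ (fun x => Subtype.ext (hMz 0 _ (χ x).2))
    (fun x => Subtype.ext (hMz 1 _ (χ x).2)) (Subtype.ext ?_) (fun x a b hab => ?_) ?_
  · change ⁅lval ω (eev h X) (fixZ 0), lval ω (eev h X) (fixZ 1)⁆ = 0
    rw [← lval_lbr ω_mul_self C.lie_eev (fixZ_ok 0) (fixZ_ok 1), lval_eq_zero fixZ_lie]
  · obtain ⟨k1, k2, k3⟩ := hind (χ x) (χ x).2 a b (congrArg Subtype.val hab)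
    refine ⟨?_, k2, k3⟩
    have : χ x = 0 := Subtype.ext k1
    exact χ.injective (this.trans (map_zero _).symm)
  · rw [hF, hso]

/-! ### The subalgebra generated by the Cartan subalgebra and the roots of `so(8)` -/

theorem lie_so8_h {u : Fin 7 → ℂ} (hu : u 0 = 0 ∧ u 1 = 0 ∧ u 2 = 0 ∧ u 3 = 0) {x : g}
    (hx : x ∈ so8 (rootVec X)) : ⁅x, h u⁆ = 0 := by
  refine lie_eq_zero_of_mem_lieSpan ?_ hx
  rintro _ ⟨v, hv, rfl⟩
  rw [rootsSO8_eq] at hv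
  obtain ⟨a, ha, rfl⟩ := hv
  obtain ⟨h4, h5, h6⟩ := so8List_rv ha
  obtain ⟨u0, u1, u2, u3⟩ := hu
  have h0 : cx (rv a) ⬝ᵥ u = 0 := by
    simp [dotProduct, Fin.sum_univ_seven, cx, h4, h5, h6, u0, u1, u2, u3]
  rw [rootVec_rv, ← lie_skew, C.lie_h_X, h0, zero_smul, neg_zero]

theorem h_cx_e_mem_so8 (i : Fin 4) : h (cx (e (i + 1))) ∈ so8 (rootVec X) := by
  have hle : Submodule.span ℂ (Set.range fun i => (C.so8Basis.h i : g)) ≤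
      (so8 (rootVec X)).toSubmodule := by
    rw [Submodule.span_le]
    rintro _ ⟨i, rfl⟩
    exact (C.so8Basis.h i).2
  exact hle (C.h_cx_e_mem i)

/-- The dropped subalgebra is `so(8) ⊕ ℂ²`. -/
theorem nonempty_dropped_lieEquiv : Nonempty (droppedSubalgebra h (rootVec X) ≃ₗ⁅ℂ⁆
    (LieAlgebra.Orthogonal.so (Fin 8) ℂ × TwoTrivial)) := by
  have := C.finiteDimensional
  obtain ⟨φ₀⟩ := C.nonempty_so8_lieEquiv
  have hso : Module.finrank ℂ (LieAlgebra.Orthogonal.so (Fin 8) ℂ) = 28 := by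
    rw [← C.so8_decomposition.2]; exact φ₀.symm.toLinearEquiv.finrank_eq
  set D := droppedSubalgebra h (rootVec X) with hD
  let z : Fin 2 → g := ![h (cx (e 5 - e 6)), h (cx (e 6 - e 7))]
  have hhD : ∀ u, h u ∈ D := fun u => LieSubalgebra.subset_lieSpan (Or.inl ⟨u, rfl⟩)
  have hzD : ∀ i, z i ∈ D := fun i => by fin_cases i <;> exact hhD _
  have hdα : ∀ i : Fin 4, ∃ j : Fin 7, (j ≠ 0 ∧ j ≠ 1 ∧ j ≠ 5) ∧ αQ j = dQ i := by
    intro i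
    fin_cases i
    exacts [⟨6, by decide, rfl⟩, ⟨2, by decide, rfl⟩, ⟨3, by decide, rfl⟩, ⟨4, by decide, rfl⟩]
  have hSD : so8 (rootVec X) ≤ D := by
    rw [C.so8_eq_lieSpan, LieSubalgebra.lieSpan_le]
    rintro _ (⟨i, rfl⟩ | ⟨i, rfl⟩)
    · obtain ⟨j, ⟨j0, j1, j5⟩, hj⟩ := hdα i
      refine LieSubalgebra.subset_lieSpan (Or.inr ⟨j, j0, j1, j5, Or.inl ?_⟩)
      rw [α_eq, hj, rootVec_rv]
    · obtain ⟨j, ⟨j0, j1, j5⟩, hj⟩ := hdα i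
      refine LieSubalgebra.subset_lieSpan (Or.inr ⟨j, j0, j1, j5, Or.inr ?_⟩)
      rw [α_eq, hj, ← rv_neg, rootVec_rv]
  have hz : ∀ j, ∀ x ∈ so8 (rootVec X), ⁅x, z j⁆ = 0 := by
    intro j x hx
    fin_cases j
    · exact C.lie_so8_h (by simp [cx, e]) hx
    · exact C.lie_so8_h (by simp [cx, e]) hx
  have hzz : ∀ i j, ⁅z i, z j⁆ = 0 := fun i j => by
    fin_cases i <;> fin_cases j <;> exact C.lie_h_h _ _
  -- An explicit subalgebra of dimension at most 28 + 2 that contains the generators, to bound the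
  -- dimension of the dropped subalgebra.
  let N : LieSubalgebra ℂ g :=
    { toSubmodule := (so8 (rootVec X)).toSubmodule ⊔ Submodule.span ℂ (Set.range z)
      lie_mem' := by
        intro x y hx hy
        obtain ⟨a, ha, b, hb, rfl⟩ := Submodule.mem_sup.mp hx
        obtain ⟨c, hc, d, hd, rfl⟩ := Submodule.mem_sup.mp hy
        obtain ⟨r, rfl⟩ := (Submodule.mem_span_range_iff_exists_fun ℂ).mp hb
        obtain ⟨s, rfl⟩ := (Submodule.mem_span_range_iff_exists_fun ℂ).mp hd
        have hz' : ∀ j, ⁅z j, c⁆ = 0 := fun j => by rw [← lie_skew, hz j c hc, neg_zero]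
        have h1 : ⁅a + ∑ i, r i • z i, c + ∑ i, s i • z i⁆ = ⁅a, c⁆ := by
          rw [Fin.sum_univ_two, Fin.sum_univ_two]
          simp only [add_lie, lie_add, smul_lie, lie_smul, hz _ a ha, hz', hzz, smul_zero, add_zero]
        change ⁅a + ∑ i, r i • z i, c + ∑ i, s i • z i⁆ ∈ _
        rw [h1]
        exact Submodule.mem_sup_left ((so8 (rootVec X)).lie_mem ha hc) }
  have hDN : D ≤ N := by
    rw [hD, droppedSubalgebra, LieSubalgebra.lieSpan_le]
    rintro _ (⟨u, rfl⟩ | ⟨j, j0, j1, j5, hj⟩)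
    -- The last three coordinates are split along e₅ - e₆, e₆ - e₇ and e₅ + e₆ + e₇; the last
    -- direction is killed by h.
    · have hu : u = ∑ i : Fin 4, u i.castSucc.castSucc.castSucc • cx (e (i + 1)) +
          ((2 * u 4 - u 5 - u 6) / 3) • cx (e 5 - e 6) + ((u 4 + u 5 - 2 * u 6) / 3) • cx (e 6 - e 7) +
          ((u 4 + u 5 + u 6) / 3) • cx (e 5 + e 6 + e 7) := by
        funext i
        rw [Fin.sum_univ_four]
        fin_cases i <;> simp [cx, e] <;> ring
      rw [hu, map_add, map_add, map_add, map_smul, map_smul, map_smul, C.degenerate, smul_zero,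
        add_zero, map_sum]
      refine N.add_mem (N.add_mem (N.sum_mem fun i _ => ?_) ?_) ?_
      · rw [map_smul]
        exact N.smul_mem _ (Submodule.mem_sup_left (C.h_cx_e_mem_so8 i))
      · exact N.smul_mem _ (Submodule.mem_sup_right (Submodule.subset_span ⟨0, rfl⟩))
      · exact N.smul_mem _ (Submodule.mem_sup_right (Submodule.subset_span ⟨1, rfl⟩))
    · have hj' : αQ j ∈ so8List := by
        have : ∀ j : Fin 7, j ≠ 0 → j ≠ 1 → j ≠ 5 → αQ j ∈ so8List := by decide +kernel
        exact this j j0 j1 j5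
      refine Submodule.mem_sup_left ?_
      rcases hj with rfl | rfl
      · rw [α_eq, rootVec_rv]; exact X_mem_so8 hj'
      · rw [α_eq, ← rv_neg, rootVec_rv]; exact X_mem_so8 (so8List_neg _ hj')
  have hDr : Module.finrank ℂ D ≤ 30 := by
    refine (Submodule.finrank_mono (show D.toSubmodule ≤ N.toSubmodule from hDN)).trans ?_
    refine (Submodule.finrank_add_le_finrank_add_finrank _ _).trans ?_
    have h1 := finrank_range_le_card (R := ℂ) (b := z)
    have h2 : Module.finrank ℂ (so8 (rootVec X)).toSubmodule = 28 := C.so8_decomposition.2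
    rw [Fintype.card_fin, Set.finrank] at h1
    omega
  refine nonempty_prod_lieEquiv ((LieSubalgebra.inclusion hSD).comp φ₀.symm.toLieHom)
    ⟨z 0, hzD 0⟩ ⟨z 1, hzD 1⟩ (fun x => Subtype.ext (hz 0 _ (φ₀.symm x).2))
    (fun x => Subtype.ext (hz 1 _ (φ₀.symm x).2)) (Subtype.ext (hzz 0 1)) (fun x a b hab => ?_) ?_
  · have hab' : (φ₀.symm x : g) + (a • z 0 + b • z 1) = 0 := congrArg Subtype.val hab
    have hm : a • cx (e 5 - e 6) + b • cx (e 6 - e 7) ∈ cartan ℂ := by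
      change _ + _ + _ = _
      simp [cx, e]
    have hs : h (a • cx (e 5 - e 6) + b • cx (e 6 - e 7)) ∈ so8 (rootVec X) := by
      have : h (a • cx (e 5 - e 6) + b • cx (e 6 - e 7)) = -(φ₀.symm x : g) := by
        rw [map_add, map_smul, map_smul]
        exact (neg_eq_of_add_eq_zero_right hab').symm
      rw [this]
      exact NegMemClass.neg_mem (φ₀.symm x).2
    obtain ⟨k4, -, k6⟩ := C.so8_of_h_mem hm hs
    have ha : a = 0 := by simpa [cx, e] using k4
    have hb : b = 0 := by simpa [cx, e] using k6
    refine ⟨?_, ha, hb⟩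
    rw [ha, hb, zero_smul, zero_smul, add_zero, add_zero] at hab'
    have : φ₀.symm x = 0 := Subtype.ext hab'
    exact φ₀.symm.injective (this.trans (map_zero _).symm)
  · rw [hso]; exact hDr

end Chev

end E6GS



namespace E6GS

variable {g : Type*} [LieRing g] [LieAlgebra ℂ g]

/-! ### Killing form and bases in the canonical coordinates. -/

theorem rv_eq_neg_iff {a b : Q} : rv b = -rv a ↔ b = -a := by
  rw [← rv_neg, rv_injective.eq_iff]

namespace Chev

variable {h : (Fin 7 → ℂ) →ₗ[ℂ] g} {X : Q → g} (C : Chev h X)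
include C

theorem killing_roots :
    (∀ u ∈ cartan ℂ, ∀ v ∈ cartan ℂ, form (h u) (h v) = u ⬝ᵥ v) ∧
      (∀ u, ∀ a ∈ roots, form (h u) (rootVec X a) = 0) ∧
      (∀ a ∈ roots, ∀ b ∈ roots, b = -a → form (rootVec X a) (rootVec X b) = 1) ∧
      (∀ a ∈ roots, ∀ b ∈ roots, b ≠ -a → form (rootVec X a) (rootVec X b) = 0) := by
  refine ⟨fun u hu v hv => C.form_h_h hu hv, ?_, ?_, ?_⟩
  · intro u v hv
    rw [roots_eq] at hv
    obtain ⟨a, -, rfl⟩ := hv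
    rw [rootVec_rv, C.form_h_X]
  · rintro v hv _ - rfl
    rw [roots_eq] at hv
    obtain ⟨a, ha, rfl⟩ := hv
    rw [← rv_neg, rootVec_rv, rootVec_rv, C.form_X_neg ha]
  · intro v hv w hw hvw
    rw [roots_eq] at hv hw
    obtain ⟨a, -, rfl⟩ := hv
    obtain ⟨b, -, rfl⟩ := hw
    rw [Ne, rv_eq_neg_iff] at hvw
    rw [rootVec_rv, rootVec_rv, C.form_X_X fun h0 => hvw (eq_neg_of_add_eq_zero_right h0)]

theorem killing_g2 :
    (∀ a ∈ orbitReps, ∀ b ∈ orbitReps, b = -a → form (E0 (rootVec X) a) (E0 (rootVec X) b) = 3) ∧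
      (∀ a ∈ orbitReps, ∀ b ∈ orbitReps, b ≠ -a →
        form (E0 (rootVec X) a) (E0 (rootVec X) b) = 0) ∧
      (∀ a ∈ fixedRoots, ∀ b ∈ fixedRoots, b = -a → form (rootVec X a) (rootVec X b) = 1) ∧
      (∀ a ∈ fixedRoots, ∀ b ∈ fixedRoots, b ≠ -a → form (rootVec X a) (rootVec X b) = 0) ∧
      (∀ a ∈ orbitReps, ∀ b ∈ fixedRoots, form (E0 (rootVec X) a) (rootVec X b) = 0) := by
  obtain ⟨-, -, k1, k2⟩ := C.killing_roots
  have hfix : ∀ v ∈ fixedRoots, v ∈ roots := fun v hv => by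
    obtain ⟨a, ha, rfl⟩ := exists_fix hv
    exact rv_mem_roots.mpr (fix_mem a ha).1
  refine ⟨?_, ?_, fun v hv w hw => k1 v (hfix v hv) w (hfix w hw),
    fun v hv w hw => k2 v (hfix v hv) w (hfix w hw), ?_⟩
  · rintro v hv _ - rfl
    obtain ⟨a, ha, rfl⟩ := exists_rep hv
    obtain ⟨h1, h2⟩ := orbit_free a (List.mem_append_left _ ha)
    rw [← rv_neg, E0_rv, E0_rv, C.form_orb_neg (one_mul 1) h1 h2]
  · intro v hv w hw hvw
    obtain ⟨a, ha, rfl⟩ := exists_rep hv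
    obtain ⟨b, hb, rfl⟩ := exists_rep hw
    rw [Ne, rv_eq_neg_iff] at hvw
    rw [E0_rv, E0_rv, C.form_orb_eq_zero (List.mem_append_left _ ha) (List.mem_append_left _ hb) hvw]
  · intro v hv w hw
    obtain ⟨a, ha, rfl⟩ := exists_rep hv
    obtain ⟨b, hb, rfl⟩ := exists_fix hw
    rw [E0_rv, rootVec_rv, C.form_orb_fix ha hb]

theorem killing_t {k l : ZMod 3} (hkl : k + l = 0) :
    (∀ a ∈ orbitReps, ∀ b ∈ orbitReps, b = -a →
        form (t (rootVec X) k a) (t (rootVec X) l b) = 1) ∧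
      (∀ a ∈ orbitReps, ∀ b ∈ orbitReps, b ≠ -a →
        form (t (rootVec X) k a) (t (rootVec X) l b) = 0) ∧
      (∀ w ∈ weightsL, ∀ v ∈ weightsL, ∀ s r : ℤˣ, v = -w → r = -s →
        form (t (rootVec X) k (aL w s)) (t (rootVec X) l (aL v r)) = 1) ∧
      (∀ w ∈ weightsL, ∀ v ∈ weightsL, ∀ s r : ℤˣ, ¬ (v = -w ∧ r = -s) →
        form (t (rootVec X) k (aL w s)) (t (rootVec X) l (aL v r)) = 0) ∧
      (∀ a ∈ orbitReps, ∀ w ∈ weightsL, ∀ s,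
        form (t (rootVec X) k a) (t (rootVec X) l (aL w s)) = 0) := by
  refine ⟨?_, ?_, ?_, ?_, ?_⟩
  · rintro v hv _ - rfl
    obtain ⟨a, ha, rfl⟩ := exists_rep hv
    rw [← rv_neg, C.form_t_neg hkl (List.mem_append_left _ ha)]
  · intro v hv w hw hvw
    obtain ⟨a, ha, rfl⟩ := exists_rep hv
    obtain ⟨b, hb, rfl⟩ := exists_rep hw
    rw [Ne, rv_eq_neg_iff] at hvw
    exact C.form_t_eq_zero k l (List.mem_append_left _ ha) (List.mem_append_left _ hb) hvw
  · rintro w hw _ - s _ rfl rfl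
    obtain ⟨a, ha, ha'⟩ := exists_spin hw s
    rw [aL_neg, ← ha', ← rv_neg, C.form_t_neg hkl (List.mem_append_right _ ha)]
  · intro w hw v hv s r hn
    obtain ⟨a, ha, ha'⟩ := exists_spin hw s
    obtain ⟨b, hb, hb'⟩ := exists_spin hv r
    rw [← ha', ← hb']
    refine C.form_t_eq_zero k l (List.mem_append_right _ ha) (List.mem_append_right _ hb) ?_
    rw [Ne, ← rv_eq_neg_iff, ha', hb', ← aL_neg]
    exact fun h0 => hn (aL_injective hv (neg_mem_weightsL hw) h0)
  · intro v hv w hw s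
    obtain ⟨a, ha, rfl⟩ := exists_rep hv
    obtain ⟨b, hb, hb'⟩ := exists_spin hw s
    rw [← hb']
    refine C.form_t_eq_zero k l (List.mem_append_left _ ha) (List.mem_append_right _ hb) ?_
    rintro rfl
    exact rep_not_spin _ (rep_neg a ha) hb

theorem form_h_t_of_mem_roots (u : Fin 7 → ℂ) (k : ZMod 3) (v : Fin 7 → ℝ) (hv : v ∈ roots) :
    form (h u) (t (rootVec X) k v) = 0 := by
  rw [roots_eq] at hv
  obtain ⟨a, -, rfl⟩ := hv
  exact C.form_h_t u k a

theorem isBasisOf_basis7 {k : ZMod 3} (hk : k ≠ 0) :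
    IsBasisOf (basis7 h (rootVec X) k) (so8Grade (rootVec X) C.aut k).toSubmodule := by
  refine ⟨C.linearIndependent_basis7 hk, ?_⟩
  obtain ⟨⟨-, h1, h2⟩, -⟩ := C.so8_decomposition
  have : k = 0 ∨ k = 1 ∨ k = 2 := by revert k; decide
  rcases this with rfl | rfl | rfl
  · exact absurd rfl hk
  · exact h1
  · exact h2

theorem isBasisOf_basisGrade {k : ZMod 3} (hk : k ≠ 0) :
    IsBasisOf (basisGrade h (rootVec X) k) (grade C.aut k) := by
  refine ⟨C.linearIndependent_basisGrade hk, ?_⟩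
  obtain ⟨-, h1, h2⟩ := C.decomposition
  have : k = 0 ∨ k = 1 ∨ k = 2 := by revert k; decide
  rcases this with rfl | rfl | rfl
  · exact absurd rfl hk
  · exact h1
  · exact h2

theorem isBasisOf_basisG2 :
    IsBasisOf (basisG2 h (rootVec X)) (so8Fixed (rootVec X) C.aut).toSubmodule :=
  ⟨C.linearIndependent_basisG2, by rw [so8Fixed_toSubmodule]; exact C.so8_decomposition.1.1⟩

theorem finrank_so8Grade {k : ZMod 3} (hk : k ≠ 0) :
    Module.finrank ℂ (so8Grade (rootVec X) C.aut k) = 7 := by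
  change Module.finrank ℂ (so8Grade (rootVec X) C.aut k).toSubmodule = 7
  rw [← (C.isBasisOf_basis7 hk).2, finrank_span_eq_card (C.linearIndependent_basis7 hk), card_basis7]

/-- The invariant subalgebra is `g₂ ⊕ V`. -/
theorem fixed_decomposition :
    Disjoint (so8Fixed (rootVec X) C.aut).toSubmodule
        (Submodule.span ℂ (Set.range (basisJ (rootVec X) 0))) ∧
      (so8Fixed (rootVec X) C.aut).toSubmodule ⊔
        Submodule.span ℂ (Set.range (basisJ (rootVec X) 0)) = grade C.aut 0 ∧
      Module.finrank ℂ (Submodule.span ℂ (Set.range (basisJ (rootVec X) 0))) = 16 := by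
  rw [← C.isBasisOf_basisG2.2]
  refine ⟨?_, ?_, ?_⟩
  · have h1 := C.linearIndependent_zero
    rw [linearIndependent_sum] at h1
    exact h1.2.2
  · rw [← Submodule.span_union, ← Set.Sum.elim_range]
    exact C.decomposition.1
  · rw [finrank_span_eq_card C.linearIndependent_basisJ, card_weightsL]

end Chev

end E6GS

/-! ### The main theorem. -/

open E6GS in
theorem mainTheorem2 :
    -- The roots, the simple roots, the minimal root and the fundamental weight.
    (roots.ncard = 72 ∧
      (∀ i, α i ∈ roots) ∧
      α 0 = -(α 1 + 2 • α 2 + 3 • α 3 + 2 • α 4 + α 5 + 2 • α 6) ∧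
      ϖ₁ ∈ cartan ℝ ∧ (∀ i, i ≠ 0 → α i ⬝ᵥ ϖ₁ = if i = 1 then 1 else 0)) ∧
    -- `λ₁` is the element of the Weyl group generated by `ϖ₁`; it has order three.
    (lam ℝ ∈ weylGroup ∧
      (∀ w ∈ weylGroup, (fun u => w (u - ϖ₁)) '' alcove = alcove ↔ w = lam ℝ) ∧
      orderOf (lam ℝ) = 3) ∧
    -- Its action on the extended Dynkin diagram and on the roots.
    (lam ℝ (α 1) = α 0 ∧ lam ℝ (α 2) = α 6 ∧ lam ℝ (α 3) = α 3 ∧ lam ℝ (α 4) = α 2 ∧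
      lam ℝ (α 5) = α 1 ∧ lam ℝ (α 6) = α 4 ∧ lam ℝ (α 0) = α 5 ∧
      lam ℝ (e 1 - e 2) = e 3 - e 4 ∧ lam ℝ (e 3 - e 4) = e 3 + e 4 ∧
      lam ℝ (e 1 - e 3) = e 2 - e 4 ∧ lam ℝ (e 2 - e 4) = e 2 + e 4 ∧
      lam ℝ (e 1 - e 4) = e 2 + e 3 ∧ lam ℝ (e 2 + e 3) = e 1 + e 4 ∧
      (∀ a ∈ roots, lam ℝ a = a ↔ a ∈ fixedRoots) ∧
      (∀ w ∈ weightsL, ∀ s, lam ℝ w ∈ weightsV ∧ lam ℝ (lam ℝ w) ∈ weightsR ∧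
        lam ℝ (aL w s) = aV (lam ℝ w) (-s) ∧
        lam ℝ (lam ℝ (aL w s)) = aR (lam ℝ (lam ℝ w)) (-s))) ∧
    -- The decomposition of every Lie algebra of type `E₆`.
    ∀ (g : Type*) [LieRing g] [LieAlgebra ℂ g], IsOfType CartanMatrix.E₆ g →
    ∃ (h : (Fin 7 → ℂ) →ₗ[ℂ] g) (E : (Fin 7 → ℝ) → g) (Λ : g ≃ₗ⁅ℂ⁆ g),
      IsChevalleyBasis h E ∧
      -- The Killing form in the Chevalley basis.
      ((∀ u ∈ cartan ℂ, ∀ v ∈ cartan ℂ, form (h u) (h v) = u ⬝ᵥ v) ∧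
        (∀ u, ∀ a ∈ roots, form (h u) (E a) = 0) ∧
        (∀ a ∈ roots, ∀ b ∈ roots, b = -a → form (E a) (E b) = 1) ∧
        (∀ a ∈ roots, ∀ b ∈ roots, b ≠ -a → form (E a) (E b) = 0)) ∧
      -- `Λ` is the action of `λ₁`, an automorphism of order three.
      ((∀ u, Λ (h u) = h (lam ℂ u)) ∧ (∀ a, Λ (E a) = E (lam ℝ a)) ∧
        (∀ x, Λ (Λ (Λ x)) = x) ∧ ∃ x, Λ x ≠ x) ∧
      -- The `ℤ/3`-grading, with `78 = 30 + 24 + 24`.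
      (DirectSum.IsInternal (grade Λ) ∧
        (∀ k l, ∀ x ∈ grade Λ k, ∀ y ∈ grade Λ l, ⁅x, y⁆ ∈ grade Λ (k + l)) ∧
        Module.finrank ℂ g = 78 ∧ Module.finrank ℂ (grade Λ 0) = 30 ∧
        Module.finrank ℂ (grade Λ 1) = 24 ∧ Module.finrank ℂ (grade Λ 2) = 24) ∧
      -- The subalgebra `so(8)` and its decomposition `g₂ ⊕ 7 ⊕ 7'`.
      (Nonempty (so8 E ≃ₗ⁅ℂ⁆ LieAlgebra.Orthogonal.so (Fin 8) ℂ) ∧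
        (∀ x ∈ so8 E, Λ x ∈ so8 E) ∧
        IsOfType CartanMatrix.G₂ (so8Fixed E Λ) ∧
        (so8Fixed E Λ).toSubmodule = (so8Grade E Λ 0).toSubmodule ∧
        iSupIndep (fun k => (so8Grade E Λ k).toSubmodule) ∧
        ⨆ k, (so8Grade E Λ k).toSubmodule = (so8 E).toSubmodule ∧
        Module.finrank ℂ (so8Grade E Λ 1) = 7 ∧ Module.finrank ℂ (so8Grade E Λ 2) = 7 ∧
        ∃ (H : LieSubalgebra ℂ (so8Fixed E Λ)) (b : LieAlgebra.Basis (Fin 2) H),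
          b.A = CartanMatrix.G₂ ∧
          IsFundamental b 1 (so8Grade E Λ 1) ∧ IsFundamental b 1 (so8Grade E Λ 2)) ∧
      -- The invariant subalgebra `g₀ = g₂ ⊕ V ≅ so(8) ⊕ 2 · 1`.
      ((fixedSubalgebra Λ).toSubmodule = grade Λ 0 ∧
        Disjoint (so8Fixed E Λ).toSubmodule (Submodule.span ℂ (Set.range (basisJ E 0))) ∧
        (so8Fixed E Λ).toSubmodule ⊔ Submodule.span ℂ (Set.range (basisJ E 0)) = grade Λ 0 ∧
        Module.finrank ℂ (Submodule.span ℂ (Set.range (basisJ E 0))) = 16 ∧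
        Nonempty (fixedSubalgebra Λ ≃ₗ⁅ℂ⁆ (LieAlgebra.Orthogonal.so (Fin 8) ℂ × TwoTrivial)) ∧
        Nonempty (fixedSubalgebra Λ ≃ₗ⁅ℂ⁆ droppedSubalgebra h E)) ∧
      -- The generalized sine bases.
      ((∀ u ∈ cartan ℂ, h u ∈ so8Fixed E Λ ↔
          u 0 = u 1 + u 2 ∧ u 3 = 0 ∧ u 4 = 0 ∧ u 5 = 0 ∧ u 6 = 0) ∧
        IsBasisOf (basisG2 h E) (so8Fixed E Λ).toSubmodule ∧
        (∀ k, k ≠ 0 → IsBasisOf (basis7 h E k) (so8Grade E Λ k).toSubmodule) ∧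
        LinearIndependent ℂ (basisJ E 0) ∧
        (∀ k, k ≠ 0 → IsBasisOf (basisGrade h E k) (grade Λ k))) ∧
      -- The Killing form on `g₂`.
      ((∀ a ∈ orbitReps, ∀ b ∈ orbitReps, b = -a → form (E0 E a) (E0 E b) = 3) ∧
        (∀ a ∈ orbitReps, ∀ b ∈ orbitReps, b ≠ -a → form (E0 E a) (E0 E b) = 0) ∧
        (∀ a ∈ fixedRoots, ∀ b ∈ fixedRoots, b = -a → form (E a) (E b) = 1) ∧
        (∀ a ∈ fixedRoots, ∀ b ∈ fixedRoots, b ≠ -a → form (E a) (E b) = 0) ∧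
        (∀ a ∈ orbitReps, ∀ b ∈ fixedRoots, form (E0 E a) (E b) = 0)) ∧
      -- The Killing form on the other generators.
      ((∀ k l, k + l ≠ 0 → ∀ x ∈ grade Λ k, ∀ y ∈ grade Λ l, form x y = 0) ∧
        (∀ k l, k ≠ 0 → k + l = 0 →
          form (hα₂ h k) (hα₂ h l) = 2 ∧ form (h₅ h k) (h₅ h l) = 1 ∧
          form (hα₂ h k) (h₅ h l) = 0) ∧
        (∀ k l, k + l = 0 →
          (∀ a ∈ orbitReps, ∀ b ∈ orbitReps, b = -a → form (t E k a) (t E l b) = 1) ∧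
          (∀ a ∈ orbitReps, ∀ b ∈ orbitReps, b ≠ -a → form (t E k a) (t E l b) = 0) ∧
          (∀ w ∈ weightsL, ∀ v ∈ weightsL, ∀ s r : ℤˣ, v = -w → r = -s →
            form (t E k (aL w s)) (t E l (aL v r)) = 1) ∧
          (∀ w ∈ weightsL, ∀ v ∈ weightsL, ∀ s r : ℤˣ, ¬ (v = -w ∧ r = -s) →
            form (t E k (aL w s)) (t E l (aL v r)) = 0) ∧
          (∀ a ∈ orbitReps, ∀ w ∈ weightsL, ∀ s, form (t E k a) (t E l (aL w s)) = 0)) ∧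
        (∀ u k, ∀ a ∈ roots, form (h u) (t E k a) = 0)) := by
  refine ⟨⟨roots_ncard, α_mem, α_zero_eq, ϖ₁_mem, α_dot_ϖ₁⟩,
    ⟨lam_mem_weylGroup, weylGroup_alcove_iff, orderOf_lam⟩, ?_, ?_⟩
  · obtain ⟨h1, h2, h3, h4, h5, h6, h7⟩ := lam_α
    obtain ⟨k1, k2, k3, k4, k5, k6⟩ := lam_e_sub
    exact ⟨h1, h2, h3, h4, h5, h6, h7, k1, k2, k3, k4, k5, k6, lam_eq_self_iff, lam_weightsL⟩
  intro g _ _ hg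
  obtain ⟨h, X, C⟩ := exists_chev hg
  obtain ⟨r0, r1, r2⟩ := C.finrank_grade
  obtain ⟨d0, d1, d2⟩ := C.fixed_decomposition
  refine ⟨h, rootVec X, C.aut, C.isChevalleyBasis, C.killing_roots,
    ⟨C.aut_h, C.rootVec_lam, C.aut_aut_aut, C.exists_aut_ne⟩,
    ⟨isInternal_grade C.aut_aut_aut, fun k l x hx y hy => lie_mem_grade hx hy, C.finrank, r0, r1, r2⟩,
    ⟨C.nonempty_so8_lieEquiv, C.aut_mem_so8, C.isOfType_so8Fixed, Chev.so8Fixed_toSubmodule _ _,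
      (iSupIndep_grade C.aut).mono fun k => inf_le_right,
      iSup_inf_grade C.aut_aut_aut C.aut_mem_so8, C.finrank_so8Grade (by decide),
      C.finrank_so8Grade (by decide), _, C.g2Basis, rfl, C.isFundamental (by decide),
      C.isFundamental (by decide)⟩,
    ⟨fixedSubalgebra_toSubmodule _, d0, d1, d2, C.nonempty_fixed_lieEquiv, ?_⟩,
    ⟨fun u hu => C.h_mem_so8Fixed_iff hu, C.isBasisOf_basisG2, fun k hk => C.isBasisOf_basis7 hk,
      C.linearIndependent_basisJ, fun k hk => C.isBasisOf_basisGrade hk⟩,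
    C.killing_g2,
    fun k l hkl x hx y hy => form_eq_zero_of_grade hkl hx hy, fun k l hk hkl => ?_,
    fun k l hkl => C.killing_t hkl, C.form_h_t_of_mem_roots⟩
  -- The two subalgebras are compared abstractly, through their common model so(8) ⊕ ℂ².
  · obtain ⟨φ⟩ := C.nonempty_fixed_lieEquiv
    obtain ⟨ψ⟩ := C.nonempty_dropped_lieEquiv
    exact ⟨φ.trans ψ.symm⟩
  · have hl : l ≠ 0 := by rintro rfl; exact hk (by simpa using hkl)
    exact ⟨C.form_hα₂_hα₂ hkl, C.form_h₅_h₅ hk hkl, C.form_hα₂_h₅ k hl⟩
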